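/- Let $F_0$ be a $p$-adic field and consider one of three cases: (uH) $F/F_0$ is an unramified quadratic extension with nontrivial automorphism $\sigma$; (S) $F=F_0$ and $p$ is odd; (A) $F=F_0$. Put $\gamma=1$ in the cases (uH), (S) and $\gamma=2$ in the case (A). Let $\varpi$ be a uniformizer of $F_0$, let $k$ be the residue field of $F$, $q=\#k$, and let $q_0$ be the cardinality of the residue field of $F_0$. Let $\mathrm{Sign}=k^\times/(k^\times)^2=\{\pm1\}$ in the case (S) and $\mathrm{Sign}=\{1\}$ otherwise, $\mathrm{sign}\colon k^\times\to\mathrm{Sign}$ the natural map, and $\epsilon=\mathrm{sign}(-1)$. A nondegenerate (Hermitian, symmetric, alternating, respectively) space $X$ over $k$ has type $\mathrm{typ}(X)=(\frac1\gamma\dim X,\ \mathrm{sign}(\det X))$ (so that the zero space has type $(0,1)$). Let $V$ be a finite-dimensional $F$-vector space with a form $\langle\cdot,\cdot\rangle$ which is Hermitian over $F/F_0$ (uH), symmetric (S), or alternating (A). A Jordan splitting of an $\mathcal O_F$-lattice $\Lambda\subseteq V$ is an orthogonal decomposition $V=\bigoplus_{i\in\mathbb Z}V^{(i)}$ such that,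 with $\Lambda^{(i)}=\Lambda\cap V^{(i)}$, one has $\Lambda=\bigoplus_i\Lambda^{(i)}$ and the dual of $\Lambda^{(i)}$ in $V^{(i)}$ is $(\Lambda^{(i)})^\vee=\varpi^{-i}\Lambda^{(i)}$. We write $\mathrm{typ}(\Lambda)=(e^0,\chi^0)$, where $e^0\colon\mathbb Z\to\mathbb Z_{\ge0}$, $\chi^0\colon\mathbb Z\to\mathrm{Sign}$, if $\Lambda$ has a Jordan splitting and for every Jordan splitting and every $i$ the space $\Lambda^{(i)}/\varpi\Lambda^{(i)}$ with the form $\langle\cdot,\cdot\rangle^{(i)}=\varpi^{-i}\langle\cdot,\cdot\rangle$ modulo the maximal ideal is nondegenerate of type $(e^0(i),\chi^0(i))$. Fix a lattice $\Lambda$ with a Jordan splitting $V=\bigoplus_iV^{(i)}$, and put $V^{(\ge i)}=\bigoplus_{j\ge i}V^{(j)}$. Then $\mathrm{typ}(\Lambda)=(e^0,\chi^0)$ is well defined, and the following holds. (1) Let $L$ be a lattice with $\varpi\Lambda\subseteq L\subseteq\Lambda$. Let $N_i$ be the projection of $L\cap V^{(\ge i)}$ to $V^{(i)}$, let $N_i^\vee$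 be its dual in $V^{(i)}$, and let $M_i=N_i\cap\varpi^{i+1}N_i^\vee$. Then $N_i/M_i$ and $\varpi^{i+1}N_i^\vee/M_i$ with the forms induced by $\langle\cdot,\cdot\rangle^{(i)}$ are nondegenerate spaces over $k$ having types $(n(i),\psi_1(i))$ and $(l(i),\psi_2(i))$; with $m(i)=\dim_k(M_i/\varpi\Lambda^{(i)})$ one has $$e^0(i)=n(i)+\tfrac2\gamma m(i)+l(i),\qquad \chi^0(i)=\psi_1(i)\,\epsilon^{m(i)}\,\psi_2(i)\qquad(*)$$ and $\mathrm{typ}(L)=(f^0,\psi^0)$ is well defined and given by $$f^0(i)=n(i)+\tfrac2\gamma m(i-1)+l(i-2),\qquad \psi^0(i)=\psi_1(i)\,\epsilon^{m(i-1)}\,\psi_2(i-2).\qquad(**)$$ In particular $\mathrm{typ}(L)$ is determined by the family $(N_i)_{i\in\mathbb Z}$. (2) By data we mean $D=(n,m,l,\psi_1,\psi_2)$ with $n,m,l\colon\mathbb Z\to\mathbb Z_{\ge0}$ and $\psi_1,\psi_2\colon\mathbb Z\to\mathrm{Sign}$ satisfying $(*)$, such that $\psi_1(i)=1$ whenever $n(i)=0$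 and $\psi_2(i)=1$ whenever $l(i)=0$. If there is a lattice $L$ with $\varpi\Lambda\subseteq L\subseteq\Lambda$ and $\mathrm{typ}(L)=(f^0,\psi^0)$, then there are data satisfying $(**)$. For all data $D$, the number of lattices $L$ with $\varpi\Lambda\subseteq L\subseteq\Lambda$ whose data in (1) are $D$ equals $$c(D)=q^{\sum_{i>j}(m(i)+\gamma l(i))(m(j)+\gamma n(j))}\prod_{i}Q\big(n(i),\psi_1(i);m(i);l(i),\psi_2(i)\big),$$ and for all $(f^0,\psi^0)$ the number of lattices $L$ with $\varpi\Lambda\subseteq L\subseteq\Lambda$ and $\mathrm{typ}(L)=(f^0,\psi^0)$ is the finite sum of $c(D)$ over all data $D$ satisfying $(**)$. Here, with $(a)_x=\prod_{i=1}^a(x^i-1)$, $r=n+\frac2\gamma m+l$, $\chi=\psi_1\epsilon^m\psi_2$, and $e(a,\eta)=q^{a/2}+\epsilon^{a/2}\eta$ for $a$ even, $e(a,\eta)=1$ for $a$ odd, $$Q(n,\psi_1;m;l,\psi_2)=\begin{cases}(-1)^m(-q_0)^{nl}\dfrac{(r)_{-q_0}}{(n)_{-q_0}(m)_{q_0^2}(l)_{-q_0}}&\text{(uH)},\\[2ex]\dfrac{q^{\lfloor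 nl/2\rfloor}}2\,\dfrac{(\lfloor r/2\rfloor)_{q^2}}{(\lfloor n/2\rfloor)_{q^2}(m)_q(\lfloor l/2\rfloor)_{q^2}}\,\dfrac{e(n,\psi_1)e(l,\psi_2)}{e(r,\chi)}&\text{(S)},\\[2ex]q^{2nl}\dfrac{(r)_{q^2}}{(n)_{q^2}(m)_q(l)_{q^2}}&\text{(A)}.\end{cases}$$ -/

import Mathlib

open scoped ValuativeRel Pointwise

noncomputable section

namespace LatticeTyp

/-- The three kinds of forms considered: Hermitian for an unramified quadratic extension,
symmetric, alternating. -/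
inductive FormCase where
  | unramifiedHermitian
  | symmetric
  | alternating

namespace FormCase

/-- The integer `γ`: `2` for alternating forms and `1` otherwise. -/
def γ : FormCase → ℕ
  | alternating => 2
  | _ => 1

/-- The group of signs, as a subgroup of `{1, -1}`: everything for symmetric forms,
trivial otherwise. -/
def signGroup : FormCase → Subgroup ℤˣ
  | symmetric => ⊤
  | _ => ⊥

/-- The set `Sign` (with its group structure). -/
abbrev Sign (c : FormCase) : Type := c.signGroup

open Classical in
/-- The map `sign : kˣ → Sign` for a finite field `k`: the class modulo squares for symmetric
forms, trivial otherwise. (Only the values at nonzero elements matter.) -/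
def sign (c : FormCase) {k : Type*} [Field k] (x : k) : c.Sign :=
  match c with
  | symmetric => ⟨if IsSquare x then 1 else -1, Subgroup.mem_top _⟩
  | unramifiedHermitian => 1
  | alternating => 1

end FormCase

section Setting

variable {F₀ F : Type*} [Field F₀] [ValuativeRel F₀] [Field F] [ValuativeRel F] [Algebra F₀ F]

/-- An extension of local fields is unramified if uniformizers of the small field stay
uniformizers in the big one. (The residue fields being finite, the residue extension is
automatically separable.) -/
def IsUnramifiedExt (F₀ F : Type*) [Field F₀] [ValuativeRel F₀] [Field F] [ValuativeRel F]
    [Algebra F₀ F] : Prop :=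
  ∀ x : 𝒪[F₀], Irreducible x → ∃ y : 𝒪[F], Irreducible y ∧ (y : F) = algebraMap F₀ F (x : F₀)

/-- The assumptions on the fields in each case: `F/F₀` is quadratic unramified with nontrivial
automorphism `σ`; or `F = F₀` has odd residue characteristic; or `F = F₀`. -/
def FormCase.IsSetting (c : FormCase) (σ : F ≃ₐ[F₀] F) : Prop :=
  match c with
  | .unramifiedHermitian => Module.finrank F₀ F = 2 ∧ IsUnramifiedExt F₀ F ∧ σ ≠ 1
  | .symmetric => Function.Bijective (algebraMap F₀ F) ∧ ringChar 𝓀[F] ≠ 2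
  | .alternating => Function.Bijective (algebraMap F₀ F)

/-- Sesquilinear forms (linear in the first variable, `σ`-linear in the second one).
If `F = F₀` then `σ` is the identity and these are the bilinear forms. -/
abbrev Form (σ : F ≃ₐ[F₀] F) (V : Type*) [AddCommGroup V] [Module F V] : Type _ :=
  V →ₗ[F] V →ₛₗ[(σ : F →+* F)] F

/-- The form is Hermitian, symmetric, or alternating. -/
def FormCase.IsForm (c : FormCase) {σ : F ≃ₐ[F₀] F} {V : Type*} [AddCommGroup V] [Module F V]
    (B : Form σ V) : Prop :=
  match c with
  | .unramifiedHermitian => ∀ x y, B y x = σ (B x y)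
  | .symmetric => ∀ x y, B y x = B x y
  | .alternating => ∀ x, B x x = 0

end Setting

/-- `(X, b)` is a nondegenerate space over the (residue) field `k` with `typ(X, b) = (d, χ)`:
`dim X = γ d`, and the determinant of the Gram matrix in a basis has sign `χ`. (For the forms
considered the sign does not depend on the basis.) -/
def IsTyp (c : FormCase) {k X : Type*} [Field k] [AddCommGroup X] [Module k X]
    (b : X → X → k) (d : ℕ) (χ : c.Sign) : Prop :=
  (∀ x, (∀ y, b x y = 0) → x = 0) ∧
  ∃ v : Module.Basis (Fin (c.γ * d)) k X, c.sign (Matrix.of fun s t => b (v s) (v t)).det = χ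

section Lattices

variable {F₀ F : Type*} [Field F₀] [Field F] [ValuativeRel F] [Algebra F₀ F]
  {σ : F ≃ₐ[F₀] F} {V : Type*} [AddCommGroup V] [Module F V]

open Classical in
/-- Reduction `𝒪[F] → 𝓀[F]` (extended by `0` to `F`; it is only used on `𝒪[F]`). -/
def toResidue (z : F) : 𝓀[F] :=
  if h : z ∈ 𝒪[F] then IsLocalRing.residue 𝒪[F] ⟨z, h⟩ else 0

/-- The dual `N^∨` of `N` inside the subspace `W`. -/
def dualIn (B : Form σ V) (W : Submodule F V) (N : Submodule 𝒪[F] V) : Submodule 𝒪[F] V where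
  carrier := {x | x ∈ W ∧ ∀ y ∈ N, B x y ∈ 𝒪[F]}
  zero_mem' := ⟨W.zero_mem, fun y _ => by simp⟩
  add_mem' := fun {x z} hx hz => ⟨W.add_mem hx.1 hz.1, fun y hy => by
    rw [map_add, LinearMap.add_apply]
    exact add_mem (hx.2 y hy) (hz.2 y hy)⟩
  smul_mem' := fun a x hx => ⟨W.smul_mem (a : F) hx.1, fun y hy => by
    have : B (a • x) y = (a : F) * B x y := by
      change B ((a : F) • x) y = _
      rw [map_smul, LinearMap.smul_apply, smul_eq_mul]
    rw [this]
    exact mul_mem a.2 (hx.2 y hy)⟩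

/-- The `𝒪[F]`-submodule `N ∩ W`. -/
def inter (N : Submodule 𝒪[F] V) (W : Submodule F V) : Submodule 𝒪[F] V :=
  N ⊓ W.restrictScalars 𝒪[F]

/-- A Jordan splitting of `Λ`: an orthogonal decomposition `V = ⨁ V^(i)` such that
`Λ = ⨁ Λ^(i)` for `Λ^(i) = Λ ∩ V^(i)`, and the dual of `Λ^(i)` in `V^(i)` is `ϖ^(-i) Λ^(i)`. -/
structure JordanSplitting (B : Form σ V) (ϖ : F) (Λ : Submodule 𝒪[F] V) where
  comp : ℤ → Submodule F V
  isInternal : DirectSum.IsInternal comp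
  orthogonal : ∀ i j, i ≠ j → ∀ x ∈ comp i, ∀ y ∈ comp j, B x y = 0
  iSup_inter : Λ = ⨆ i, inter Λ (comp i)
  dual_eq : ∀ i, dualIn B (comp i) (inter Λ (comp i)) = ϖ ^ (-i) • inter Λ (comp i)

/-- The residue space `N/𝔪N`, a vector space over `𝓀[F]`. -/
abbrev ResSpace (N : Submodule 𝒪[F] V) : Type _ := N ⧸ (𝓂[F] • ⊤ : Submodule 𝒪[F] N)

instance (N : Submodule 𝒪[F] V) : Module 𝓀[F] (ResSpace N) :=
  inferInstanceAs (Module (𝒪[F] ⧸ 𝓂[F]) (N ⧸ (𝓂[F] • ⊤ : Submodule 𝒪[F] N)))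

/-- The form `ϖ^(-i)⟨·,·⟩` modulo `𝔪`, on `N/𝔪N`. It is computed on representatives; if
`ϖ^(-i)⟨·,·⟩` is integral on `N` then these do not matter. -/
def resForm (B : Form σ V) (ϖ : F) (i : ℤ) (N : Submodule 𝒪[F] V) (x y : ResSpace N) : 𝓀[F] :=
  toResidue (ϖ ^ (-i) * B (Quotient.out x : N) (Quotient.out y : N))

/-- The image of `N ⊆ P` in `P/𝔪P`; if moreover `𝔪P ⊆ N` this is `N/𝔪P`. -/
def resSub (P N : Submodule 𝒪[F] V) : Submodule 𝓀[F] (ResSpace P) :=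
  Submodule.span 𝓀[F]
    ((Submodule.mkQ (𝓂[F] • ⊤ : Submodule 𝒪[F] P)) '' {x : P | (x : V) ∈ N})

/-- The quotient of `N/𝔪P` by `M/𝔪P`, that is `N/M` (for `𝔪P ⊆ M ⊆ N ⊆ P`). -/
abbrev SubQuot (P N M : Submodule 𝒪[F] V) : Type _ :=
  resSub P N ⧸ (resSub P M).submoduleOf (resSub P N)

/-- The form induced by `ϖ^(-i)⟨·,·⟩` modulo `𝔪` on `N/M`. -/
def subQuotForm (B : Form σ V) (ϖ : F) (i : ℤ) (P N M : Submodule 𝒪[F] V)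
    (x y : SubQuot P N M) : 𝓀[F] :=
  resForm B ϖ i P (Quotient.out x : resSub P N) (Quotient.out y : resSub P N)

/-- `typ(Λ) = (e, χ)`: there is a Jordan splitting, and for each of them the residue space of
`Λ^(i)` with the form `ϖ^(-i)⟨·,·⟩` has type `(e i, χ i)`. -/
def HasTyp (c : FormCase) (B : Form σ V) (ϖ : F) (Λ : Submodule 𝒪[F] V)
    (e : ℤ → ℕ) (χ : ℤ → c.Sign) : Prop :=
  Nonempty (JordanSplitting B ϖ Λ) ∧
  ∀ (J : JordanSplitting B ϖ Λ) (i : ℤ),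
    IsTyp c (resForm B ϖ i (inter Λ (J.comp i))) (e i) (χ i)

namespace JordanSplitting

variable {B : Form σ V} {ϖ : F} {Λ : Submodule 𝒪[F] V} (J : JordanSplitting B ϖ Λ)

/-- The projection of `V = ⨁ V^(i)` to `V^(i)`. -/
def proj (i : ℤ) : V →ₗ[F] V :=
  (J.comp i).subtype ∘ₗ DirectSum.component F ℤ (fun j => J.comp j) i ∘ₗ
    (LinearEquiv.ofBijective (DirectSum.coeLinearMap J.comp) J.isInternal).symm.toLinearMap

/-- `V^(≥ i)`, the sum of the `V^(j)` for `j ≥ i`. -/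
def compGE (i : ℤ) : Submodule F V := ⨆ j ≥ i, J.comp j

/-- `N_i`, the projection of `L ∩ V^(≥ i)` to `V^(i)`. -/
def N (L : Submodule 𝒪[F] V) (i : ℤ) : Submodule 𝒪[F] V :=
  (inter L (J.compGE i)).map ((J.proj i).restrictScalars 𝒪[F])

/-- For `N ⊆ V^(i)`, the submodule `ϖ^(i+1) N^∨` (dual in `V^(i)`). -/
def perp (i : ℤ) (N : Submodule 𝒪[F] V) : Submodule 𝒪[F] V :=
  ϖ ^ (i + 1) • dualIn B (J.comp i) N

/-- For `N ⊆ V^(i)`, the submodule `M = N ∩ ϖ^(i+1) N^∨`. -/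
def rad (i : ℤ) (N : Submodule 𝒪[F] V) : Submodule 𝒪[F] V := N ⊓ J.perp i N

end JordanSplitting

/-- The numerical data `(n, m, l, ψ₁, ψ₂)`. -/
structure TypData (c : FormCase) where
  n : ℤ → ℕ
  m : ℤ → ℕ
  l : ℤ → ℕ
  ψ₁ : ℤ → c.Sign
  ψ₂ : ℤ → c.Sign

/-- `d` is the data attached to the family `(N i)`, with `M i = N i ∩ ϖ^(i+1) (N i)^∨`:
`m i = dim (M i / ϖ Λ^(i))`, `(n i, ψ₁ i)` is the type of `N i / M i`, and `(l i, ψ₂ i)` is the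
type of `ϖ^(i+1) (N i)^∨ / M i`, for the form `ϖ^(-i)⟨·,·⟩`. -/
def IsDataOf {c : FormCase} {B : Form σ V} {ϖ : F} {Λ : Submodule 𝒪[F] V}
    (J : JordanSplitting B ϖ Λ) (N : ℤ → Submodule 𝒪[F] V) (d : TypData c) : Prop :=
  ∀ i : ℤ,
    d.m i = Module.finrank 𝓀[F] (resSub (inter Λ (J.comp i)) (J.rad i (N i))) ∧
    IsTyp c (subQuotForm B ϖ i (inter Λ (J.comp i)) (N i) (J.rad i (N i))) (d.n i) (d.ψ₁ i) ∧
    IsTyp c (subQuotForm B ϖ i (inter Λ (J.comp i)) (J.perp i (N i)) (J.rad i (N i)))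
      (d.l i) (d.ψ₂ i)

namespace TypData

variable {c : FormCase} (d : TypData c)

/-- `n(i) + (2/γ) m(i) + l(i)` -/
def e (i : ℤ) : ℕ := d.n i + 2 / c.γ * d.m i + d.l i

/-- `ψ₁(i) ε^(m(i)) ψ₂(i)` -/
def χ (ε : c.Sign) (i : ℤ) : c.Sign := d.ψ₁ i * ε ^ d.m i * d.ψ₂ i

/-- `f(i) = n(i) + (2/γ) m(i-1) + l(i-2)` -/
def f (i : ℤ) : ℕ := d.n i + 2 / c.γ * d.m (i - 1) + d.l (i - 2)

/-- `ψ(i) = ψ₁(i) ε^(m(i-1)) ψ₂(i-2)` -/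
def ψ (ε : c.Sign) (i : ℤ) : c.Sign := d.ψ₁ i * ε ^ d.m (i - 1) * d.ψ₂ (i - 2)

/-- The pairs `(n i, ψ₁ i)` and `(l i, ψ₂ i)` are types of spaces: the zero space has sign `1`. -/
def IsNormalized : Prop := ∀ i, (d.n i = 0 → d.ψ₁ i = 1) ∧ (d.l i = 0 → d.ψ₂ i = 1)

end TypData

/-- `(n)_x = ∏_{i=1}^n (x^i - 1)` -/
def poch (x : ℚ) (n : ℕ) : ℚ := ∏ i ∈ Finset.range n, (x ^ (i + 1) - 1)

/-- `e(r, χ) = q^(r/2) + ε^(r/2) χ` for `r` even and `1` for `r` odd. -/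
def eFactor {c : FormCase} (q : ℚ) (ε : c.Sign) (r : ℕ) (χ : c.Sign) : ℚ :=
  if Even r then q ^ (r / 2) + (((ε ^ (r / 2) * χ : c.Sign) : ℤˣ) : ℤ) else 1

/-- The number `Q(n, ψ₁; m; l, ψ₂)`, where `r = n + (2/γ) m + l` and `χ = ψ₁ ε^m ψ₂`. -/
def Q (c : FormCase) (q₀ q : ℚ) (ε : c.Sign) (n : ℕ) (ψ₁ : c.Sign) (m l : ℕ) (ψ₂ : c.Sign) : ℚ :=
  match c with
  | .unramifiedHermitian =>
      (-1) ^ m * (-q₀) ^ (n * l) * poch (-q₀) (n + 2 * m + l) /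
        (poch (-q₀) n * poch (q₀ ^ 2) m * poch (-q₀) l)
  | .symmetric =>
      q ^ (n * l / 2) / 2 *
        (poch (q ^ 2) ((n + 2 * m + l) / 2) /
          (poch (q ^ 2) (n / 2) * poch q m * poch (q ^ 2) (l / 2))) *
        (eFactor q ε n ψ₁ * eFactor q ε l ψ₂ /
          eFactor q ε (n + 2 * m + l) (ψ₁ * ε ^ m * ψ₂))
  | .alternating =>
      q ^ (2 * (n * l)) * poch (q ^ 2) (n + m + l) /
        (poch (q ^ 2) n * poch q m * poch (q ^ 2) l)

/-- `q^(∑_{i>j} (m(i) + γ l(i)) (m(j) + γ n(j))) ∏_i Q(n(i), ψ₁(i); m(i); l(i), ψ₂(i))` -/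
def TypData.count {c : FormCase} (d : TypData c) (q₀ q : ℚ) (ε : c.Sign) : ℚ :=
  q ^ (∑ᶠ p : {p : ℤ × ℤ // p.2 < p.1},
      (d.m p.1.1 + c.γ * d.l p.1.1) * (d.m p.1.2 + c.γ * d.n p.1.2)) *
    ∏ᶠ i : ℤ, Q c q₀ q ε (d.n i) (d.ψ₁ i) (d.m i) (d.l i) (d.ψ₂ i)

/-- The lattices `L` with `ϖΛ ⊆ L ⊆ Λ`. -/
def lattices (ϖ : F) (Λ : Submodule 𝒪[F] V) : Set (Submodule 𝒪[F] V) :=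
  {L | L.IsLattice F ∧ ϖ • Λ ≤ L ∧ L ≤ Λ}

end Lattices

end LatticeTyp

end

open LatticeTyp

/-! Modulo `ϖ`, the component `Λ^(i)` becomes a nondegenerate space `X_i` over the residue field,
`N_i` becomes a subspace `W_i` of `X_i`, the lattice `ϖ^(i+1) N_i^∨` becomes the orthogonal of
`W_i`, and `M_i` its radical. So the data of `L` are invariants of the subspaces `W_i`: the types of
`W_i` and of its orthogonal modulo the common radical, and the dimension of that radical. Each `X_i`
has an adapted basis (`SubTyp.exists_adaptedBasis`): vectors `a` spanning a complement of the
radical in `W_i`, vectors `c` doing the same in the orthogonal, a basis `μ` of the radical, and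
vectors `ν` dual to `μ`. Its Gram determinant gives (*), the dual pairs contributing one factor `-1`
each.

For (**), adapted bases of all `X_i` are lifted to `Λ`, with `a` and `μ` lifted into `L ∩ V^(≥ i)`.
The lifts form a basis of `Λ`, and it can be made orthogonal between different levels by changing
vectors only by elements of `ϖΛ ⊆ L` (`IsGraded.exists_orthogonal`). Then `a`, `μ`, `ϖν`, `ϖc` form
a basis of `L`. Products within the `a` stay at level `i`, products within the `ϖc` move to level `i
+ 2`, and the dual pairs `μ`, `ϖν` to level `i + 1`; at every level the reduced Gram matrix is
invertible. Reading off its size and determinant gives the type of `L`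
(`JordanSplitting.hasTyp_of_isDataOf`). One Jordan splitting is enough: projecting the `i`-th
component of one splitting to that of another preserves the form modulo `ϖ^(i+1)`
(`JordanSplitting.form_proj_congr`).

For the count, lattices between `ϖΛ` and `Λ` are subspaces of `Λ/ϖΛ`, the direct sum of the `X_i`,
and the `W_i` are their graded pieces for the filtration by `V^(≥ i)`. For prescribed pieces the
subspaces are built step by step, each step being the choice of a linear map; this gives the power
of `q` (`card_gradedSubs`). What remains is the number of `W` in a single space with given
invariants, which is `Q` (`card_goodSubs_eq_Q`). It follows by double counting: pairs of `W` and a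
nonzero vector of its radical lower `m`, and for `m = 0` pairs of `W` and a frame in `W` with fixed
Gram matrix lower `n`. The inputs are the numbers of isotropic vectors, of vectors of given norm,
and of hyperbolic pairs.

The arithmetic of the fields enters only through `LatSetting`. In the Hermitian case this means that
`σ` preserves the integers and acts on the residue field as `x ↦ x ^ q₀`, which rests on Hensel's
lemma and Teichmüller representatives (`FormCase.IsSetting.exists_latSetting`). -/

noncomputable section

namespace LatticeTyp

/-! ### Forms over finite fields and their types -/

section FiniteForms

open Module

/-- The properties of a finite field with an endomorphism `τ` needed for the forms of kind `c`. -/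
def FormCase.IsResSetting (c : FormCase) {k : Type*} [Field k] (τ : k →+* k) (q₀ : ℕ) : Prop :=
  match c with
  | .unramifiedHermitian => Nat.card k = q₀ ^ 2 ∧ ∀ x, τ x = x ^ q₀
  | .symmetric => τ = RingHom.id k ∧ ringChar k ≠ 2
  | .alternating => τ = RingHom.id k

variable {k X : Type*} [Field k] [AddCommGroup X] [Module k X] {τ : k →+* k}

/-- Hermitian, symmetric or alternating forms over the residue field. -/
def FormCase.IsResForm (c : FormCase) (b : X →ₗ[k] X →ₛₗ[τ] k) : Prop :=
  match c with
  | .unramifiedHermitian => ∀ x y, b y x = τ (b x y)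
  | .symmetric => ∀ x y, b y x = b x y
  | .alternating => ∀ x, b x x = 0

lemma FormCase.Sign.subsingleton {c : FormCase} (hc : c ≠ .symmetric) : Subsingleton c.Sign := by
  cases c
  · exact inferInstanceAs (Subsingleton (⊥ : Subgroup ℤˣ))
  · exact absurd rfl hc
  · exact inferInstanceAs (Subsingleton (⊥ : Subgroup ℤˣ))

lemma FormCase.Sign.mul_self (c : FormCase) (χ : c.Sign) : χ * χ = 1 :=
  Subtype.ext (Int.units_mul_self _)

lemma FormCase.sign_mul (c : FormCase) [Finite k] {x y : k} (hx : x ≠ 0) (hy : y ≠ 0) :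
    c.sign (x * y) = c.sign x * c.sign y := by
  classical
  rcases eq_or_ne c .symmetric with rfl | hc
  swap
  · have := Sign.subsingleton hc
    exact Subsingleton.elim _ _
  have := Fintype.ofFinite k
  apply Subtype.ext
  have hh : ∀ z : k, z ≠ 0 → (((FormCase.sign .symmetric z : FormCase.Sign .symmetric) : ℤˣ) : ℤ)
      = quadraticChar k z := by
    intro z hz
    rw [quadraticChar_apply, quadraticCharFun, if_neg hz]
    simp only [sign]
    split_ifs <;> rfl
  apply Units.ext
  rw [hh _ (mul_ne_zero hx hy), map_mul, ← hh x hx, ← hh y hy]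
  rfl

lemma FormCase.sign_one (c : FormCase) : c.sign (1 : k) = 1 := by
  rcases eq_or_ne c .symmetric with rfl | hc
  · apply Subtype.ext
    simp [sign]
  · have := Sign.subsingleton hc
    exact Subsingleton.elim _ _

lemma FormCase.sign_pow (c : FormCase) [Finite k] {x : k} (hx : x ≠ 0) (m : ℕ) :
    c.sign (x ^ m) = c.sign x ^ m := by
  induction m with
  | zero => simp [sign_one]
  | succ m ih => rw [pow_succ, sign_mul c (pow_ne_zero m hx) hx, ih, pow_succ]

/-- A change of basis with matrix `P` multiplies a Gram determinant by `det P * τ (det P)`. For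
symmetric forms this is a square, otherwise there are no signs; hence the sign of a space is
independent of the basis. -/
lemma FormCase.sign_mul_map {c : FormCase} {q₀ : ℕ} [Finite k] (hτ : c.IsResSetting τ q₀) {x : k}
    (hx : x ≠ 0) : c.sign (x * τ x) = 1 := by
  rcases eq_or_ne c .symmetric with rfl | hc
  · obtain ⟨rfl, -⟩ := hτ
    rw [RingHom.id_apply, sign_mul _ hx hx, Sign.mul_self]
  · have := Sign.subsingleton hc
    exact Subsingleton.elim _ _

/-- The Gram matrix of a family of vectors. -/
def gram (b : X →ₗ[k] X →ₛₗ[τ] k) {ι : Type*} (v : ι → X) : Matrix ι ι k :=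
  Matrix.of fun s t => b (v s) (v t)

@[simp]
lemma gram_apply (b : X →ₗ[k] X →ₛₗ[τ] k) {ι : Type*} (v : ι → X) (s t : ι) :
    gram b v s t = b (v s) (v t) := rfl

/-- Vectors left orthogonal to `W`. -/
def orth (b : X →ₗ[k] X →ₛₗ[τ] k) (W : Submodule k X) : Submodule k X where
  carrier := {x | ∀ y ∈ W, b x y = 0}
  zero_mem' := fun y _ => by simp
  add_mem' := fun {x z} hx hz y hy => by simp [hx y hy, hz y hy]
  smul_mem' := fun a x hx y hy => by simp [hx y hy]

/-- Nondegenerate forms. -/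
def Nondeg (b : X →ₗ[k] X →ₛₗ[τ] k) : Prop := ∀ x, (∀ y, b x y = 0) → x = 0

/-- The three symmetry conditions become one, with `s = -1` for alternating forms and `s = 1`
otherwise, so most arguments need no case distinction. The value `s = 1` for symmetric forms is
needed for the sign of hyperbolic blocks. -/
lemma FormCase.IsResForm.exists_symm {c : FormCase} {q₀ : ℕ} (hτ : c.IsResSetting τ q₀)
    {b : X →ₗ[k] X →ₛₗ[τ] k} (hb : c.IsResForm b) :
    ∃ s : k, s * s = 1 ∧ (c = .symmetric → s = 1) ∧ ∀ x y, b y x = s * τ (b x y) := by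
  cases c
  · exact ⟨1, by simp, by simp, fun x y => by rw [hb x y, one_mul]⟩
  · obtain ⟨rfl, -⟩ := hτ
    exact ⟨1, by simp, by simp, fun x y => by rw [hb x y, one_mul]; rfl⟩
  · have hτ' : τ = RingHom.id k := hτ
    subst hτ'
    refine ⟨-1, by simp, by simp, fun x y => ?_⟩
    have h := hb (x + y)
    have hx := hb x
    have hy := hb y
    simp only [map_add, LinearMap.add_apply, hx, hy] at h
    simp only [RingHom.id_apply]
    linear_combination h

lemma FormCase.IsResForm.refl {c : FormCase} {q₀ : ℕ} (hτ : c.IsResSetting τ q₀)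
    {b : X →ₗ[k] X →ₛₗ[τ] k} (hb : c.IsResForm b) {x y : X} (h : b x y = 0) : b y x = 0 := by
  obtain ⟨s, -, -, hs⟩ := hb.exists_symm hτ
  rw [hs, h, map_zero, mul_zero]

lemma linearIndependent_of_gram {b : X →ₗ[k] X →ₛₗ[τ] k} {ι : Type*} [Fintype ι] [DecidableEq ι]
    {v : ι → X} (h : (gram b v).det ≠ 0) : LinearIndependent k v := by
  rw [Fintype.linearIndependent_iff]
  intro g hg
  have h1 : Matrix.vecMul g (gram b v) = 0 := by
    ext t
    have := congrArg (fun x => b x (v t)) hg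
    simpa [Matrix.vecMul, dotProduct] using this
  intro i
  have := Matrix.eq_zero_of_vecMul_eq_zero h h1
  exact congrFun this i

lemma gram_linearCombination (b : X →ₗ[k] X →ₛₗ[τ] k) {ι κ : Type*} [Fintype ι] (v : ι → X)
    (P : Matrix κ ι k) (w : κ → X) (hw : ∀ s, w s = ∑ i, P s i • v i) :
    gram b w = P * gram b v * (P.map τ).transpose := by
  ext s t
  simp only [gram_apply, hw, Matrix.mul_apply, map_sum, LinearMap.sum_apply, map_smul,
    LinearMap.smul_apply, LinearMap.map_smulₛₗ, smul_eq_mul, Matrix.transpose_apply,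
    Matrix.map_apply, Finset.sum_mul]
  refine Finset.sum_congr rfl fun i _ => ?_
  rw [Finset.mul_sum]
  exact Finset.sum_congr rfl fun j _ => by ring

lemma det_map_ringHom {ι : Type*} [Fintype ι] [DecidableEq ι] (P : Matrix ι ι k) :
    (P.map τ).det = τ P.det := (RingHom.map_det τ P).symm

lemma gram_det_ne_zero {b : X →ₗ[k] X →ₛₗ[τ] k} (hb : Nondeg b) {ι : Type*} [Fintype ι]
    [DecidableEq ι] (v : Basis ι k X) : (gram b v).det ≠ 0 := by
  intro h
  obtain ⟨g, hg, h1⟩ := Matrix.exists_vecMul_eq_zero_iff.2 h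
  apply hg
  have h2 : ∑ i, g i • v i = 0 := by
    apply hb
    intro y
    have h3 : ∀ t, b (∑ i, g i • v i) (v t) = 0 := by
      intro t
      have := congrFun h1 t
      simpa [Matrix.vecMul, dotProduct] using this
    have h4 : b (∑ i, g i • v i) = 0 := v.ext fun t => by rw [h3 t]; rfl
    rw [h4]; rfl
  have := Fintype.linearIndependent_iff.1 v.linearIndependent g h2
  exact funext this

lemma nondeg_of_gram {b : X →ₗ[k] X →ₛₗ[τ] k} {ι : Type*} [Fintype ι] [DecidableEq ι]
    [Module.Finite k X] {v : ι → X} (h : (gram b v).det ≠ 0) (hc : Fintype.card ι = finrank k X) :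
    Nondeg b := by
  intro x hx
  have hli := linearIndependent_of_gram h
  by_cases hι : Nonempty ι
  · let w := basisOfLinearIndependentOfCardEqFinrank hli hc
    have hw : ⇑w = v := coe_basisOfLinearIndependentOfCardEqFinrank hli hc
    have h1 : Matrix.vecMul (fun i => w.repr x i) (gram b v) = 0 := by
      ext t
      have := hx (v t)
      rw [← w.sum_repr x] at this
      simpa [Matrix.vecMul, dotProduct, hw] using this
    have := Matrix.eq_zero_of_vecMul_eq_zero h h1
    rw [← w.sum_repr x]
    exact Finset.sum_eq_zero fun i _ => by rw [congrFun this i]; simp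
  · have : finrank k X = 0 := by
      rw [← hc]; exact Fintype.card_eq_zero_iff.2 (not_nonempty_iff.1 hι)
    have := finrank_zero_iff.1 this
    exact Subsingleton.elim _ _

/-- `(X, b)` is nondegenerate of type `(d, χ)`. -/
def HT (c : FormCase) (b : X →ₗ[k] X →ₛₗ[τ] k) (d : ℕ) (χ : c.Sign) : Prop :=
  ∃ a : Fin (c.γ * d) → X, (gram b a).det ≠ 0 ∧ finrank k X = c.γ * d ∧
    c.sign (gram b a).det = χ

lemma FormCase.γ_pos (c : FormCase) : 0 < c.γ := by cases c <;> simp [FormCase.γ]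

lemma gram_comp_equiv_det (b : X →ₗ[k] X →ₛₗ[τ] k) {ι κ : Type*} [Fintype ι] [DecidableEq ι]
    [Fintype κ] [DecidableEq κ] (v : ι → X) (e : κ ≃ ι) :
    (gram b (v ∘ e)).det = (gram b v).det := Matrix.det_submatrix_equiv_self e (gram b v)

lemma HT.mk' {c : FormCase} {b : X →ₗ[k] X →ₛₗ[τ] k} {ι : Type*} [Fintype ι] [DecidableEq ι]
    (v : ι → X) (h : (gram b v).det ≠ 0) (hX : finrank k X = Fintype.card ι) {d : ℕ}
    (hd : Fintype.card ι = c.γ * d) : HT c b d (c.sign (gram b v).det) := by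
  let e : Fin (c.γ * d) ≃ ι := (Fintype.equivFinOfCardEq hd).symm
  exact ⟨v ∘ e, by rwa [gram_comp_equiv_det], by rw [hX, hd], by rw [gram_comp_equiv_det]⟩

/-- A family of the right length with invertible Gram matrix is automatically a basis, and its
existence makes the form nondegenerate. `HT` is the convenient version of a type when families are
lifted, projected or glued. -/
lemma isTyp_iff_HT [Module.Finite k X] {c : FormCase} {b : X →ₗ[k] X →ₛₗ[τ] k} {d : ℕ}
    {χ : c.Sign} : IsTyp c (fun x y => b x y) d χ ↔ HT c b d χ := by
  constructor
  · rintro ⟨h1, v, hv⟩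
    exact ⟨v, gram_det_ne_zero h1 v, by simpa using finrank_eq_card_basis v, hv⟩
  · rintro ⟨a, h1, h2, h3⟩
    have hc : Fintype.card (Fin (c.γ * d)) = finrank k X := by simp [h2]
    refine ⟨nondeg_of_gram h1 hc, ?_⟩
    have hli := linearIndependent_of_gram h1
    have hsp : ⊤ ≤ Submodule.span k (Set.range a) :=
      (hli.span_eq_top_of_card_eq_finrank' hc).ge
    refine ⟨Basis.mk hli hsp, ?_⟩
    rw [Basis.coe_mk]
    exact h3

lemma HT.nondeg [Module.Finite k X] {c : FormCase} {b : X →ₗ[k] X →ₛₗ[τ] k} {d : ℕ}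
    {χ : c.Sign} (h : HT c b d χ) : Nondeg b := by
  obtain ⟨a, h1, h2, h3⟩ := h
  exact nondeg_of_gram h1 (by simp [h2])

lemma sign_gram_eq [Finite k] {c : FormCase} {q₀ : ℕ} (hτ : c.IsResSetting τ q₀)
    {b : X →ₗ[k] X →ₛₗ[τ] k} {ι : Type*} [Fintype ι] [DecidableEq ι] {v w : ι → X}
    (hv : (gram b v).det ≠ 0) (hw : (gram b w).det ≠ 0)
    (hspan : ∀ s, w s ∈ Submodule.span k (Set.range v)) :
    c.sign (gram b w).det = c.sign (gram b v).det := by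
  have h1 : ∀ s, ∃ g : ι → k, ∑ i, g i • v i = w s := fun s =>
    (Submodule.mem_span_range_iff_exists_fun k).1 (hspan s)
  choose P hP using h1
  have h2 := gram_linearCombination b v (Matrix.of P) w fun s => (hP s).symm
  have h3 : (gram b w).det = ((Matrix.of P).det * τ (Matrix.of P).det) * (gram b v).det := by
    rw [h2, Matrix.det_mul, Matrix.det_mul, Matrix.det_transpose, det_map_ringHom]
    ring
  have h4 : (Matrix.of P).det ≠ 0 := by
    intro h; apply hw; rw [h3, h]; simp
  rw [h3, c.sign_mul (mul_ne_zero h4 (by simpa using h4)) hv, FormCase.sign_mul_map hτ h4, one_mul]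

lemma HT.unique [Finite k] [Module.Finite k X] {c : FormCase} {q₀ : ℕ} (hτ : c.IsResSetting τ q₀)
    {b : X →ₗ[k] X →ₛₗ[τ] k} {d d' : ℕ} {χ χ' : c.Sign} (h : HT c b d χ) (h' : HT c b d' χ') :
    d = d' ∧ χ = χ' := by
  obtain ⟨a, h1, h2, h3⟩ := h
  obtain ⟨a', h1', h2', h3'⟩ := h'
  have : d = d' := Nat.eq_of_mul_eq_mul_left c.γ_pos (h2.symm.trans h2')
  subst this
  refine ⟨rfl, ?_⟩
  rw [← h3, ← h3']
  refine sign_gram_eq hτ h1' h1 fun s => ?_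
  rw [(linearIndependent_of_gram h1').span_eq_top_of_card_eq_finrank' (by simp [h2])]
  trivial

end FiniteForms

/-! ### Orthogonal complements, radicals and adapted bases -/

section FiniteForms2

open Module

variable {k X : Type*} [Field k] [AddCommGroup X] [Module k X] {τ : k →+* k}

/-- Otherwise a nonzero functional on `ι → k` kills all the vectors `(b x (w i))ᵢ`. As `τ` is
bijective on the finite field, its coefficients can be written as `τ (g i)`; then `∑ g i • w i` is
orthogonal to everything, against linear independence. -/
lemma Nondeg.exists_apply_eq [Finite k] {c : FormCase} {q₀ : ℕ} (hτ : c.IsResSetting τ q₀)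
    {b : X →ₗ[k] X →ₛₗ[τ] k} (hb : c.IsResForm b) (hn : Nondeg b) {ι : Type*} [Finite ι]
    {w : ι → X} (hw : LinearIndependent k w) (f : ι → k) : ∃ x, ∀ i, b x (w i) = f i := by
  classical
  have := Fintype.ofFinite ι
  let φ : X →ₗ[k] (ι → k) :=
    { toFun := fun x i => b x (w i)
      map_add' := fun x y => by ext i; simp
      map_smul' := fun a x => by ext i; simp }
  have hφ : LinearMap.range φ = ⊤ := by
    by_contra h
    obtain ⟨f, hf, hle⟩ := Submodule.exists_le_ker_of_lt_top _ (lt_top_iff_ne_top.2 h)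
    have hsurj : Function.Surjective τ := Finite.injective_iff_surjective.1 τ.injective
    choose g hg using fun i => hsurj (f (Pi.single i 1))
    apply hf
    have h0 : ∑ i, g i • w i = 0 := by
      apply hn
      intro y
      apply FormCase.IsResForm.refl hτ hb
      have h1 : f (φ y) = 0 := hle ⟨y, rfl⟩
      rw [LinearMap.pi_apply_eq_sum_univ f] at h1
      rw [map_sum, ← h1]
      refine Finset.sum_congr rfl fun i _ => ?_
      have : (Pi.single i 1 : ι → k) = fun j => if i = j then 1 else 0 := by
        ext j; simp [Pi.single_apply, eq_comm]
      rw [LinearMap.map_smulₛₗ, hg, smul_eq_mul, smul_eq_mul, mul_comm, this]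
      rfl
    have h2 := Fintype.linearIndependent_iff.1 hw g h0
    refine LinearMap.pi_ext' fun i => LinearMap.ext_ring ?_
    simp [← hg, h2]
  obtain ⟨x, hx⟩ := LinearMap.range_eq_top.1 hφ f
  exact ⟨x, fun i => congrFun hx i⟩

lemma Nondeg.finrank_add_orth [Finite k] [Module.Finite k X] {c : FormCase} {q₀ : ℕ}
    (hτ : c.IsResSetting τ q₀) {b : X →ₗ[k] X →ₛₗ[τ] k} (hb : c.IsResForm b) (hn : Nondeg b)
    (W : Submodule k X) : finrank k W + finrank k (orth b W) = finrank k X := by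
  let w := finBasis k W
  let φ : X →ₗ[k] (Fin (finrank k W) → k) :=
    { toFun := fun x i => b x (w i)
      map_add' := fun x y => by ext i; simp
      map_smul' := fun a x => by ext i; simp }
  have hs : LinearMap.range φ = ⊤ := by
    rw [LinearMap.range_eq_top]
    intro f
    have hli : LinearIndependent k fun i => (w i : X) :=
      w.linearIndependent.map' W.subtype (Submodule.ker_subtype W)
    obtain ⟨x, hx⟩ := hn.exists_apply_eq hτ hb hli f
    exact ⟨x, funext hx⟩
  have hk : LinearMap.ker φ = orth b W := by
    ext x
    constructor
    · intro h y hy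
      have h1 : ∀ i, b x (w i) = 0 := fun i => congrFun h i
      have h2 := w.sum_repr ⟨y, hy⟩
      have h3 : y = ∑ i, w.repr ⟨y, hy⟩ i • (w i : X) := by
        have := congrArg W.subtype h2
        rw [map_sum] at this
        exact this.symm
      rw [h3, map_sum]
      exact Finset.sum_eq_zero fun i _ => by rw [LinearMap.map_smulₛₗ, h1 i, smul_zero]
    · intro h
      exact funext fun i => h _ (w i).2
  have := LinearMap.finrank_range_add_finrank_ker φ
  rw [hs, hk, finrank_top] at this
  simpa using this

lemma Nondeg.orth_orth [Finite k] [Module.Finite k X] {c : FormCase} {q₀ : ℕ}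
    (hτ : c.IsResSetting τ q₀) {b : X →ₗ[k] X →ₛₗ[τ] k} (hb : c.IsResForm b) (hn : Nondeg b)
    (W : Submodule k X) : orth b (orth b W) = W := by
  symm
  apply Submodule.eq_of_le_of_finrank_eq
  · intro x hx y hy
    exact FormCase.IsResForm.refl hτ hb (hy x hx)
  · have h1 := hn.finrank_add_orth hτ hb W
    have h2 := hn.finrank_add_orth hτ hb (orth b W)
    omega

/-- Restriction of a form to a subspace. -/
def restr (b : X →ₗ[k] X →ₛₗ[τ] k) (W : Submodule k X) : W →ₗ[k] W →ₛₗ[τ] k :=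
  b.domRestrict₁₂ W W

@[simp]
lemma restr_apply (b : X →ₗ[k] X →ₛₗ[τ] k) (W : Submodule k X) (x y : W) :
    restr b W x y = b x y := rfl

lemma FormCase.IsResForm.restr {c : FormCase} {b : X →ₗ[k] X →ₛₗ[τ] k} (hb : c.IsResForm b)
    (W : Submodule k X) : c.IsResForm (restr b W) := by
  cases c
  · exact fun x y => hb x y
  · exact fun x y => hb x y
  · exact fun x => hb x

lemma disjoint_orth_of_gram {b : X →ₗ[k] X →ₛₗ[τ] k} {ι : Type*} [Fintype ι] [DecidableEq ι]
    {e : ι → X} (he : (gram b e).det ≠ 0) :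
    Disjoint (Submodule.span k (Set.range e)) (orth b (Submodule.span k (Set.range e))) := by
  rw [Submodule.disjoint_def]
  intro x hx hx'
  obtain ⟨g, rfl⟩ := (Submodule.mem_span_range_iff_exists_fun k).1 hx
  have h1 : Matrix.vecMul g (gram b e) = 0 := by
    ext t
    have := hx' (e t) (Submodule.subset_span ⟨t, rfl⟩)
    simpa [Matrix.vecMul, dotProduct] using this
  have := Matrix.eq_zero_of_vecMul_eq_zero he h1
  exact Finset.sum_eq_zero fun i _ => by rw [congrFun this i]; simp

lemma Nondeg.isCompl_orth [Finite k] [Module.Finite k X] {c : FormCase} {q₀ : ℕ}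
    (hτ : c.IsResSetting τ q₀) {b : X →ₗ[k] X →ₛₗ[τ] k} (hb : c.IsResForm b) (hn : Nondeg b)
    {W : Submodule k X} (hW : Disjoint W (orth b W)) : IsCompl W (orth b W) := by
  refine ⟨hW, codisjoint_iff.2 (Submodule.eq_top_of_disjoint _ _ ?_ hW)⟩
  exact (hn.finrank_add_orth hτ hb W).ge

lemma Nondeg.restr_orth [Finite k] [Module.Finite k X] {c : FormCase} {q₀ : ℕ}
    (hτ : c.IsResSetting τ q₀) {b : X →ₗ[k] X →ₛₗ[τ] k} (hb : c.IsResForm b) (hn : Nondeg b)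
    {W : Submodule k X} (hW : Disjoint W (orth b W)) : Nondeg (restr b (orth b W)) := by
  intro x hx
  apply Subtype.ext
  apply hn
  intro y
  have : y ∈ W ⊔ orth b W := by rw [(hn.isCompl_orth hτ hb hW).sup_eq_top]; trivial
  obtain ⟨u, hu, v, hv, rfl⟩ := Submodule.mem_sup.1 this
  rw [map_add, x.2 u hu, zero_add]
  exact hx ⟨v, hv⟩

lemma gram_sumElim {b : X →ₗ[k] X →ₛₗ[τ] k} {ι κ : Type*} [Fintype ι] [DecidableEq ι]
    [Fintype κ] [DecidableEq κ] {v : ι → X} {w : κ → X} (h : ∀ s t, b (w s) (v t) = 0) :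
    (gram b (Sum.elim v w)).det = (gram b v).det * (gram b w).det := by
  have : gram b (Sum.elim v w) =
      Matrix.fromBlocks (gram b v) (Matrix.of fun s t => b (v s) (w t)) 0 (gram b w) := by
    ext s t
    rcases s with s | s <;> rcases t with t | t <;> simp [h]
  rw [this, Matrix.det_fromBlocks_zero₂₁]

lemma gram_orth_coe {b : X →ₗ[k] X →ₛₗ[τ] k} {ι : Type*} {W : Submodule k X} (a : ι → W) :
    gram b (fun s => (a s : X)) = gram (restr b W) a := rfl

/-- The type of an orthogonal sum. -/
lemma HT.glue [Finite k] [Module.Finite k X] {c : FormCase} {q₀ : ℕ}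
    (hτ : c.IsResSetting τ q₀) {b : X →ₗ[k] X →ₛₗ[τ] k} (hb : c.IsResForm b) (hn : Nondeg b)
    {ι : Type*} [Fintype ι] [DecidableEq ι] {e : ι → X} (he : (gram b e).det ≠ 0) {d₁ : ℕ}
    (hd₁ : Fintype.card ι = c.γ * d₁) {d : ℕ} {χ : c.Sign}
    (h : HT c (restr b (orth b (Submodule.span k (Set.range e)))) d χ) :
    HT c b (d₁ + d) (c.sign (gram b e).det * χ) := by
  obtain ⟨a, h1, h2, rfl⟩ := h
  have h3 : (gram b (Sum.elim e fun s => (a s : X))).det = (gram b e).det *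
      (gram (restr b (orth b (Submodule.span k (Set.range e)))) a).det := by
    rw [gram_sumElim fun s t => (a s).2 _ (Submodule.subset_span ⟨t, rfl⟩), gram_orth_coe]
  rw [← c.sign_mul he h1, ← h3]
  have h4 := hn.finrank_add_orth hτ hb (Submodule.span k (Set.range e))
  have h5 := finrank_span_eq_card (linearIndependent_of_gram he)
  refine HT.mk' _ ?_ ?_ ?_
  · rw [h3]; exact mul_ne_zero he h1
  · rw [← h4, h5, h2]; simp
  · simp [hd₁, mul_add]

lemma gram_pair_det {b : X →ₗ[k] X →ₛₗ[τ] k} {u w : X} (hu : b u u = 0) (h : b u w ≠ 0)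
    (h' : b w u ≠ 0) : (gram b ![u, w]).det ≠ 0 := by
  rw [Matrix.det_fin_two]
  simp [hu, h, h']

lemma Nondeg.exists_one {c : FormCase}
    {b : X →ₗ[k] X →ₛₗ[τ] k} (hn : Nondeg b) [Finite k] {q₀ : ℕ}
    (hτ : c.IsResSetting τ q₀) (hb : c.IsResForm b) {u : X} (hu : u ≠ 0) : ∃ w, b w u = 1 := by
  obtain ⟨x, hx⟩ := hn.exists_apply_eq hτ hb (w := ![u])
    (LinearIndependent.of_subsingleton (v := ![u]) 0 hu) fun _ => 1
  exact ⟨x, hx 0⟩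

/-- Every nondegenerate space has a type. -/
lemma Nondeg.exists_HT [Finite k] {c : FormCase} {q₀ : ℕ}
    (hτ : c.IsResSetting τ q₀) [Module.Finite k X] {b : X →ₗ[k] X →ₛₗ[τ] k} (hb : c.IsResForm b)
    (hn : Nondeg b) : ∃ d χ, HT c b d χ := by
  by_cases hc : c = .alternating
  swap
  · have hγ : c.γ = 1 := by cases c <;> simp_all [FormCase.γ]
    exact ⟨finrank k X, _, HT.mk' (finBasis k X) (gram_det_ne_zero hn _) (by simp) (by simp [hγ])⟩
  induction h : finrank k X using Nat.strong_induction_on generalizing X with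
  | _ r ih =>
    by_cases hr : r = 0
    · subst hr
      refine ⟨0, _, HT.mk' (ι := Fin 0) Fin.elim0 ?_ (by simpa using h) (by simp)⟩
      simp
    -- An alternating space splits off a hyperbolic plane; this is why its dimension is a multiple
    -- of `γ = 2`.
    · have : Nontrivial X := by
        rw [← finrank_pos_iff (R := k)]; omega
      obtain ⟨u, hu⟩ := exists_ne (0 : X)
      obtain ⟨w, hw⟩ := hn.exists_one hτ hb hu
      have hu0 : b u u = 0 := by subst hc; exact hb u
      have hw0 : b w u ≠ 0 := by simp [hw]
      have hw1 : b u w ≠ 0 := fun h => hw0 (FormCase.IsResForm.refl hτ hb h)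
      have hdet := gram_pair_det hu0 hw1 hw0
      have hdis := disjoint_orth_of_gram hdet
      have hf := hn.finrank_add_orth hτ hb (Submodule.span k (Set.range ![u, w]))
      have h5 := finrank_span_eq_card (linearIndependent_of_gram hdet)
      simp only [Fintype.card_fin] at h5
      obtain ⟨d, χ, hd⟩ := ih (finrank k (orth b (Submodule.span k (Set.range ![u, w]))))
        (by omega) (hb.restr _) (hn.restr_orth hτ hb hdis) rfl
      exact ⟨_, _, hd.glue hτ hb hn hdet (d₁ := 1) (by subst hc; simp [FormCase.γ])⟩

/-- `W` modulo its radical has type `(d, χ)`. -/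
def SubTyp (c : FormCase) (b : X →ₗ[k] X →ₛₗ[τ] k) (W : Submodule k X) (d : ℕ) (χ : c.Sign) :
    Prop :=
  ∃ a : Fin (c.γ * d) → X, (∀ s, a s ∈ W) ∧ (gram b a).det ≠ 0 ∧
    finrank k W = c.γ * d + finrank k (W ⊓ orth b W : Submodule k X) ∧
    c.sign (gram b a).det = χ

/-- A complement of the radical in `W` is nondegenerate: a vector of it orthogonal to the complement
is orthogonal to all of `W`, so it lies in the radical. -/
lemma exists_subTyp [Finite k] {c : FormCase} {q₀ : ℕ}
    (hτ : c.IsResSetting τ q₀) [Module.Finite k X] {b : X →ₗ[k] X →ₛₗ[τ] k} (hb : c.IsResForm b)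
    (W : Submodule k X) : ∃ d χ, SubTyp c b W d χ := by
  obtain ⟨U, hU⟩ := ((W ⊓ orth b W).submoduleOf W).exists_isCompl
  have hn : Nondeg (restr (restr b W) U) := by
    intro x hx
    have h1 : ((x : W) : X) ∈ orth b W := by
      intro y hy
      have h2 : (⟨y, hy⟩ : W) ∈ (W ⊓ orth b W).submoduleOf W ⊔ U := by
        rw [hU.sup_eq_top]; trivial
      obtain ⟨m, hm, u, hu, huv⟩ := Submodule.mem_sup.1 h2
      have h3 : y = (m : X) + u := congrArg Subtype.val huv.symm
      have h4 : b (m : X) (x : W) = 0 := by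
        have : (m : X) ∈ W ⊓ orth b W := hm
        exact this.2 _ (x : W).2
      rw [h3, map_add, FormCase.IsResForm.refl hτ hb h4, zero_add]
      exact hx ⟨u, hu⟩
    have h5 : (x : W) ∈ (W ⊓ orth b W).submoduleOf W := ⟨(x : W).2, h1⟩
    exact Subtype.ext (Submodule.disjoint_def.1 hU.disjoint _ h5 x.2)
  obtain ⟨d, χ, a, h1, h2, h3⟩ := hn.exists_HT hτ ((hb.restr W).restr U)
  refine ⟨d, χ, fun s => ((a s : W) : X), fun s => (a s : W).2, h1, ?_, h3⟩
  have h4 := Submodule.finrank_add_eq_of_isCompl hU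
  rw [h2] at h4
  have h6 : finrank k ((W ⊓ orth b W).submoduleOf W) =
      finrank k (W ⊓ orth b W : Submodule k X) :=
    (Submodule.submoduleOfEquivOfLe inf_le_left).finrank_eq
  omega

lemma SubTyp.finrank_eq {c : FormCase} {b : X →ₗ[k] X →ₛₗ[τ] k} {W : Submodule k X} {d : ℕ}
    {χ : c.Sign} (h : SubTyp c b W d χ) :
    finrank k W = c.γ * d + finrank k (W ⊓ orth b W : Submodule k X) := h.choose_spec.2.2.1

/-- A basis adapted to a subspace `W` of a nondegenerate space: `W` is spanned by the blocks
indexed by `Fin (γ n)` and the first `Fin m`. -/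
structure AdaptedBasis (c : FormCase) (b : X →ₗ[k] X →ₛₗ[τ] k) (W : Submodule k X)
    (n : ℕ) (ψ₁ : c.Sign) (m l : ℕ) (ψ₂ : c.Sign) where
  a : Fin (c.γ * n) → X
  c' : Fin (c.γ * l) → X
  μ : Fin m → X
  ν : Fin m → X
  s : k
  s_mul : s * s = 1
  s_eq : c = .symmetric → s = 1
  a_mem : ∀ i, a i ∈ W
  μ_mem : ∀ i, μ i ∈ W ⊓ orth b W
  c_mem : ∀ i, c' i ∈ orth b W
  det_a : (gram b a).det ≠ 0
  sign_a : c.sign (gram b a).det = ψ₁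
  det_c : (gram b c').det ≠ 0
  sign_c : c.sign (gram b c').det = ψ₂
  ν_μ : ∀ i j, b (ν i) (μ j) = if i = j then 1 else 0
  μ_ν : ∀ i j, b (μ i) (ν j) = if i = j then s else 0
  μ_c : ∀ i j, b (μ i) (c' j) = 0
  c_μ : ∀ i j, b (c' i) (μ j) = 0
  a_c : ∀ i j, b (a i) (c' j) = 0
  a_μ : ∀ i j, b (a i) (μ j) = 0
  ν_a : ∀ i j, b (ν i) (a j) = 0
  ν_c : ∀ i j, b (ν i) (c' j) = 0
  dim : finrank k X = c.γ * n + c.γ * l + (m + m)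
  dim_W : finrank k W = c.γ * n + m

/-- The nondegenerate parts `a` of `W` and `e` of its orthogonal are independent together with a
basis `μ` of the common radical, so nondegeneracy provides `ν` dual to `μ` and orthogonal to `a` and
`e`. Nothing is required of the products of the `ν` among themselves, since that block drops out of
the determinants. -/
lemma SubTyp.exists_adaptedBasis [Finite k] {c : FormCase} {q₀ : ℕ}
    (hτ : c.IsResSetting τ q₀) [Module.Finite k X] {b : X →ₗ[k] X →ₛₗ[τ] k} (hb : c.IsResForm b)
    (hn : Nondeg b) {W : Submodule k X} {n m l : ℕ} {ψ₁ ψ₂ : c.Sign} (h₁ : SubTyp c b W n ψ₁)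
    (hm : finrank k (W ⊓ orth b W : Submodule k X) = m) (h₂ : SubTyp c b (orth b W) l ψ₂) :
    Nonempty (AdaptedBasis c b W n ψ₁ m l ψ₂) := by
  obtain ⟨a, a1, a2, a3, a4⟩ := h₁
  obtain ⟨e, e1, e2, e3, e4⟩ := h₂
  obtain ⟨s, s1, s2, s3⟩ := hb.exists_symm hτ
  rw [hn.orth_orth hτ hb, inf_comm, hm] at e3
  rw [hm] at a3
  let μ := finBasisOfFinrankEq k (W ⊓ orth b W : Submodule k X) hm
  have hli : LinearIndependent k fun i => (μ i : X) :=
    μ.linearIndependent.map' (Submodule.subtype _) (Submodule.ker_subtype _)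
  have hrefl := fun {x y : X} (h : b x y = 0) => FormCase.IsResForm.refl hτ hb h
  have hmem : ∀ i, (μ i : X) ∈ W ⊓ orth b W := fun i => (μ i).2
  have hμc : ∀ i j, b (μ i) (e j) = 0 := fun i j => hrefl (e1 j _ (hmem i).1)
  have hμa : ∀ i j, b (μ i) (a j) = 0 := fun i j => (hmem i).2 _ (a1 j)
  have hac : (gram b (Sum.elim a e)).det ≠ 0 := by
    rw [gram_sumElim fun s t => e1 s _ (a1 t)]
    exact mul_ne_zero a2 e2
  have hli' : LinearIndependent k (Sum.elim (Sum.elim a e) fun i => (μ i : X)) := by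
    refine (linearIndependent_of_gram hac).sum_type hli ((disjoint_orth_of_gram hac).mono_right ?_)
    rw [Submodule.span_le]
    rintro _ ⟨i, rfl⟩ y hy
    induction hy using Submodule.span_induction with
    | mem y hy =>
      obtain ⟨j | j, rfl⟩ := hy
      · exact hμa i j
      · exact hμc i j
    | zero => simp
    | add y z _ _ hy hz => rw [map_add, hy, hz, add_zero]
    | smul r y _ hy => rw [LinearMap.map_smulₛₗ, hy, smul_zero]
  choose ν hν using fun i : Fin m => hn.exists_apply_eq hτ hb hli'
    (Sum.elim (fun _ => 0) fun j => if i = j then 1 else 0)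
  have hνμ : ∀ i j, b (ν i) (μ j) = if i = j then 1 else 0 := fun i j => hν i (.inr j)
  refine ⟨⟨a, e, fun i => μ i, ν, s, s1, s2, a1, hmem, e1, a2, a4, e2, e4, hνμ, ?_, hμc, ?_, ?_,
    ?_, fun i j => hν i (.inl (.inl j)), fun i j => hν i (.inl (.inr j)), ?_, a3⟩⟩
  · intro i j
    rw [s3, hνμ]
    simp only [eq_comm (a := i)]
    split_ifs <;> simp
  · exact fun i j => e1 i _ (hmem j).1
  · exact fun i j => hrefl (e1 j _ (a1 i))
  · exact fun i j => hrefl ((hmem j).2 _ (a1 i))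
  · have := hn.finrank_add_orth hτ hb W
    omega

/-- Exchanging the two block columns makes the matrix block triangular. The exchange matrix `J` has
determinant `(-1) ^ m`, found by making it triangular with the unipotent matrices `A` and `A'`; this
is the source of the factor `ε ^ m` in the sign formulas. -/
lemma det_fromBlocks_zero_right {m : Type*} [Fintype m] [DecidableEq m] {R : Type*} [CommRing R]
    (Z P P' : Matrix m m R) :
    (Matrix.fromBlocks Z P P' 0).det = (-1) ^ Fintype.card m * (P.det * P'.det) := by
  let J : Matrix (m ⊕ m) (m ⊕ m) R := Matrix.fromBlocks 0 1 1 0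
  let A : Matrix (m ⊕ m) (m ⊕ m) R := Matrix.fromBlocks 1 1 0 1
  let A' : Matrix (m ⊕ m) (m ⊕ m) R := Matrix.fromBlocks 1 (-1) 0 1
  have h : (Matrix.fromBlocks Z P P' 0) * J = Matrix.fromBlocks P Z 0 P' := by
    simp [J, Matrix.fromBlocks_multiply]
  have h2 : J.det = (-1) ^ Fintype.card m := by
    have h3 : A * J * A' = Matrix.fromBlocks 1 0 1 (-1) := by
      simp [A, A', J, Matrix.fromBlocks_multiply]
    have h4 := congrArg Matrix.det h3
    rw [Matrix.det_mul, Matrix.det_mul, Matrix.det_fromBlocks_zero₂₁, Matrix.det_fromBlocks_zero₂₁,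
      Matrix.det_fromBlocks_zero₁₂, Matrix.det_neg] at h4
    simpa using h4
  have h5 := congrArg Matrix.det h
  rw [Matrix.det_mul, h2, Matrix.det_fromBlocks_zero₂₁] at h5
  have h6 : ((-1 : R) ^ Fintype.card m) * (-1) ^ Fintype.card m = 1 := by
    rw [← mul_pow]; simp
  calc _ = (Matrix.fromBlocks Z P P' 0).det * ((-1 : R) ^ Fintype.card m *
        (-1) ^ Fintype.card m) := by rw [h6, mul_one]
    _ = _ := by rw [← mul_assoc, h5]; ring

namespace AdaptedBasis

variable {c : FormCase} {b : X →ₗ[k] X →ₛₗ[τ] k} {W : Submodule k X} {n m l : ℕ}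
  {ψ₁ ψ₂ : c.Sign} (β : AdaptedBasis c b W n ψ₁ m l ψ₂)

/-- The basis as one family. -/
def fam : (Fin (c.γ * n) ⊕ Fin (c.γ * l)) ⊕ (Fin m ⊕ Fin m) → X :=
  Sum.elim (Sum.elim β.a β.c') (Sum.elim β.ν β.μ)

/-- Determinant of the block `[[Z, s], [1, 0]]`. -/
lemma sign_hyperbolic [Finite k] (c : FormCase) {s : k} (hs : s * s = 1)
    (hs' : c = .symmetric → s = 1) (m : ℕ) :
    (((-1) ^ m * (s ^ m * 1) : k) ≠ 0) ∧
    c.sign ((-1) ^ m * (s ^ m * 1) : k) = c.sign (-1 : k) ^ m := by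
  have h0 : s ≠ 0 := fun h => by simp [h] at hs
  have h1 : (-1 : k) ≠ 0 := by simp
  refine ⟨by simp [h0], ?_⟩
  rcases eq_or_ne c .symmetric with rfl | hc
  · rw [hs' rfl, one_pow, mul_one, mul_one, FormCase.sign_pow _ h1]
  · have := FormCase.Sign.subsingleton hc
    exact Subsingleton.elim _ _

lemma fam_det [Finite k] {q₀ : ℕ} (hτ : c.IsResSetting τ q₀) (hb : c.IsResForm b) :
    (gram b β.fam).det ≠ 0 ∧
    c.sign (gram b β.fam).det = ψ₁ * c.sign (-1 : k) ^ m * ψ₂ := by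
  have hrefl := fun {x y : X} (h : b x y = 0) => FormCase.IsResForm.refl hτ hb h
  have h1 : (gram b (Sum.elim β.a β.c')).det = (gram b β.a).det * (gram b β.c').det :=
    gram_sumElim fun s t => hrefl (β.a_c t s)
  have h2 : (gram b (Sum.elim β.ν β.μ)).det = (-1) ^ m * (β.s ^ m * 1) := by
    have : gram b (Sum.elim β.ν β.μ) = Matrix.fromBlocks (gram b β.ν) 1
        (Matrix.diagonal fun _ => β.s) 0 := by
      ext i j
      rcases i with i | i <;> rcases j with j | j <;>
        simp [β.ν_μ, β.μ_ν, Matrix.one_apply, Matrix.diagonal_apply, (β.μ_mem i).2 _ (β.μ_mem j).1]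
    rw [this, det_fromBlocks_zero_right]
    simp
  have h3 : (gram b β.fam).det = (gram b β.a).det * (gram b β.c').det *
      ((-1) ^ m * (β.s ^ m * 1)) := by
    rw [fam, gram_sumElim, h1, h2]
    rintro (i | i) (j | j)
    · exact β.ν_a i j
    · exact β.ν_c i j
    · exact hrefl (β.a_μ j i)
    · exact β.μ_c i j
  obtain ⟨h4, h5⟩ := sign_hyperbolic c β.s_mul β.s_eq m
  have h6 := mul_ne_zero β.det_a β.det_c
  refine ⟨by rw [h3]; exact mul_ne_zero h6 h4, ?_⟩
  rw [h3, c.sign_mul h6 h4, c.sign_mul β.det_a β.det_c, h5, β.sign_a, β.sign_c]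
  exact mul_right_comm _ _ _

/-- The type of a nondegenerate space in terms of the data of a subspace. -/
lemma hT [Finite k] {q₀ : ℕ} (β : AdaptedBasis c b W n ψ₁ m l ψ₂) (hτ : c.IsResSetting τ q₀) (hb : c.IsResForm b) :
    HT c b (n + 2 / c.γ * m + l) (ψ₁ * c.sign (-1 : k) ^ m * ψ₂) := by
  obtain ⟨h1, h2⟩ := β.fam_det hτ hb
  rw [← h2]
  refine HT.mk' _ h1 ?_ ?_
  · rw [β.dim]; simp
  · have : c.γ * (2 / c.γ) = 2 := by cases c <;> simp [FormCase.γ]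
    simp only [Fintype.card_sum, Fintype.card_fin]
    rw [mul_add, mul_add, ← mul_assoc, this]
    ring

end AdaptedBasis

end FiniteForms2

/-! ### Recursions for numbers of subspaces by double counting -/

section SubspaceRecursion

open Module

variable {k X : Type*} [Field k] [AddCommGroup X] [Module k X] {τ : k →+* k}

/-- `W` is the sum of its radical and the span of `a`. Moving the vectors of `a'` by elements of the
radical into this span leaves their Gram matrix unchanged, and then only a change of basis remains.
-/
lemma SubTyp.unique [Finite k] [Module.Finite k X] {c : FormCase} {q₀ : ℕ}
    (hτ : c.IsResSetting τ q₀) {b : X →ₗ[k] X →ₛₗ[τ] k} (hb : c.IsResForm b) {W : Submodule k X}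
    {d d' : ℕ} {χ χ' : c.Sign} (h : SubTyp c b W d χ) (h' : SubTyp c b W d' χ') :
    d = d' ∧ χ = χ' := by
  have hd : d = d' := by
    have h1 := h.finrank_eq
    have h2 := h'.finrank_eq
    exact Nat.eq_of_mul_eq_mul_left c.γ_pos (by omega)
  subst hd
  refine ⟨rfl, ?_⟩
  obtain ⟨a, h1, h2, h3, rfl⟩ := h
  obtain ⟨a', h1', h2', h3', rfl⟩ := h'
  have hsp : Submodule.span k (Set.range a) ⊔ (W ⊓ orth b W) = W := by
    apply Submodule.eq_of_le_of_finrank_eq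
    · exact sup_le (Submodule.span_le.2 (by rintro _ ⟨i, rfl⟩; exact h1 i)) inf_le_left
    · have h4 : Submodule.span k (Set.range a) ⊓ (W ⊓ orth b W) = ⊥ := by
        rw [← disjoint_iff]
        refine (disjoint_orth_of_gram h2).mono_right ?_
        intro x hx y hy
        exact hx.2 y ((Submodule.span_le.2 (by rintro _ ⟨i, rfl⟩; exact h1 i)) hy)
      have h5 := Submodule.finrank_sup_add_finrank_inf_eq (Submodule.span k (Set.range a))
        (W ⊓ orth b W)
      rw [h4, finrank_bot, finrank_span_eq_card (linearIndependent_of_gram h2),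
        Fintype.card_fin] at h5
      omega
  have h4 : ∀ i, ∃ u ∈ Submodule.span k (Set.range a), ∃ r ∈ W ⊓ orth b W, u + r = a' i := by
    intro i
    rw [← Submodule.mem_sup, hsp]
    exact h1' i
  choose u hu r hr hur using h4
  have h5 : gram b a' = gram b u := by
    ext i j
    have e1 : b (r i) (a' j) = 0 := (hr i).2 _ (h1' j)
    have e2 : b (u i) (r j) = 0 := FormCase.IsResForm.refl hτ hb ((hr j).2 _ (by
      have : u i = a' i - r i := by rw [← hur]; simp
      rw [this]
      exact W.sub_mem (h1' i) (hr i).1))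
    simp only [gram_apply]
    conv_lhs => rw [← hur i, map_add, LinearMap.add_apply, e1, add_zero, ← hur j, map_add, e2,
      add_zero]
  rw [h5] at h2' ⊢
  exact (sign_gram_eq hτ h2 h2' hu).symm

/-- The set of subspaces whose radical has dimension `m` and whose nondegenerate quotient has type
`(n, ψ)`. -/
def goodSubs (c : FormCase) (b : X →ₗ[k] X →ₛₗ[τ] k) (n : ℕ) (ψ : c.Sign) (m : ℕ) :
    Set (Submodule k X) :=
  {W | finrank k (W ⊓ orth b W : Submodule k X) = m ∧ SubTyp c b W n ψ}

section Isotropic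

variable {b : X →ₗ[k] X →ₛₗ[τ] k} {v w : X}

/-- The subspace `⟨v⟩ + W'` for a subspace `W'` of the orthogonal of `⟨v, w⟩`. -/
def addLine (v w : X) (W' : Submodule k (orth b (Submodule.span k (Set.range ![v, w])))) :
    Submodule k X :=
  Submodule.span k {v} ⊔ W'.map (Submodule.subtype _)

lemma mem_orth_pair {x : X} : x ∈ orth b (Submodule.span k (Set.range ![v, w])) ↔
    b x v = 0 ∧ b x w = 0 := by
  constructor
  · intro h
    exact ⟨h v (Submodule.subset_span ⟨0, rfl⟩), h w (Submodule.subset_span ⟨1, rfl⟩)⟩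
  · rintro ⟨h1, h2⟩ y hy
    induction hy using Submodule.span_induction with
    | mem y hy =>
      obtain ⟨j, rfl⟩ := hy
      fin_cases j
      · exact h1
      · exact h2
    | zero => simp
    | add y z _ _ hy hz => rw [map_add, hy, hz, add_zero]
    | smul r y _ hy => rw [LinearMap.map_smulₛₗ, hy, smul_zero]

lemma mem_addLine {W' : Submodule k (orth b (Submodule.span k (Set.range ![v, w])))} {y : X} :
    y ∈ addLine v w W' ↔ ∃ (α : k), ∃ x' ∈ W', α • v + (x' : X) = y := by
  rw [addLine, Submodule.mem_sup]
  constructor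
  · rintro ⟨_, h1, _, ⟨x', h2, rfl⟩, rfl⟩
    obtain ⟨α, rfl⟩ := Submodule.mem_span_singleton.1 h1
    exact ⟨α, x', h2, rfl⟩
  · rintro ⟨α, x', h2, rfl⟩
    exact ⟨_, Submodule.mem_span_singleton.2 ⟨α, rfl⟩, _, ⟨x', h2, rfl⟩, rfl⟩

lemma comap_addLine (hvw : b v w ≠ 0)
    (W' : Submodule k (orth b (Submodule.span k (Set.range ![v, w])))) :
    (addLine v w W').comap (Submodule.subtype _) = W' := by
  ext x
  rw [Submodule.mem_comap, mem_addLine]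
  constructor
  · rintro ⟨α, x', h2, h3⟩
    have h4 := (mem_orth_pair.1 x.2).2
    have h5 := (mem_orth_pair.1 x'.2).2
    rw [Submodule.subtype_apply] at h3
    rw [← h3, map_add, LinearMap.add_apply, h5, map_smul, LinearMap.smul_apply, add_zero,
      smul_eq_mul, mul_eq_zero, or_iff_left hvw] at h4
    rw [h4, zero_smul, zero_add] at h3
    rwa [← Subtype.ext h3]
  · intro h
    exact ⟨0, x, h, by simp⟩

lemma addLine_comap (hv : b v v = 0) (hvw : b v w ≠ 0) {W : Submodule k X} (hvW : v ∈ W)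
    (hW : ∀ x ∈ W, b x v = 0) : addLine v w (W.comap
      (Submodule.subtype (orth b (Submodule.span k (Set.range ![v, w]))))) = W := by
  ext y
  rw [mem_addLine]
  constructor
  · rintro ⟨α, x', h2, rfl⟩
    exact W.add_mem (W.smul_mem _ hvW) h2
  · intro hy
    have h1 : y - (b y w / b v w) • v ∈ orth b (Submodule.span k (Set.range ![v, w])) := by
      rw [mem_orth_pair]
      simp [hv, hW y hy, hvw]
    exact ⟨b y w / b v w, ⟨_, h1⟩, W.sub_mem hy (W.smul_mem _ hvW), by simp⟩

lemma addLine_inf_orth (hv : b v v = 0) (hrefl : ∀ x y, b x y = 0 → b y x = 0)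
    (W' : Submodule k (orth b (Submodule.span k (Set.range ![v, w])))) :
    addLine v w W' ⊓ orth b (addLine v w W') = addLine v w (W' ⊓ orth (restr b _) W') := by
  ext y
  simp only [Submodule.mem_inf, mem_addLine]
  constructor
  · rintro ⟨⟨α, x', h2, rfl⟩, h3⟩
    refine ⟨α, x', ⟨h2, ?_⟩, rfl⟩
    intro z hz
    have h4 := h3 z (mem_addLine.2 ⟨0, z, hz, by simp⟩)
    rw [map_add, LinearMap.add_apply, map_smul, LinearMap.smul_apply,
      hrefl _ _ (mem_orth_pair.1 z.2).1, smul_zero, zero_add] at h4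
    exact h4
  · rintro ⟨α, x', ⟨h2, h3⟩, rfl⟩
    refine ⟨⟨α, x', h2, rfl⟩, ?_⟩
    intro z hz
    obtain ⟨β, z', h4, rfl⟩ := mem_addLine.1 hz
    have h5 : b x' z' = 0 := h3 z' h4
    simp [hv, hrefl _ _ (mem_orth_pair.1 z'.2).1, (mem_orth_pair.1 x'.2).1, h5]

lemma finrank_addLine [Module.Finite k X] (hv0 : v ≠ 0) (hvw : b v w ≠ 0)
    (W' : Submodule k (orth b (Submodule.span k (Set.range ![v, w])))) :
    finrank k (addLine v w W') = finrank k W' + 1 := by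
  have h := Submodule.finrank_sup_add_finrank_inf_eq (Submodule.span k {v})
    (W'.map (Submodule.subtype _))
  have h1 : Submodule.span k {v} ⊓ W'.map (Submodule.subtype _) = ⊥ := by
    rw [eq_bot_iff]
    rintro x ⟨h1, x', -, rfl⟩
    obtain ⟨α, h2⟩ := Submodule.mem_span_singleton.1 h1
    have h3 := (mem_orth_pair.1 x'.2).2
    rw [Submodule.subtype_apply] at h2
    rw [← h2, map_smul, LinearMap.smul_apply, smul_eq_mul, mul_eq_zero, or_iff_left hvw] at h3
    rw [Submodule.subtype_apply, ← h2, h3, zero_smul]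
    exact Submodule.zero_mem _
  rw [h1, finrank_bot, finrank_span_singleton hv0, LinearEquiv.finrank_eq
    (Submodule.equivMapOfInjective (Submodule.subtype _) (Submodule.injective_subtype _) W').symm]
    at h
  rw [addLine]
  omega

lemma subTyp_addLine_iff [Module.Finite k X] {c : FormCase} (hv0 : v ≠ 0) (hv : b v v = 0)
    (hvw : b v w ≠ 0) (hrefl : ∀ x y, b x y = 0 → b y x = 0)
    (W' : Submodule k (orth b (Submodule.span k (Set.range ![v, w])))) (n : ℕ) (ψ : c.Sign) :
    SubTyp c b (addLine v w W') n ψ ↔ SubTyp c (restr b _) W' n ψ := by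
  have hd : (finrank k (addLine v w W') = c.γ * n +
      finrank k (addLine v w W' ⊓ orth b (addLine v w W') : Submodule k X)) ↔
      (finrank k W' = c.γ * n + finrank k (W' ⊓ orth (restr b _) W' : Submodule k _)) := by
    rw [addLine_inf_orth hv hrefl, finrank_addLine hv0 hvw, finrank_addLine hv0 hvw]
    omega
  constructor
  · rintro ⟨a, h1, h2, h3, h4⟩
    choose α a' h5 h6 using fun i => mem_addLine.1 (h1 i)
    have h7 : gram b a = gram (restr b _) a' := by
      ext i j
      simp only [gram_apply, restr_apply, ← h6]
      simp [hv, hrefl _ _ (mem_orth_pair.1 (a' j).2).1, (mem_orth_pair.1 (a' i).2).1]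
    exact ⟨a', h5, by rwa [← h7], hd.1 h3, by rwa [← h7]⟩
  · rintro ⟨a, h1, h2, h3, h4⟩
    exact ⟨fun i => a i, fun i => mem_addLine.2 ⟨0, a i, h1 i, by simp⟩, h2, hd.2 h3, h4⟩

/-- Subspaces with `v` in the radical correspond to subspaces of `v^⊥ / ⟨v⟩`, for which the
orthogonal of the plane `⟨v, w⟩` is a model. The radical loses the line of `v`, and the
nondegenerate quotient does not change. -/
lemma card_goodSubs_mem [Module.Finite k X] {c : FormCase} (hv0 : v ≠ 0) (hv : b v v = 0)
    (hvw : b v w ≠ 0) (hrefl : ∀ x y, b x y = 0 → b y x = 0) (n : ℕ) (ψ : c.Sign) (m : ℕ) :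
    Nat.card {W : goodSubs c b n ψ (m + 1) // v ∈ W.1 ⊓ orth b W.1} =
      Nat.card (goodSubs c (restr b (orth b (Submodule.span k (Set.range ![v, w])))) n ψ m) := by
  have hW : ∀ W : {W : goodSubs c b n ψ (m + 1) // v ∈ W.1 ⊓ orth b W.1},
      addLine v w (W.1.1.comap
      (Submodule.subtype (orth b (Submodule.span k (Set.range ![v, w]))))) = W.1.1 :=
    fun W => addLine_comap hv hvw W.2.1 fun x hx => hrefl _ _ (W.2.2 x hx)
  refine Nat.card_congr
    { toFun := fun W => ⟨W.1.1.comap (Submodule.subtype _), ?_, ?_⟩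
      invFun := fun W' => ⟨⟨addLine v w W'.1, ?_, ?_⟩, ?_, ?_⟩
      left_inv := fun W => Subtype.ext (Subtype.ext (hW W))
      right_inv := fun W' => Subtype.ext (comap_addLine hvw _) }
  · have h := W.1.2.1
    rw [← hW W, addLine_inf_orth hv hrefl, finrank_addLine hv0 hvw] at h
    omega
  · have h := W.1.2.2
    rw [← hW W] at h
    exact (subTyp_addLine_iff hv0 hv hvw hrefl _ _ _).1 h
  · rw [addLine_inf_orth hv hrefl, finrank_addLine hv0 hvw, W'.2.1]
  · exact (subTyp_addLine_iff hv0 hv hvw hrefl _ _ _).2 W'.2.2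
  · exact mem_addLine.2 ⟨1, 0, W'.1.zero_mem, by simp⟩
  · intro z hz
    obtain ⟨β, z', h4, rfl⟩ := mem_addLine.1 hz
    simp [hv, hrefl _ _ (mem_orth_pair.1 z'.2).1]

end Isotropic

/-- Double counting. -/
lemma card_mul_eq_of_forall {α β : Type*} [Finite α] [Finite β] (r : α → β → Prop) {x y : ℚ}
    (hx : ∀ a, (Nat.card {b // r a b} : ℚ) = x) (hy : ∀ b, (Nat.card {a // r a b} : ℚ) = y) :
    Nat.card α * x = Nat.card β * y := by
  have := Fintype.ofFinite α
  have := Fintype.ofFinite β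
  let e : (Σ a, {b // r a b}) ≃ (Σ b, {a // r a b}) :=
    { toFun := fun p => ⟨p.2.1, p.1, p.2.2⟩
      invFun := fun p => ⟨p.2.1, p.1, p.2.2⟩
      left_inv := fun _ => rfl
      right_inv := fun _ => rfl }
  have h := Nat.card_congr e
  rw [Nat.card_sigma, Nat.card_sigma] at h
  have h' := congrArg (fun n : ℕ => (n : ℚ)) h
  simpa [hx, hy] using h'

instance finite_submodule (k X : Type*) [Field k] [Finite k] [AddCommGroup X] [Module k X]
    [Module.Finite k X] : Finite (Submodule k X) :=
  have : Finite X := Module.finite_of_finite k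
  Finite.of_injective (fun W : Submodule k X => (W : Set X)) SetLike.coe_injective

lemma card_nonzero (k X : Type*) [Field k] [Finite k] [AddCommGroup X] [Module k X]
    [Module.Finite k X] (m : ℕ) (hm : finrank k X = m) :
    Nat.card {x : X // x ≠ 0} = Nat.card k ^ m - 1 := by
  have : Finite X := Module.finite_of_finite k
  have h := Module.natCard_eq_pow_finrank (K := k) (V := X)
  rw [hm] at h
  rw [← h]
  have := Fintype.ofFinite X
  classical
  rw [Nat.card_eq_fintype_card, Nat.card_eq_fintype_card, Fintype.card_subtype_compl]
  simp

/-- Recursion for the number of subspaces with given radical dimension. -/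
lemma card_goodSubs_succ [Finite k] [Module.Finite k X] {c : FormCase} {q₀ : ℕ}
    (hτ : c.IsResSetting τ q₀) {b : X →ₗ[k] X →ₛₗ[τ] k} (hb : c.IsResForm b) (hn : Nondeg b)
    {n : ℕ} {ψ : c.Sign} {m : ℕ} {R : ℚ}
    (hR : ∀ v w, b v v = 0 → b v w ≠ 0 → b w v = 1 →
      (Nat.card (goodSubs c (restr b (orth b (Submodule.span k (Set.range ![v, w])))) n ψ m) : ℚ) =
        R) :
    (Nat.card (goodSubs c b n ψ (m + 1)) : ℚ) * ((Nat.card k : ℚ) ^ (m + 1) - 1) =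
      Nat.card {v : X // v ≠ 0 ∧ b v v = 0} * R := by
  have : Finite X := Module.finite_of_finite k
  have hrefl : ∀ x y, b x y = 0 → b y x = 0 := fun x y => FormCase.IsResForm.refl hτ hb
  -- The pairs counted consist of a subspace and a nonzero vector of its radical. The radical has `q
  -- ^ (m + 1) - 1` such vectors, and every isotropic `v ≠ 0` lies in the radical of `R` subspaces.
  apply card_mul_eq_of_forall fun (W : goodSubs c b n ψ (m + 1)) (v : {v : X // v ≠ 0 ∧ b v v = 0})
    => v.1 ∈ W.1 ⊓ orth b W.1
  · intro W
    have h1 : ((Nat.card k ^ (m + 1) - 1 : ℕ) : ℚ) = (Nat.card k : ℚ) ^ (m + 1) - 1 := by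
      rw [Nat.cast_sub (Nat.one_le_pow _ _ Nat.card_pos)]
      push_cast
      rfl
    rw [← h1, ← card_nonzero k (W.1 ⊓ orth b W.1 : Submodule k X) _ W.2.1, Nat.cast_inj]
    refine Nat.card_congr
      { toFun := fun v => ⟨⟨v.1.1, v.2⟩, fun h => v.1.2.1 (congrArg Subtype.val h)⟩
        invFun := fun v => ⟨⟨v.1.1, fun h => v.2 (Subtype.ext h), v.1.2.2 _ v.1.2.1⟩, v.1.2⟩
        left_inv := fun _ => rfl
        right_inv := fun _ => rfl }
  · rintro ⟨v, hv0, hv⟩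
    obtain ⟨w, hw⟩ := hn.exists_one hτ hb hv0
    have hvw : b v w ≠ 0 := fun h => by simp [hrefl _ _ h] at hw
    rw [card_goodSubs_mem hv0 hv hvw hrefl, hR v w hv hvw hw]

section Frames

variable {b : X →ₗ[k] X →ₛₗ[τ] k} {ι : Type*}

/-- The subspace `E + U'` for a subspace `U'` of the orthogonal of `E`. -/
def addFrame (e : ι → X) (U' : Submodule k (orth b (Submodule.span k (Set.range e)))) :
    Submodule k X :=
  Submodule.span k (Set.range e) ⊔ U'.map (Submodule.subtype _)

lemma mem_addFrame {e : ι → X} {U' : Submodule k (orth b (Submodule.span k (Set.range e)))}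
    {y : X} : y ∈ addFrame e U' ↔
      ∃ u ∈ Submodule.span k (Set.range e), ∃ x' ∈ U', u + (x' : X) = y := by
  rw [addFrame, Submodule.mem_sup]
  constructor
  · rintro ⟨u, h1, _, ⟨x', h2, rfl⟩, rfl⟩
    exact ⟨u, h1, x', h2, rfl⟩
  · rintro ⟨u, h1, x', h2, rfl⟩
    exact ⟨u, h1, _, ⟨x', h2, rfl⟩, rfl⟩

lemma addFrame_comap {e : ι → X}
    (hE : IsCompl (Submodule.span k (Set.range e)) (orth b (Submodule.span k (Set.range e))))
    {U : Submodule k X} (hU : ∀ i, e i ∈ U) : addFrame e (U.comap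
      (Submodule.subtype (orth b (Submodule.span k (Set.range e))))) = U := by
  have hle : Submodule.span k (Set.range e) ≤ U :=
    Submodule.span_le.2 (by rintro _ ⟨i, rfl⟩; exact hU i)
  ext y
  rw [mem_addFrame]
  constructor
  · rintro ⟨u, hu, x', h2, rfl⟩
    exact U.add_mem (hle hu) h2
  · intro hy
    have h1 : y ∈ Submodule.span k (Set.range e) ⊔ orth b (Submodule.span k (Set.range e)) := by
      rw [hE.sup_eq_top]; trivial
    obtain ⟨u, hu, v, hv, rfl⟩ := Submodule.mem_sup.1 h1
    refine ⟨u, hu, ⟨v, hv⟩, ?_, rfl⟩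
    have := U.sub_mem hy (hle hu)
    rwa [add_sub_cancel_left] at this

variable [Fintype ι] [DecidableEq ι]

lemma comap_addFrame {e : ι → X} (he : (gram b e).det ≠ 0)
    (U' : Submodule k (orth b (Submodule.span k (Set.range e)))) :
    (addFrame e U').comap (Submodule.subtype _) = U' := by
  ext x
  rw [Submodule.mem_comap, mem_addFrame]
  constructor
  · rintro ⟨u, hu, x', h2, h3⟩
    have h4 : u ∈ orth b (Submodule.span k (Set.range e)) := by
      have : u = x - x' := by rw [Submodule.subtype_apply] at h3; rw [← h3]; simp
      rw [this]
      exact Submodule.sub_mem _ x.2 x'.2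
    have h5 := Submodule.disjoint_def.1 (disjoint_orth_of_gram he) u hu h4
    rw [h5, zero_add, Submodule.subtype_apply] at h3
    rwa [← Subtype.ext h3]
  · intro h
    exact ⟨0, Submodule.zero_mem _, x, h, by simp⟩

lemma addFrame_inf_orth {e : ι → X} (he : (gram b e).det ≠ 0)
    (U' : Submodule k (orth b (Submodule.span k (Set.range e)))) :
    addFrame e U' ⊓ orth b (addFrame e U') =
      (U' ⊓ orth (restr b _) U').map (Submodule.subtype _) := by
  ext y
  rw [Submodule.mem_inf, mem_addFrame]
  constructor
  · rintro ⟨⟨u, hu, x', h2, rfl⟩, h3⟩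
    have h4 : u ∈ orth b (Submodule.span k (Set.range e)) := by
      intro z hz
      have h5 := h3 z (mem_addFrame.2 ⟨z, hz, 0, U'.zero_mem, by simp⟩)
      rwa [map_add, LinearMap.add_apply, x'.2 z hz, add_zero] at h5
    have h5 := Submodule.disjoint_def.1 (disjoint_orth_of_gram he) u hu h4
    refine ⟨x', ⟨h2, ?_⟩, by simp [h5]⟩
    intro z hz
    have h4 := h3 z (mem_addFrame.2 ⟨0, Submodule.zero_mem _, z, hz, by simp⟩)
    rwa [h5, zero_add] at h4
  · rintro ⟨x', ⟨h2, h3⟩, rfl⟩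
    refine ⟨⟨0, Submodule.zero_mem _, x', h2, by simp⟩, ?_⟩
    intro z hz
    obtain ⟨u, hu, z', h4, rfl⟩ := mem_addFrame.1 hz
    have h5 : b x' z' = 0 := h3 z' h4
    rw [map_add, Submodule.subtype_apply, x'.2 u hu, h5, add_zero]

lemma finrank_addFrame [Module.Finite k X] {e : ι → X} (he : (gram b e).det ≠ 0)
    (U' : Submodule k (orth b (Submodule.span k (Set.range e)))) :
    finrank k (addFrame e U') = Fintype.card ι + finrank k U' := by
  have h := Submodule.finrank_sup_add_finrank_inf_eq (Submodule.span k (Set.range e))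
    (U'.map (Submodule.subtype _))
  have h1 : Submodule.span k (Set.range e) ⊓ U'.map (Submodule.subtype _) = ⊥ := by
    rw [← disjoint_iff]
    refine (disjoint_orth_of_gram he).mono_right ?_
    rintro x ⟨x', -, rfl⟩
    exact x'.2
  rw [h1, finrank_bot, finrank_span_eq_card (linearIndependent_of_gram he), LinearEquiv.finrank_eq
    (Submodule.equivMapOfInjective (Submodule.subtype _) (Submodule.injective_subtype _) U').symm]
    at h
  rw [addFrame]
  omega

lemma subTyp_addFrame [Finite k] [Module.Finite k X] {c : FormCase} {e : ι → X}
    (he : (gram b e).det ≠ 0) (hι : Fintype.card ι = c.γ)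
    {U' : Submodule k (orth b (Submodule.span k (Set.range e)))} {n : ℕ} {ψ : c.Sign}
    (h : SubTyp c (restr b _) U' n ψ) :
    SubTyp c b (addFrame e U') (n + 1) (c.sign (gram b e).det * ψ) := by
  obtain ⟨a, h1, h2, h3, rfl⟩ := h
  have hcard : Fintype.card (ι ⊕ Fin (c.γ * n)) = c.γ * (n + 1) := by
    simp [hι]; ring
  let f : Fin (c.γ * (n + 1)) ≃ ι ⊕ Fin (c.γ * n) := (Fintype.equivFinOfCardEq hcard).symm
  have h4 : (gram b (Sum.elim e fun s => (a s : X))).det = (gram b e).det *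
      (gram (restr b (orth b (Submodule.span k (Set.range e)))) a).det := by
    rw [gram_sumElim fun s t => (a s).2 _ (Submodule.subset_span ⟨t, rfl⟩), gram_orth_coe]
  refine ⟨(Sum.elim e fun s => (a s : X)) ∘ f, fun s => ?_, ?_, ?_, ?_⟩
  · rw [Function.comp_apply]
    rcases f s with i | i
    · exact mem_addFrame.2 ⟨e i, Submodule.subset_span ⟨i, rfl⟩, 0, U'.zero_mem, by simp⟩
    · exact mem_addFrame.2 ⟨0, Submodule.zero_mem _, a i, h1 i, by simp⟩
  · rw [gram_comp_equiv_det, h4]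
    exact mul_ne_zero he h2
  · rw [addFrame_inf_orth he, finrank_addFrame he, h3, hι, LinearEquiv.finrank_eq
      (Submodule.equivMapOfInjective (Submodule.subtype _) (Submodule.injective_subtype _)
        (U' ⊓ orth (restr b _) U')).symm]
    ring
  · rw [gram_comp_equiv_det, h4, c.sign_mul he h2]

/-- A nondegenerate subspace containing the frame `e` is the orthogonal sum of the span of `e` and
its intersection with the orthogonal of `e`; dimensions add and signs multiply. -/
lemma card_goodSubs_frame [Finite k] [Module.Finite k X] {c : FormCase} {q₀ : ℕ}
    (hτ : c.IsResSetting τ q₀) (hb : c.IsResForm b) (hn : Nondeg b) {e : ι → X}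
    (he : (gram b e).det ≠ 0) (hι : Fintype.card ι = c.γ) (n : ℕ) (ψ : c.Sign) :
    Nat.card {U : goodSubs c b (n + 1) (c.sign (gram b e).det * ψ) 0 // ∀ i, e i ∈ U.1} =
      Nat.card (goodSubs c (restr b (orth b (Submodule.span k (Set.range e)))) n ψ 0) := by
  have hrefl : ∀ x y, b x y = 0 → b y x = 0 := fun x y => FormCase.IsResForm.refl hτ hb
  have hE := hn.isCompl_orth hτ hb (disjoint_orth_of_gram he)
  have hfin : ∀ U' : Submodule k (orth b (Submodule.span k (Set.range e))),
      finrank k (addFrame e U' ⊓ orth b (addFrame e U') : Submodule k X) =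
      finrank k (U' ⊓ orth (restr b _) U' : Submodule k _) := fun U' => by
    rw [addFrame_inf_orth he, LinearEquiv.finrank_eq
      (Submodule.equivMapOfInjective (Submodule.subtype _) (Submodule.injective_subtype _)
        (U' ⊓ orth (restr b _) U')).symm]
  refine Nat.card_congr
    { toFun := fun U => ⟨U.1.1.comap (Submodule.subtype _), ?_, ?_⟩
      invFun := fun U' => ⟨⟨addFrame e U'.1, ?_, ?_⟩, ?_⟩
      left_inv := fun U => Subtype.ext (Subtype.ext (addFrame_comap hE U.2))
      right_inv := fun U' => Subtype.ext (comap_addFrame he _) }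
  · rw [← hfin, addFrame_comap hE U.2]
    exact U.1.2.1
  -- The type of the intersection is found by cancellation: it has some type, adding the frame gives
  -- the type of `U`, and types are unique.
  · obtain ⟨d, χ, hd⟩ := exists_subTyp hτ (hb.restr (orth b (Submodule.span k (Set.range e))))
      (U.1.1.comap (Submodule.subtype _))
    have h1 := subTyp_addFrame he hι hd
    rw [addFrame_comap hE U.2] at h1
    obtain ⟨h2, h3⟩ := h1.unique hτ hb U.1.2.2
    obtain rfl : d = n := by omega
    rw [mul_right_inj] at h3
    exact h3 ▸ hd
  · rw [hfin, U'.2.1]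
  · exact subTyp_addFrame he hι U'.2.2
  · intro i
    exact mem_addFrame.2 ⟨e i, Submodule.subset_span ⟨i, rfl⟩, 0, U'.1.zero_mem, by simp⟩

/-- Recursion for the number of nondegenerate subspaces. -/
lemma card_goodSubs_zero_succ [Finite k] [Module.Finite k X] {c : FormCase} {q₀ : ℕ}
    (hτ : c.IsResSetting τ q₀) (hb : c.IsResForm b) (hn : Nondeg b) {G : Matrix ι ι k}
    (hG : G.det ≠ 0) (hι : Fintype.card ι = c.γ) {n : ℕ} {ψ : c.Sign} {N R : ℚ}
    (hN : ∀ U ∈ goodSubs c b (n + 1) (c.sign G.det * ψ) 0,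
      (Nat.card {e : ι → U // gram (restr b U) e = G} : ℚ) = N)
    (hR : ∀ e : ι → X, gram b e = G →
      (Nat.card (goodSubs c (restr b (orth b (Submodule.span k (Set.range e)))) n ψ 0) : ℚ) = R) :
    (Nat.card (goodSubs c b (n + 1) (c.sign G.det * ψ) 0) : ℚ) * N =
      Nat.card {e : ι → X // gram b e = G} * R := by
  have : Finite X := Module.finite_of_finite k
  apply card_mul_eq_of_forall fun (U : goodSubs c b (n + 1) (c.sign G.det * ψ) 0)
    (e : {e : ι → X // gram b e = G}) => ∀ i, e.1 i ∈ U.1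
  · intro U
    rw [← hN U.1 U.2, Nat.cast_inj]
    refine Nat.card_congr
      { toFun := fun e => ⟨fun i => ⟨e.1.1 i, e.2 i⟩, e.1.2⟩
        invFun := fun e => ⟨⟨fun i => (e.1 i : X), e.2⟩, fun i => (e.1 i).2⟩
        left_inv := fun _ => rfl
        right_inv := fun _ => rfl }
  · rintro ⟨e, rfl⟩
    rw [card_goodSubs_frame hτ hb hn hG hι, hR e rfl]

end Frames

lemma goodSubs_zero_zero [Finite k] [Module.Finite k X] {c : FormCase}
    {b : X →ₗ[k] X →ₛₗ[τ] k} : Nat.card (goodSubs c b 0 1 0) = 1 := by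
  have : goodSubs c b 0 1 0 = {⊥} := by
    ext W
    rw [Set.mem_singleton_iff]
    constructor
    · rintro ⟨h1, h2⟩
      have := h2.finrank_eq
      rw [h1] at this
      exact Submodule.finrank_eq_zero.1 (by simpa using this)
    · rintro rfl
      refine ⟨by simp, ⟨fun _ => 0, by simp, ?_, by rw [bot_inf_eq]; simp, ?_⟩⟩
      · rw [Matrix.det_eq_one_of_card_eq_zero (by simp)]; exact one_ne_zero
      · rw [Matrix.det_eq_one_of_card_eq_zero (by simp), c.sign_one]
  rw [this]
  simp

end SubspaceRecursion

/-! ### Numbers of vectors of given norm and of hyperbolic pairs -/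

section RepresentationNumbers

open Module

variable {k X : Type*} [Field k] [AddCommGroup X] [Module k X] {τ : k →+* k}

/-- The number of vectors with `b(x, x) = a`. -/
def nrep (b : X →ₗ[k] X →ₛₗ[τ] k) (a : k) : ℕ := Nat.card {x // b x x = a}

/-- Splitting `x` along the span `E` of the frame and its orthogonal, one counts over each `x'` in
the orthogonal how often `E` represents `a - b(x', x')`. In the applications this depends only on
whether the difference vanishes (value `A`) or not (value `B`), which turns the count into a
recursion. -/
lemma nrep_glue [Finite k] [Module.Finite k X] {c : FormCase} {q₀ : ℕ}
    (hτ : c.IsResSetting τ q₀) {b : X →ₗ[k] X →ₛₗ[τ] k} (hb : c.IsResForm b) (hn : Nondeg b)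
    {ι : Type*} [Fintype ι] [DecidableEq ι] {e : ι → X} (he : (gram b e).det ≠ 0) {a : k}
    {A B : ℤ} (hA : ∀ x' ∈ orth b (Submodule.span k (Set.range e)), b x' x' = a →
      (Nat.card {t : ι → k // b (∑ i, t i • e i) (∑ i, t i • e i) = a - b x' x'} : ℤ) = A)
    (hB : ∀ x' ∈ orth b (Submodule.span k (Set.range e)), b x' x' ≠ a →
      (Nat.card {t : ι → k // b (∑ i, t i • e i) (∑ i, t i • e i) = a - b x' x'} : ℤ) = B) :
    (nrep b a : ℤ) = B * Nat.card k ^ finrank k (orth b (Submodule.span k (Set.range e))) +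
      (A - B) * nrep (restr b (orth b (Submodule.span k (Set.range e)))) a := by
  classical
  have hfX : Finite X := Module.finite_of_finite k
  have hE := hn.isCompl_orth hτ hb (disjoint_orth_of_gram he)
  have := Fintype.ofFinite (orth b (Submodule.span k (Set.range e)))
  have hrefl : ∀ x y, b x y = 0 → b y x = 0 := fun x y => FormCase.IsResForm.refl hτ hb
  have hmem : ∀ t : ι → k, ∑ i, t i • e i ∈ Submodule.span k (Set.range e) := fun t =>
    (Submodule.mem_span_range_iff_exists_fun k).2 ⟨t, rfl⟩
  have hexp : ∀ (t : ι → k) (x' : orth b (Submodule.span k (Set.range e))),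
      b (∑ i, t i • e i + x') (∑ i, t i • e i + x') =
      b (∑ i, t i • e i) (∑ i, t i • e i) + b x' x' := by
    intro t x'
    have h1 := x'.2 _ (hmem t)
    rw [map_add, map_add, LinearMap.add_apply, LinearMap.add_apply, h1, hrefl _ _ h1]
    ring
  let f : (Σ x' : orth b (Submodule.span k (Set.range e)),
      {t : ι → k // b (∑ i, t i • e i) (∑ i, t i • e i) = a - b x' x'}) → {x // b x x = a} :=
    fun p => ⟨∑ i, p.2.1 i • e i + p.1, by rw [hexp, p.2.2]; ring⟩
  have hf : Function.Bijective f := by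
    constructor
    · rintro ⟨x, t, ht⟩ ⟨x', t', ht'⟩ h
      have h1 : ∑ i, t i • e i + (x : X) = ∑ i, t' i • e i + x' := congrArg Subtype.val h
      have h2 : ∑ i, t i • e i - ∑ i, t' i • e i = x' - x := by
        rw [sub_eq_sub_iff_add_eq_add, h1, add_comm]
      have h3 : ∑ i, t i • e i - ∑ i, t' i • e i = 0 :=
        Submodule.disjoint_def.1 hE.disjoint _ (Submodule.sub_mem _ (hmem t) (hmem t'))
          (by rw [h2]; exact Submodule.sub_mem _ x'.2 x.2)
      have h4 : x = x' := by
        rw [h3] at h2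
        exact Subtype.ext (sub_eq_zero.1 h2.symm).symm
      have h5 : t = t' := by
        rw [← Finset.sum_sub_distrib] at h3
        simp only [← sub_smul] at h3
        have := Fintype.linearIndependent_iff.1 (linearIndependent_of_gram he) _ h3
        exact funext fun i => sub_eq_zero.1 (this i)
      subst h4 h5
      rfl
    · rintro ⟨y, hy⟩
      have h1 : y ∈ Submodule.span k (Set.range e) ⊔ orth b (Submodule.span k (Set.range e)) := by
        rw [hE.sup_eq_top]; trivial
      obtain ⟨u, hu, v, hv, rfl⟩ := Submodule.mem_sup.1 h1
      obtain ⟨t, rfl⟩ := (Submodule.mem_span_range_iff_exists_fun k).1 hu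
      refine ⟨⟨⟨v, hv⟩, t, ?_⟩, rfl⟩
      have := hexp t ⟨v, hv⟩
      rw [hy] at this
      simp only [this]
      ring
  rw [nrep, ← Nat.card_congr (Equiv.ofBijective f hf), Nat.card_sigma]
  have h1 : ∀ x' : orth b (Submodule.span k (Set.range e)),
      (Nat.card {t : ι → k // b (∑ i, t i • e i) (∑ i, t i • e i) = a - b x' x'} : ℤ) =
      B + (A - B) * if restr b _ x' x' = a then 1 else 0 := by
    intro x'
    split_ifs with h
    · rw [hA x' x'.2 h]; ring
    · rw [hB x' x'.2 h]; ring
  rw [Nat.cast_sum, Finset.sum_congr rfl fun x' _ => h1 x', Finset.sum_add_distrib,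
    ← Finset.mul_sum, Finset.sum_boole, nrep, Finset.sum_const, Nat.card_eq_fintype_card (α := {x // _}),
    Fintype.card_subtype, Finset.card_univ, ← Nat.card_eq_fintype_card,
    Module.natCard_eq_pow_finrank (K := k)]
  simp [mul_comm]

section Hermitian

variable {q₀ : ℕ}

lemma two_le_of_card_eq_sq [Finite k] (h : Nat.card k = q₀ ^ 2) : 2 ≤ q₀ := by
  have := Finite.one_lt_card (α := k)
  by_contra! h2
  interval_cases q₀ <;> simp_all

lemma card_units_eq_sq [Finite k] (h : Nat.card k = q₀ ^ 2) :
    Nat.card kˣ = (q₀ - 1) * (q₀ + 1) := by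
  rw [Nat.card_units, h, mul_comm, ← Nat.sq_sub_sq, one_pow]

/-- The unit group is cyclic of order `(q₀ - 1) * (q₀ + 1)`, so the image of the `(q₀ + 1)`-power
map is the kernel of the `(q₀ - 1)`-power map, and its fibres have `q₀ + 1` elements. -/
lemma card_norm_eq [Finite k] (h : Nat.card k = q₀ ^ 2) {y : k} (hy0 : y ≠ 0) (hy : y ^ q₀ = y) :
    Nat.card {t : k // t ^ (q₀ + 1) = y} = q₀ + 1 := by
  have h2 := two_le_of_card_eq_sq h
  have hcard := card_units_eq_sq h
  have hr : (powMonoidHom (q₀ + 1) : kˣ →* kˣ).range = (powMonoidHom (q₀ - 1) : kˣ →* kˣ).ker := by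
    apply Subgroup.eq_of_le_of_card_ge
    · rintro _ ⟨t, rfl⟩
      rw [MonoidHom.mem_ker, powMonoidHom_apply, powMonoidHom_apply, ← pow_mul,
        mul_comm, ← hcard, pow_card_eq_one']
    · rw [IsCyclic.card_powMonoidHom_range, IsCyclic.card_powMonoidHom_ker, hcard,
        Nat.gcd_eq_right (Dvd.intro _ rfl), Nat.gcd_eq_right (Dvd.intro_left _ rfl),
        Nat.mul_div_cancel _ (by omega)]
  have hyk : Units.mk0 y hy0 ∈ (powMonoidHom (q₀ - 1) : kˣ →* kˣ).ker := by
    rw [MonoidHom.mem_ker, powMonoidHom_apply]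
    apply Units.ext
    have h3 : y ^ (q₀ - 1) * y = 1 * y := by
      rw [← pow_succ, Nat.sub_add_cancel (by omega), hy, one_mul]
    simpa using mul_right_cancel₀ hy0 h3
  rw [← hr] at hyk
  obtain ⟨s, hs⟩ := hyk
  have hs' : (s : k) ^ (q₀ + 1) = y := by
    have := congrArg Units.val hs
    simpa using this
  have hk : Nat.card (powMonoidHom (q₀ + 1) : kˣ →* kˣ).ker = q₀ + 1 := by
    rw [IsCyclic.card_powMonoidHom_ker, hcard, Nat.gcd_eq_right (Dvd.intro_left _ rfl)]
  have hne : ∀ t : k, t ^ (q₀ + 1) = y → t ≠ 0 := by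
    rintro t ht rfl
    rw [zero_pow (by omega)] at ht
    exact hy0 ht.symm
  refine Eq.trans ?_ hk
  refine Nat.card_congr
    { toFun := fun t => ⟨Units.mk0 t.1 (hne _ t.2) * s⁻¹, ?_⟩
      invFun := fun u => ⟨u.1 * s, ?_⟩
      left_inv := fun t => by simp
      right_inv := fun u => by ext; simp }
  · rw [MonoidHom.mem_ker, powMonoidHom_apply]
    apply Units.ext
    have h5 := t.2
    simp [mul_pow, h5, hs', hy0]
  · have h5 : (u.1 : k) ^ (q₀ + 1) = 1 := by
      have := congrArg Units.val (MonoidHom.mem_ker.1 u.2)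
      simpa using this
    rw [mul_pow, h5, one_mul, hs']

/-- Nonzero spaces that are not alternating have anisotropic vectors. -/
lemma Nondeg.exists_anisotropic [Finite k] [Nontrivial X] {c : FormCase}
    (hτ : c.IsResSetting τ q₀) {b : X →ₗ[k] X →ₛₗ[τ] k} (hb : c.IsResForm b) (hn : Nondeg b)
    (hc : c ≠ .alternating) : ∃ u, b u u ≠ 0 := by
  by_contra! h
  obtain ⟨u, hu⟩ := exists_ne (0 : X)
  obtain ⟨w, hw⟩ := hn.exists_one hτ hb hu
  have h1 : ∀ x y, b x y + b y x = 0 := by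
    intro x y
    have h2 := h (x + y)
    rw [map_add, map_add, LinearMap.add_apply, LinearMap.add_apply, h, h] at h2
    linear_combination h2
  cases c
  · have hwu : b u w = 1 := by rw [hb w u, hw, map_one]
    -- For `t = 1` this gives `2 = 0`, hence `τ` is trivial and every unit satisfies `t ^ (q₀ - 1) =
    -- 1`. The order `(q₀ - 1) * (q₀ + 1)` of the cyclic unit group forbids this.
    have h2 : ∀ t : k, t + τ t = 0 := by
      intro t
      have := h1 (t • w) u
      rw [map_smul, LinearMap.smul_apply, hw, LinearMap.map_smulₛₗ, hwu] at this
      simpa using this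
    obtain ⟨hq, hfr⟩ := hτ
    have hq2 := two_le_of_card_eq_sq hq
    have h3 : (powMonoidHom (q₀ - 1) : kˣ →* kˣ).ker = ⊤ := by
      rw [eq_top_iff]
      rintro t -
      rw [MonoidHom.mem_ker, powMonoidHom_apply]
      apply Units.ext
      have h4 : (t : k) ^ q₀ = t := by
        have e1 := h2 t
        have e2 := h2 1
        rw [hfr] at e1 e2
        rw [one_pow] at e2
        linear_combination e1 - t * e2
      have h5 : (t : k) ^ (q₀ - 1) * t = 1 * t := by
        rw [← pow_succ, Nat.sub_add_cancel (by omega), h4, one_mul]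
      simpa using mul_right_cancel₀ t.ne_zero h5
    have h4 := IsCyclic.card_powMonoidHom_ker (G := kˣ) (q₀ - 1)
    rw [h3, card_units_eq_sq hq, Nat.gcd_eq_right (Dvd.intro _ rfl), Subgroup.card_top,
      card_units_eq_sq hq] at h4
    have h5 : q₀ - 1 ≠ 0 := by omega
    have := (Nat.mul_eq_left h5).1 h4
    omega
  · have h2 := h1 u w
    rw [hb w u, hw] at h2
    obtain ⟨-, hch⟩ := hτ
    exact (Ring.two_ne_zero hch) (by linear_combination h2)
  · exact hc rfl

/-- The number of vectors of given norm in a Hermitian space. -/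
lemma nrep_hermitian [Finite k] [DecidableEq k] [Module.Finite k X]
    (hτ : FormCase.unramifiedHermitian.IsResSetting τ q₀) {b : X →ₗ[k] X →ₛₗ[τ] k}
    (hb : FormCase.unramifiedHermitian.IsResForm b) (hn : Nondeg b) {a : k} (ha : τ a = a) :
    (q₀ : ℤ) * nrep b a = q₀ ^ (2 * finrank k X) +
      (if a = 0 then (q₀ : ℤ) - 1 else -1) * (-q₀) ^ finrank k X := by
  induction h : finrank k X generalizing X with
  | zero =>
    have := finrank_zero_iff.1 h
    have h1 : nrep b a = if a = 0 then 1 else 0 := by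
      rw [nrep]
      split_ifs with h0
      · subst h0
        rw [Nat.card_eq_one_iff_unique]
        exact ⟨inferInstance, ⟨⟨0, by simp⟩⟩⟩
      · rw [Nat.card_eq_zero]
        left
        refine ⟨fun x => h0 ?_⟩
        rw [← x.2, Subsingleton.elim x.1 0]
        simp
    rw [h1]
    split_ifs <;> simp
  | succ r ih =>
    have : Nontrivial X := by
      rw [← finrank_pos_iff (R := k)]; omega
    obtain ⟨u, hu⟩ := hn.exists_anisotropic hτ hb (by simp)
    have he : (gram b ![u]).det ≠ 0 := by simpa using hu
    have hf := hn.finrank_add_orth hτ hb (Submodule.span k (Set.range ![u]))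
    rw [finrank_span_eq_card (linearIndependent_of_gram he), h, Fintype.card_fin] at hf
    have hr : finrank k (orth b (Submodule.span k (Set.range ![u]))) = r := by omega
    have ih' := ih (hb.restr _) (hn.restr_orth hτ hb (disjoint_orth_of_gram he)) hr
    have hq := hτ.1
    have hfr := hτ.2
    have hself : ∀ x, b x x ^ q₀ = b x x := fun x => by rw [← hfr, ← hb]
    have hcount : ∀ y : k, Nat.card {t : Fin 1 → k //
        b (∑ i, t i • ![u] i) (∑ i, t i • ![u] i) = y} =
        Nat.card {t : k // t ^ (q₀ + 1) = y / b u u} := by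
      intro y
      refine Nat.card_congr ((Equiv.funUnique (Fin 1) k).subtypeEquiv fun t => ?_)
      simp [hfr]
      rw [eq_div_iff hu, pow_succ]
      constructor <;> intro h <;> rw [← h] <;> ring
    -- On the line of `u` the equation is `t ^ (q₀ + 1) = y / b u u`, with one solution for `y = 0`
    -- and `q₀ + 1` solutions otherwise. The difference `A - B = -q₀` produces the powers of `-q₀`.
    rw [nrep_glue hτ hb hn he (A := 1) (B := q₀ + 1), hr, hq, mul_add]
    · have : (1 - ((q₀ : ℤ) + 1)) * (nrep (restr b (orth b (Submodule.span k
          (Set.range ![u])))) a : ℤ) = - (q₀ * nrep (restr b (orth b (Submodule.span k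
          (Set.range ![u])))) a) := by ring
      rw [this, ih']
      push_cast
      ring
    · rintro x' - hx'
      rw [hcount, hx', sub_self, zero_div]
      norm_cast
      rw [Nat.card_eq_one_iff_unique]
      refine ⟨⟨fun s t => ?_⟩, ⟨⟨0, by simp⟩⟩⟩
      have hs := s.2
      have ht := t.2
      simp only [pow_eq_zero_iff (Nat.succ_ne_zero q₀)] at hs ht
      exact Subtype.ext (hs.trans ht.symm)
    · rintro x' - hx'
      rw [hcount, card_norm_eq hq]
      · push_cast; rfl
      · exact div_ne_zero (sub_ne_zero.2 (Ne.symm hx')) hu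
      · rw [← hfr, map_div₀, map_sub, ha, hfr, hfr, hself, hself]

end Hermitian

section Symmetric

lemma coe_sign_symmetric [Fintype k] [DecidableEq k] {z : k} (hz : z ≠ 0) :
    (((FormCase.sign .symmetric z : FormCase.Sign .symmetric) : ℤˣ) : ℤ) = quadraticChar k z := by
  rw [quadraticChar_apply, quadraticCharFun, if_neg hz]
  simp only [FormCase.sign]
  split_ifs <;> rfl

lemma card_sq_eq [Fintype k] [DecidableEq k] (hk : ringChar k ≠ 2) (a : k) :
    (Nat.card {x : k // x ^ 2 = a} : ℤ) = quadraticChar k a + 1 := by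
  rw [← quadraticChar_card_sqrts hk a, Set.toFinset_card, Nat.card_eq_fintype_card]
  rfl

/-- The hyperbola `u ^ 2 - t ^ 2 = a` has `q - 1` points, parametrized by the unit `u - t`. Counting
them instead for each `t`, as `1` plus the character value, gives `q` plus the sum in question. -/
lemma sum_quadraticChar_sq_add [Fintype k] [DecidableEq k] (hk : ringChar k ≠ 2) {a : k}
    (ha : a ≠ 0) : ∑ t : k, quadraticChar k (t ^ 2 + a) = -1 := by
  have h2 : (2 : k) ≠ 0 := Ring.two_ne_zero hk
  have h1 : Nat.card (Σ t : k, {u : k // u ^ 2 = t ^ 2 + a}) = Nat.card kˣ := by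
    refine Nat.card_congr
      { toFun := fun p => Units.mk0 (p.2.1 - p.1) ?_
        invFun := fun y => ⟨(a / y - y) / 2, (a / y + y) / 2, ?_⟩
        left_inv := ?_
        right_inv := ?_ }
    · intro h
      apply ha
      have := p.2.2
      linear_combination (p.2.1 + p.1) * h - this
    · field_simp
      ring
    · rintro ⟨t, u, hu⟩
      have h3 : u - t ≠ 0 := by
        intro h
        apply ha
        linear_combination (u + t) * h - hu
      have h4 : a / (u - t) = u + t := by
        rw [div_eq_iff h3]; linear_combination -hu
      have e1 : (u + t - (u - t)) / 2 = t := by rw [div_eq_iff h2]; ring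
      have e2 : (u + t + (u - t)) / 2 = u := by rw [div_eq_iff h2]; ring
      refine Sigma.subtype_ext ?_ ?_ <;> simp only [Units.val_mk0, h4, e1, e2]
    · intro y
      apply Units.ext
      simp only [Units.val_mk0]
      rw [div_sub_div_same, div_eq_iff h2]
      ring
  rw [Nat.card_sigma] at h1
  have h3 := congrArg (fun n : ℕ => (n : ℤ)) h1
  simp only [Nat.cast_sum, card_sq_eq hk, Finset.sum_add_distrib] at h3
  rw [Nat.card_units, Nat.card_eq_fintype_card, Nat.cast_sub Fintype.card_pos] at h3
  simp only [Finset.sum_const, Finset.card_univ, nsmul_eq_mul, mul_one, Nat.cast_one] at h3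
  linarith

lemma sum_quadraticChar_sq [Fintype k] [DecidableEq k] :
    ∑ t : k, quadraticChar k (t ^ 2) = Fintype.card k - 1 := by
  have : ∀ t : k, quadraticChar k (t ^ 2) = 1 - if t = 0 then 1 else 0 := by
    intro t
    split_ifs with h
    · subst h; simp
    · rw [quadraticChar_sq_one' h]; simp
  simp only [this, Finset.sum_sub_distrib]
  simp

/-- The number of representations by a binary quadratic form. -/
lemma card_binary [Fintype k] [DecidableEq k] (hk : ringChar k ≠ 2) {d₁ d₂ : k} (h₁ : d₁ ≠ 0)
    (h₂ : d₂ ≠ 0) (y : k) :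
    (Nat.card {t : Fin 2 → k // d₁ * t 0 ^ 2 + d₂ * t 1 ^ 2 = y} : ℤ) =
      Fintype.card k + quadraticChar k (-1) * quadraticChar k (d₁ * d₂) *
        if y = 0 then (Fintype.card k : ℤ) - 1 else -1 := by
  -- Solving for the first coordinate leaves the number of square roots of a multiple of `t ^ 2 - y
  -- / d₂`; the multiplier has the quadratic character of `-(d₁ * d₂)`.
  have e1 : Nat.card {t : Fin 2 → k // d₁ * t 0 ^ 2 + d₂ * t 1 ^ 2 = y} =
      Nat.card (Σ t : k, {s : k // s ^ 2 = -(d₁ * d₂) / d₁ ^ 2 * (t ^ 2 + -(y / d₂))}) := by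
    refine Nat.card_congr
      { toFun := fun t => ⟨t.1 1, t.1 0, ?_⟩
        invFun := fun p => ⟨![p.2.1, p.1], ?_⟩
        left_inv := fun t => Subtype.ext (by ext i; fin_cases i <;> rfl)
        right_inv := fun _ => rfl }
    · have ht := t.2
      field_simp
      linear_combination ht
    · simp only [Matrix.cons_val_zero, Matrix.cons_val_one]
      rw [p.2.2]
      field_simp
      ring
  have e2 : quadraticChar k (-(d₁ * d₂) / d₁ ^ 2) =
      quadraticChar k (-1) * quadraticChar k (d₁ * d₂) := by
    rw [div_eq_mul_inv, ← inv_pow, map_mul, quadraticChar_sq_one' (inv_ne_zero h₁), mul_one,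
      neg_eq_neg_one_mul, map_mul]
  rw [e1, Nat.card_sigma, Nat.cast_sum]
  simp only [card_sq_eq hk, map_mul (quadraticChar k) (-(d₁ * d₂) / d₁ ^ 2), e2,
    Finset.sum_add_distrib, ← Finset.mul_sum]
  split_ifs with h
  · subst h
    simp only [zero_div, neg_zero, add_zero, sum_quadraticChar_sq]
    simp
    ring
  · rw [sum_quadraticChar_sq_add hk (neg_ne_zero.2 (div_ne_zero h h₂))]
    simp
    ring

/-- The sign as an integer. -/
def sgnZ (χ : FormCase.Sign .symmetric) : ℤ := ((χ : ℤˣ) : ℤ)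

lemma sgnZ_mul (χ χ' : FormCase.Sign .symmetric) : sgnZ (χ * χ') = sgnZ χ * sgnZ χ' := by
  simp [sgnZ]

lemma sgnZ_sign [Fintype k] [DecidableEq k] {z : k} (hz : z ≠ 0) :
    sgnZ (FormCase.sign .symmetric z) = quadraticChar k z := coe_sign_symmetric hz

lemma Nondeg.exists_orthogonal_pair [Finite k] [Module.Finite k X] {c : FormCase} {q₀ : ℕ}
    (hτ : c.IsResSetting τ q₀) {b : X →ₗ[k] X →ₛₗ[τ] k} (hb : c.IsResForm b) (hn : Nondeg b)
    (hc : c ≠ .alternating) (hr : 2 ≤ finrank k X) :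
    ∃ u w, b u u ≠ 0 ∧ b w w ≠ 0 ∧ b u w = 0 ∧ b w u = 0 := by
  have : Nontrivial X := by
    rw [← finrank_pos_iff (R := k)]; omega
  obtain ⟨u, hu⟩ := hn.exists_anisotropic hτ hb hc
  have he : (gram b ![u]).det ≠ 0 := by simpa using hu
  have hf := hn.finrank_add_orth hτ hb (Submodule.span k (Set.range ![u]))
  rw [finrank_span_eq_card (linearIndependent_of_gram he), Fintype.card_fin] at hf
  have : Nontrivial (orth b (Submodule.span k (Set.range ![u]))) := by
    rw [← finrank_pos_iff (R := k)]; omega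
  obtain ⟨w, hw⟩ := (hn.restr_orth hτ hb (disjoint_orth_of_gram he)).exists_anisotropic hτ
    (hb.restr _) hc
  have hwu : b w u = 0 := w.2 u (Submodule.subset_span ⟨0, rfl⟩)
  exact ⟨u, w, hu, hw, FormCase.IsResForm.refl hτ hb hwu, hwu⟩

/-- Splitting off a binary form. -/
lemma nrep_symmetric_step [Fintype k] [DecidableEq k] [Module.Finite k X] {q₀ : ℕ}
    (hτ : FormCase.symmetric.IsResSetting τ q₀) {b : X →ₗ[k] X →ₛₗ[τ] k}
    (hb : FormCase.symmetric.IsResForm b) {r : ℕ} {χ : FormCase.Sign .symmetric}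
    (hX : HT .symmetric b (r + 2) χ) (a : k) :
    ∃ (W : Submodule k X) (η : ℤ) (χ' : FormCase.Sign .symmetric), η * η = 1 ∧
      HT .symmetric (restr b W) r χ' ∧ sgnZ χ = quadraticChar k (-1) * η * sgnZ χ' ∧
      (nrep b a : ℤ) = (Fintype.card k - η) * Fintype.card k ^ r +
        η * Fintype.card k * nrep (restr b W) a := by
  have hn := hX.nondeg
  have hrank : finrank k X = r + 2 := by
    obtain ⟨_, _, h, _⟩ := hX
    simpa [FormCase.γ] using h
  obtain ⟨u, w, hu, hw, huw, hwu⟩ := hn.exists_orthogonal_pair hτ hb (by simp) (by omega)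
  have hdet : (gram b ![u, w]).det = b u u * b w w := by
    rw [Matrix.det_fin_two]; simp [huw]
  have he : (gram b ![u, w]).det ≠ 0 := by rw [hdet]; exact mul_ne_zero hu hw
  have hf := hn.finrank_add_orth hτ hb (Submodule.span k (Set.range ![u, w]))
  rw [finrank_span_eq_card (linearIndependent_of_gram he), Fintype.card_fin] at hf
  obtain ⟨d, χ', hd⟩ := (hn.restr_orth hτ hb (disjoint_orth_of_gram he)).exists_HT hτ (hb.restr _)
  obtain ⟨h1, h2⟩ := hX.unique hτ (hd.glue hτ hb hn he (d₁ := 2) (by simp [FormCase.γ]))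
  obtain rfl : d = r := by omega
  have hneg : (-1 : k) ≠ 0 := by simp
  have hκ : quadraticChar k (-1) * quadraticChar k (-1) = 1 := by
    rw [← map_mul]; simp
  have hδ : quadraticChar k (b u u * b w w) * quadraticChar k (b u u * b w w) = 1 := by
    rw [← sq]; exact quadraticChar_sq_one (mul_ne_zero hu hw)
  -- `η` is the character of minus the determinant of the plane: `1` for a hyperbolic plane, `-1`
  -- for an anisotropic one.
  refine ⟨_, quadraticChar k (-1) * quadraticChar k (b u u * b w w), χ', ?_, hd, ?_, ?_⟩
  · linear_combination (quadraticChar k (b u u * b w w) * quadraticChar k (b u u * b w w)) * hκ + hδ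
  · rw [h2, sgnZ_mul, sgnZ_sign he, hdet]
    linear_combination (- quadraticChar k (b u u * b w w) * sgnZ χ') * hκ
  · obtain ⟨rfl, hk⟩ := hτ
    have hτ' : FormCase.symmetric.IsResSetting (RingHom.id k) q₀ := ⟨rfl, hk⟩
    have hcount : ∀ y : k, {t : Fin 2 → k //
        b (∑ i, t i • ![u, w] i) (∑ i, t i • ![u, w] i) = y} =
        {t : Fin 2 → k // b u u * t 0 ^ 2 + b w w * t 1 ^ 2 = y} := by
      intro y
      congr 1
      ext t
      simp only [Fin.sum_univ_two, Matrix.cons_val_zero, Matrix.cons_val_one, map_add, map_smul,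
        LinearMap.add_apply, LinearMap.smul_apply, huw, hwu, smul_eq_mul, mul_zero, add_zero,
        zero_add]
      constructor <;> intro h <;> rw [← h] <;> ring
    rw [nrep_glue hτ' hb hn he (A := Fintype.card k + quadraticChar k (-1) *
        quadraticChar k (b u u * b w w) * (Fintype.card k - 1)) (B := Fintype.card k -
        quadraticChar k (-1) * quadraticChar k (b u u * b w w)),
        (by omega : finrank k (orth b (Submodule.span k (Set.range ![u, w]))) = d),
        Nat.card_eq_fintype_card]
    · ring
    · rintro x' - hx'
      rw [hcount, card_binary hk hu hw, if_pos (by rw [hx', sub_self])]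
    · rintro x' - hx'
      rw [hcount, card_binary hk hu hw, if_neg (sub_ne_zero.2 (Ne.symm hx'))]
      ring

/-- The number of vectors of given norm in an even-dimensional quadratic space. -/
lemma nrep_symmetric_even [Fintype k] [DecidableEq k] [Module.Finite k X] {q₀ : ℕ}
    (hτ : FormCase.symmetric.IsResSetting τ q₀) {b : X →ₗ[k] X →ₛₗ[τ] k}
    (hb : FormCase.symmetric.IsResForm b) {s : ℕ} {χ : FormCase.Sign .symmetric}
    (hX : HT .symmetric b (2 * s) χ) (a : k) :
    (Fintype.card k : ℤ) * nrep b a = Fintype.card k ^ (2 * s) +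
      quadraticChar k (-1) ^ s * sgnZ χ * ((if a = 0 then (Fintype.card k : ℤ) else 0) - 1) *
        Fintype.card k ^ s := by
  induction s generalizing X χ with
  | zero =>
    obtain ⟨v, h1, h2, rfl⟩ := hX
    have : Subsingleton X := finrank_zero_iff.1 h2
    have h1 : nrep b a = if a = 0 then 1 else 0 := by
      rw [nrep]
      split_ifs with h0
      · subst h0
        rw [Nat.card_eq_one_iff_unique]
        exact ⟨inferInstance, ⟨⟨0, by simp⟩⟩⟩
      · rw [Nat.card_eq_zero]
        left
        refine ⟨fun x => h0 ?_⟩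
        rw [← x.2, Subsingleton.elim x.1 0]
        simp
    have h3 : sgnZ (FormCase.sign .symmetric (gram b v).det) = 1 := by
      rw [Matrix.det_eq_one_of_card_eq_zero (by simp), FormCase.sign_one]; rfl
    rw [h1, h3]
    split_ifs <;> simp
  | succ s ih =>
    obtain ⟨W, η, χ', h1, h2, h3, h4⟩ := nrep_symmetric_step hτ hb (r := 2 * s) hX a
    have h5 := ih (hb.restr W) h2
    have hκ : quadraticChar k (-1) * quadraticChar k (-1) = 1 := by
      rw [← map_mul]; simp
    rw [h4, h3]
    linear_combination (η * Fintype.card k) * h5 - (quadraticChar k (-1) ^ s * η * sgnZ χ' *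
      ((if a = 0 then (Fintype.card k : ℤ) else 0) - 1) * Fintype.card k ^ (s + 1)) * hκ

/-- The number of vectors of given norm in an odd-dimensional quadratic space. -/
lemma nrep_symmetric_odd [Fintype k] [DecidableEq k] [Module.Finite k X] {q₀ : ℕ}
    (hτ : FormCase.symmetric.IsResSetting τ q₀) {b : X →ₗ[k] X →ₛₗ[τ] k}
    (hb : FormCase.symmetric.IsResForm b) {s : ℕ} {χ : FormCase.Sign .symmetric}
    (hX : HT .symmetric b (2 * s + 1) χ) (a : k) :
    (nrep b a : ℤ) = Fintype.card k ^ (2 * s) +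
      quadraticChar k (-1) ^ s * sgnZ χ * quadraticChar k a * Fintype.card k ^ s := by
  induction s generalizing X χ with
  | zero =>
    obtain ⟨v, h1, h2, rfl⟩ : ∃ v : Fin 1 → X, (gram b v).det ≠ 0 ∧ finrank k X = 1 ∧
      FormCase.sign .symmetric (gram b v).det = χ := hX
    obtain ⟨rfl, hk⟩ := hτ
    have hli := linearIndependent_of_gram h1
    let w := basisOfLinearIndependentOfCardEqFinrank hli (by simp [h2])
    have hw : ⇑w = v := coe_basisOfLinearIndependentOfCardEqFinrank hli (by simp [h2])
    have hdet : (gram b v).det = b (v 0) (v 0) := Matrix.det_fin_one _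
    rw [hdet] at h1
    have h3 : nrep b a = Nat.card {t : k // t ^ 2 = a / b (v 0) (v 0)} := by
      refine Nat.card_congr ((w.equivFun.toEquiv.trans
        (Equiv.funUnique (Fin 1) k)).subtypeEquiv fun x => ?_)
      have hx := w.sum_repr x
      rw [hw] at hx
      have hx2 : w.repr x 0 • v 0 = x := by
        rw [Fin.sum_univ_one] at hx
        exact hx
      simp only [Equiv.trans_apply, LinearEquiv.coe_toEquiv, Equiv.funUnique_apply,
        Basis.equivFun_apply]
      rw [eq_div_iff h1]
      conv_lhs => rw [← hx2]
      simp only [map_smul, LinearMap.smul_apply, smul_eq_mul]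
      rw [sq, mul_assoc]
      rfl
    have h4 : quadraticChar k (b (v 0) (v 0)) * quadraticChar k (b (v 0) (v 0)) = 1 := by
      rw [← sq]; exact quadraticChar_sq_one h1
    have h5 : quadraticChar k (a / b (v 0) (v 0)) * quadraticChar k (b (v 0) (v 0)) =
        quadraticChar k a := by
      rw [← map_mul, div_mul_cancel₀ _ h1]
    rw [h3, card_sq_eq hk, hdet, sgnZ_sign h1]
    simp only [pow_zero, mul_zero, one_mul, mul_one]
    rw [← h5]
    linear_combination (- quadraticChar k (a / b (v 0) (v 0))) * h4
  | succ s ih =>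
    obtain ⟨W, η, χ', h1, h2, h3, h4⟩ := nrep_symmetric_step hτ hb (r := 2 * s + 1) hX a
    have h5 := ih (hb.restr W) h2
    have hκ : quadraticChar k (-1) * quadraticChar k (-1) = 1 := by
      rw [← map_mul]; simp
    rw [h4, h3]
    linear_combination (η * Fintype.card k) * h5 - (quadraticChar k (-1) ^ s * η * sgnZ χ' *
      quadraticChar k a * Fintype.card k ^ (s + 1)) * hκ

end Symmetric

section Alternating

/-- The level sets of `x ↦ b x u` are translates of each other by multiples of `w`, so all of them
have the same size. -/
lemma card_apply_eq_one [Finite k] [Module.Finite k X] {b : X →ₗ[k] X →ₛₗ[τ] k} {u w : X}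
    (hw : b w u = 1) : Nat.card k * Nat.card {x // b x u = 1} = Nat.card k ^ finrank k X := by
  have : Finite X := Module.finite_of_finite k
  have := Fintype.ofFinite k
  rw [← Module.natCard_eq_pow_finrank (K := k) (V := X)]
  have e : (Σ t : k, {x // b x u = 1}) ≃ X :=
    { toFun := fun p => p.2.1 + p.1 • w - w
      invFun := fun x => ⟨b x u, x - b x u • w + w, by simp [hw]⟩
      left_inv := fun p => by
        refine Sigma.subtype_ext ?_ ?_
        · simp [hw, p.2.2]
        · simp only [map_add, map_sub, map_smul, LinearMap.add_apply, LinearMap.sub_apply,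
            LinearMap.smul_apply, hw, p.2.2, smul_eq_mul, mul_one, add_sub_cancel_left]
          abel
      right_inv := fun x => by simp only; abel }
  rw [← Nat.card_congr e, Nat.card_sigma]
  simp [Nat.card_eq_fintype_card]

/-- The number of hyperbolic pairs in an alternating space. -/
lemma card_hyperbolic_pairs [Finite k] [Module.Finite k X] {q₀ : ℕ}
    (hτ : FormCase.alternating.IsResSetting τ q₀) {b : X →ₗ[k] X →ₛₗ[τ] k}
    (hb : FormCase.alternating.IsResForm b) (hn : Nondeg b) :
    Nat.card k * Nat.card {e : Fin 2 → X // gram b e = !![0, 1; -1, 0]} =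
      (Nat.card k ^ finrank k X - 1) * Nat.card k ^ finrank k X := by
  have hfX : Finite X := Module.finite_of_finite k
  classical
  have := Fintype.ofFinite X
  have hskew : ∀ x y, b y x = - b x y := by
    intro x y
    have h1 := hb (x + y)
    rw [map_add, map_add, LinearMap.add_apply, LinearMap.add_apply, hb, hb] at h1
    linear_combination h1
  -- A hyperbolic pair amounts to a nonzero second vector `u` and a first vector `x` with `b x u =
  -- 1`; the other Gram entries hold because the form is alternating.
  have e : {e : Fin 2 → X // gram b e = !![0, 1; -1, 0]} ≃
      (Σ u : {u : X // u ≠ 0}, {x // b x u = 1}) :=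
    { toFun := fun e => ⟨⟨e.1 1, by
          intro h
          have := congrFun (congrFun e.2 0) 1
          simp [h] at this⟩, e.1 0, by
          have := congrFun (congrFun e.2 0) 1
          simpa using this⟩
      invFun := fun p => ⟨![p.2.1, p.1.1], by
        have h1 := p.2.2
        have h2 := hskew p.2.1 p.1.1
        have h3 : ∀ x, b x x = 0 := hb
        ext i j
        fin_cases i <;> fin_cases j <;> simp [h1, h2, h3]⟩
      left_inv := fun e => Subtype.ext (by ext i; fin_cases i <;> rfl)
      right_inv := fun _ => rfl }
  rw [Nat.card_congr e, Nat.card_sigma, Finset.mul_sum]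
  have h1 : ∀ u : {u : X // u ≠ 0}, Nat.card k * Nat.card {x // b x u = 1} =
      Nat.card k ^ finrank k X := by
    intro u
    obtain ⟨w, hw⟩ := hn.exists_one hτ hb u.2
    exact card_apply_eq_one hw
  rw [Finset.sum_congr rfl fun u _ => h1 u, Finset.sum_const, Finset.card_univ,
    ← Nat.card_eq_fintype_card, card_nonzero k X _ rfl, smul_eq_mul]

end Alternating

end RepresentationNumbers

/-! ### The formula `Q` for the number of subspaces of given data -/

section SubspaceCount

open Module

variable {k X : Type*} [Field k] [AddCommGroup X] [Module k X] {τ : k →+* k}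

lemma poch_succ (x : ℚ) (n : ℕ) : poch x (n + 1) = poch x n * (x ^ (n + 1) - 1) :=
  Finset.prod_range_succ _ _

@[simp]
lemma poch_zero (x : ℚ) : poch x 0 = 1 := rfl

lemma poch_ne_zero {x : ℚ} (hx : 1 < |x|) (n : ℕ) : poch x n ≠ 0 := by
  rw [poch, Finset.prod_ne_zero_iff]
  intro i _ h
  have h1 : |x| ^ (i + 1) = 1 := by rw [← abs_pow, sub_eq_zero.1 h, abs_one]
  exact (one_lt_pow₀ hx (Nat.succ_ne_zero i)).ne' h1

/-- The sign as a rational number. -/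
def sQ {c : FormCase} (χ : c.Sign) : ℚ := ((χ : ℤˣ) : ℤ)

lemma sQ_mul {c : FormCase} (χ χ' : c.Sign) : sQ (χ * χ') = sQ χ * sQ χ' := by simp [sQ]

lemma sQ_pow {c : FormCase} (χ : c.Sign) (n : ℕ) : sQ (χ ^ n) = sQ χ ^ n := by simp [sQ]

@[simp]
lemma sQ_one {c : FormCase} : sQ (1 : c.Sign) = 1 := by simp [sQ]

lemma sQ_mul_self {c : FormCase} (χ : c.Sign) : sQ χ * sQ χ = 1 := by
  rw [← sQ_mul, FormCase.Sign.mul_self, sQ_one]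

lemma sQ_eq_or {c : FormCase} (χ : c.Sign) : sQ χ = 1 ∨ sQ χ = -1 := by
  have h := sQ_mul_self χ
  rcases mul_self_eq_one_iff.1 h with h | h <;> simp [h]

lemma eFactor_even {c : FormCase} (q : ℚ) (ε : c.Sign) (s : ℕ) (χ : c.Sign) :
    eFactor q ε (2 * s) χ = q ^ s + sQ ε ^ s * sQ χ := by
  rw [eFactor, if_pos (even_two_mul s), Nat.mul_div_cancel_left _ (by norm_num), ← sQ_pow, ← sQ_mul]
  rfl

lemma eFactor_odd {c : FormCase} (q : ℚ) (ε : c.Sign) (s : ℕ) (χ : c.Sign) :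
    eFactor q ε (2 * s + 1) χ = 1 := by
  rw [eFactor, if_neg (by simp)]

/-- The hypothesis excludes `r = 0` with sign `-1`: there the factor is `1 - 1 = 0`, and no space
has this type. -/
lemma eFactor_ne_zero {c : FormCase} {q : ℚ} (hq : 1 < q) (ε : c.Sign) {r : ℕ} {χ : c.Sign}
    (h : r = 0 → χ = 1) : eFactor q ε r χ ≠ 0 := by
  rcases Nat.even_or_odd' r with ⟨s, rfl | rfl⟩
  · rw [eFactor_even]
    rcases Nat.eq_zero_or_pos s with rfl | hs
    · rw [h rfl]
      norm_num
    · have h1 : 1 < q ^ s := one_lt_pow₀ hq hs.ne'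
      have h2 : sQ ε ^ s * sQ χ = 1 ∨ sQ ε ^ s * sQ χ = -1 := by
        rw [← sQ_pow, ← sQ_mul]; exact sQ_eq_or _
      rcases h2 with h2 | h2 <;> rw [h2] <;> linarith
  · rw [eFactor_odd]
    exact one_ne_zero

lemma Q_zero {c : FormCase} {q₀ q : ℚ} (hq₀ : c = .unramifiedHermitian → 1 < q₀) (hq : 1 < q)
    (ε : c.Sign) {l : ℕ} {ψ : c.Sign} (h : l = 0 → ψ = 1) : Q c q₀ q ε 0 1 0 l ψ = 1 := by
  have h2 : 1 < |q ^ 2| := by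
    rw [abs_of_pos (by positivity)]
    exact one_lt_pow₀ hq (by norm_num)
  cases c
  · have h1 : poch (-q₀) l ≠ 0 := poch_ne_zero (by
      rw [abs_neg]; exact (hq₀ rfl).trans_le (le_abs_self _)) l
    simp [Q, h1]
  · have h1 : poch (q ^ 2) (l / 2) ≠ 0 := poch_ne_zero h2 _
    have h3 := eFactor_ne_zero hq ε h
    have h4 : eFactor q ε 0 1 = 2 := by
      have := eFactor_even q ε 0 1
      rw [mul_zero] at this
      rw [this]
      norm_num
    simp [Q, h1, h3, h4]
  · have h1 : poch (q ^ 2) l ≠ 0 := poch_ne_zero h2 _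
    simp [Q, h1]

/-- The number of nonzero isotropic vectors, as a function of the type. -/
def isoCount (c : FormCase) (q₀ q : ℚ) (ε : c.Sign) (r : ℕ) (χ : c.Sign) : ℚ :=
  match c with
  | .unramifiedHermitian => - ((-q₀) ^ (r + 2) - 1) * ((-q₀) ^ (r + 1) - 1)
  | .symmetric =>
      if Even r then (q ^ (r / 2 + 1) - sQ (ε ^ (r / 2) * χ)) * (q ^ (r / 2) + sQ (ε ^ (r / 2) * χ))
      else q ^ (r + 1) - 1
  | .alternating => q ^ (2 * (r + 1)) - 1

/-- This is the recursion of `card_goodSubs_succ` for the closed formula. The arguments of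
`isoCount` are the type of the space that remains after splitting off a hyperbolic plane, so it
counts isotropic vectors in the space of type `(r + 2 / γ, χ * ε)`. -/
lemma Q_succ {c : FormCase} {q₀ q : ℚ} (hq₀ : c = .unramifiedHermitian → 1 < q₀ ∧ q = q₀ ^ 2)
    (hq : 1 < q) (ε : c.Sign) {n m l : ℕ} {ψ₁ ψ₂ : c.Sign} (h₁ : n = 0 → ψ₁ = 1)
    (h₂ : l = 0 → ψ₂ = 1) :
    Q c q₀ q ε n ψ₁ (m + 1) l ψ₂ * (q ^ (m + 1) - 1) =
      isoCount c q₀ q ε (n + 2 / c.γ * m + l) (ψ₁ * ε ^ m * ψ₂) * Q c q₀ q ε n ψ₁ m l ψ₂ := by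
  have hq2 : 1 < |q ^ 2| := by
    rw [abs_of_pos (by positivity)]
    exact one_lt_pow₀ hq (by norm_num)
  have hqa : 1 < |q| := hq.trans_le (le_abs_self _)
  have hm : q ^ (m + 1) - 1 ≠ 0 := (sub_pos.2 (one_lt_pow₀ hq (Nat.succ_ne_zero m))).ne'
  cases c
  · obtain ⟨h0, rfl⟩ := hq₀ rfl
    have hx : 1 < |-q₀| := by rw [abs_neg]; exact h0.trans_le (le_abs_self _)
    have e1 := poch_ne_zero hx n
    have e2 := poch_ne_zero hx l
    have e3 := poch_ne_zero hqa m
    have e4 : n + 2 * (m + 1) + l = (n + 2 * m + l) + 1 + 1 := by ring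
    simp only [Q, isoCount, FormCase.γ, e4, poch_succ, Nat.div_one]
    field_simp
    ring
  · have e1 := poch_ne_zero hq2 (n / 2)
    have e2 := poch_ne_zero hq2 (l / 2)
    have e3 := poch_ne_zero hqa m
    have e4 : (n + 2 * (m + 1) + l) / 2 = (n + 2 * m + l) / 2 + 1 := by omega
    have hχ : ψ₁ * ε ^ (m + 1) * ψ₂ = (ψ₁ * ε ^ m * ψ₂) * ε := by
      rw [pow_succ, ← mul_assoc, mul_right_comm]
    have h3 : n + 2 * m + l = 0 → ψ₁ * ε ^ m * ψ₂ = 1 := by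
      intro h
      rw [h₁ (by omega), h₂ (by omega), (by omega : m = 0)]
      simp
    -- For `r = 2 * s` and `η` the sign of `ε ^ s * χ`, the number `(q ^ 2) ^ (s + 1) - 1` is `(q ^
    -- (s + 1) - η) * (q ^ (s + 1) + η)`, while `isoCount` is `(q ^ (s + 1) - η) * (q ^ s + η)`; the
    -- two remaining factors are the values of `eFactor`.
    have key : ((q ^ 2) ^ ((n + 2 * m + l) / 2 + 1) - 1) *
        eFactor q ε (n + 2 * m + l) (ψ₁ * ε ^ m * ψ₂) =
        isoCount .symmetric q₀ q ε (n + 2 * m + l) (ψ₁ * ε ^ m * ψ₂) *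
          eFactor q ε (n + 2 * (m + 1) + l) (ψ₁ * ε ^ m * ψ₂ * ε) := by
      have e5 : n + 2 * (m + 1) + l = (n + 2 * m + l) + 2 := by ring
      rw [e5]
      generalize ψ₁ * ε ^ m * ψ₂ = χ
      generalize n + 2 * m + l = r
      rcases Nat.even_or_odd' r with ⟨s, rfl | rfl⟩
      · have e6 : 2 * s + 2 = 2 * (s + 1) := by ring
        have e7 : 2 * s / 2 = s := by omega
        have h5 := sQ_mul_self (ε ^ s * χ)
        have h6 := sQ_mul_self ε
        rw [sQ_mul, sQ_pow] at h5
        rw [e6, eFactor_even, eFactor_even, isoCount, if_pos (even_two_mul s), e7, sQ_mul, sQ_mul,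
          sQ_pow, pow_succ (sQ ε) s,
          (by linear_combination (sQ ε ^ s * sQ χ) * h6 :
            sQ ε ^ s * sQ ε * (sQ χ * sQ ε) = sQ ε ^ s * sQ χ)]
        linear_combination (q ^ s + sQ ε ^ s * sQ χ) * h5
      · have e6 : 2 * s + 1 + 2 = 2 * (s + 1) + 1 := by ring
        have e7 : (2 * s + 1) / 2 = s := by omega
        rw [e6, eFactor_odd, eFactor_odd, isoCount, if_neg (by simp), e7]
        ring
    have e8 := eFactor_ne_zero hq ε h3
    have e9 : eFactor q ε (n + 2 * (m + 1) + l) (ψ₁ * ε ^ m * ψ₂ * ε) ≠ 0 :=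
      eFactor_ne_zero hq ε (by omega)
    simp only [Q, hχ, e4, poch_succ, FormCase.γ, Nat.div_one]
    have key' := (div_eq_div_iff e9 e8).2 key
    calc _ = q ^ (n * l / 2) / 2 * (poch (q ^ 2) ((n + 2 * m + l) / 2) / (poch (q ^ 2) (n / 2) *
          poch q m * poch (q ^ 2) (l / 2))) * (eFactor q ε n ψ₁ * eFactor q ε l ψ₂) *
          (((q ^ 2) ^ ((n + 2 * m + l) / 2 + 1) - 1) /
            eFactor q ε (n + 2 * (m + 1) + l) (ψ₁ * ε ^ m * ψ₂ * ε)) := by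
          field_simp
      _ = _ := by
          rw [key']
          field_simp
  · have e1 := poch_ne_zero hq2 n
    have e2 := poch_ne_zero hq2 l
    have e3 := poch_ne_zero hqa m
    have e4 : n + (m + 1) + l = (n + m + l) + 1 := by ring
    simp only [Q, isoCount, FormCase.γ, e4, poch_succ, Nat.div_self (by norm_num : 0 < 2), one_mul]
    field_simp
    rw [← pow_mul]

lemma card_isotropic [Finite k] [Module.Finite k X] (b : X →ₗ[k] X →ₛₗ[τ] k) :
    (Nat.card {v : X // v ≠ 0 ∧ b v v = 0} : ℤ) = nrep b 0 - 1 := by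
  have : Finite X := Module.finite_of_finite k
  have h : Nat.card (Option {v : X // v ≠ 0 ∧ b v v = 0}) = nrep b 0 := by
    classical
    refine Nat.card_congr
      { toFun := fun o => o.elim ⟨0, by simp⟩ fun v => ⟨v.1, v.2.2⟩
        invFun := fun x => if h : x.1 = 0 then none else some ⟨x.1, h, x.2⟩
        left_inv := ?_
        right_inv := ?_ }
    · rintro (_ | v)
      · simp
      · simp [v.2.1]
    · rintro ⟨x, hx⟩
      by_cases h : x = 0
      · simp [h]
      · simp [h]
  rw [← h, Finite.card_option]
  push_cast
  ring

lemma HT.finrank_eq {c : FormCase} {b : X →ₗ[k] X →ₛₗ[τ] k} {d : ℕ} {χ : c.Sign}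
    (h : HT c b d χ) : finrank k X = c.γ * d := h.choose_spec.2.1

lemma one_lt_card (k : Type*) [Field k] [Finite k] : (1 : ℚ) < Nat.card k := by
  exact_mod_cast Finite.one_lt_card (α := k)

lemma card_isotropic_eq [Finite k] [Module.Finite k X] {c : FormCase} {q₀ : ℕ}
    (hτ : c.IsResSetting τ q₀) {b : X →ₗ[k] X →ₛₗ[τ] k} (hb : c.IsResForm b) {r : ℕ} {χ : c.Sign}
    (hX : HT c b (r + 2 / c.γ) (χ * c.sign (-1 : k))) :
    (Nat.card {v : X // v ≠ 0 ∧ b v v = 0} : ℚ) =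
      isoCount c q₀ (Nat.card k) (c.sign (-1 : k)) r χ := by
  classical
  have := Fintype.ofFinite k
  have hn := hX.nondeg
  have hr := hX.finrank_eq
  have hiso : (Nat.card {v : X // v ≠ 0 ∧ b v v = 0} : ℚ) = nrep b 0 - 1 := by
    exact_mod_cast card_isotropic b
  have hq := one_lt_card k
  cases c
  · have h1 := nrep_hermitian hτ hb hn (a := 0) (map_zero τ)
    simp only [FormCase.γ, Nat.div_one, one_mul] at hr
    rw [hr, if_pos rfl] at h1
    have h0 : (2 : ℚ) ≤ q₀ := by exact_mod_cast two_le_of_card_eq_sq hτ.1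
    have h2 : (q₀ : ℚ) * nrep b 0 = q₀ ^ (2 * (r + 2)) + (q₀ - 1) * (-q₀) ^ (r + 2) := by
      exact_mod_cast h1
    rw [hiso, isoCount]
    have h3 : (q₀ : ℚ) ≠ 0 := by positivity
    apply mul_left_cancel₀ h3
    rw [mul_sub, h2, pow_mul, ← neg_sq, ← pow_mul]
    ring
  · have hκ : quadraticChar k (-1) * quadraticChar k (-1) = 1 := by
      rw [← map_mul]; simp
    have hκ' : ((quadraticChar k (-1) : ℤ) : ℚ) = sQ (FormCase.sign .symmetric (-1 : k)) := by
      rw [← sgnZ_sign (by simp)]; rfl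
    have hκ2 := sQ_mul_self (FormCase.sign .symmetric (-1 : k))
    have hc : ∀ χ : FormCase.Sign .symmetric, ((sgnZ χ : ℤ) : ℚ) = sQ χ := fun _ => rfl
    have hcard : (Fintype.card k : ℚ) = Nat.card k := by rw [Nat.card_eq_fintype_card]
    rcases Nat.even_or_odd' r with ⟨s, rfl | rfl⟩
    · have h1 := nrep_symmetric_even hτ hb (s := s + 1) hX 0
      rw [if_pos rfl] at h1
      have h2 := congrArg (fun n : ℤ => (n : ℚ)) h1
      simp only [Int.cast_mul, Int.cast_add, Int.cast_natCast, Int.cast_pow, Int.cast_sub,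
        Int.cast_one, hκ', hc, hcard, sQ_mul] at h2
      have h3 : (Nat.card k : ℚ) ≠ 0 := by positivity
      have hχ := sQ_mul_self (FormCase.sign .symmetric (-1 : k) ^ s * χ)
      rw [sQ_mul, sQ_pow] at hχ
      rw [hiso, isoCount, if_pos (even_two_mul s), Nat.mul_div_cancel_left _ (by norm_num), sQ_mul,
        sQ_pow]
      apply mul_left_cancel₀ h3
      linear_combination h2 + ((Nat.card k : ℚ)) * hχ + (sQ χ *
        sQ (FormCase.sign .symmetric (-1 : k)) ^ s *
        (Nat.card k - 1) * (Nat.card k : ℚ) ^ (s + 1)) * hκ2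
    · have h1 := nrep_symmetric_odd hτ hb (s := s + 1) 
        (by convert hX using 1; change _ = 2 * s + 1 + 2; ring) 0
      rw [quadraticChar_zero, mul_zero, zero_mul, add_zero] at h1
      have h2 := congrArg (fun n : ℤ => (n : ℚ)) h1
      simp only [Int.cast_natCast, Int.cast_pow, hcard] at h2
      rw [hiso, isoCount, if_neg (by simp), h2]
      ring
  · have h1 : Nat.card {v : X // v ≠ 0 ∧ b v v = 0} = Nat.card {v : X // v ≠ 0} := by
      refine Nat.card_congr (Equiv.subtypeEquivRight fun v => ?_)
      have : b v v = 0 := hb v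
      simp [this]
    rw [h1, card_nonzero k X _ rfl, hr, isoCount, Nat.cast_sub (Nat.one_le_pow _ _ Nat.card_pos)]
    simp [FormCase.γ]

lemma SubTyp.hT [Module.Finite k X] {c : FormCase} {b : X →ₗ[k] X →ₛₗ[τ] k} {W : Submodule k X}
    {d : ℕ} {χ : c.Sign} (h : SubTyp c b W d χ)
    (h0 : finrank k (W ⊓ orth b W : Submodule k X) = 0) : HT c (restr b W) d χ := by
  obtain ⟨a, h1, h2, h3, h4⟩ := h
  exact ⟨fun s => ⟨a s, h1 s⟩, h2, by rw [h3, h0, add_zero], h4⟩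

lemma sign_gram_hyperbolic [Finite k] {c : FormCase} {q₀ : ℕ}
    (hτ : c.IsResSetting τ q₀) {b : X →ₗ[k] X →ₛₗ[τ] k} (hb : c.IsResForm b) {v w : X}
    (hv : b v v = 0) (hwv : b w v = 1) : c.sign (gram b ![v, w]).det = c.sign (-1 : k) := by
  rcases eq_or_ne c .symmetric with rfl | hc
  · have : b v w = 1 := by rw [hb w v, hwv]
    rw [Matrix.det_fin_two]
    simp [hv, hwv, this]
  · have := FormCase.Sign.subsingleton hc
    exact Subsingleton.elim _ _

/-- The number of vectors of norm of sign `δ` in a quadratic space of type `(r, χ)`. -/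
def normCount (q : ℚ) (ε δ : FormCase.Sign .symmetric) (r : ℕ) (χ : FormCase.Sign .symmetric) : ℚ :=
  if Even r then (q ^ r - sQ ε ^ (r / 2) * sQ χ * q ^ (r / 2)) / q
  else q ^ (r - 1) + sQ ε ^ (r / 2) * sQ χ * sQ δ * q ^ (r / 2)

lemma normCount_even (q : ℚ) (ε δ : FormCase.Sign .symmetric) (s : ℕ)
    (χ : FormCase.Sign .symmetric) :
    normCount q ε δ (2 * (s + 1)) χ = q ^ s * (q ^ (s + 1) - sQ ε ^ (s + 1) * sQ χ) ∨ q = 0 := by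
  rcases eq_or_ne q 0 with h | h
  · exact Or.inr h
  left
  rw [normCount, if_pos (even_two_mul _), Nat.mul_div_cancel_left _ (by norm_num), div_eq_iff h]
  ring

lemma normCount_odd (q : ℚ) (ε δ : FormCase.Sign .symmetric) (s : ℕ)
    (χ : FormCase.Sign .symmetric) :
    normCount q ε δ (2 * s + 1) χ = q ^ s * (q ^ s + sQ ε ^ s * sQ χ * sQ δ) := by
  rw [normCount, if_neg (by simp), (by omega : (2 * s + 1) / 2 = s), Nat.add_sub_cancel]
  ring

/-- This is the recursion of `card_goodSubs_zero_succ` for the closed formula, when a vector whose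
norm has sign `ε ^ (n / 2) * ψ₁` is split off. The parities of `n` and `l` decide which `eFactor`s
are trivial and how the Gaussian factors grow, hence four cases. -/
lemma normCount_mul_Q {q : ℚ} (q₀ : ℚ) (hq : 1 < q) (ε : FormCase.Sign .symmetric) (n l : ℕ)
    {ψ₁ ψ₂ : FormCase.Sign .symmetric} (h₂ : l = 0 → ψ₂ = 1) :
    normCount q ε (ε ^ (n / 2) * ψ₁) (n + 1) ψ₁ ≠ 0 ∧
    normCount q ε (ε ^ (n / 2) * ψ₁) (n + 1) ψ₁ * Q .symmetric q₀ q ε (n + 1) ψ₁ 0 l ψ₂ =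
      normCount q ε (ε ^ (n / 2) * ψ₁) (n + 1 + l) (ψ₁ * ψ₂) *
        Q .symmetric q₀ q ε n (ε ^ (n / 2) * ψ₁ * ψ₁) 0 l ψ₂ := by
  have hq0 : q ≠ 0 := by positivity
  have hq2 : 1 < |q ^ 2| := by
    rw [abs_of_pos (by positivity)]
    exact one_lt_pow₀ hq (by norm_num)
  have hψ := sQ_mul_self ψ₁
  have hψ' := sQ_mul_self ψ₂
  have hε : ∀ s : ℕ, sQ ε ^ s * sQ ε ^ s = 1 := fun s => by
    rw [← mul_pow, sQ_mul_self, one_pow]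
  have hP : ∀ s, poch (q ^ 2) s ≠ 0 := poch_ne_zero hq2
  have hpos : ∀ s : ℕ, q ^ s ≠ 0 := fun s => pow_ne_zero s hq0
  have hb : ∀ (s : ℕ) (χ : FormCase.Sign .symmetric), q ^ (s + 1) + sQ ε ^ (s + 1) * sQ χ ≠ 0 ∧
      q ^ (s + 1) - sQ ε ^ (s + 1) * sQ χ ≠ 0 := by
    intro s χ
    have h1 : 1 < q ^ (s + 1) := one_lt_pow₀ hq (Nat.succ_ne_zero s)
    have h2 : sQ ε ^ (s + 1) * sQ χ = 1 ∨ sQ ε ^ (s + 1) * sQ χ = -1 := by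
      rw [← sQ_pow, ← sQ_mul]; exact sQ_eq_or _
    rcases h2 with h2 | h2 <;> rw [h2] <;> constructor <;> linarith
  have h7 : ∀ s, (sQ ε ^ s * (sQ ψ₁ * sQ ψ₂)) * (sQ ε ^ s * (sQ ψ₁ * sQ ψ₂)) = 1 := fun s => by
    linear_combination (sQ ψ₁ * sQ ψ₁ * sQ ψ₂ * sQ ψ₂) * hε s + sQ ψ₂ * sQ ψ₂ * hψ + hψ'
  -- A new factor of a Pochhammer symbol splits for either sign `η`; one half cancels an `eFactor`,
  -- the other appears in `normCount`.
  have hfac : ∀ (s : ℕ) (η : ℚ), η * η = 1 → (q ^ 2) ^ s - 1 = (q ^ s - η) * (q ^ s + η) :=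
    fun s η h => by linear_combination h
  rcases Nat.even_or_odd' n with ⟨s, rfl | rfl⟩
  · rw [Nat.mul_div_cancel_left _ (by norm_num : 0 < 2), mul_assoc (ε ^ s), FormCase.Sign.mul_self,
      mul_one, normCount_odd, sQ_mul, sQ_pow]
    have hN : q ^ s + sQ ε ^ s * sQ ψ₁ * (sQ ε ^ s * sQ ψ₁) = q ^ s + 1 := by
      linear_combination sQ ψ₁ * sQ ψ₁ * hε s + hψ
    have hs1 : (q ^ s + 1) ≠ 0 := by positivity
    rw [hN]
    refine ⟨mul_ne_zero (hpos s) hs1, ?_⟩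
    rcases Nat.even_or_odd' l with ⟨t, rfl | rfl⟩
    · have e0 : 2 * s + 1 + 2 * t = 2 * (s + t) + 1 := by ring
      have e1 : (2 * s + 1) * (2 * t) / 2 = 2 * s * t + t := by
        rw [show (2 * s + 1) * (2 * t) = 2 * (2 * s * t + t) by ring]; omega
      have e2 : (2 * s) * (2 * t) / 2 = 2 * s * t := by
        rw [show (2 * s) * (2 * t) = 2 * (2 * s * t) by ring]; omega
      have e3 : 2 * s + 2 * t = 2 * (s + t) := by ring
      have e4 : (2 * (s + t) + 1) / 2 = s + t := by omega
      have e5 : (2 * s + 1) / 2 = s := by omega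
      have e6 : ∀ x, 2 * x / 2 = x := fun x => by omega
      rw [e0, normCount_odd]
      simp only [Q, mul_zero, add_zero, pow_zero, mul_one, e0, e1, e2, e3, e4, e5, e6, eFactor_odd,
        eFactor_even, sQ_mul, sQ_pow, poch_zero]
      have h3 : q ^ (s + t) + sQ ε ^ (s + t) * (sQ ε ^ s * sQ ψ₂) ≠ 0 := by
        have := eFactor_ne_zero hq ε (r := 2 * (s + t)) (χ := ε ^ s * ψ₂) (fun h => by
          rw [h₂ (by omega), (by omega : s = 0)]; simp)
        rwa [eFactor_even, sQ_mul, sQ_pow] at this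
      have h4 : q ^ (s + t) + sQ ε ^ (s + t) * (sQ ψ₁ * sQ ψ₂) * (sQ ε ^ s * sQ ψ₁) =
          q ^ (s + t) + sQ ε ^ (s + t) * (sQ ε ^ s * sQ ψ₂) := by
        linear_combination sQ ε ^ (s + t) * sQ ε ^ s * sQ ψ₂ * hψ
      have h5 := hε s
      rw [h4]
      have := hP s
      have := hP t
      generalize q ^ (s + t) + sQ ε ^ (s + t) * (sQ ε ^ s * sQ ψ₂) = D at h3 ⊢
      rw [h5]
      field_simp
      ring
    · have e0 : 2 * s + 1 + (2 * t + 1) = 2 * (s + t + 1) := by ring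
      have e1 : (2 * s + 1) * (2 * t + 1) / 2 = 2 * s * t + s + t := by
        rw [show (2 * s + 1) * (2 * t + 1) = 2 * (2 * s * t + s + t) + 1 by ring]; omega
      have e2 : (2 * s) * (2 * t + 1) / 2 = 2 * s * t + s := by
        rw [show (2 * s) * (2 * t + 1) = 2 * (2 * s * t + s) by ring]; omega
      have e3 : 2 * s + (2 * t + 1) = 2 * (s + t) + 1 := by ring
      have e4 : ∀ x, (2 * x + 1) / 2 = x := fun x => by omega
      have e6 : ∀ x, 2 * x / 2 = x := fun x => by omega
      rw [e0, (normCount_even q ε _ (s + t) _).resolve_right hq0]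
      simp only [Q, mul_zero, add_zero, pow_zero, mul_one, e0, e1, e2, e3, e4, e6, eFactor_odd,
        eFactor_even, sQ_mul, sQ_pow, poch_zero, poch_succ]
      have h3 := (hb (s + t) (ψ₁ * ψ₂)).1
      rw [sQ_mul] at h3
      have h5 := hε s
      have := hP s
      have := hP t
      rw [h5, hfac _ _ (h7 (s + t + 1))]
      generalize q ^ (s + t + 1) + sQ ε ^ (s + t + 1) * (sQ ψ₁ * sQ ψ₂) = D at h3 ⊢
      generalize q ^ (s + t + 1) - sQ ε ^ (s + t + 1) * (sQ ψ₁ * sQ ψ₂) = B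
      field_simp
      ring
  · have e9 : 2 * s + 1 + 1 = 2 * (s + 1) := by ring
    have e4 : ∀ x, (2 * x + 1) / 2 = x := fun x => by omega
    have e6 : ∀ x, 2 * x / 2 = x := fun x => by omega
    have hN := (hb s ψ₁).2
    have h8 : (sQ ε ^ (s + 1) * sQ ψ₁) * (sQ ε ^ (s + 1) * sQ ψ₁) = 1 := by
      linear_combination (sQ ψ₁ * sQ ψ₁) * hε (s + 1) + hψ
    rw [e9, e4, mul_assoc (ε ^ s), FormCase.Sign.mul_self, mul_one,
      (normCount_even q ε _ s _).resolve_right hq0]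
    refine ⟨mul_ne_zero (hpos s) hN, ?_⟩
    rcases Nat.even_or_odd' l with ⟨t, rfl | rfl⟩
    · have e0 : 2 * (s + 1) + 2 * t = 2 * (s + t + 1) := by ring
      have e1 : 2 * (s + 1) * (2 * t) / 2 = 2 * s * t + 2 * t := by
        rw [show 2 * (s + 1) * (2 * t) = 2 * (2 * s * t + 2 * t) by ring]; omega
      have e2 : (2 * s + 1) * (2 * t) / 2 = 2 * s * t + t := by
        rw [show (2 * s + 1) * (2 * t) = 2 * (2 * s * t + t) by ring]; omega
      have e3 : 2 * s + 1 + 2 * t = 2 * (s + t) + 1 := by ring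
      rw [e0, (normCount_even q ε _ (s + t) _).resolve_right hq0]
      simp only [Q, mul_zero, add_zero, pow_zero, mul_one, e0, e1, e2, e3, e4, e6, eFactor_odd,
        eFactor_even, sQ_mul, poch_zero, poch_succ]
      have h3 := (hb (s + t) (ψ₁ * ψ₂)).1
      rw [sQ_mul] at h3
      have := hP s
      have := hP t
      rw [hfac _ _ (h7 (s + t + 1)), hfac _ _ h8]
      have hA := (hb s ψ₁).1
      generalize q ^ (s + t + 1) + sQ ε ^ (s + t + 1) * (sQ ψ₁ * sQ ψ₂) = D at h3 ⊢
      generalize q ^ (s + t + 1) - sQ ε ^ (s + t + 1) * (sQ ψ₁ * sQ ψ₂) = B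
      generalize q ^ (s + 1) + sQ ε ^ (s + 1) * sQ ψ₁ = A₁ at hA ⊢
      generalize q ^ (s + 1) - sQ ε ^ (s + 1) * sQ ψ₁ = B₁ at hN ⊢
      field_simp
      ring
    · have e0 : 2 * (s + 1) + (2 * t + 1) = 2 * (s + t + 1) + 1 := by ring
      have e1 : 2 * (s + 1) * (2 * t + 1) / 2 = 2 * s * t + s + 2 * t + 1 := by
        rw [show 2 * (s + 1) * (2 * t + 1) = 2 * (2 * s * t + s + 2 * t + 1) by ring]; omega
      have e2 : (2 * s + 1) * (2 * t + 1) / 2 = 2 * s * t + s + t := by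
        rw [show (2 * s + 1) * (2 * t + 1) = 2 * (2 * s * t + s + t) + 1 by ring]; omega
      have e3 : 2 * s + 1 + (2 * t + 1) = 2 * (s + t + 1) := by ring
      rw [e0, normCount_odd]
      simp only [Q, mul_zero, add_zero, pow_zero, mul_one, e0, e1, e2, e3, e4, e6, eFactor_odd,
        eFactor_even, sQ_mul, sQ_pow, poch_zero, poch_succ]
      have h3 := (hb (s + t) (ε ^ s * ψ₂)).1
      rw [sQ_mul, sQ_pow] at h3
      have h4 : q ^ (s + t + 1) + sQ ε ^ (s + t + 1) * (sQ ψ₁ * sQ ψ₂) * (sQ ε ^ s * sQ ψ₁) =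
          q ^ (s + t + 1) + sQ ε ^ (s + t + 1) * (sQ ε ^ s * sQ ψ₂) := by
        linear_combination sQ ε ^ (s + t + 1) * sQ ε ^ s * sQ ψ₂ * hψ
      rw [h4]
      have := hP s
      have := hP t
      rw [hfac (s + 1) _ h8]
      have hA := (hb s ψ₁).1
      generalize q ^ (s + t + 1) + sQ ε ^ (s + t + 1) * (sQ ε ^ s * sQ ψ₂) = D at h3 ⊢
      generalize q ^ (s + 1) + sQ ε ^ (s + 1) * sQ ψ₁ = A₁ at hA ⊢
      generalize q ^ (s + 1) - sQ ε ^ (s + 1) * sQ ψ₁ = B₁ at hN ⊢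
      field_simp
      ring

lemma gram_fin_one_eq_iff {b : X →ₗ[k] X →ₛₗ[τ] k} (a : k) (e : Fin 1 → X) :
    gram b e = !![a] ↔ b (e 0) (e 0) = a := by
  constructor
  · intro h
    exact congrFun (congrFun h 0) 0
  · intro h
    ext i j
    fin_cases i
    fin_cases j
    exact h

lemma card_frame_one (b : X →ₗ[k] X →ₛₗ[τ] k) (a : k) :
    Nat.card {e : Fin 1 → X // gram b e = !![a]} = nrep b a :=
  Nat.card_congr ((Equiv.funUnique (Fin 1) X).subtypeEquiv fun e => gram_fin_one_eq_iff a e)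

/-- Numbers of frames used to peel off nondegenerate subspaces: a matrix `G`,
and the number of frames with Gram matrix `G` in a space of given type. -/
lemma exists_frame_count.{u} [Finite k] {c : FormCase} {q₀ : ℕ} (hτ : c.IsResSetting τ q₀) (n : ℕ)
    (ψ₁ : c.Sign) :
    ∃ (G : Matrix (Fin c.γ) (Fin c.γ) k) (f : ℕ → c.Sign → ℚ), G.det ≠ 0 ∧
      (n = 0 → c.sign G.det = ψ₁) ∧ f (n + 1) ψ₁ ≠ 0 ∧
      (∀ (l : ℕ) (ψ₂ : c.Sign), (l = 0 → ψ₂ = 1) →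
        f (n + 1) ψ₁ * Q c q₀ (Nat.card k) (c.sign (-1 : k)) (n + 1) ψ₁ 0 l ψ₂ =
        f (n + 1 + l) (ψ₁ * ψ₂) *
          Q c q₀ (Nat.card k) (c.sign (-1 : k)) n (c.sign G.det * ψ₁) 0 l ψ₂) ∧
      -- The same `f` has to serve for the ambient space and for its subspaces, hence the
      -- quantification over `X` inside the statement.
      ∀ {X : Type u} [AddCommGroup X] [Module k X] [Module.Finite k X] {b : X →ₗ[k] X →ₛₗ[τ] k}
        (r : ℕ) (χ : c.Sign), r ≠ 0 → c.IsResForm b → HT c b r χ →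
        (Nat.card {e : Fin c.γ → X // gram b e = G} : ℚ) = f r χ := by
  classical
  have := Fintype.ofFinite k
  have hq := one_lt_card k
  have hq2 : 1 < |(Nat.card k : ℚ) ^ 2| := by
    rw [abs_of_pos (by positivity)]
    exact one_lt_pow₀ hq (by norm_num)
  cases c
  · have h0 : (2 : ℚ) ≤ q₀ := by exact_mod_cast two_le_of_card_eq_sq hτ.1
    have h3 : (q₀ : ℚ) ≠ 0 := by positivity
    have hx : 1 < |-(q₀ : ℚ)| := by
      rw [abs_neg, abs_of_pos (by positivity)]
      linarith
    have hs : ∀ r : ℕ, (-(q₀ : ℚ)) ^ (r + 1) - 1 ≠ 0 := by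
      intro r h
      have h1 : |-(q₀ : ℚ)| ^ (r + 1) = 1 := by rw [← abs_pow, sub_eq_zero.1 h, abs_one]
      exact (one_lt_pow₀ hx (Nat.succ_ne_zero r)).ne' h1
    refine ⟨!![1], fun r _ => (-(q₀ : ℚ)) ^ r * ((-(q₀ : ℚ)) ^ r - 1) / q₀, ?_, fun _ => ?_, ?_, fun l ψ₂ hl => ?_, ?_⟩
    · change (!![1] : Matrix (Fin 1) (Fin 1) k).det ≠ 0
      rw [Matrix.det_fin_one]
      simp
    · have := FormCase.Sign.subsingleton (c := .unramifiedHermitian) (by simp)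
      exact Subsingleton.elim _ _
    · exact div_ne_zero (mul_ne_zero (pow_ne_zero _ (neg_ne_zero.2 h3)) (hs n)) h3
    · have e1 : n + 1 + l = n + l + 1 := by ring
      have h4 := poch_ne_zero hx n
      have h5 := poch_ne_zero hx l
      have h6 := hs n
      simp only [Q, mul_zero, add_zero, poch_zero, mul_one, pow_zero, one_mul, e1, poch_succ]
      generalize (-(q₀ : ℚ)) ^ (n + 1) - 1 = A at h6 ⊢
      generalize (-(q₀ : ℚ)) ^ (n + l + 1) - 1 = B
      field_simp
      ring
    · intro X _ _ _ b r χ _ hb hX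
      have h1 := nrep_hermitian hτ hb hX.nondeg (a := 1) (map_one τ)
      have hr : finrank k X = r := by simpa [FormCase.γ] using hX.finrank_eq
      rw [hr, if_neg one_ne_zero] at h1
      have h2 : (q₀ : ℚ) * nrep b 1 = q₀ ^ (2 * r) + (-1) * (-q₀) ^ r := by exact_mod_cast h1
      have h4 := card_frame_one b 1
      change ((Nat.card {e : Fin 1 → X // gram b e = !![1]} : ℕ) : ℚ) = _
      rw [h4, eq_div_iff h3, mul_comm, h2, pow_mul, ← neg_sq, ← pow_mul]
      ring
  · have hk := hτ.2
    -- With this sign of `a` the part of a space of type `(n + 1, ψ₁)` orthogonal to a vector of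
    -- norm `a` has type `(n, ε ^ (n / 2))`. For `n = 0` this is the sign `1` of the zero space, and
    -- the number of such vectors is never zero.
    obtain ⟨a, ha0, ha⟩ : ∃ a : k, a ≠ 0 ∧
        FormCase.sign .symmetric a = FormCase.sign .symmetric (-1 : k) ^ (n / 2) * ψ₁ := by
      generalize FormCase.sign .symmetric (-1 : k) ^ (n / 2) * ψ₁ = δ
      rcases Int.units_eq_one_or (δ : ℤˣ) with h | h
      · exact ⟨1, one_ne_zero, by rw [FormCase.sign_one]; exact Subtype.ext h.symm⟩
      · obtain ⟨a, ha⟩ := FiniteField.exists_nonsquare hk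
        refine ⟨a, ?_, Subtype.ext ?_⟩
        · rintro rfl
          exact ha (by simp)
        · simp [FormCase.sign, ha, h]
    have hκ' : ((quadraticChar k (-1) : ℤ) : ℚ) = sQ (FormCase.sign .symmetric (-1 : k)) := by
      rw [← sgnZ_sign (by simp)]; rfl
    have ha' : ((quadraticChar k a : ℤ) : ℚ) = sQ (FormCase.sign .symmetric a) := by
      rw [← sgnZ_sign ha0]; rfl
    have hc : ∀ χ : FormCase.Sign .symmetric, ((sgnZ χ : ℤ) : ℚ) = sQ χ := fun _ => rfl
    have hcard : (Fintype.card k : ℚ) = Nat.card k := by rw [Nat.card_eq_fintype_card]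
    have hdet : (!![a] : Matrix (Fin 1) (Fin 1) k).det = a := Matrix.det_fin_one _
    refine ⟨!![a], normCount (Nat.card k) (FormCase.sign .symmetric (-1 : k))
      (FormCase.sign .symmetric (-1 : k) ^ (n / 2) * ψ₁), ?_, ?_, ?_, ?_, ?_⟩
    · change (!![a] : Matrix (Fin 1) (Fin 1) k).det ≠ 0
      rwa [hdet]
    · rintro rfl
      change FormCase.sign .symmetric (!![a] : Matrix (Fin 1) (Fin 1) k).det = _
      rw [hdet, ha]
      simp
    · exact (normCount_mul_Q q₀ hq _ n 1 (ψ₂ := 1) fun _ => rfl).1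
    · intro l ψ₂ hl
      change _ = _ * Q .symmetric _ _ _ n (FormCase.sign .symmetric
        (!![a] : Matrix (Fin 1) (Fin 1) k).det * ψ₁) _ _ _
      rw [hdet, ha]
      exact (normCount_mul_Q q₀ hq _ n l hl).2
    · intro X _ _ _ b r χ hr0 hb hX
      change ((Nat.card {e : Fin 1 → X // gram b e = !![a]} : ℕ) : ℚ) = _
      rw [card_frame_one b a, ← ha]
      rcases Nat.even_or_odd' r with ⟨s, rfl | rfl⟩
      · obtain ⟨s, rfl⟩ : ∃ s', s = s' + 1 := ⟨s - 1, by omega⟩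
        have h1 := nrep_symmetric_even hτ hb hX a
        rw [if_neg ha0] at h1
        have h2 := congrArg (fun n : ℤ => (n : ℚ)) h1
        simp only [Int.cast_mul, Int.cast_add, Int.cast_natCast, Int.cast_pow, Int.cast_sub,
          Int.cast_one, Int.cast_zero, hκ', hc, hcard] at h2
        have h3 : (Nat.card k : ℚ) ≠ 0 := by positivity
        rw [(normCount_even _ _ _ s _).resolve_right h3]
        apply mul_left_cancel₀ h3
        rw [h2]
        ring
      · have h1 := nrep_symmetric_odd hτ hb hX a
        have h2 := congrArg (fun n : ℤ => (n : ℚ)) h1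
        simp only [Int.cast_mul, Int.cast_add, Int.cast_natCast, Int.cast_pow, hκ', hc, hcard,
          ha'] at h2
        rw [h2, normCount_odd]
        ring
  · have h3 : (Nat.card k : ℚ) ≠ 0 := by positivity
    have hs : ∀ r : ℕ, ((Nat.card k : ℚ) ^ 2) ^ (r + 1) - 1 ≠ 0 := fun r =>
      sub_ne_zero.2 (one_lt_pow₀ (one_lt_pow₀ hq (by norm_num)) (Nat.succ_ne_zero r)).ne'
    refine ⟨!![0, 1; -1, 0], fun r _ => (((Nat.card k : ℚ) ^ 2) ^ r - 1) *
      ((Nat.card k : ℚ) ^ 2) ^ r / Nat.card k, ?_, fun _ => ?_, ?_, fun l ψ₂ hl => ?_, ?_⟩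
    · change (!![0, 1; -1, 0] : Matrix (Fin 2) (Fin 2) k).det ≠ 0
      rw [Matrix.det_fin_two]
      simp
    · have := FormCase.Sign.subsingleton (c := .alternating) (by simp)
      exact Subsingleton.elim _ _
    · exact div_ne_zero (mul_ne_zero (hs n) (pow_ne_zero _ (pow_ne_zero _ h3))) h3
    · have e1 : n + 1 + l = n + l + 1 := by ring
      have h4 := poch_ne_zero hq2 n
      have h5 := poch_ne_zero hq2 l
      have h6 := hs n
      simp only [Q, add_zero, poch_zero, mul_one, e1, poch_succ]
      generalize ((Nat.card k : ℚ) ^ 2) ^ (n + 1) - 1 = A at h6 ⊢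
      generalize ((Nat.card k : ℚ) ^ 2) ^ (n + l + 1) - 1 = B
      field_simp
      ring
    · intro X _ _ _ b r χ _ hb hX
      have h1 := card_hyperbolic_pairs hτ hb hX.nondeg
      have hr : finrank k X = 2 * r := hX.finrank_eq
      rw [hr] at h1
      have h2 := congrArg (fun n : ℕ => (n : ℚ)) h1
      simp only [Nat.cast_mul, Nat.cast_pow, Nat.cast_sub (Nat.one_le_pow (2 * r) (Nat.card k)
        Nat.card_pos), Nat.cast_one] at h2
      change ((Nat.card {e : Fin 2 → X // gram b e = !![0, 1; -1, 0]} : ℕ) : ℚ) = _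
      rw [eq_div_iff h3, mul_comm, h2, pow_mul]

/-- The number of subspaces with given data of a nondegenerate space over a finite field. -/
theorem card_goodSubs_eq_Q [Finite k] [Module.Finite k X] {c : FormCase} {q₀ : ℕ}
    (hτ : c.IsResSetting τ q₀) {b : X →ₗ[k] X →ₛₗ[τ] k} (hb : c.IsResForm b) {n m l : ℕ}
    {ψ₁ ψ₂ : c.Sign} (hX : HT c b (n + 2 / c.γ * m + l) (ψ₁ * c.sign (-1 : k) ^ m * ψ₂))
    (h₁ : n = 0 → ψ₁ = 1) (h₂ : l = 0 → ψ₂ = 1) :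
    (Nat.card (goodSubs c b n ψ₁ m) : ℚ) =
      Q c q₀ (Nat.card k) (c.sign (-1 : k)) n ψ₁ m l ψ₂ := by
  have hq := one_lt_card k
  have hq₀ : c = .unramifiedHermitian → (1 : ℚ) < q₀ ∧ (Nat.card k : ℚ) = (q₀ : ℚ) ^ 2 := by
    rintro rfl
    exact ⟨by exact_mod_cast two_le_of_card_eq_sq hτ.1, by exact_mod_cast hτ.1⟩
  have hγ : c.γ * (2 / c.γ) = 2 := by cases c <;> simp [FormCase.γ]
  induction m generalizing X with
  | zero =>
    simp only [mul_zero, add_zero, pow_zero, mul_one] at hX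
    -- Without radical, frames are split off one at a time. The sign of what remains changes, so
    -- `ψ₁` varies in the induction.
    induction n generalizing X ψ₁ with
    | zero =>
      obtain rfl := h₁ rfl
      rw [goodSubs_zero_zero, Nat.cast_one, Q_zero (fun h => (hq₀ h).1) hq _ h₂]
    | succ n ih =>
      have hn := hX.nondeg
      obtain ⟨G, f, hG, hG0, hf0, hfQ, hf⟩ := exists_frame_count hτ n ψ₁
      have hψ : c.sign G.det * (c.sign G.det * ψ₁) = ψ₁ := by
        rw [← mul_assoc, FormCase.Sign.mul_self, one_mul]
      have key := card_goodSubs_zero_succ hτ hb hn hG (by simp) (n := n)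
        (ψ := c.sign G.det * ψ₁) (N := f (n + 1) ψ₁)
        (R := Q c q₀ (Nat.card k) (c.sign (-1 : k)) n (c.sign G.det * ψ₁) 0 l ψ₂) ?_ ?_
      · rw [hψ, hf (n + 1 + l) _ (by omega) hb hX, ← hfQ l ψ₂ h₂, mul_comm] at key
        exact mul_left_cancel₀ hf0 key
      · rintro U ⟨hU1, hU2⟩
        rw [hψ] at hU2
        exact hf (n + 1) ψ₁ (by omega) (hb.restr U) (hU2.hT hU1)
      · rintro e he
        have hdet : (gram b e).det ≠ 0 := by rw [he]; exact hG
        have hn' := hn.restr_orth hτ hb (disjoint_orth_of_gram hdet)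
        -- The type of the orthogonal of the frame is obtained by cancellation in the type of the
        -- orthogonal sum.
        obtain ⟨d, χ, hd⟩ := hn'.exists_HT hτ (hb.restr _)
        obtain ⟨h3, h4⟩ := hX.unique hτ (hd.glue hτ hb hn hdet (d₁ := 1) (by simp))
        obtain rfl : d = n + l := by omega
        have h5 : c.sign G.det * ψ₁ * ψ₂ = χ := by
          rw [mul_assoc, h4, he, ← mul_assoc, FormCase.Sign.mul_self, one_mul]
        refine ih (fun h => ?_) (hb.restr _) (by rw [h5]; exact hd)
        rw [hG0 h, FormCase.Sign.mul_self]
  | succ m ih =>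
    have hn := hX.nondeg
    have hm : (Nat.card k : ℚ) ^ (m + 1) - 1 ≠ 0 :=
      (sub_pos.2 (one_lt_pow₀ hq (Nat.succ_ne_zero m))).ne'
    have e1 : n + 2 / c.γ * (m + 1) + l = (n + 2 / c.γ * m + l) + 2 / c.γ := by ring
    have e2 : ψ₁ * c.sign (-1 : k) ^ (m + 1) * ψ₂ =
        (ψ₁ * c.sign (-1 : k) ^ m * ψ₂) * c.sign (-1 : k) := by
      rw [pow_succ, ← mul_assoc, mul_right_comm]
    rw [e1, e2] at hX
    have key := card_goodSubs_succ hτ hb hn (n := n) (ψ := ψ₁) (m := m)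
      (R := Q c q₀ (Nat.card k) (c.sign (-1 : k)) n ψ₁ m l ψ₂) ?_
    · rw [card_isotropic_eq hτ hb hX, ← Q_succ hq₀ hq _ h₁ h₂] at key
      exact mul_right_cancel₀ hm key
    · intro v w hv hvw hwv
      have hdet := gram_pair_det hv hvw (by rw [hwv]; exact one_ne_zero)
      have hn' := hn.restr_orth hτ hb (disjoint_orth_of_gram hdet)
      obtain ⟨d, χ, hd⟩ := hn'.exists_HT hτ (hb.restr _)
      obtain ⟨h3, h4⟩ := hX.unique hτ (hd.glue hτ hb hn hdet (d₁ := 2 / c.γ) (by simp [hγ]))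
      obtain rfl : d = n + 2 / c.γ * m + l := by omega
      rw [sign_gram_hyperbolic hτ hb hv hwv, mul_comm, mul_right_inj] at h4
      exact ih (hb.restr _) (h4 ▸ hd)

end SubspaceCount

/-! ### Lattices, residue spaces and residue forms -/

section FormSMul

variable {F₀ F : Type*} [Field F₀] [Field F] [Algebra F₀ F]
  {σ : F ≃ₐ[F₀] F} {V : Type*} [AddCommGroup V] [Module F V]

lemma form_smul_left (B : Form σ V) (a : F) (x y : V) : B (a • x) y = a * B x y := by
  rw [map_smul, LinearMap.smul_apply, smul_eq_mul]

lemma form_smul_right (B : Form σ V) (a : F) (x y : V) : B x (a • y) = σ a * B x y := by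
  rw [LinearMap.map_smulₛₗ, smul_eq_mul]
  rfl

end FormSMul

section LatticeBasics

open Module

variable {F₀ F : Type*} [Field F₀] [Field F] [ValuativeRel F] [Algebra F₀ F]
  {σ : F ≃ₐ[F₀] F} {V : Type*} [AddCommGroup V] [Module F V]

/-- The assumptions on the automorphism, the uniformizer and the induced automorphism of the
residue field. -/
structure LatSetting (c : FormCase) (σ : F ≃ₐ[F₀] F) (ϖ : F) (τ : 𝓀[F] →+* 𝓀[F]) (q₀ : ℕ) :
    Prop where
  maximalIdeal_eq : ∃ p : 𝒪[F], (p : F) = ϖ ∧ 𝓂[F] = Ideal.span {p}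
  ne_zero : ϖ ≠ 0
  map_mem : ∀ x ∈ 𝒪[F], σ x ∈ 𝒪[F]
  map_unif : σ ϖ = ϖ
  toResidue_map : ∀ x ∈ 𝒪[F], toResidue (σ x) = τ (toResidue x)
  isResSetting : c.IsResSetting τ q₀
  eq_one : c ≠ .unramifiedHermitian → σ = 1

section Residue

lemma toResidue_coe (x : 𝒪[F]) : toResidue (x : F) = IsLocalRing.residue 𝒪[F] x := by
  rw [toResidue, dif_pos x.2]

lemma toResidue_add {x y : F} (hx : x ∈ 𝒪[F]) (hy : y ∈ 𝒪[F]) :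
    toResidue (x + y) = toResidue x + toResidue y := by
  lift x to 𝒪[F] using hx
  lift y to 𝒪[F] using hy
  rw [← Subring.coe_add, toResidue_coe, toResidue_coe, toResidue_coe, map_add]

lemma toResidue_mul {x y : F} (hx : x ∈ 𝒪[F]) (hy : y ∈ 𝒪[F]) :
    toResidue (x * y) = toResidue x * toResidue y := by
  lift x to 𝒪[F] using hx
  lift y to 𝒪[F] using hy
  rw [← Subring.coe_mul, toResidue_coe, toResidue_coe, toResidue_coe, map_mul]

end Residue

/-- The fractional ideal `ϖ^i 𝒪`. -/
def fracPow (ϖ : F) (i : ℤ) : AddSubgroup F where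
  carrier := {x | ϖ ^ (-i) * x ∈ 𝒪[F]}
  zero_mem' := by simp
  add_mem' := fun {x y} hx hy => by
    change ϖ ^ (-i) * (x + y) ∈ 𝒪[F]
    rw [mul_add]
    exact add_mem hx hy
  neg_mem' := fun {x} hx => by
    change ϖ ^ (-i) * (-x) ∈ 𝒪[F]
    rw [mul_neg]
    exact neg_mem hx

lemma mem_fracPow {ϖ : F} {i : ℤ} {x : F} : x ∈ fracPow ϖ i ↔ ϖ ^ (-i) * x ∈ 𝒪[F] := Iff.rfl

lemma mem_fracPow_zero {ϖ : F} {x : F} : x ∈ fracPow ϖ 0 ↔ x ∈ 𝒪[F] := by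
  rw [mem_fracPow, neg_zero, zpow_zero, one_mul]

namespace LatSetting

variable {c : FormCase} {ϖ : F} {τ : 𝓀[F] →+* 𝓀[F]} {q₀ : ℕ} (hS : LatSetting c σ ϖ τ q₀)

lemma unif_mem (hS : LatSetting c σ ϖ τ q₀) : ϖ ∈ 𝒪[F] := by
  obtain ⟨p, rfl, -⟩ := hS.maximalIdeal_eq
  exact p.2

lemma mul_mem_fracPow (hS : LatSetting c σ ϖ τ q₀) {i j : ℤ} {x y : F} (hx : x ∈ fracPow ϖ i)
    (hy : y ∈ fracPow ϖ j) : x * y ∈ fracPow ϖ (i + j) := by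
  rw [mem_fracPow] at *
  have : ϖ ^ (-(i + j)) * (x * y) = (ϖ ^ (-i) * x) * (ϖ ^ (-j) * y) := by
    rw [neg_add, zpow_add₀ hS.ne_zero]
    ring
  rw [this]
  exact mul_mem hx hy

lemma zpow_mem_fracPow (hS : LatSetting c σ ϖ τ q₀) {i j : ℤ} (h : i ≤ j) :
    ϖ ^ j ∈ fracPow ϖ i := by
  rw [mem_fracPow, ← zpow_add₀ hS.ne_zero]
  obtain ⟨n, hn⟩ := Int.eq_ofNat_of_zero_le (by omega : 0 ≤ -i + j)
  rw [hn, zpow_natCast]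
  exact pow_mem hS.unif_mem n

lemma zpow_mul_mem_fracPow (hS : LatSetting c σ ϖ τ q₀) {i j : ℤ} {x : F} :
    ϖ ^ j * x ∈ fracPow ϖ i ↔ x ∈ fracPow ϖ (i - j) := by
  rw [mem_fracPow, mem_fracPow, ← mul_assoc, ← zpow_add₀ hS.ne_zero]
  have : -i + j = -(i - j) := by ring
  rw [this]

lemma fracPow_anti (hS : LatSetting c σ ϖ τ q₀) {i j : ℤ} (h : i ≤ j) {x : F}
    (hx : x ∈ fracPow ϖ j) : x ∈ fracPow ϖ i := by
  have h1 : x = ϖ ^ j * (ϖ ^ (-j) * x) := by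
    rw [← mul_assoc, ← zpow_add₀ hS.ne_zero, add_neg_cancel, zpow_zero, one_mul]
  rw [h1, ← add_zero i]
  exact hS.mul_mem_fracPow (hS.zpow_mem_fracPow h) (mem_fracPow_zero.2 hx)

lemma mul_mem_fracPow_of_mem (hS : LatSetting c σ ϖ τ q₀) {i : ℤ} {a x : F} (ha : a ∈ 𝒪[F])
    (hx : x ∈ fracPow ϖ i) : a * x ∈ fracPow ϖ i := by
  have := hS.mul_mem_fracPow (mem_fracPow_zero.2 ha) hx
  rwa [zero_add] at this

lemma map_zpow (hS : LatSetting c σ ϖ τ q₀) (i : ℤ) : σ (ϖ ^ i) = ϖ ^ i := by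
  rw [map_zpow₀, hS.map_unif]

lemma map_mem_fracPow (hS : LatSetting c σ ϖ τ q₀) {i : ℤ} {x : F} (hx : x ∈ fracPow ϖ i) :
    σ x ∈ fracPow ϖ i := by
  have := hS.map_mem _ hx
  rwa [map_mul, hS.map_zpow] at this

lemma toResidue_eq_zero (hS : LatSetting c σ ϖ τ q₀) {x : F} (hx : x ∈ 𝒪[F]) :
    toResidue x = 0 ↔ x ∈ fracPow ϖ 1 := by
  obtain ⟨p, hp, hm⟩ := hS.maximalIdeal_eq
  lift x to 𝒪[F] using hx
  rw [toResidue_coe, IsLocalRing.residue_eq_zero_iff, hm, Ideal.mem_span_singleton', mem_fracPow,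
    ← hp]
  have hp0 : (p : F) ≠ 0 := hp ▸ hS.ne_zero
  constructor
  · rintro ⟨a, rfl⟩
    have : (p : F) ^ (-1 : ℤ) * (a * p : 𝒪[F]) = a := by
      push_cast
      rw [zpow_neg_one]
      field_simp
    rw [this]
    exact a.2
  · intro h
    refine ⟨⟨_, h⟩, Subtype.ext ?_⟩
    rw [Subring.coe_mul]
    simp only [zpow_neg_one]
    field_simp

/-- The residue of `ϖ^(-i) x`. -/
lemma toResidue_zpow_mul_eq_zero (hS : LatSetting c σ ϖ τ q₀) {i : ℤ} {x : F}
    (hx : x ∈ fracPow ϖ i) : toResidue (ϖ ^ (-i) * x) = 0 ↔ x ∈ fracPow ϖ (i + 1) := by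
  rw [hS.toResidue_eq_zero hx, hS.zpow_mul_mem_fracPow, sub_neg_eq_add, add_comm]

lemma toResidue_congr (hS : LatSetting c σ ϖ τ q₀) {i : ℤ} {x y : F}
    (hx : x ∈ fracPow ϖ i) (h : x - y ∈ fracPow ϖ (i + 1)) :
    toResidue (ϖ ^ (-i) * x) = toResidue (ϖ ^ (-i) * y) := by
  have h1 : x - y ∈ fracPow ϖ i := hS.fracPow_anti (by omega) h
  have hy : y ∈ fracPow ϖ i := by
    have := (fracPow ϖ i).sub_mem hx h1
    rwa [sub_sub_cancel] at this
  have h2 := (hS.toResidue_zpow_mul_eq_zero h1).2 h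
  have h3 : ϖ ^ (-i) * x = ϖ ^ (-i) * (x - y) + ϖ ^ (-i) * y := by ring
  rw [h3, toResidue_add h1 hy, h2, zero_add]

end LatSetting

/-- The class of an element of a lattice in its residue space. -/
def resMk (P : Submodule 𝒪[F] V) : P →ₗ[𝒪[F]] ResSpace P := Submodule.mkQ _

lemma resMk_surjective (P : Submodule 𝒪[F] V) : Function.Surjective (resMk P) :=
  Submodule.mkQ_surjective _

lemma residue_smul_resMk (P : Submodule 𝒪[F] V) (a : 𝒪[F]) (x : P) :
    IsLocalRing.residue 𝒪[F] a • resMk P x = resMk P (a • x) := rfl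

instance (P : Submodule 𝒪[F] V) : IsScalarTower 𝒪[F] 𝓀[F] (ResSpace P) :=
  ⟨fun a b x => by
    obtain ⟨b, rfl⟩ := IsLocalRing.residue_surjective b
    obtain ⟨x, rfl⟩ := resMk_surjective P x
    change IsLocalRing.residue 𝒪[F] (a * b) • resMk P x = resMk P (a • b • x)
    rw [residue_smul_resMk, mul_smul]⟩

instance (P : Submodule 𝒪[F] V) [Module.Finite 𝒪[F] P] : Module.Finite 𝓀[F] (ResSpace P) :=
  Module.Finite.of_restrictScalars_finite 𝒪[F] 𝓀[F] (ResSpace P)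

lemma LatSetting.resMk_eq_zero {c : FormCase} {ϖ : F} {τ : 𝓀[F] →+* 𝓀[F]} {q₀ : ℕ}
    (hS : LatSetting c σ ϖ τ q₀) {P : Submodule 𝒪[F] V} {x : P} :
    resMk P x = 0 ↔ ∃ y ∈ P, (x : V) = ϖ • y := by
  obtain ⟨p, hp, hm⟩ := hS.maximalIdeal_eq
  rw [resMk, Submodule.mkQ_apply, Submodule.Quotient.mk_eq_zero, hm,
    Submodule.ideal_span_singleton_smul, ← hp]
  constructor
  · intro h
    obtain ⟨y, -, hy⟩ := Submodule.mem_smul_pointwise_iff_exists _ _ _ |>.1 h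
    exact ⟨y, y.2, congrArg Subtype.val hy.symm⟩
  · rintro ⟨y, hy, h⟩
    exact Submodule.mem_smul_pointwise_iff_exists _ _ _ |>.2 ⟨⟨y, hy⟩, trivial, Subtype.ext h.symm⟩

lemma LatSetting.resMk_eq_iff {c : FormCase} {ϖ : F} {τ : 𝓀[F] →+* 𝓀[F]} {q₀ : ℕ}
    (hS : LatSetting c σ ϖ τ q₀) {P : Submodule 𝒪[F] V} {x x' : P} :
    resMk P x = resMk P x' ↔ ∃ y ∈ P, (x : V) - x' = ϖ • y := by
  rw [← sub_eq_zero, ← map_sub, hS.resMk_eq_zero]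
  rfl

section Form

variable {c : FormCase} {ϖ : F} {τ : 𝓀[F] →+* 𝓀[F]} {q₀ : ℕ}

/-- The form is divisible by `ϖ^i` on `P`. -/
def IntegralAt (B : Form σ V) (ϖ : F) (i : ℤ) (P : Submodule 𝒪[F] V) : Prop :=
  ∀ x ∈ P, ∀ y ∈ P, B x y ∈ fracPow ϖ i

/-- Other representatives differ by elements of `ϖP`, and since the form is divisible by `ϖ^i` on
`P`, its values then change only by multiples of `ϖ^(i+1)`. -/
lemma resForm_resMk (hS : LatSetting c σ ϖ τ q₀) {B : Form σ V} {i : ℤ} {P : Submodule 𝒪[F] V}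
    (hP : IntegralAt B ϖ i P) (x y : P) :
    resForm B ϖ i P (resMk P x) (resMk P y) = toResidue (ϖ ^ (-i) * B x y) := by
  have hout : ∀ x : P, ∃ u ∈ P, ((Quotient.out (resMk P x) : P) : V) - x = ϖ • u := fun x =>
    hS.resMk_eq_iff.1 (Quotient.out_eq (resMk P x))
  obtain ⟨u, hu, h1⟩ := hout x
  obtain ⟨w, hw, h2⟩ := hout y
  rw [resForm]
  refine hS.toResidue_congr (hP _ (Subtype.property _) _ (Subtype.property _)) ?_
  generalize ((Quotient.out (resMk P x) : P) : V) = x' at h1 ⊢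
  generalize hy' : ((Quotient.out (resMk P y) : P) : V) = y' at h2 ⊢
  have hy'P : y' ∈ P := hy' ▸ Subtype.property _
  have h3 : B x' y' - B x y = B (x' - x) y' + B x (y' - y) := by
    simp only [map_sub, LinearMap.sub_apply]
    ring
  rw [h3, h1, h2, form_smul_left, form_smul_right, hS.map_unif]
  have hϖ : ϖ ∈ fracPow ϖ 1 := by
    have := hS.zpow_mem_fracPow (le_refl (1 : ℤ))
    rwa [zpow_one] at this
  rw [add_comm i]
  exact (fracPow ϖ (1 + i)).add_mem (hS.mul_mem_fracPow hϖ (hP _ hu _ hy'P))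
    (hS.mul_mem_fracPow hϖ (hP _ x.2 _ hw))

/-- The residue form as a sesquilinear form. -/
def resB (hS : LatSetting c σ ϖ τ q₀) {B : Form σ V} {i : ℤ} {P : Submodule 𝒪[F] V}
    (hP : IntegralAt B ϖ i P) : ResSpace P →ₗ[𝓀[F]] ResSpace P →ₛₗ[τ] 𝓀[F] :=
  LinearMap.mk₂'ₛₗ (RingHom.id _) τ (resForm B ϖ i P)
    (fun x x' y => by
      obtain ⟨x, rfl⟩ := resMk_surjective P x
      obtain ⟨x', rfl⟩ := resMk_surjective P x'
      obtain ⟨y, rfl⟩ := resMk_surjective P y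
      rw [← map_add, resForm_resMk hS hP, resForm_resMk hS hP, resForm_resMk hS hP,
        ← toResidue_add (hP _ x.2 _ y.2) (hP _ x'.2 _ y.2), Submodule.coe_add, map_add,
        LinearMap.add_apply, mul_add])
    (fun a x y => by
      obtain ⟨x, rfl⟩ := resMk_surjective P x
      obtain ⟨y, rfl⟩ := resMk_surjective P y
      obtain ⟨a, rfl⟩ := IsLocalRing.residue_surjective a
      rw [residue_smul_resMk, resForm_resMk hS hP, resForm_resMk hS hP, RingHom.id_apply,
        smul_eq_mul, ← toResidue_coe, ← toResidue_mul a.2 (hP _ x.2 _ y.2)]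
      change toResidue (_ * B ((a : F) • (x : V)) y) = _
      rw [form_smul_left]
      congr 1
      ring)
    (fun x y y' => by
      obtain ⟨x, rfl⟩ := resMk_surjective P x
      obtain ⟨y', rfl⟩ := resMk_surjective P y'
      obtain ⟨y, rfl⟩ := resMk_surjective P y
      rw [← map_add, resForm_resMk hS hP, resForm_resMk hS hP, resForm_resMk hS hP,
        ← toResidue_add (hP _ x.2 _ y.2) (hP _ x.2 _ y'.2), Submodule.coe_add, map_add,
        mul_add])
    (fun a x y => by
      obtain ⟨x, rfl⟩ := resMk_surjective P x
      obtain ⟨y, rfl⟩ := resMk_surjective P y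
      obtain ⟨a, rfl⟩ := IsLocalRing.residue_surjective a
      rw [residue_smul_resMk, resForm_resMk hS hP, resForm_resMk hS hP,
        smul_eq_mul, ← toResidue_coe, ← hS.toResidue_map _ a.2,
        ← toResidue_mul (hS.map_mem _ a.2) (hP _ x.2 _ y.2)]
      change toResidue (_ * B (x : V) ((a : F) • (y : V))) = _
      rw [form_smul_right]
      congr 1
      ring)

lemma resB_resMk (hS : LatSetting c σ ϖ τ q₀) {B : Form σ V} {i : ℤ} {P : Submodule 𝒪[F] V}
    (hP : IntegralAt B ϖ i P) (x y : P) :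
    resB hS hP (resMk P x) (resMk P y) = toResidue (ϖ ^ (-i) * B x y) := resForm_resMk hS hP x y

lemma isResForm_resB (hS : LatSetting c σ ϖ τ q₀) {B : Form σ V} (hB : c.IsForm B) {i : ℤ}
    {P : Submodule 𝒪[F] V} (hP : IntegralAt B ϖ i P) : c.IsResForm (resB hS hP) := by
  cases c
  · intro x y
    obtain ⟨x, rfl⟩ := resMk_surjective P x
    obtain ⟨y, rfl⟩ := resMk_surjective P y
    rw [resB_resMk, resB_resMk, ← hS.toResidue_map _ (hP _ x.2 _ y.2), map_mul, hS.map_zpow,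
      ← hB (x : V) y]
  · intro x y
    obtain ⟨x, rfl⟩ := resMk_surjective P x
    obtain ⟨y, rfl⟩ := resMk_surjective P y
    rw [resB_resMk, resB_resMk, hB (x : V) y]
  · intro x
    obtain ⟨x, rfl⟩ := resMk_surjective P x
    rw [resB_resMk, hB (x : V), mul_zero, ← ZeroMemClass.coe_zero 𝒪[F], toResidue_coe, map_zero]

end Form

end LatticeBasics

/-! ### Jordan splittings and independence of the type -/

section JordanBasics

open Module

variable {F₀ F : Type*} [Field F₀] [Field F] [ValuativeRel F] [Algebra F₀ F]
  {σ : F ≃ₐ[F₀] F} {V : Type*} [AddCommGroup V] [Module F V]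
  {c : FormCase} {ϖ : F} {τ : 𝓀[F] →+* 𝓀[F]} {q₀ : ℕ} {B : Form σ V}

lemma LatSetting.form_swap (hS : LatSetting c σ ϖ τ q₀) (hB : c.IsForm B) (x y : V) :
    B y x = σ (B x y) ∨ B y x = - B x y := by
  cases c
  · exact .inl (hB x y)
  · have h : σ (B x y) = B x y :=
      congrArg (fun s : F ≃ₐ[F₀] F => s (B x y)) (hS.eq_one (by simp))
    exact .inl ((hB x y).trans h.symm)
  · right
    have h := hB (x + y)
    simp only [map_add, LinearMap.add_apply, hB x, hB y, zero_add, add_zero] at h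
    exact eq_neg_of_add_eq_zero_left h

lemma LatSetting.form_swap_mem (hS : LatSetting c σ ϖ τ q₀) (hB : c.IsForm B) {x y : V} {i : ℤ}
    (h : B x y ∈ fracPow ϖ i) : B y x ∈ fracPow ϖ i := by
  rcases hS.form_swap hB x y with h1 | h1 <;> rw [h1]
  · exact hS.map_mem_fracPow h
  · exact (fracPow ϖ i).neg_mem h

namespace JordanSplitting

variable {L : Submodule 𝒪[F] V} (J : JordanSplitting B ϖ L)

lemma proj_mem (i : ℤ) (x : V) : J.proj i x ∈ J.comp i := Subtype.property _

lemma proj_of_mem {i : ℤ} {x : V} (hx : x ∈ J.comp i) : J.proj i x = x := by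
  have h : (LinearEquiv.ofBijective (DirectSum.coeLinearMap J.comp) J.isInternal).symm x =
      DirectSum.lof F ℤ (fun j => J.comp j) i ⟨x, hx⟩ := by
    rw [LinearEquiv.symm_apply_eq]
    exact (DirectSum.coeLinearMap_lof J.comp i ⟨x, hx⟩).symm
  simp only [proj, LinearMap.comp_apply, LinearEquiv.coe_coe, h, Submodule.subtype_apply,
    DirectSum.component.lof_self]

lemma proj_of_mem_ne {i j : ℤ} (hij : j ≠ i) {x : V} (hx : x ∈ J.comp j) : J.proj i x = 0 := by
  have h : (LinearEquiv.ofBijective (DirectSum.coeLinearMap J.comp) J.isInternal).symm x =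
      DirectSum.lof F ℤ (fun j => J.comp j) j ⟨x, hx⟩ := by
    rw [LinearEquiv.symm_apply_eq]
    exact (DirectSum.coeLinearMap_lof J.comp j ⟨x, hx⟩).symm
  simp only [proj, LinearMap.comp_apply, LinearEquiv.coe_coe, h, Submodule.subtype_apply,
    DirectSum.component.of]
  rw [dif_neg hij, ZeroMemClass.coe_zero]

lemma iSup_comp : ⨆ i, J.comp i = ⊤ := J.isInternal.submodule_iSup_eq_top

lemma finite_ne_bot [FiniteDimensional F V] : {i | J.comp i ≠ ⊥}.Finite :=
  WellFoundedGT.finite_ne_bot_of_iSupIndep J.isInternal.submodule_iSupIndep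

/-- The set of indices with nonzero component. -/
def supp [FiniteDimensional F V] : Finset ℤ := J.finite_ne_bot.toFinset

lemma mem_supp [FiniteDimensional F V] {i : ℤ} : i ∈ J.supp ↔ J.comp i ≠ ⊥ :=
  J.finite_ne_bot.mem_toFinset

lemma comp_eq_bot [FiniteDimensional F V] {i : ℤ} (hi : i ∉ J.supp) : J.comp i = ⊥ := by
  rwa [mem_supp, not_not] at hi

lemma sum_proj [FiniteDimensional F V] (x : V) : ∑ i ∈ J.supp, J.proj i x = x := by
  have hx : x ∈ ⨆ i, J.comp i := J.iSup_comp ▸ Submodule.mem_top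
  induction hx using Submodule.iSup_induction' with
  | mem i x hx =>
    by_cases hi : i ∈ J.supp
    · rw [Finset.sum_eq_single_of_mem i hi fun j _ hj => J.proj_of_mem_ne hj.symm hx,
        J.proj_of_mem hx]
    · have : x = 0 := by simpa [J.comp_eq_bot hi] using hx
      simp [this]
  | zero => simp
  | add x y _ _ hx hy => simp only [map_add, Finset.sum_add_distrib, hx, hy]

lemma proj_eq_zero [FiniteDimensional F V] {i : ℤ} (hi : i ∉ J.supp) (x : V) :
    J.proj i x = 0 := by
  simpa [J.comp_eq_bot hi] using J.proj_mem i x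

lemma proj_mem_inter {i : ℤ} {x : V} (hx : x ∈ L) : J.proj i x ∈ inter L (J.comp i) := by
  refine ⟨?_, J.proj_mem i x⟩
  rw [J.iSup_inter] at hx
  induction hx using Submodule.iSup_induction' with
  | mem j x hx =>
    by_cases hj : j = i
    · subst hj
      rw [J.proj_of_mem hx.2]
      exact hx.1
    · rw [J.proj_of_mem_ne hj hx.2]
      exact zero_mem _
  | zero => simp
  | add x y _ _ hx hy => rw [map_add]; exact add_mem hx hy

lemma map_proj (i : ℤ) : L.map ((J.proj i).restrictScalars 𝒪[F]) = inter L (J.comp i) := by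
  ext x
  constructor
  · rintro ⟨y, hy, rfl⟩
    exact J.proj_mem_inter hy
  · exact fun hx => ⟨x, hx.1, J.proj_of_mem hx.2⟩

lemma finite_inter (hL : L.FG) (i : ℤ) : Module.Finite 𝒪[F] (inter L (J.comp i)) := by
  rw [Module.Finite.iff_fg, ← J.map_proj]
  exact hL.map _

lemma form_eq_proj_right [FiniteDimensional F V] {i : ℤ} {x : V} (hx : x ∈ J.comp i) (y : V) :
    B x y = B x (J.proj i y) := by
  conv_lhs => rw [← J.sum_proj y, map_sum]
  by_cases hi : i ∈ J.supp
  · exact Finset.sum_eq_single_of_mem i hi fun j _ hj =>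
      J.orthogonal i j hj.symm x hx _ (J.proj_mem j y)
  · have : x = 0 := by simpa [J.comp_eq_bot hi] using hx
    simp [this]

lemma form_eq_proj_left [FiniteDimensional F V] {i : ℤ} {x : V} (hx : x ∈ J.comp i) (y : V) :
    B y x = B (J.proj i y) x := by
  conv_lhs => rw [← J.sum_proj y, map_sum, LinearMap.sum_apply]
  by_cases hi : i ∈ J.supp
  · exact Finset.sum_eq_single_of_mem i hi fun j _ hj =>
      J.orthogonal j i hj _ (J.proj_mem j y) x hx
  · have : x = 0 := by simpa [J.comp_eq_bot hi] using hx
    simp [this]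

lemma mem_compGE [FiniteDimensional F V] {i : ℤ} {x : V} :
    x ∈ J.compGE i ↔ ∀ j < i, J.proj j x = 0 := by
  constructor
  · intro hx j hj
    have : J.compGE i ≤ LinearMap.ker (J.proj j) := by
      refine iSup₂_le fun a ha y hy => ?_
      exact J.proj_of_mem_ne (by omega) hy
    exact this hx
  · intro h
    rw [← J.sum_proj x]
    refine sum_mem fun j _ => ?_
    rcases lt_or_ge j i with hj | hj
    · rw [h j hj]
      exact zero_mem _
    · exact (le_iSup₂_of_le (f := fun j (_ : j ≥ i) => J.comp j) j hj le_rfl) (J.proj_mem j x)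

lemma mem_zpow_smul (hS : LatSetting c σ ϖ τ q₀) {N : Submodule 𝒪[F] V} {i : ℤ} {x : V} :
    x ∈ ϖ ^ i • N ↔ ϖ ^ (-i) • x ∈ N := by
  constructor
  · intro h
    obtain ⟨y, hy, rfl⟩ := (Submodule.mem_smul_pointwise_iff_exists _ _ _).1 h
    rwa [smul_smul, ← zpow_add₀ hS.ne_zero, neg_add_cancel, zpow_zero, one_smul]
  · intro h
    refine (Submodule.mem_smul_pointwise_iff_exists _ _ _).2 ⟨_, h, ?_⟩
    rw [smul_smul, ← zpow_add₀ hS.ne_zero, add_neg_cancel, zpow_zero, one_smul]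

/-- A vector of `V^(i)` whose products with `L^(i)` are in `ϖ^a 𝒪` is in `ϖ^(a-i) L^(i)`. -/
lemma mem_of_form_mem (hS : LatSetting c σ ϖ τ q₀) {i a : ℤ} {x : V} (hx : x ∈ J.comp i)
    (h : ∀ y ∈ inter L (J.comp i), B x y ∈ fracPow ϖ a) :
    ∃ y ∈ inter L (J.comp i), x = ϖ ^ (a - i) • y := by
  have h1 : ϖ ^ (-a) • x ∈ dualIn B (J.comp i) (inter L (J.comp i)) :=
    ⟨(J.comp i).smul_mem _ hx, fun y hy => by rw [form_smul_left]; exact h y hy⟩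
  rw [J.dual_eq, mem_zpow_smul hS, smul_smul, ← zpow_add₀ hS.ne_zero] at h1
  refine ⟨_, h1, ?_⟩
  rw [smul_smul, ← zpow_add₀ hS.ne_zero, show a - i + (- -i + -a) = 0 by ring, zpow_zero, one_smul]

lemma integralAt (hS : LatSetting c σ ϖ τ q₀) (i : ℤ) :
    IntegralAt B ϖ i (inter L (J.comp i)) := by
  intro x hx y hy
  have h1 : ϖ ^ (-i) • x ∈ dualIn B (J.comp i) (inter L (J.comp i)) := by
    rw [J.dual_eq, mem_zpow_smul hS, smul_smul, ← zpow_add₀ hS.ne_zero]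
    simpa using hx
  have := h1.2 y hy
  rwa [form_smul_left] at this

/-- The residue form of the `i`-th component. -/
def resB (hS : LatSetting c σ ϖ τ q₀) (i : ℤ) :
    ResSpace (inter L (J.comp i)) →ₗ[𝓀[F]] ResSpace (inter L (J.comp i)) →ₛₗ[τ] 𝓀[F] :=
  LatticeTyp.resB hS (J.integralAt hS i)

lemma resB_resMk (hS : LatSetting c σ ϖ τ q₀) (i : ℤ) (x y : inter L (J.comp i)) :
    J.resB hS i (resMk _ x) (resMk _ y) = toResidue (ϖ ^ (-i) * B x y) :=
  LatticeTyp.resB_resMk hS _ x y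

lemma isResForm_resB (hS : LatSetting c σ ϖ τ q₀) (hB : c.IsForm B) (i : ℤ) :
    c.IsResForm (J.resB hS i) := LatticeTyp.isResForm_resB hS hB _

/-- A vector of `Λ^(i)` whose products with `Λ^(i)` all lie in `ϖ^(i+1) 𝒪` is in `ϖΛ^(i)`, because
the dual of `Λ^(i)` is `ϖ^(-i) Λ^(i)`. -/
lemma nondeg_resB (hS : LatSetting c σ ϖ τ q₀) (i : ℤ) : Nondeg (J.resB hS i) := by
  intro x hx
  obtain ⟨x, rfl⟩ := resMk_surjective _ x
  obtain ⟨y, hy, h⟩ := J.mem_of_form_mem hS (a := i + 1) x.2.2 fun y hy => by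
    have := hx (resMk _ ⟨y, hy⟩)
    rw [resB_resMk] at this
    exact (hS.toResidue_zpow_mul_eq_zero (J.integralAt hS i _ x.2 _ hy)).1 this
  rw [add_sub_cancel_left, zpow_one] at h
  exact hS.resMk_eq_zero.2 ⟨y, hy, h⟩

/-- Comparison of two Jordan splittings: the projection preserves the form up to higher order. -/
lemma form_proj_congr [FiniteDimensional F V] (hS : LatSetting c σ ϖ τ q₀)
    (J' : JordanSplitting B ϖ L) {i : ℤ} {x y : V} (hx : x ∈ inter L (J.comp i))
    (hy : y ∈ inter L (J.comp i)) :
    B x y - B (J'.proj i x) (J'.proj i y) ∈ fracPow ϖ (i + 1) := by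
  have h0 : B x y = ∑ j ∈ J'.supp, B (J'.proj j x) (J'.proj j y) := by
    conv_lhs => rw [← J'.sum_proj x, map_sum, LinearMap.sum_apply]
    exact Finset.sum_congr rfl fun j _ => J'.form_eq_proj_right (J'.proj_mem j x) y
  have h1 : ∀ j, j ≠ i → B (J'.proj j x) (J'.proj j y) ∈ fracPow ϖ (i + 1) := by
    intro j hj
    have hx' := J'.proj_mem_inter (i := j) hx.1
    have hy' := J'.proj_mem_inter (i := j) hy.1
    rcases lt_or_gt_of_ne hj with hj | hj
    -- For `j < i` the products of `x` with `L` lie in `ϖ^i 𝒪`, so the `j`-th projection is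
    -- divisible by `ϖ^(i-j)`. The contribution of level `j` is then divisible by `ϖ^(2(i-j)+j)`,
    -- and `2i - j ≥ i + 1`. For `j > i` integrality at level `j` suffices.
    · have key : ∀ x ∈ inter L (J.comp i), ∃ z ∈ inter L (J'.comp j),
          J'.proj j x = ϖ ^ (i - j) • z := by
        intro x hx
        refine J'.mem_of_form_mem hS (J'.proj_mem j x) fun z hz => ?_
        rw [← J'.form_eq_proj_left hz.2, J.form_eq_proj_right hx.2]
        exact J.integralAt hS i _ hx _ (J.proj_mem_inter hz.1)
      obtain ⟨z, hz, hxz⟩ := key x hx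
      obtain ⟨w, hw, hyw⟩ := key y hy
      rw [hxz, hyw, form_smul_left, form_smul_right, hS.map_zpow, hS.zpow_mul_mem_fracPow,
        hS.zpow_mul_mem_fracPow]
      exact hS.fracPow_anti (by omega) (J'.integralAt hS j _ hz _ hw)
    · exact hS.fracPow_anti (by omega) (J'.integralAt hS j _ hx' _ hy')
  rw [h0]
  by_cases hi : i ∈ J'.supp
  · rw [← Finset.add_sum_erase _ _ hi, add_sub_cancel_left]
    exact AddSubgroup.sum_mem _ fun j hj => h1 j (Finset.ne_of_mem_erase hj)
  · rw [J'.proj_eq_zero hi x, map_zero, LinearMap.zero_apply, sub_zero]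
    exact AddSubgroup.sum_mem _ fun j hj => h1 j fun h => hi (h ▸ hj)

lemma exists_gram_eq [FiniteDimensional F V] (hS : LatSetting c σ ϖ τ q₀)
    (J' : JordanSplitting B ϖ L) {i : ℤ} {ι : Type*} (a : ι → ResSpace (inter L (J.comp i))) :
    ∃ a' : ι → ResSpace (inter L (J'.comp i)), gram (J'.resB hS i) a' = gram (J.resB hS i) a := by
  choose v hv using fun s => resMk_surjective _ (a s)
  refine ⟨fun s => resMk _ ⟨_, J'.proj_mem_inter (i := i) (v s).2.1⟩, ?_⟩
  ext s t
  rw [gram_apply, gram_apply, ← hv, ← hv, resB_resMk, resB_resMk]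
  exact (hS.toResidue_congr (J.integralAt hS i _ (v s).2 _ (v t).2)
    (J.form_proj_congr hS J' (v s).2 (v t).2)).symm

/-- The types of the components do not depend on the Jordan splitting. -/
lemma hT_congr [FiniteDimensional F V] (hS : LatSetting c σ ϖ τ q₀) (hL : L.FG)
    (J' : JordanSplitting B ϖ L) {i : ℤ} {d : ℕ} {χ : c.Sign} (h : HT c (J.resB hS i) d χ) :
    HT c (J'.resB hS i) d χ := by
  have := J.finite_inter hL i
  have := J'.finite_inter hL i
  -- A basis is carried to a family with the same invertible Gram matrix, which is therefore
  -- independent; by symmetry the dimensions agree.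
  have hle : ∀ J J' : JordanSplitting B ϖ L, finrank 𝓀[F] (ResSpace (inter L (J.comp i))) ≤
      finrank 𝓀[F] (ResSpace (inter L (J'.comp i))) := by
    intro J J'
    have := J.finite_inter hL i
    have := J'.finite_inter hL i
    let v := finBasis 𝓀[F] (ResSpace (inter L (J.comp i)))
    obtain ⟨a', ha'⟩ := J.exists_gram_eq hS J' v
    have h1 := gram_det_ne_zero (J.nondeg_resB hS i) v
    rw [← ha'] at h1
    simpa using (linearIndependent_of_gram h1).fintype_card_le_finrank
  obtain ⟨a, h1, h2, h3⟩ := h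
  obtain ⟨a', ha'⟩ := J.exists_gram_eq hS J' a
  refine ⟨a', ha' ▸ h1, ?_, ha' ▸ h3⟩
  rw [← h2]
  exact le_antisymm (hle J' J) (hle J J')

end JordanSplitting

/-- The type can be read off from one Jordan splitting. -/
lemma JordanSplitting.hasTyp_iff [FiniteDimensional F V] {L : Submodule 𝒪[F] V}
    (J : JordanSplitting B ϖ L) (hS : LatSetting c σ ϖ τ q₀)
    (hL : L.FG) {e : ℤ → ℕ} {χ : ℤ → c.Sign} :
    HasTyp c B ϖ L e χ ↔ ∀ i, HT c (J.resB hS i) (e i) (χ i) := by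
  have key : ∀ (J : JordanSplitting B ϖ L) (i : ℤ),
      IsTyp c (resForm B ϖ i (inter L (J.comp i))) (e i) (χ i) ↔
      HT c (J.resB hS i) (e i) (χ i) := by
    intro J i
    have := J.finite_inter hL i
    rw [← isTyp_iff_HT]
    rfl
  constructor
  · exact fun h i => (key J i).1 (h.2 J i)
  · exact fun h => ⟨⟨J⟩, fun J' i => (key J' i).2 (J.hT_congr hS hL J' (h i))⟩

lemma HasTyp.unique [FiniteDimensional F V] [Finite 𝓀[F]] {L : Submodule 𝒪[F] V}
    (hS : LatSetting c σ ϖ τ q₀) (hL : L.FG)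
    {e e' : ℤ → ℕ} {χ χ' : ℤ → c.Sign} (h : HasTyp c B ϖ L e χ) (h' : HasTyp c B ϖ L e' χ') :
    e = e' ∧ χ = χ' := by
  obtain ⟨J⟩ := h.1
  have h1 := (J.hasTyp_iff hS hL).1 h
  have h2 := (J.hasTyp_iff hS hL).1 h'
  have h3 := fun i => by
    have := J.finite_inter hL i
    exact (h1 i).unique hS.isResSetting (h2 i)
  exact ⟨funext fun i => (h3 i).1, funext fun i => (h3 i).2⟩

lemma JordanSplitting.exists_hasTyp [FiniteDimensional F V] [Finite 𝓀[F]] {L : Submodule 𝒪[F] V}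
    (J : JordanSplitting B ϖ L) (hS : LatSetting c σ ϖ τ q₀) (hB : c.IsForm B)
    (hL : L.FG) : ∃ (e : ℤ → ℕ) (χ : ℤ → c.Sign), HasTyp c B ϖ L e χ := by
  have key : ∀ i, ∃ d χ, HT c (J.resB hS i) d χ := fun i => by
    have := J.finite_inter hL i
    exact (J.nondeg_resB hS i).exists_HT hS.isResSetting (J.isResForm_resB hS hB i)
  choose e χ h using key
  exact ⟨e, χ, (J.hasTyp_iff hS hL).2 h⟩

end JordanBasics

/-! ### Graded families of vectors and their orthogonalization -/

section Graded

open Module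

lemma det_ne_zero_of_toSquareBlock {k ι : Type*} [Field k] [Fintype ι] [DecidableEq ι]
    (M : Matrix ι ι k) (lam : ι → ℤ) (h : ∀ u t, lam u < lam t → M u t = 0)
    (hd : ∀ j, (M.toSquareBlock lam j).det ≠ 0) : M.det ≠ 0 := by
  have h1 : M.transpose.BlockTriangular lam := fun i j hij => h j i hij
  rw [← Matrix.det_transpose, h1.det, Finset.prod_ne_zero_iff]
  intro j _
  have h2 : M.transpose.toSquareBlock lam j = (M.toSquareBlock lam j).transpose := rfl
  rw [h2, Matrix.det_transpose]
  exact hd j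

variable {F₀ F : Type*} [Field F₀] [Field F] [ValuativeRel F] [Algebra F₀ F]
  {σ : F ≃ₐ[F₀] F} {V : Type*} [AddCommGroup V] [Module F V]
  {c : FormCase} {ϖ : F} {τ : 𝓀[F] →+* 𝓀[F]} {q₀ : ℕ} {B : Form σ V}
  {ι : Type*} [Fintype ι] [DecidableEq ι]

lemma isUnit_det_of_residue {M : Matrix ι ι 𝒪[F]}
    (h : (M.map (IsLocalRing.residue 𝒪[F])).det ≠ 0) : IsUnit M.det := by
  have h1 := RingHom.map_det (IsLocalRing.residue 𝒪[F]) M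
  rw [RingHom.mapMatrix_apply] at h1
  rw [← h1] at h
  exact (IsLocalRing.residue_ne_zero_iff_isUnit _).1 h

lemma LatSetting.maximalIdeal_smul (hS : LatSetting c σ ϖ τ q₀) (N : Submodule 𝒪[F] V) :
    𝓂[F] • N = ϖ • N := by
  obtain ⟨p, rfl, hm⟩ := hS.maximalIdeal_eq
  rw [hm, Submodule.ideal_span_singleton_smul]
  rfl

lemma LatSetting.le_of_le_sup (hS : LatSetting c σ ϖ τ q₀) {N N' : Submodule 𝒪[F] V}
    (hN : N'.FG) (h : N' ≤ N ⊔ ϖ • N') : N' ≤ N :=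
  Submodule.le_of_le_smul_of_le_jacobson_bot (I := 𝓂[F]) hN
    (IsLocalRing.maximalIdeal_le_jacobson _) (by rwa [hS.maximalIdeal_smul])

/-- The residues of `ϖ^(-lam u) ⟨v u, v t⟩`. -/
def redGram (B : Form σ V) (ϖ : F) (lam : ι → ℤ) (v : ι → V) : Matrix ι ι 𝓀[F] :=
  Matrix.of fun u t => toResidue (ϖ ^ (-lam u) * B (v u) (v t))

/-- Families of vectors with levels, such that the Gram matrix is divisible by `ϖ^lam` and
invertible modulo `ϖ` at each level. -/
structure IsGraded (B : Form σ V) (ϖ : F) (lam : ι → ℤ) (v : ι → V) : Prop where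
  mem : ∀ s t, B (v s) (v t) ∈ fracPow ϖ (max (lam s) (lam t))
  det : ∀ j, ((redGram B ϖ lam v).toSquareBlock lam j).det ≠ 0

/-- The family is orthogonal for different levels. -/
def IsLevelOrthogonal (B : Form σ V) (lam : ι → ℤ) (v : ι → V) : Prop :=
  ∀ s t, lam s ≠ lam t → B (v s) (v t) = 0

namespace IsGraded

variable {lam : ι → ℤ} {v : ι → V}

/-- Row `u` of the Gram matrix is divisible by `ϖ^(lam u)`. After division the residue vanishes at
`(u, t)` when `lam u < lam t`, so it is block triangular with invertible diagonal blocks. Thus `G`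
is invertible over the integers, which gives independence and makes the linear systems below
solvable. -/
lemma exists_matrix (hS : LatSetting c σ ϖ τ q₀) (h : IsGraded B ϖ lam v) :
    ∃ G : Matrix ι ι 𝒪[F], (∀ u t, (G u t : F) = ϖ ^ (-lam u) * B (v u) (v t)) ∧
      ∀ u t, IsLocalRing.residue 𝒪[F] (G u t) = redGram B ϖ lam v u t := by
  refine ⟨Matrix.of fun u t => ⟨ϖ ^ (-lam u) * B (v u) (v t),
    hS.fracPow_anti (le_max_left _ _) (h.mem u t)⟩, fun u t => rfl, fun u t => ?_⟩
  rw [← toResidue_coe]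
  rfl

lemma redGram_eq_zero (hS : LatSetting c σ ϖ τ q₀) (h : IsGraded B ϖ lam v) {u t : ι}
    (hut : lam u < lam t) : redGram B ϖ lam v u t = 0 :=
  (hS.toResidue_zpow_mul_eq_zero (hS.fracPow_anti (le_max_left _ _) (h.mem u t))).2
    (hS.fracPow_anti (by rw [max_eq_right hut.le]; omega) (h.mem u t))

lemma isUnit_det (hS : LatSetting c σ ϖ τ q₀) (h : IsGraded B ϖ lam v) {G : Matrix ι ι 𝒪[F]}
    (hG : ∀ u t, IsLocalRing.residue 𝒪[F] (G u t) = redGram B ϖ lam v u t) : IsUnit G.det := by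
  apply isUnit_det_of_residue
  have : G.map (IsLocalRing.residue 𝒪[F]) = redGram B ϖ lam v := Matrix.ext hG
  rw [this]
  exact det_ne_zero_of_toSquareBlock _ lam (fun u t => h.redGram_eq_zero hS) h.det

lemma linearIndependent (hS : LatSetting c σ ϖ τ q₀) (h : IsGraded B ϖ lam v) :
    LinearIndependent F v := by
  obtain ⟨G, hG, hG'⟩ := h.exists_matrix hS
  have hu := h.isUnit_det hS hG'
  rw [Fintype.linearIndependent_iff]
  intro g hg
  have hu' : (G.map (algebraMap 𝒪[F] F)).det ≠ 0 := by
    have := RingHom.map_det (algebraMap 𝒪[F] F) G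
    rw [RingHom.mapMatrix_apply] at this
    rw [← this]
    exact (hu.map (algebraMap 𝒪[F] F)).ne_zero
  have h1 : (G.map (algebraMap 𝒪[F] F)).mulVec (fun t => σ (g t)) = 0 := by
    ext u
    have h2 := congrArg (fun x => ϖ ^ (-lam u) * B (v u) x) hg
    simp only [map_sum, form_smul_right, map_zero, mul_zero] at h2
    rw [Pi.zero_apply, ← h2, Finset.mul_sum, Matrix.mulVec, dotProduct]
    refine Finset.sum_congr rfl fun t _ => ?_
    have h3 : (G.map (algebraMap 𝒪[F] F)) u t = ϖ ^ (-lam u) * B (v u) (v t) := hG u t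
    rw [h3]
    ring
  have h2 := Matrix.eq_zero_of_mulVec_eq_zero hu' h1
  intro t
  simpa using congrFun h2 t

/-- The coefficients of the correction making `v s` orthogonal to lower levels. -/
lemma exists_lower (hS : LatSetting c σ ϖ τ q₀) (h : IsGraded B ϖ lam v) (s : ι) :
    ∃ d : ι → 𝒪[F], (∀ t, lam s ≤ lam t → d t = 0) ∧ ∀ u, lam u < lam s →
      B (v s) (v u) = ∑ t, (d t : F) * ϖ ^ (lam s - lam t) * B (v t) (v u) := by
  classical
  obtain ⟨G, hG, hG'⟩ := h.exists_matrix hS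
  -- The system involves only the levels below that of `s`. Filling `M` with the identity elsewhere
  -- keeps it indexed by `ι`; its residue is again block triangular with invertible blocks, and the
  -- solution vanishes at the levels from `lam s` on.
  let M : Matrix ι ι 𝒪[F] := Matrix.of fun u t =>
    if lam u < lam s then if lam t < lam s then G u t else 0 else if u = t then 1 else 0
  have hM : IsUnit M.det := by
    apply isUnit_det_of_residue
    refine det_ne_zero_of_toSquareBlock _ lam (fun u t hut => ?_) fun j => ?_
    · have hne : u ≠ t := fun h => by rw [h] at hut; exact lt_irrefl _ hut
      simp only [M, Matrix.map_apply, Matrix.of_apply, if_neg hne]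
      split_ifs
      · rw [hG', h.redGram_eq_zero hS hut]
      all_goals simp
    · by_cases hj : j < lam s
      · have : (M.map (IsLocalRing.residue 𝒪[F])).toSquareBlock lam j =
            (redGram B ϖ lam v).toSquareBlock lam j := by
          ext u t
          obtain ⟨u, rfl⟩ := u
          obtain ⟨t, ht⟩ := t
          simp only [M, Matrix.toSquareBlock_def, Matrix.of_apply, Matrix.map_apply, hj, ht,
            if_true, hG']
        rw [this]
        exact h.det j
      · have : (M.map (IsLocalRing.residue 𝒪[F])).toSquareBlock lam j = 1 := by
          ext u t
          obtain ⟨u, rfl⟩ := u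
          obtain ⟨t, ht⟩ := t
          simp only [M, Matrix.toSquareBlock_def, Matrix.of_apply, Matrix.map_apply, hj, if_false,
            Matrix.one_apply, Subtype.mk.injEq]
          split_ifs <;> simp
        rw [this, Matrix.det_one]
        exact one_ne_zero
  have hr : ∀ u, ∃ r : 𝒪[F], (lam u < lam s → (r : F) = ϖ ^ (-lam s) * B (v s) (v u)) ∧
      (¬ lam u < lam s → r = 0) := by
    intro u
    by_cases hu : lam u < lam s
    · exact ⟨⟨_, hS.fracPow_anti (le_max_left _ _) (h.mem s u)⟩, fun _ => rfl, fun h => absurd hu h⟩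
    · exact ⟨0, fun h => absurd h hu, fun _ => rfl⟩
  choose r hr1 hr2 using hr
  have hd : Matrix.vecMul (Matrix.vecMul r M⁻¹) M = r := by
    rw [Matrix.vecMul_vecMul, Matrix.nonsing_inv_mul _ hM, Matrix.vecMul_one]
  generalize Matrix.vecMul r M⁻¹ = d at hd
  have hd0 : ∀ t, lam s ≤ lam t → d t = 0 := by
    intro t ht
    have h1 := congrFun hd t
    rw [hr2 t (not_lt.2 ht), Matrix.vecMul, dotProduct, Finset.sum_eq_single t] at h1
    · simpa [M, not_lt.2 ht] using h1
    · intro u _ hu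
      simp [M, not_lt.2 ht, hu]
    · simp
  refine ⟨d, hd0, fun u hu => ?_⟩
  have h1 := congrArg (fun x : 𝒪[F] => ϖ ^ lam s * (x : F)) (congrFun hd u)
  simp only [hr1 u hu] at h1
  rw [← mul_assoc, ← zpow_add₀ hS.ne_zero, add_neg_cancel, zpow_zero, one_mul] at h1
  rw [← h1, Matrix.vecMul, dotProduct, AddSubmonoidClass.coe_finsetSum, Finset.mul_sum]
  refine Finset.sum_congr rfl fun t _ => ?_
  by_cases ht : lam t < lam s
  · have h2 : M t u = G t u := by simp [M, ht, hu]
    rw [Subring.coe_mul, h2, hG, sub_eq_add_neg, zpow_add₀ hS.ne_zero]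
    ring
  · rw [hd0 t (not_lt.1 ht)]
    simp

/-- Orthogonalization: a graded family can be modified to one which is orthogonal for different
levels. -/
lemma exists_orthogonal (hS : LatSetting c σ ϖ τ q₀) (hB : c.IsForm B)
    (h : IsGraded B ϖ lam v) :
    ∃ v' : ι → V, (∀ s, v' s - v s ∈ ϖ • Submodule.span 𝒪[F] (Set.range v)) ∧
      IsLevelOrthogonal B lam v' ∧
      (∀ s t, lam s = lam t → B (v' s) (v' t) - B (v s) (v t) ∈ fracPow ϖ (lam s + 1)) := by
  choose d hd0 hd using h.exists_lower hS
  -- All corrections are made at once: `v s - z s` is orthogonal to the original vectors of lower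
  -- levels, hence to their corrections too, because these involve only still lower vectors.
  let z : ι → V := fun s => ∑ t, ((d s t : F) * ϖ ^ (lam s - lam t)) • v t
  let v' : ι → V := fun s => v s - z s
  have h1 : ∀ s u, lam u < lam s → B (v' s) (v u) = 0 := by
    intro s u hu
    simp only [v', z, map_sub, map_sum, LinearMap.sub_apply, LinearMap.sum_apply,
      form_smul_left, hd s u hu, sub_self]
  have hz : ∀ s x, (∀ u, lam u < lam s → B x (v u) = 0) → B x (z s) = 0 := by
    intro s x hx
    simp only [z, map_sum, form_smul_right]
    refine Finset.sum_eq_zero fun t _ => ?_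
    by_cases ht : lam t < lam s
    · rw [hx t ht, mul_zero]
    · rw [hd0 s t (not_lt.1 ht)]
      simp
  have h2 : ∀ s t, lam t < lam s → B (v' s) (v' t) = 0 := by
    intro s t hst
    change B (v' s) (v t - z t) = 0
    rw [map_sub, h1 s t hst, hz t _ fun u hu => h1 s u (hu.trans hst), sub_zero]
  refine ⟨v', fun s => ?_, fun s t hst => ?_, fun s t hst => ?_⟩
  · change v s - z s - v s ∈ _
    rw [sub_sub_cancel_left]
    refine neg_mem (sum_mem fun t _ => ?_)
    by_cases ht : lam t < lam s
    · have h3 : ϖ ^ (lam s - lam t - 1) ∈ 𝒪[F] :=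
        mem_fracPow_zero.1 (hS.zpow_mem_fracPow (by omega))
      have h4 : ((d s t : F) * ϖ ^ (lam s - lam t)) • v t =
          ϖ • ((d s t * ⟨_, h3⟩ : 𝒪[F]) • v t) := by
        change _ = ϖ • ((d s t * ⟨_, h3⟩ : 𝒪[F]) : F) • v t
        rw [smul_smul]
        congr 1
        have h5 : ϖ ^ (lam s - lam t) = ϖ * ϖ ^ (lam s - lam t - 1) := by
          rw [← zpow_one_add₀ hS.ne_zero, add_sub_cancel]
        rw [Subring.coe_mul, h5]
        ring
      rw [h4]
      exact Submodule.smul_mem_pointwise_smul _ _ _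
        (Submodule.smul_mem _ _ (Submodule.subset_span ⟨t, rfl⟩))
    · rw [hd0 s t (not_lt.1 ht)]
      simp
  · rcases lt_or_gt_of_ne hst with hst | hst
    · rcases hS.form_swap hB (v' t) (v' s) with h3 | h3 <;> rw [h3, h2 t s hst] <;> simp
    · exact h2 s t hst
  · have h3 : B (v' s) (v' t) = B (v' s) (v t) := by
      change B (v' s) (v t - z t) = _
      rw [map_sub, hz t _ fun u hu => h1 s u (hst ▸ hu), sub_zero]
    rw [h3]
    have h4 : B (v' s) (v t) - B (v s) (v t) = -B (z s) (v t) := by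
      simp only [v', map_sub, LinearMap.sub_apply]
      ring
    rw [h4]
    refine (fracPow ϖ _).neg_mem ?_
    simp only [z, map_sum, LinearMap.sum_apply, form_smul_left]
    refine AddSubgroup.sum_mem _ fun u _ => ?_
    by_cases hu : lam u < lam s
    · rw [mul_assoc]
      refine hS.mul_mem_fracPow_of_mem (d s u).2 (hS.zpow_mul_mem_fracPow.2 ?_)
      -- Divisibility of `⟨v u, v t⟩` by `ϖ^(lam u + 1)` is required. The exponent `max (lam u) (lam
      -- t)` is `lam s`, which is larger than `lam u`.
      refine hS.fracPow_anti ?_ (h.mem u t)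
      rw [← hst, max_eq_right hu.le]
      omega
    · rw [hd0 s u (not_lt.1 hu)]
      simp

lemma of_congr (hS : LatSetting c σ ϖ τ q₀) (h : IsGraded B ϖ lam v) {v' : ι → V}
    (h0 : IsLevelOrthogonal B lam v')
    (h1 : ∀ s t, lam s = lam t → B (v' s) (v' t) - B (v s) (v t) ∈ fracPow ϖ (lam s + 1)) :
    IsGraded B ϖ lam v' ∧ ∀ s t, lam s = lam t →
      redGram B ϖ lam v' s t = redGram B ϖ lam v s t := by
  have hm : ∀ s t, lam s = lam t → B (v' s) (v' t) ∈ fracPow ϖ (lam s) := by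
    intro s t hst
    have h2 := (fracPow ϖ (lam s)).add_mem (hS.fracPow_anti (by omega) (h1 s t hst))
      (hS.fracPow_anti (le_max_left _ _) (h.mem s t))
    rwa [sub_add_cancel] at h2
  have key : ∀ s t, lam s = lam t → redGram B ϖ lam v' s t = redGram B ϖ lam v s t :=
    fun s t hst => hS.toResidue_congr (hm s t hst) (h1 s t hst)
  refine ⟨⟨fun s t => ?_, fun j => ?_⟩, key⟩
  · by_cases hst : lam s = lam t
    · rw [← hst, max_self]
      exact hm s t hst
    · rw [h0 s t hst]
      exact zero_mem _
  · have : (redGram B ϖ lam v').toSquareBlock lam j = (redGram B ϖ lam v).toSquareBlock lam j :=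
      Matrix.ext fun u t => key _ _ (u.2.trans t.2.symm)
    rw [this]
    exact h.det j

/-- By Nakayama's lemma, as the two families agree modulo `ϖ` times the span. -/
lemma span_eq {κ : Type*} [Finite κ] (hS : LatSetting c σ ϖ τ q₀) {v v' : κ → V}
    (h : ∀ s, v' s - v s ∈ ϖ • Submodule.span 𝒪[F] (Set.range v)) :
    Submodule.span 𝒪[F] (Set.range v') = Submodule.span 𝒪[F] (Set.range v) := by
  have hle : ϖ • Submodule.span 𝒪[F] (Set.range v) ≤ Submodule.span 𝒪[F] (Set.range v) := by
    rw [← hS.maximalIdeal_smul]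
    exact Submodule.smul_le_right
  apply le_antisymm
  · rw [Submodule.span_le]
    rintro _ ⟨s, rfl⟩
    have h1 := add_mem (hle (h s)) (Submodule.subset_span ⟨s, rfl⟩)
    rwa [sub_add_cancel] at h1
  · refine hS.le_of_le_sup (Submodule.fg_span (Set.finite_range v)) ?_
    refine Submodule.span_le.2 ?_
    rintro _ ⟨s, rfl⟩
    have h2 : v' s ∈ Submodule.span 𝒪[F] (Set.range v') ⊔
        ϖ • Submodule.span 𝒪[F] (Set.range v) :=
      Submodule.mem_sup_left (Submodule.subset_span ⟨s, rfl⟩)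
    have h1 := sub_mem h2 (Submodule.mem_sup_right (h s))
    rwa [sub_sub_cancel] at h1

section Splitting

/-- The span of the vectors of one level. -/
def levelSpan (lam : ι → ℤ) (v : ι → V) (i : ℤ) : Submodule F V :=
  Submodule.span F (v '' {s | lam s = i})

lemma disjoint_levelSpan (hS : LatSetting c σ ϖ τ q₀) (h : IsGraded B ϖ lam v) (i : ℤ) :
    Disjoint (levelSpan lam v i) (Submodule.span F (v '' {s | lam s ≠ i})) := by
  refine (h.linearIndependent hS).disjoint_span_image ?_
  rw [Set.disjoint_left]
  exact fun s hs hs' => hs' hs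

lemma mem_inter_levelSpan (hS : LatSetting c σ ϖ τ q₀) (h : IsGraded B ϖ lam v) {i : ℤ} {x : V} :
    x ∈ inter (Submodule.span 𝒪[F] (Set.range v)) (levelSpan lam v i) ↔
      ∃ a : {s // lam s = i} → 𝒪[F], x = ∑ s, a s • v s := by
  have hmem : ∀ a : {s // lam s = i} → 𝒪[F],
      ∑ s, a s • v s ∈ inter (Submodule.span 𝒪[F] (Set.range v)) (levelSpan lam v i) := fun a =>
    ⟨sum_mem fun s _ => Submodule.smul_mem _ _ (Submodule.subset_span ⟨s, rfl⟩),
      sum_mem fun s _ => (levelSpan lam v i).smul_mem (a s : F)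
        (Submodule.subset_span ⟨s, s.2, rfl⟩)⟩
  constructor
  · rintro ⟨hx, hx'⟩
    obtain ⟨a, rfl⟩ := (Submodule.mem_span_range_iff_exists_fun 𝒪[F]).1 hx
    refine ⟨fun s => a s, ?_⟩
    have h1 : ∑ s, a s • v s = ∑ s : {s // lam s = i}, a s • v s +
        ∑ s : {s // ¬ lam s = i}, a s • v s :=
      (Fintype.sum_subtype_add_sum_subtype (fun s => lam s = i) fun s => a s • v s).symm
    rw [h1, add_eq_left]
    refine Submodule.disjoint_def.1 (disjoint_levelSpan hS h i) _ ?_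
      (sum_mem fun s _ => Submodule.smul_mem _ (a s : F) (Submodule.subset_span ⟨s, s.2, rfl⟩))
    rw [h1] at hx'
    exact (Submodule.add_mem_iff_right _ (hmem fun s => a s).2).1 hx'
  · rintro ⟨a, rfl⟩
    exact hmem a

/-- At level `i` the Gram matrix is `ϖ^i` times a matrix invertible over the integers. Applying the
inverse to the integral products of a vector of the dual shows that its coordinates lie in `ϖ^(-i)
𝒪`. -/
lemma dualIn_levelSpan (hS : LatSetting c σ ϖ τ q₀) (h : IsGraded B ϖ lam v) (i : ℤ) :
    dualIn B (levelSpan lam v i) (inter (Submodule.span 𝒪[F] (Set.range v)) (levelSpan lam v i)) =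
      ϖ ^ (-i) • inter (Submodule.span 𝒪[F] (Set.range v)) (levelSpan lam v i) := by
  classical
  obtain ⟨G, hG, hG'⟩ := h.exists_matrix hS
  ext x
  rw [JordanSplitting.mem_zpow_smul hS, neg_neg, mem_inter_levelSpan hS h]
  constructor
  · rintro ⟨hx, hx'⟩
    have hmem : ∀ s : {s // lam s = i},
        v s ∈ inter (Submodule.span 𝒪[F] (Set.range v)) (levelSpan lam v i) := fun s =>
      ⟨Submodule.subset_span ⟨s, rfl⟩, Submodule.subset_span ⟨s, s.2, rfl⟩⟩
    have hu : IsUnit (G.toSquareBlock lam i).det := by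
      apply isUnit_det_of_residue
      have : (G.toSquareBlock lam i).map (IsLocalRing.residue 𝒪[F]) =
          (redGram B ϖ lam v).toSquareBlock lam i := Matrix.ext fun s t => hG' s t
      rw [this]
      exact h.det i
    have himg : v '' {s | lam s = i} = Set.range fun s : {s // lam s = i} => v s := by
      rw [Set.image_eq_range]
      rfl
    rw [levelSpan, himg] at hx
    obtain ⟨g, rfl⟩ := (Submodule.mem_span_range_iff_exists_fun F).1 hx
    let r : {s // lam s = i} → 𝒪[F] := fun t => ⟨_, hx' _ (hmem t)⟩
    refine ⟨Matrix.vecMul r (G.toSquareBlock lam i)⁻¹, ?_⟩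
    have hr : ∀ t, (r t : F) = ∑ s : {s // lam s = i}, ϖ ^ i * g s * (G s t : F) := by
      intro t
      simp only [r, map_sum, LinearMap.sum_apply, form_smul_left]
      refine Finset.sum_congr rfl fun s _ => ?_
      rw [hG, s.2, mul_comm (ϖ ^ i), mul_assoc, ← mul_assoc (ϖ ^ i), ← zpow_add₀ hS.ne_zero,
        add_neg_cancel, zpow_zero, one_mul]
    have hr' : (fun t => (r t : F)) = Matrix.vecMul (fun s => ϖ ^ i * g s)
        ((G.toSquareBlock lam i).map (algebraMap 𝒪[F] F)) := by
      ext t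
      exact hr t
    have key : ∀ s, ((Matrix.vecMul r (G.toSquareBlock lam i)⁻¹ s : 𝒪[F]) : F) = ϖ ^ i * g s := by
      intro s
      have h1 : ((Matrix.vecMul r (G.toSquareBlock lam i)⁻¹ s : 𝒪[F]) : F) =
          Matrix.vecMul (fun t => (r t : F))
            ((G.toSquareBlock lam i)⁻¹.map (algebraMap 𝒪[F] F)) s :=
        RingHom.map_vecMul (algebraMap 𝒪[F] F) _ _ _
      rw [h1, hr', Matrix.vecMul_vecMul, ← Matrix.map_mul, Matrix.mul_nonsing_inv _ hu,
        Matrix.map_one _ (map_zero _) (map_one _), Matrix.vecMul_one]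
    rw [Finset.smul_sum]
    refine Finset.sum_congr rfl fun s _ => ?_
    rw [smul_smul, ← key s]
    rfl
  · rintro ⟨a, ha⟩
    have hx : x = ϖ ^ (-i) • ∑ s, a s • v s := by
      rw [← ha, smul_smul, ← zpow_add₀ hS.ne_zero, neg_add_cancel, zpow_zero, one_smul]
    rw [hx]
    refine ⟨Submodule.smul_mem _ _ ((mem_inter_levelSpan hS h).2 ⟨a, rfl⟩).2, fun y hy => ?_⟩
    obtain ⟨b, rfl⟩ := (mem_inter_levelSpan hS h).1 hy
    rw [form_smul_left]
    change _ ∈ fracPow ϖ i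
    rw [map_sum]
    refine AddSubgroup.sum_mem _ fun t _ => ?_
    rw [map_sum, LinearMap.sum_apply]
    refine AddSubgroup.sum_mem _ fun s _ => ?_
    change B ((a s : F) • v s) ((b t : F) • v t) ∈ _
    rw [form_smul_left, form_smul_right]
    refine hS.mul_mem_fracPow_of_mem (a s).2 (hS.mul_mem_fracPow_of_mem (hS.map_mem _ (b t).2) ?_)
    have := h.mem s t
    rwa [s.2, t.2, max_self] at this

/-- The Jordan splitting given by a graded family which is orthogonal for different levels. -/
def splitting (hS : LatSetting c σ ϖ τ q₀) (h : IsGraded B ϖ lam v)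
    (h0 : IsLevelOrthogonal B lam v) (hv : Submodule.span F (Set.range v) = ⊤) :
    JordanSplitting B ϖ (Submodule.span 𝒪[F] (Set.range v)) where
  comp := levelSpan lam v
  isInternal := by
    rw [DirectSum.isInternal_submodule_iff_iSupIndep_and_iSup_eq_top]
    constructor
    · intro i
      refine (disjoint_levelSpan hS h i).mono_right (iSup₂_le fun j hj => Submodule.span_mono ?_)
      exact Set.image_mono fun s (hs : lam s = j) => hs.trans_ne hj
    · rw [eq_top_iff, ← hv, Submodule.span_le]
      rintro _ ⟨s, rfl⟩
      exact Submodule.mem_iSup_of_mem (lam s) (Submodule.subset_span ⟨s, rfl, rfl⟩)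
  orthogonal i j hij x hx y hy := by
    induction hx using Submodule.span_induction with
    | mem x hx =>
      obtain ⟨s, rfl, rfl⟩ := hx
      induction hy using Submodule.span_induction with
      | mem y hy =>
        obtain ⟨t, rfl, rfl⟩ := hy
        exact h0 s t hij
      | zero => simp
      | add y z _ _ hy hz => rw [map_add, hy, hz, add_zero]
      | smul r y _ hy => rw [form_smul_right, hy, mul_zero]
    | zero => simp
    | add x z _ _ hx hz => rw [map_add, LinearMap.add_apply, hx, hz, add_zero]
    | smul r x _ hx => rw [form_smul_left, hx, mul_zero]
  iSup_inter := by
    apply le_antisymm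
    · refine Submodule.span_le.2 ?_
      rintro _ ⟨s, rfl⟩
      exact Submodule.mem_iSup_of_mem (lam s)
        ⟨Submodule.subset_span ⟨s, rfl⟩, Submodule.subset_span ⟨s, rfl, rfl⟩⟩
    · exact iSup_le fun i => inf_le_left
  dual_eq := dualIn_levelSpan hS h

lemma hT_splitting (hS : LatSetting c σ ϖ τ q₀) (h : IsGraded B ϖ lam v)
    (h0 : IsLevelOrthogonal B lam v) (hv : Submodule.span F (Set.range v) = ⊤) (i : ℤ) {d : ℕ}
    (hd : Fintype.card {s // lam s = i} = c.γ * d) :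
    HT c ((h.splitting hS h0 hv).resB hS i) d
      (c.sign ((redGram B ϖ lam v).toSquareBlock lam i).det) := by
  let P := inter (Submodule.span 𝒪[F] (Set.range v)) ((h.splitting hS h0 hv).comp i)
  let w : {s // lam s = i} → P := fun s =>
    ⟨v s, Submodule.subset_span ⟨s, rfl⟩, Submodule.subset_span ⟨s, s.2, rfl⟩⟩
  have hgram : gram ((h.splitting hS h0 hv).resB hS i) (fun s => resMk P (w s)) =
      (redGram B ϖ lam v).toSquareBlock lam i := by
    ext s t
    rw [gram_apply, JordanSplitting.resB_resMk]
    change _ = toResidue (ϖ ^ (-lam s) * B (v s) (v t))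
    rw [s.2]
  have hdet : (gram ((h.splitting hS h0 hv).resB hS i) (fun s => resMk P (w s))).det ≠ 0 := by
    rw [hgram]
    exact h.det i
  rw [← hgram]
  refine HT.mk' _ hdet ?_ hd
  have hspan : ⊤ ≤ Submodule.span 𝓀[F] (Set.range fun s => resMk P (w s)) := by
    intro x _
    obtain ⟨x, rfl⟩ := resMk_surjective P x
    obtain ⟨a, ha⟩ := (mem_inter_levelSpan hS h).1 x.2
    have hx : x = ∑ s, a s • w s := by
      apply Subtype.ext
      rw [ha]
      simp [w]
    rw [hx, map_sum]
    refine sum_mem fun s _ => ?_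
    rw [← residue_smul_resMk]
    exact Submodule.smul_mem _ _ (Submodule.subset_span ⟨s, rfl⟩)
  exact finrank_eq_card_basis (Basis.mk (linearIndependent_of_gram hdet) hspan)

end Splitting

/-- The type of the span of a graded family. -/
lemma hasTyp [FiniteDimensional F V] (hS : LatSetting c σ ϖ τ q₀) (hB : c.IsForm B)
    (h : IsGraded B ϖ lam v) (hv : Submodule.span F (Set.range v) = ⊤) {f : ℤ → ℕ}
    {ψ : ℤ → c.Sign} (hf : ∀ i, Fintype.card {s // lam s = i} = c.γ * f i)
    (hψ : ∀ i, c.sign ((redGram B ϖ lam v).toSquareBlock lam i).det = ψ i) :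
    HasTyp c B ϖ (Submodule.span 𝒪[F] (Set.range v)) f ψ := by
  obtain ⟨v', h1, h2, h3⟩ := h.exists_orthogonal hS hB
  obtain ⟨h4, h5⟩ := h.of_congr hS h2 h3
  have hspan := span_eq hS h1
  have hv' : Submodule.span F (Set.range v') = ⊤ := by
    rw [← Submodule.span_span_of_tower 𝒪[F], hspan, Submodule.span_span_of_tower, hv]
  rw [← hspan, (h4.splitting hS h2 hv').hasTyp_iff hS (Submodule.fg_span (Set.finite_range v'))]
  intro i
  have := h4.hT_splitting hS h2 hv' i (hf i)
  have h6 : (redGram B ϖ lam v').toSquareBlock lam i = (redGram B ϖ lam v).toSquareBlock lam i :=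
    Matrix.ext fun u t => h5 _ _ (u.2.trans t.2.symm)
  rwa [h6, hψ i] at this

end IsGraded

end Graded

/-! ### Types of quotients by the radical -/

section QuotientType

open Module

variable {k X : Type*} [Field k] [AddCommGroup X] [Module k X] {τ : k →+* k}

/-- The form induced on the quotient of a subspace by its radical. -/
lemma exists_quotient_form {c : FormCase} {q₀ : ℕ} (hτ : c.IsResSetting τ q₀)
    {b : X →ₗ[k] X →ₛₗ[τ] k} (hb : c.IsResForm b) {W R : Submodule k X} (hR : R = W ⊓ orth b W) :
    ∃ b' : (W ⧸ R.submoduleOf W) →ₗ[k] (W ⧸ R.submoduleOf W) →ₛₗ[τ] k,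
      (∀ x y, b' x y = b (Quotient.out x : W) (Quotient.out y : W)) ∧
      ∀ x y : W, b' (Submodule.Quotient.mk x) (Submodule.Quotient.mk y) = b x y := by
  have hout : ∀ x : W, ∃ r ∈ R, ((Quotient.out (Submodule.Quotient.mk (p := R.submoduleOf W) x) :
      W) : X) = x + r := by
    intro x
    have h1 := (Submodule.Quotient.eq (R.submoduleOf W)).1
      (Quotient.out_eq (Submodule.Quotient.mk (p := R.submoduleOf W) x))
    exact ⟨_, h1, by simp⟩
  have key : ∀ x y : W, b (Quotient.out (Submodule.Quotient.mk (p := R.submoduleOf W) x) : W)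
      (Quotient.out (Submodule.Quotient.mk (p := R.submoduleOf W) y) : W) = b x y := by
    intro x y
    obtain ⟨r, hr, h1⟩ := hout x
    obtain ⟨r', hr', h2⟩ := hout y
    rw [hR] at hr hr'
    rw [h1, h2, map_add, map_add, LinearMap.add_apply, LinearMap.add_apply, hr.2 _ y.2,
      hr.2 _ hr'.1, FormCase.IsResForm.refl hτ hb (hr'.2 _ x.2)]
    ring
  refine ⟨LinearMap.mk₂'ₛₗ (RingHom.id _) τ
    (fun x y => b (Quotient.out x : W) (Quotient.out y : W)) ?_ ?_ ?_ ?_, fun x y => rfl, key⟩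
  · intro x x' y
    obtain ⟨x, rfl⟩ := Submodule.Quotient.mk_surjective _ x
    obtain ⟨x', rfl⟩ := Submodule.Quotient.mk_surjective _ x'
    obtain ⟨y, rfl⟩ := Submodule.Quotient.mk_surjective _ y
    rw [← Submodule.Quotient.mk_add, key, key, key]
    simp
  · intro a x y
    obtain ⟨x, rfl⟩ := Submodule.Quotient.mk_surjective _ x
    obtain ⟨y, rfl⟩ := Submodule.Quotient.mk_surjective _ y
    rw [← Submodule.Quotient.mk_smul, key, key]
    simp
  · intro x y y'
    obtain ⟨x, rfl⟩ := Submodule.Quotient.mk_surjective _ x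
    obtain ⟨y', rfl⟩ := Submodule.Quotient.mk_surjective _ y'
    obtain ⟨y, rfl⟩ := Submodule.Quotient.mk_surjective _ y
    rw [← Submodule.Quotient.mk_add, key, key, key]
    simp
  · intro a x y
    obtain ⟨x, rfl⟩ := Submodule.Quotient.mk_surjective _ x
    obtain ⟨y, rfl⟩ := Submodule.Quotient.mk_surjective _ y
    rw [← Submodule.Quotient.mk_smul, key, key]
    simp

lemma isTyp_quotient_iff [Module.Finite k X] {c : FormCase} {q₀ : ℕ} (hτ : c.IsResSetting τ q₀)
    {b : X →ₗ[k] X →ₛₗ[τ] k} (hb : c.IsResForm b) {W R : Submodule k X} (hR : R = W ⊓ orth b W)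
    {d : ℕ} {χ : c.Sign} :
    IsTyp c (fun x y : W ⧸ R.submoduleOf W => b (Quotient.out x : W) (Quotient.out y : W)) d χ ↔
      SubTyp c b W d χ := by
  obtain ⟨b', h1, h2⟩ := exists_quotient_form hτ hb hR
  have h3 : (fun x y : W ⧸ R.submoduleOf W => b (Quotient.out x : W) (Quotient.out y : W)) =
      fun x y => b' x y := by
    ext x y
    exact (h1 x y).symm
  have hdim : finrank k (W ⧸ R.submoduleOf W) + finrank k (W ⊓ orth b W : Submodule k X) =
      finrank k W := by
    have h4 := (R.submoduleOf W).finrank_quotient_add_finrank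
    have h5 : R ≤ W := hR ▸ inf_le_left
    have h6 : finrank k R = finrank k (W ⊓ orth b W : Submodule k X) := by rw [hR]
    rwa [(Submodule.submoduleOfEquivOfLe h5).finrank_eq, h6] at h4
  rw [h3, isTyp_iff_HT]
  constructor
  · rintro ⟨a, h4, h5, h6⟩
    have hg : gram b (fun s => ((Quotient.out (a s) : W) : X)) = gram b' a :=
      Matrix.ext fun s t => (h1 _ _).symm
    refine ⟨fun s => ((Quotient.out (a s) : W) : X), fun s => Subtype.property _, hg ▸ h4, ?_,
      hg ▸ h6⟩
    rw [← hdim, h5]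
  · rintro ⟨a, h4, h5, h6, h7⟩
    have hg : gram b' (fun s => Submodule.Quotient.mk (⟨a s, h4 s⟩ : W)) = gram b a :=
      Matrix.ext fun s t => h2 _ _
    exact ⟨fun s => Submodule.Quotient.mk (⟨a s, h4 s⟩ : W), hg ▸ h5, by omega, hg ▸ h7⟩

lemma SubTyp.sign_eq_one {c : FormCase} {b : X →ₗ[k] X →ₛₗ[τ] k} {W : Submodule k X} {d : ℕ}
    {χ : c.Sign} (h : SubTyp c b W d χ) (hd : d = 0) : χ = 1 := by
  subst hd
  obtain ⟨a, -, -, -, rfl⟩ := h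
  rw [mul_zero] at a
  have : IsEmpty (Fin (c.γ * 0)) := by rw [mul_zero]; infer_instance
  rw [Matrix.det_isEmpty, FormCase.sign_one]

end QuotientType

/-! ### The projections `N_i` as subspaces of the residue spaces -/

section ResidueSubspaces

open Module

variable {F₀ F : Type*} [Field F₀] [Field F] [ValuativeRel F] [Algebra F₀ F]
  {σ : F ≃ₐ[F₀] F} {V : Type*} [AddCommGroup V] [Module F V]
  {c : FormCase} {ϖ : F} {τ : 𝓀[F] →+* 𝓀[F]} {q₀ : ℕ} {B : Form σ V}

/-- The image of `N` is already a subspace, so the span in `resSub` adds nothing, and since `N`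
contains `ϖP`, membership does not depend on the representative. -/
lemma resMk_mem_resSub (hS : LatSetting c σ ϖ τ q₀) {P N : Submodule 𝒪[F] V}
    (h : ∀ y ∈ P, ϖ • y ∈ N) {p : P} : resMk P p ∈ resSub P N ↔ (p : V) ∈ N := by
  constructor
  · intro hp
    have key : ∀ x ∈ resSub P N, ∃ p : P, (p : V) ∈ N ∧ resMk P p = x := by
      intro x hx
      induction hx using Submodule.span_induction with
      | mem x hx => exact hx
      | zero => exact ⟨0, N.zero_mem, map_zero _⟩
      | add x y _ _ hx hy =>
        obtain ⟨p, hp, rfl⟩ := hx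
        obtain ⟨p', hp', rfl⟩ := hy
        exact ⟨p + p', N.add_mem hp hp', map_add _ _ _⟩
      | smul r x _ hx =>
        obtain ⟨p, hp, rfl⟩ := hx
        obtain ⟨r, rfl⟩ := IsLocalRing.residue_surjective r
        exact ⟨r • p, N.smul_mem r hp, rfl⟩
    obtain ⟨p', hp', h1⟩ := key _ hp
    obtain ⟨y, hy, h2⟩ := hS.resMk_eq_iff.1 h1.symm
    rw [sub_eq_iff_eq_add] at h2
    rw [h2]
    exact N.add_mem (h y hy) hp'
  · exact fun hp => Submodule.subset_span ⟨p, hp, rfl⟩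

lemma smul_le_of_le (hS : LatSetting c σ ϖ τ q₀) (N : Submodule 𝒪[F] V) : ϖ • N ≤ N := by
  rw [← hS.maximalIdeal_smul]
  exact Submodule.smul_le_right

namespace JordanSplitting

variable {Λ L : Submodule 𝒪[F] V} (J : JordanSplitting B ϖ Λ)

lemma comp_le_compGE (i : ℤ) : J.comp i ≤ J.compGE i :=
  le_iSup₂_of_le (f := fun j (_ : j ≥ i) => J.comp j) i le_rfl le_rfl

lemma smul_mem_N (hL : ϖ • Λ ≤ L) {i : ℤ} {y : V} (hy : y ∈ inter Λ (J.comp i)) :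
    ϖ • y ∈ J.N L i :=
  ⟨ϖ • y, ⟨hL (Submodule.smul_mem_pointwise_smul _ _ _ hy.1),
    J.comp_le_compGE i ((J.comp i).smul_mem _ hy.2)⟩, J.proj_of_mem ((J.comp i).smul_mem _ hy.2)⟩

lemma N_le (hL : L ≤ Λ) (i : ℤ) : J.N L i ≤ inter Λ (J.comp i) := by
  rintro _ ⟨y, hy, rfl⟩
  exact J.proj_mem_inter (hL hy.1)

/-- The image of `N_i` in the residue space of `Λ^(i)`. -/
def resN (L : Submodule 𝒪[F] V) (i : ℤ) : Submodule 𝓀[F] (ResSpace (inter Λ (J.comp i))) :=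
  resSub (inter Λ (J.comp i)) (J.N L i)

lemma mem_perp (hS : LatSetting c σ ϖ τ q₀) {i : ℤ} {N : Submodule 𝒪[F] V} {x : V} :
    x ∈ J.perp i N ↔ x ∈ J.comp i ∧ ∀ y ∈ N, B x y ∈ fracPow ϖ (i + 1) := by
  rw [perp, mem_zpow_smul hS]
  constructor
  · rintro ⟨h1, h2⟩
    refine ⟨?_, fun y hy => ?_⟩
    · rwa [Submodule.smul_mem_iff _ (zpow_ne_zero _ hS.ne_zero)] at h1
    · have := h2 y hy
      rwa [form_smul_left] at this
  · rintro ⟨h1, h2⟩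
    exact ⟨(J.comp i).smul_mem _ h1, fun y hy => by rw [form_smul_left]; exact h2 y hy⟩

lemma smul_mem_perp (hS : LatSetting c σ ϖ τ q₀) (hL : L ≤ Λ) {i : ℤ} {y : V}
    (hy : y ∈ inter Λ (J.comp i)) : ϖ • y ∈ J.perp i (J.N L i) := by
  rw [J.mem_perp hS]
  refine ⟨(J.comp i).smul_mem _ hy.2, fun z hz => ?_⟩
  have h1 := (hS.zpow_mul_mem_fracPow (i := i + 1) (j := 1) (x := B y z)).2 (by
    rw [add_sub_cancel_right]
    exact J.integralAt hS i _ hy _ (J.N_le hL i hz))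
  rwa [zpow_one, ← form_smul_left] at h1

/-- Both conditions say that products with `N_i` are divisible by `ϖ^(i+1)`, that is, that the
residue form vanishes. -/
lemma resSub_perp (hS : LatSetting c σ ϖ τ q₀) (hL : L ≤ Λ) (hL' : ϖ • Λ ≤ L) (i : ℤ) :
    resSub (inter Λ (J.comp i)) (J.perp i (J.N L i)) = orth (J.resB hS i) (J.resN L i) := by
  ext x
  obtain ⟨x, rfl⟩ := resMk_surjective _ x
  rw [resMk_mem_resSub hS fun y hy => J.smul_mem_perp hS hL hy, J.mem_perp hS]
  constructor
  · rintro ⟨-, h⟩ y hy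
    obtain ⟨y, rfl⟩ := resMk_surjective _ y
    rw [resN, resMk_mem_resSub hS fun y hy => J.smul_mem_N hL' hy] at hy
    rw [resB_resMk, hS.toResidue_zpow_mul_eq_zero (J.integralAt hS i _ x.2 _ y.2)]
    exact h y hy
  · intro h
    refine ⟨x.2.2, fun y hy => ?_⟩
    have hy' := J.N_le hL i hy
    rw [← hS.toResidue_zpow_mul_eq_zero (J.integralAt hS i _ x.2 _ hy'),
      ← J.resB_resMk hS i x ⟨y, hy'⟩]
    exact h _ ((resMk_mem_resSub hS fun y hy => J.smul_mem_N hL' hy).2 hy)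

lemma resSub_rad (hS : LatSetting c σ ϖ τ q₀) (hL : L ≤ Λ) (hL' : ϖ • Λ ≤ L) (i : ℤ) :
    resSub (inter Λ (J.comp i)) (J.rad i (J.N L i)) =
      J.resN L i ⊓ orth (J.resB hS i) (J.resN L i) := by
  rw [← J.resSub_perp hS hL hL']
  ext x
  obtain ⟨x, rfl⟩ := resMk_surjective _ x
  rw [Submodule.mem_inf, resN, resMk_mem_resSub hS fun y hy => J.smul_mem_perp hS hL hy,
    resMk_mem_resSub hS fun y hy => J.smul_mem_N hL' hy]
  exact resMk_mem_resSub hS fun y hy =>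
      Submodule.mem_inf.2 ⟨J.smul_mem_N hL' hy, J.smul_mem_perp hS hL hy⟩

/-- The data in terms of the residue subspaces. -/
lemma isDataOf_iff [Finite 𝓀[F]] (hS : LatSetting c σ ϖ τ q₀) (hB : c.IsForm B) (hΛ : Λ.FG)
    (hL : L ≤ Λ) (hL' : ϖ • Λ ≤ L) {d : TypData c} :
    IsDataOf J (J.N L) d ↔ ∀ i,
      finrank 𝓀[F] (J.resN L i ⊓ orth (J.resB hS i) (J.resN L i) : Submodule 𝓀[F] _) = d.m i ∧
      SubTyp c (J.resB hS i) (J.resN L i) (d.n i) (d.ψ₁ i) ∧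
      SubTyp c (J.resB hS i) (orth (J.resB hS i) (J.resN L i)) (d.l i) (d.ψ₂ i) := by
  refine forall_congr' fun i => ?_
  have := J.finite_inter hΛ i
  have hτ := hS.isResSetting
  have hb := J.isResForm_resB hS hB i
  have hn := J.nondeg_resB hS i
  have h1 := J.resSub_rad hS hL hL' i
  have h2 : resSub (inter Λ (J.comp i)) (J.rad i (J.N L i)) =
      resSub (inter Λ (J.comp i)) (J.perp i (J.N L i)) ⊓
        orth (J.resB hS i) (resSub (inter Λ (J.comp i)) (J.perp i (J.N L i))) := by
    rw [J.resSub_perp hS hL hL' i, hn.orth_orth hτ hb, inf_comm, h1]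
  have h3 := isTyp_quotient_iff hτ hb h1 (d := d.n i) (χ := d.ψ₁ i)
  have h4 := isTyp_quotient_iff hτ hb h2 (d := d.l i) (χ := d.ψ₂ i)
  rw [← J.resSub_perp hS hL hL' i]
  refine and_congr ?_ (and_congr h3 h4)
  rw [h1, J.resSub_perp hS hL hL' i, eq_comm]

lemma exists_isDataOf [Finite 𝓀[F]] (hS : LatSetting c σ ϖ τ q₀) (hB : c.IsForm B) (hΛ : Λ.FG)
    (hL : L ≤ Λ) (hL' : ϖ • Λ ≤ L) : ∃ d : TypData c, IsDataOf J (J.N L) d := by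
  have key : ∀ i, ∃ n ψ₁ l ψ₂, SubTyp c (J.resB hS i) (J.resN L i) n ψ₁ ∧
      SubTyp c (J.resB hS i) (orth (J.resB hS i) (J.resN L i)) l ψ₂ := by
    intro i
    have := J.finite_inter hΛ i
    obtain ⟨n, ψ₁, h1⟩ := exists_subTyp hS.isResSetting (J.isResForm_resB hS hB i) (J.resN L i)
    obtain ⟨l, ψ₂, h2⟩ := exists_subTyp hS.isResSetting (J.isResForm_resB hS hB i)
      (orth (J.resB hS i) (J.resN L i))
    exact ⟨n, ψ₁, l, ψ₂, h1, h2⟩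
  choose n ψ₁ l ψ₂ h using key
  exact ⟨⟨n, _, l, ψ₁, ψ₂⟩, (J.isDataOf_iff hS hB hΛ hL hL').2 fun i => ⟨rfl, h i⟩⟩

lemma isDataOf_isNormalized [Finite 𝓀[F]] (hS : LatSetting c σ ϖ τ q₀) (hB : c.IsForm B)
    (hΛ : Λ.FG) (hL : L ≤ Λ) (hL' : ϖ • Λ ≤ L) {d : TypData c} (h : IsDataOf J (J.N L) d) :
    d.IsNormalized := fun i =>
  ⟨((J.isDataOf_iff hS hB hΛ hL hL').1 h i).2.1.sign_eq_one,
    ((J.isDataOf_iff hS hB hΛ hL hL').1 h i).2.2.sign_eq_one⟩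

lemma isDataOf_unique [Finite 𝓀[F]] (hS : LatSetting c σ ϖ τ q₀) (hB : c.IsForm B)
    (hΛ : Λ.FG) (hL : L ≤ Λ) (hL' : ϖ • Λ ≤ L) {d d' : TypData c} (h : IsDataOf J (J.N L) d)
    (h' : IsDataOf J (J.N L) d') : d = d' := by
  rw [J.isDataOf_iff hS hB hΛ hL hL'] at h h'
  have key : ∀ i, d.n i = d'.n i ∧ d.ψ₁ i = d'.ψ₁ i ∧ d.l i = d'.l i ∧ d.ψ₂ i = d'.ψ₂ i := by
    intro i
    have := J.finite_inter hΛ i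
    obtain ⟨h1, h2⟩ := (h i).2.1.unique hS.isResSetting (J.isResForm_resB hS hB i) (h' i).2.1
    obtain ⟨h3, h4⟩ := (h i).2.2.unique hS.isResSetting (J.isResForm_resB hS hB i) (h' i).2.2
    exact ⟨h1, h2, h3, h4⟩
  have hm : d.m = d'.m := funext fun i => (h i).1.symm.trans (h' i).1
  have hn : d.n = d'.n := funext fun i => (key i).1
  have hl : d.l = d'.l := funext fun i => (key i).2.2.1
  have h1 : d.ψ₁ = d'.ψ₁ := funext fun i => (key i).2.1
  have h2 : d.ψ₂ = d'.ψ₂ := funext fun i => (key i).2.2.2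
  cases d
  cases d'
  simp_all

end JordanSplitting

end ResidueSubspaces

/-! ### Lifted bases of `Λ` and the type of the sublattice `L` -/

section TypeOfSublattice

open Module

variable {F₀ F : Type*} [Field F₀] [Field F] [ValuativeRel F] [Algebra F₀ F]
  {σ : F ≃ₐ[F₀] F} {V : Type*} [AddCommGroup V] [Module F V]
  {c : FormCase} {ϖ : F} {τ : 𝓀[F] →+* 𝓀[F]} {q₀ : ℕ} {B : Form σ V}

namespace JordanSplitting

variable {Λ L : Submodule 𝒪[F] V} (J : JordanSplitting B ϖ Λ) [FiniteDimensional F V]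

lemma form_eq_sum (x y : V) : B x y = ∑ k ∈ J.supp, B (J.proj k x) (J.proj k y) := by
  conv_lhs => rw [← J.sum_proj x, map_sum, LinearMap.sum_apply]
  exact Finset.sum_congr rfl fun j _ => J.form_eq_proj_right (J.proj_mem j x) y

lemma form_mem_of_compGE (hS : LatSetting c σ ϖ τ q₀) {j : ℤ} {x y : V} (hx : x ∈ Λ) (hy : y ∈ Λ)
    (hy' : y ∈ J.compGE j) : B x y ∈ fracPow ϖ j := by
  rw [J.form_eq_sum]
  refine AddSubgroup.sum_mem _ fun k _ => ?_
  rcases lt_or_ge k j with hk | hk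
  · rw [J.mem_compGE.1 hy' k hk, map_zero]
    exact zero_mem _
  · exact hS.fracPow_anti hk (J.integralAt hS k _ (J.proj_mem_inter hx) _ (J.proj_mem_inter hy))

/-- For `y` in `V^(≥ i)` the components other than the `i`-th contribute only multiples of
`ϖ^(i+1)`. So vectors of `L ∩ V^(≥ i)` have the same residue products as their projections to
`V^(i)`, which need not lie in `L`. -/
lemma form_sub_proj_mem (hS : LatSetting c σ ϖ τ q₀) {i : ℤ} {x y : V} (hx : x ∈ Λ) (hy : y ∈ Λ)
    (hy' : y ∈ J.compGE i) : B x y - B (J.proj i x) (J.proj i y) ∈ fracPow ϖ (i + 1) := by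
  have h1 : B x y - B (J.proj i x) (J.proj i y) = B x (y - J.proj i y) := by
    rw [map_sub, ← J.form_eq_proj_left (J.proj_mem i y)]
  rw [h1]
  refine J.form_mem_of_compGE hS hx (sub_mem hy (J.proj_mem_inter hy).1) ?_
  rw [J.mem_compGE]
  intro j hj
  rw [map_sub]
  rcases (Int.lt_add_one_iff.1 hj).lt_or_eq with hj | rfl
  · rw [J.mem_compGE.1 hy' j hj, J.proj_of_mem_ne hj.ne' (J.proj_mem i y), sub_zero]
  · rw [J.proj_of_mem (J.proj_mem j y), sub_self]

/-- Climbing the filtration: an element of `L ∩ V^(≥ i)` is corrected by the given vectors and by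
`ϖΛ^(i)`, so that its `i`-th projection vanishes and it falls into `V^(≥ i + 1)`. This ends after
the last nonzero component. -/
lemma le_span_sup (hL : ϖ • Λ ≤ L) {κ : ℤ → Type*} [∀ i, Fintype (κ i)]
    {v : (Σ i, κ i) → V} (hv : ∀ s, v s ∈ L ∧ v s ∈ J.compGE s.1)
    (h : ∀ i, ∀ x ∈ L, x ∈ J.compGE i → ∃ a : κ i → 𝒪[F], ∃ y ∈ inter Λ (J.comp i),
      J.proj i x - ∑ s, a s • J.proj i (v ⟨i, s⟩) = ϖ • y) :
    L ≤ Submodule.span 𝒪[F] (Set.range v) ⊔ ϖ • Λ := by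
  have key : ∀ (n : ℕ) (i : ℤ), (∀ k ∈ J.supp, k < i + n) → ∀ x ∈ L, x ∈ J.compGE i →
      x ∈ Submodule.span 𝒪[F] (Set.range v) ⊔ ϖ • Λ := by
    intro n
    induction n with
    | zero =>
      intro i hi x _ hx
      have h0 : x = 0 := by
        rw [← J.sum_proj x]
        exact Finset.sum_eq_zero fun k hk => J.mem_compGE.1 hx k (by simpa using hi k hk)
      rw [h0]
      exact zero_mem _
    | succ n ih =>
      intro i hi x hx hx'
      obtain ⟨a, y, hy, h1⟩ := h i x hx hx'
      have h2 : x = (x - ∑ s, a s • v ⟨i, s⟩ - ϖ • y) + (∑ s, a s • v ⟨i, s⟩ + ϖ • y) := by abel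
      have h3 : ϖ • y ∈ ϖ • Λ := Submodule.smul_mem_pointwise_smul _ _ _ hy.1
      have h4 : ∑ s, a s • v ⟨i, s⟩ ∈ L := sum_mem fun s _ => L.smul_mem _ (hv ⟨i, s⟩).1
      have h5 : ∑ s, a s • v ⟨i, s⟩ ∈ J.compGE i :=
        sum_mem fun s _ => (J.compGE i).smul_mem (a s : F) (hv ⟨i, s⟩).2
      have h5' : J.proj i (∑ s, a s • v ⟨i, s⟩) = ∑ s, a s • J.proj i (v ⟨i, s⟩) := by
        rw [map_sum]
        exact Finset.sum_congr rfl fun s _ => (J.proj i).map_smul (a s : F) _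
      rw [h2]
      refine add_mem (ih (i + 1) (fun k hk => ?_) _ (sub_mem (sub_mem hx h4) (hL h3)) ?_)
        (add_mem (Submodule.mem_sup_left (sum_mem fun s _ => Submodule.smul_mem _ _
          (Submodule.subset_span ⟨_, rfl⟩))) (Submodule.mem_sup_right h3))
      · have := hi k hk
        push_cast at this
        omega
      · rw [J.mem_compGE]
        intro j hj
        rw [map_sub, map_sub, map_smul]
        rcases (Int.lt_add_one_iff.1 hj).lt_or_eq with hj | rfl
        · rw [J.mem_compGE.1 hx' j hj, J.mem_compGE.1 h5 j hj, J.proj_of_mem_ne hj.ne' hy.2]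
          simp
        · rw [h5', J.proj_of_mem hy.2, h1, sub_self]
  intro x hx
  have hb : ∃ i : ℤ, ∀ k ∈ J.supp, i ≤ k := by
    obtain ⟨i, hi⟩ := J.supp.bddBelow
    exact ⟨i, fun k hk => hi hk⟩
  have hb' : ∃ i : ℤ, ∀ k ∈ J.supp, k ≤ i := by
    obtain ⟨i, hi⟩ := J.supp.bddAbove
    exact ⟨i, fun k hk => hi hk⟩
  obtain ⟨i, hi⟩ := hb
  obtain ⟨i', hi'⟩ := hb'
  refine key (i' - i + 1).toNat i (fun k hk => ?_) x hx (J.mem_compGE.2 fun j hj => ?_)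
  · have := hi' k hk
    omega
  · exact J.proj_eq_zero (fun h => absurd (hi j h) (not_le.2 hj)) x

end JordanSplitting

lemma exists_lift_of_mem_span (hS : LatSetting c σ ϖ τ q₀) {P : Submodule 𝒪[F] V} {κ : Type*}
    [Fintype κ] {w : κ → P} {x : P}
    (hx : resMk P x ∈ Submodule.span 𝓀[F] (Set.range fun s => resMk P (w s))) :
    ∃ a : κ → 𝒪[F], ∃ y ∈ P, (x : V) - ∑ s, a s • (w s : V) = ϖ • y := by
  obtain ⟨g, hg⟩ := (Submodule.mem_span_range_iff_exists_fun 𝓀[F]).1 hx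
  choose a ha using fun s => IsLocalRing.residue_surjective (R := 𝒪[F]) (g s)
  have h1 : resMk P x = resMk P (∑ s, a s • w s) := by
    rw [← hg, map_sum]
    refine Finset.sum_congr rfl fun s _ => ?_
    rw [← ha, residue_smul_resMk]
  obtain ⟨y, hy, h2⟩ := hS.resMk_eq_iff.1 h1
  refine ⟨a, y, hy, ?_⟩
  rw [← h2]
  congr 1
  simp

/-- Indices for an adapted basis of the residue space of level `i`. -/
abbrev AdaptedIdx (d : TypData c) (i : ℤ) : Type :=
  (Fin (c.γ * d.n i) ⊕ Fin (c.γ * d.l i)) ⊕ (Fin (d.m i) ⊕ Fin (d.m i))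

/-- Indices for the basis of the sublattice at level `j`. -/
abbrev SublatticeIdx (d : TypData c) (j : ℤ) : Type :=
  (Fin (c.γ * d.n j) ⊕ Fin (c.γ * d.l (j - 2))) ⊕ (Fin (d.m (j - 1)) ⊕ Fin (d.m (j - 1)))

namespace AdaptedIdx

variable {d : TypData c}

/-- The shift of the level in the sublattice. -/
def shift {i : ℤ} : AdaptedIdx d i → ℤ :=
  Sum.elim (Sum.elim (fun _ => 0) fun _ => 2) fun _ => 1

/-- The exponent of the uniformizer in the basis of the sublattice. -/
def weight {i : ℤ} : AdaptedIdx d i → ℤ :=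
  Sum.elim (Sum.elim (fun _ => 0) fun _ => 1) (Sum.elim (fun _ => 1) fun _ => 0)

/-- The element of the adapted bases corresponding to a basis element of the sublattice. -/
def source : (Σ j, SublatticeIdx d j) → Σ i, AdaptedIdx d i
  | ⟨j, .inl (.inl s)⟩ => ⟨j, .inl (.inl s)⟩
  | ⟨j, .inl (.inr s)⟩ => ⟨j - 2, .inl (.inr s)⟩
  | ⟨j, .inr (.inl s)⟩ => ⟨j - 1, .inr (.inr s)⟩
  | ⟨j, .inr (.inr s)⟩ => ⟨j - 1, .inr (.inl s)⟩

/-- Passing to `L` leaves the vectors `a` at their level, raises `μ` and `ϖν` by one and `ϖc` by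
two. `source` exchanges the `μ` and `ν` blocks: after multiplying `ν` by `ϖ` it is their own block
that vanishes in the residue, and it should again be the last one. -/
lemma source_level (x : Σ j, SublatticeIdx d j) :
    x.1 = (source x).1 + shift (source x).2 := by
  obtain ⟨j, (s | s) | s | s⟩ := x <;> simp [source, shift]

lemma weight_eq {i : ℤ} (s : AdaptedIdx d i) : weight s = 0 ∨ weight s = 1 := by
  obtain (s | s) | s | s := s <;> simp [weight]

lemma source_surjective : Function.Surjective (source (d := d)) := by
  have h1 : ∀ (i j : ℤ) (_ : j - 2 = i) (s : Fin (c.γ * d.l i)),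
      ∃ x, source x = ⟨i, .inl (.inr s)⟩ := by
    rintro i j rfl s
    exact ⟨⟨j, .inl (.inr s)⟩, rfl⟩
  have h2 : ∀ (i j : ℤ) (_ : j - 1 = i) (s : Fin (d.m i)),
      (∃ x, source x = ⟨i, .inr (.inl s)⟩) ∧ ∃ x, source x = ⟨i, .inr (.inr s)⟩ := by
    rintro i j rfl s
    exact ⟨⟨⟨j, .inr (.inr s)⟩, rfl⟩, ⟨⟨j, .inr (.inl s)⟩, rfl⟩⟩
  rintro ⟨i, (s | s) | s | s⟩
  · exact ⟨⟨i, .inl (.inl s)⟩, rfl⟩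
  · exact h1 i (i + 2) (by ring) s
  · exact (h2 i (i + 1) (by ring) s).1
  · exact (h2 i (i + 1) (by ring) s).2

end AdaptedIdx

lemma finite_sigma_of_isEmpty {κ : ℤ → Type*} [∀ i, Finite (κ i)] (T : Finset ℤ)
    (h : ∀ i ∉ T, IsEmpty (κ i)) : Finite (Σ i, κ i) := by
  have hT : ∀ s : Σ i, κ i, s.1 ∈ T := fun s => by
    by_contra hs
    exact (h _ hs).elim s.2
  refine Finite.of_injective (fun s : Σ i, κ i => (⟨⟨s.1, hT s⟩, s.2⟩ : Σ i : T, κ i)) ?_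
  rintro ⟨i, s⟩ ⟨j, t⟩ hst
  simp only [Sigma.mk.injEq, Subtype.mk.injEq] at hst
  obtain ⟨rfl, h2⟩ := hst
  rw [eq_of_heq h2]

lemma det_toSquareBlock_sigma {k : Type*} [CommRing k] {κ : ℤ → Type*} [∀ i, Fintype (κ i)]
    [∀ i, DecidableEq (κ i)] [Fintype (Σ i, κ i)] [DecidableEq (Σ i, κ i)]
    (M : Matrix (Σ i, κ i) (Σ i, κ i) k) (j : ℤ) :
    (M.toSquareBlock Sigma.fst j).det = (Matrix.of fun s t : κ j => M ⟨j, s⟩ ⟨j, t⟩).det :=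
  (Matrix.det_submatrix_equiv_self (Equiv.sigmaSubtype j).symm (M.toSquareBlock Sigma.fst j)).symm

namespace JordanSplitting

variable {Λ L : Submodule 𝒪[F] V} (J : JordanSplitting B ϖ Λ) {d : TypData c}

/-- Adapted bases of all residue spaces. -/
abbrev AdaptedBases (hS : LatSetting c σ ϖ τ q₀) (L : Submodule 𝒪[F] V) (d : TypData c) :=
  ∀ i, AdaptedBasis c (J.resB hS i) (J.resN L i) (d.n i) (d.ψ₁ i) (d.m i) (d.l i) (d.ψ₂ i)

variable {hS : LatSetting c σ ϖ τ q₀}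

lemma AdaptedBases.eq_zero [FiniteDimensional F V] (β : J.AdaptedBases hS L d) {i : ℤ} (hi : i ∉ J.supp) :
    d.n i = 0 ∧ d.m i = 0 ∧ d.l i = 0 := by
  have h1 : Subsingleton (ResSpace (inter Λ (J.comp i))) := by
    have : Subsingleton (inter Λ (J.comp i)) := by
      refine ⟨fun x y => Subtype.ext ?_⟩
      have h : ∀ x ∈ inter Λ (J.comp i), x = 0 := fun x hx => by
        simpa [J.comp_eq_bot hi] using hx.2
      rw [h x x.2, h y y.2]
    exact (resMk_surjective (inter Λ (J.comp i))).subsingleton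
  have h2 := (β i).dim
  rw [finrank_zero_of_subsingleton] at h2
  have h3 := c.γ_pos
  have h4 : c.γ * d.n i = 0 := by omega
  have h5 : c.γ * d.l i = 0 := by omega
  refine ⟨?_, by omega, ?_⟩
  · exact (Nat.mul_eq_zero.1 h4).resolve_left h3.ne'
  · exact (Nat.mul_eq_zero.1 h5).resolve_left h3.ne'

lemma AdaptedBases.finite [FiniteDimensional F V] (β : J.AdaptedBases hS L d) : Finite (Σ i, AdaptedIdx d i) := by
  refine finite_sigma_of_isEmpty J.supp fun i hi => ?_
  obtain ⟨h1, h2, h3⟩ := AdaptedBases.eq_zero J β hi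
  simp only [AdaptedIdx, h1, h2, h3, mul_zero, isEmpty_sum]
  exact ⟨⟨inferInstance, inferInstance⟩, inferInstance, inferInstance⟩

lemma AdaptedBases.finite' [FiniteDimensional F V] (β : J.AdaptedBases hS L d) : Finite (Σ i, SublatticeIdx d i) := by
  refine finite_sigma_of_isEmpty
    (J.supp ∪ J.supp.image (fun i => i + 1) ∪ J.supp.image (fun i => i + 2)) fun i hi => ?_
  simp only [Finset.mem_union, Finset.mem_image, not_or, not_exists, not_and] at hi
  obtain ⟨h1, -, -⟩ := AdaptedBases.eq_zero J β hi.1.1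
  obtain ⟨-, h2, -⟩ := AdaptedBases.eq_zero J β
    (i := i - 1) fun h => hi.1.2 _ h (sub_add_cancel _ _)
  obtain ⟨-, -, h3⟩ := AdaptedBases.eq_zero J β (i := i - 2) fun h => hi.2 _ h (sub_add_cancel _ _)
  simp only [SublatticeIdx, h1, h2, h3, mul_zero, isEmpty_sum]
  exact ⟨⟨inferInstance, inferInstance⟩, inferInstance, inferInstance⟩

/-- Lifts of adapted bases. -/
structure IsLift (β : J.AdaptedBases hS L d) (v : (Σ i, AdaptedIdx d i) → V) : Prop where
  mem : ∀ s, v s ∈ Λ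
  mem_compGE : ∀ s, v s ∈ J.compGE s.1
  mem_sub : ∀ s, AdaptedIdx.weight s.2 = 0 → v s ∈ L
  resMk_proj : ∀ s, resMk (inter Λ (J.comp s.1)) ⟨_, J.proj_mem_inter (mem s)⟩ = (β s.1).fam s.2

/-- Vectors of the residue subspace of `N_i` lift to `L ∩ V^(≥ i)` by the definition of `N_i`; the
others are lifted into `Λ^(i)` itself. -/
lemma exists_isLift (hL : L ≤ Λ) (hL' : ϖ • Λ ≤ L) (β : J.AdaptedBases hS L d) :
    ∃ v, J.IsLift β v := by
  have key : ∀ s : Σ i, AdaptedIdx d i, ∃ x, ∃ h : x ∈ Λ, x ∈ J.compGE s.1 ∧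
      (AdaptedIdx.weight s.2 = 0 → x ∈ L) ∧
      resMk (inter Λ (J.comp s.1)) ⟨_, J.proj_mem_inter h⟩ = (β s.1).fam s.2 := by
    rintro ⟨i, s⟩
    have h1 : ∀ w ∈ J.resN L i, ∃ x, ∃ h : x ∈ Λ, x ∈ J.compGE i ∧ x ∈ L ∧
        resMk (inter Λ (J.comp i)) ⟨_, J.proj_mem_inter h⟩ = w := by
      intro w hw
      obtain ⟨p, rfl⟩ := resMk_surjective _ w
      rw [resN, resMk_mem_resSub hS fun y hy => J.smul_mem_N hL' hy] at hw
      obtain ⟨x, hx, hxp⟩ := hw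
      exact ⟨x, hL hx.1, hx.2, hx.1, congrArg _ (Subtype.ext hxp)⟩
    have h2 : ∀ w, ∃ x, ∃ h : x ∈ Λ, x ∈ J.compGE i ∧
        resMk (inter Λ (J.comp i)) ⟨_, J.proj_mem_inter h⟩ = w := by
      intro w
      obtain ⟨p, rfl⟩ := resMk_surjective _ w
      exact ⟨p, p.2.1, J.comp_le_compGE i p.2.2, congrArg _ (Subtype.ext (J.proj_of_mem p.2.2))⟩
    rcases s with (s | s) | s | s
    · obtain ⟨x, h, h3, h4, h5⟩ := h1 _ ((β i).a_mem s)
      exact ⟨x, h, h3, fun _ => h4, h5⟩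
    · obtain ⟨x, h, h3, h4⟩ := h2 ((β i).c' s)
      exact ⟨x, h, h3, fun h => absurd h (by simp [AdaptedIdx.weight]), h4⟩
    · obtain ⟨x, h, h3, h4⟩ := h2 ((β i).ν s)
      exact ⟨x, h, h3, fun h => absurd h (by simp [AdaptedIdx.weight]), h4⟩
    · obtain ⟨x, h, h3, h4, h5⟩ := h1 _ ((β i).μ_mem s).1
      exact ⟨x, h, h3, fun _ => h4, h5⟩
  choose v h1 h2 h3 h4 using key
  exact ⟨v, h1, h2, h3, h4⟩

namespace IsLift

variable [FiniteDimensional F V] {J} {β : J.AdaptedBases hS L d} {v : (Σ i, AdaptedIdx d i) → V}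

lemma toResidue_form (hv : J.IsLift β v) (i : ℤ) (s t : AdaptedIdx d i) :
    toResidue (ϖ ^ (-i) * B (v ⟨i, s⟩) (v ⟨i, t⟩)) =
      J.resB hS i ((β i).fam s) ((β i).fam t) := by
  rw [← hv.resMk_proj ⟨i, s⟩, ← hv.resMk_proj ⟨i, t⟩, resB_resMk]
  exact hS.toResidue_congr (J.form_mem_of_compGE hS (hv.mem _) (hv.mem _) (hv.mem_compGE ⟨i, t⟩))
    (J.form_sub_proj_mem hS (hv.mem _) (hv.mem _) (hv.mem_compGE ⟨i, t⟩))

lemma isGraded [Finite 𝓀[F]] [Fintype (Σ i, AdaptedIdx d i)] [DecidableEq (Σ i, AdaptedIdx d i)]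
    (hB : c.IsForm B) (hv : J.IsLift β v) : IsGraded B ϖ Sigma.fst v := by
  refine ⟨fun s t => ?_, fun j => ?_⟩
  · rcases le_total s.1 t.1 with h | h
    · rw [max_eq_right h]
      exact J.form_mem_of_compGE hS (hv.mem _) (hv.mem _) (hv.mem_compGE t)
    · rw [max_eq_left h]
      exact hS.form_swap_mem hB
        (J.form_mem_of_compGE hS (hv.mem _) (hv.mem _) (hv.mem_compGE s))
  · rw [det_toSquareBlock_sigma]
    have h1 : (Matrix.of fun s t : AdaptedIdx d j => redGram B ϖ Sigma.fst v ⟨j, s⟩ ⟨j, t⟩) =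
        gram (J.resB hS j) (β j).fam := Matrix.ext fun s t => hv.toResidue_form j s t
    rw [h1]
    exact ((β j).fam_det hS.isResSetting (J.isResForm_resB hS hB j)).1

end IsLift

end JordanSplitting

end TypeOfSublattice

section FamSpan

open Module

variable {k X : Type*} [Field k] [AddCommGroup X] [Module k X] {τ : k →+* k}
  {c : FormCase} {b : X →ₗ[k] X →ₛₗ[τ] k} {W : Submodule k X} {n m l : ℕ}
  {ψ₁ ψ₂ : c.Sign}

lemma AdaptedBasis.span_fam [Finite k] {q₀ : ℕ} [Module.Finite k X]
    (β : AdaptedBasis c b W n ψ₁ m l ψ₂) (hτ : c.IsResSetting τ q₀) (hb : c.IsResForm b) :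
    Submodule.span k (Set.range β.fam) = ⊤ :=
  (linearIndependent_of_gram (β.fam_det hτ hb).1).span_eq_top_of_card_eq_finrank'
    (by rw [β.dim]; simp)

lemma AdaptedBasis.span_fam_sub [Finite k] {q₀ : ℕ} [Module.Finite k X]
    (β : AdaptedBasis c b W n ψ₁ m l ψ₂) (hτ : c.IsResSetting τ q₀) (hb : c.IsResForm b) :
    Submodule.span k (Set.range (β.fam ∘ Sum.map Sum.inl Sum.inr)) = W := by
  refine Submodule.eq_of_le_of_finrank_eq ?_ ?_
  · rw [Submodule.span_le]
    rintro _ ⟨s | s, rfl⟩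
    · exact β.a_mem s
    · exact (β.μ_mem s).1
  · rw [finrank_span_eq_card ((linearIndependent_of_gram (β.fam_det hτ hb).1).comp _
      (Sum.map_injective.2 ⟨Sum.inl_injective, Sum.inr_injective⟩)), β.dim_W]
    simp

end FamSpan

section TypeOfSublattice

open Module

variable {F₀ F : Type*} [Field F₀] [Field F] [ValuativeRel F] [Algebra F₀ F]
  {σ : F ≃ₐ[F₀] F} {V : Type*} [AddCommGroup V] [Module F V]
  {c : FormCase} {ϖ : F} {τ : 𝓀[F] →+* 𝓀[F]} {q₀ : ℕ} {B : Form σ V}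

namespace JordanSplitting.IsLift

variable {Λ L : Submodule 𝒪[F] V} {J : JordanSplitting B ϖ Λ}
  {d : TypData c} [FiniteDimensional F V] {hS : LatSetting c σ ϖ τ q₀}
  {β : J.AdaptedBases hS L d} {v : (Σ i, AdaptedIdx d i) → V}

lemma le_span [Finite 𝓀[F]] (hB : c.IsForm B) (hΛ : Λ.FG) (hv : J.IsLift β v) :
    Λ ≤ Submodule.span 𝒪[F] (Set.range v) ⊔ ϖ • Λ := by
  refine J.le_span_sup (smul_le_of_le hS Λ) (fun s => ⟨hv.mem s, hv.mem_compGE s⟩)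
    fun i x hx hx' => ?_
  have := J.finite_inter hΛ i
  refine exists_lift_of_mem_span hS (P := inter Λ (J.comp i)) (x := ⟨_, J.proj_mem_inter hx⟩)
    (w := fun s => ⟨_, J.proj_mem_inter (hv.mem ⟨i, s⟩)⟩) ?_
  have h1 : (fun s => resMk (inter Λ (J.comp i)) ⟨_, J.proj_mem_inter (hv.mem ⟨i, s⟩)⟩) =
      (β i).fam := funext fun s => hv.resMk_proj ⟨i, s⟩
  rw [h1, (β i).span_fam hS.isResSetting (J.isResForm_resB hS hB i)]
  exact Submodule.mem_top

/-- The elements of the lift lying in the sublattice. -/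
def sub (v : (Σ i, AdaptedIdx d i) → V) : (Σ i, Fin (c.γ * d.n i) ⊕ Fin (d.m i)) → V :=
  fun s => v ⟨s.1, Sum.map Sum.inl Sum.inr s.2⟩

lemma sub_le_span [Finite 𝓀[F]] (hB : c.IsForm B) (hΛ : Λ.FG) (hv : J.IsLift β v) (hL : L ≤ Λ)
    (hL' : ϖ • Λ ≤ L) : L ≤ Submodule.span 𝒪[F] (Set.range (sub v)) ⊔ ϖ • Λ := by
  refine J.le_span_sup hL' (fun s =>
    ⟨hv.mem_sub ⟨s.1, Sum.map Sum.inl Sum.inr s.2⟩ ?_,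
      hv.mem_compGE ⟨s.1, Sum.map Sum.inl Sum.inr s.2⟩⟩) fun i x hx hx' => ?_
  · obtain ⟨i, s | s⟩ := s <;> rfl
  have := J.finite_inter hΛ i
  refine exists_lift_of_mem_span hS (P := inter Λ (J.comp i)) (x := ⟨_, J.proj_mem_inter (hL hx)⟩)
    (w := fun s => ⟨_, J.proj_mem_inter (hv.mem ⟨i, Sum.map Sum.inl Sum.inr s⟩)⟩) ?_
  have h1 : (fun s => resMk (inter Λ (J.comp i))
      ⟨_, J.proj_mem_inter (hv.mem ⟨i, Sum.map Sum.inl Sum.inr s⟩)⟩) =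
      (β i).fam ∘ Sum.map Sum.inl Sum.inr := funext fun s => hv.resMk_proj ⟨i, _⟩
  rw [h1, (β i).span_fam_sub hS.isResSetting (J.isResForm_resB hS hB i)]
  exact (resMk_mem_resSub hS fun y hy => J.smul_mem_N hL' hy).2 ⟨x, ⟨hx, hx'⟩, rfl⟩

end JordanSplitting.IsLift

/-- A basis which is orthogonal for different levels, with residue Gram matrices those of adapted
bases. -/
structure IsOrthoLift (B : Form σ V) {Λ L : Submodule 𝒪[F] V} {J : JordanSplitting B ϖ Λ}
    {d : TypData c} {hS : LatSetting c σ ϖ τ q₀} (β : J.AdaptedBases hS L d)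
    (v : (Σ i, AdaptedIdx d i) → V) : Prop where
  ortho : ∀ s t, s.1 ≠ t.1 → B (v s) (v t) = 0
  mem : ∀ i s t, B (v ⟨i, s⟩) (v ⟨i, t⟩) ∈ fracPow ϖ i
  toResidue_form : ∀ i s t, toResidue (ϖ ^ (-i) * B (v ⟨i, s⟩) (v ⟨i, t⟩)) =
    J.resB hS i ((β i).fam s) ((β i).fam t)

namespace IsOrthoLift

variable {Λ L : Submodule 𝒪[F] V} {J : JordanSplitting B ϖ Λ}
  {d : TypData c} {hS : LatSetting c σ ϖ τ q₀}
  {β : J.AdaptedBases hS L d} {v : (Σ i, AdaptedIdx d i) → V}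

/-- The basis of the sublattice. -/
def subBasis (ϖ : F) (v : (Σ i, AdaptedIdx d i) → V) (x : Σ j, SublatticeIdx d j) : V :=
  ϖ ^ AdaptedIdx.weight (AdaptedIdx.source x).2 • v (AdaptedIdx.source x)

lemma form_subBasis (hS : LatSetting c σ ϖ τ q₀) (v : (Σ i, AdaptedIdx d i) → V)
    (x y : Σ j, SublatticeIdx d j) : B (subBasis ϖ v x) (subBasis ϖ v y) =
      ϖ ^ (AdaptedIdx.weight (AdaptedIdx.source x).2 + AdaptedIdx.weight (AdaptedIdx.source y).2) *
        B (v (AdaptedIdx.source x)) (v (AdaptedIdx.source y)) := by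
  rw [subBasis, subBasis, form_smul_left, form_smul_right, hS.map_zpow, zpow_add₀ hS.ne_zero,
    mul_assoc]

lemma mem_of_resB_eq_zero (hv : IsOrthoLift B β v) {i : ℤ} {s t : AdaptedIdx d i}
    (h : J.resB hS i ((β i).fam s) ((β i).fam t) = 0) :
    B (v ⟨i, s⟩) (v ⟨i, t⟩) ∈ fracPow ϖ (i + 1) := by
  rw [← hS.toResidue_zpow_mul_eq_zero (hv.mem i s t), hv.toResidue_form, h]

/-- In the sixteen pairs of blocks the required exponent is at most `i`, except for the pairs
`a`–`c`, `a`–`μ`, `c`–`μ` and `μ`–`μ`, where it is `i + 1`. These are pairs on which the residue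
form vanishes in an adapted basis. -/
lemma form_mem_shift [Finite 𝓀[F]] (hB : c.IsForm B) (hv : IsOrthoLift B β v) (i : ℤ)
    (s t : AdaptedIdx d i) : B (v ⟨i, s⟩) (v ⟨i, t⟩) ∈
      fracPow ϖ (i + max (AdaptedIdx.shift s) (AdaptedIdx.shift t) -
        (AdaptedIdx.weight s + AdaptedIdx.weight t)) := by
  have h0 : ∀ e : ℤ, e ≤ i → B (v ⟨i, s⟩) (v ⟨i, t⟩) ∈ fracPow ϖ e :=
    fun e he => hS.fracPow_anti he (hv.mem i s t)
  have h1 : ∀ e : ℤ, e ≤ i + 1 → J.resB hS i ((β i).fam s) ((β i).fam t) = 0 →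
      B (v ⟨i, s⟩) (v ⟨i, t⟩) ∈ fracPow ϖ e :=
    fun e he h => hS.fracPow_anti he (hv.mem_of_resB_eq_zero h)
  have hrefl := fun {x y} (h : J.resB hS i x y = 0) =>
    FormCase.IsResForm.refl hS.isResSetting (J.isResForm_resB hS hB i) h
  rcases s with (s | s) | s | s <;> rcases t with (t | t) | t | t
  · exact h0 _ (by simp [AdaptedIdx.shift, AdaptedIdx.weight])
  · exact h1 _ (by simp [AdaptedIdx.shift, AdaptedIdx.weight]; omega) ((β i).a_c s t)
  · exact h0 _ (by simp [AdaptedIdx.shift, AdaptedIdx.weight])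
  · exact h1 _ (by simp [AdaptedIdx.shift, AdaptedIdx.weight]) ((β i).a_μ s t)
  · exact h1 _ (by simp [AdaptedIdx.shift, AdaptedIdx.weight]; omega) (hrefl ((β i).a_c t s))
  · exact h0 _ (by simp [AdaptedIdx.shift, AdaptedIdx.weight])
  · exact h0 _ (by simp [AdaptedIdx.shift, AdaptedIdx.weight])
  · exact h1 _ (by simp [AdaptedIdx.shift, AdaptedIdx.weight]; omega) ((β i).c_μ s t)
  · exact h0 _ (by simp [AdaptedIdx.shift, AdaptedIdx.weight])
  · exact h0 _ (by simp [AdaptedIdx.shift, AdaptedIdx.weight])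
  · exact h0 _ (by simp [AdaptedIdx.shift, AdaptedIdx.weight])
  · exact h0 _ (by simp [AdaptedIdx.shift, AdaptedIdx.weight])
  · exact h1 _ (by simp [AdaptedIdx.shift, AdaptedIdx.weight]) (hrefl ((β i).a_μ t s))
  · exact h1 _ (by simp [AdaptedIdx.shift, AdaptedIdx.weight]; omega) ((β i).μ_c s t)
  · exact h0 _ (by simp [AdaptedIdx.shift, AdaptedIdx.weight])
  · exact h1 _ (by simp [AdaptedIdx.shift, AdaptedIdx.weight])
      (((β i).μ_mem s).2 _ ((β i).μ_mem t).1)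

lemma subBasis_mem [Finite 𝓀[F]] (hB : c.IsForm B) (hv : IsOrthoLift B β v)
    (x y : Σ j, SublatticeIdx d j) :
    B (subBasis ϖ v x) (subBasis ϖ v y) ∈ fracPow ϖ (max x.1 y.1) := by
  rw [form_subBasis hS, hS.zpow_mul_mem_fracPow, AdaptedIdx.source_level x,
    AdaptedIdx.source_level y]
  generalize AdaptedIdx.source x = s
  generalize AdaptedIdx.source y = t
  by_cases h : s.1 = t.1
  · obtain ⟨i, s⟩ := s
    obtain ⟨j, t⟩ := t
    obtain rfl : i = j := h
    rw [max_add_add_left]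
    exact hv.form_mem_shift hB i s t
  · rw [hv.ortho s t h]
    exact zero_mem _

lemma toResidue_subBasis (hv : IsOrthoLift B β v) {i j w : ℤ} (hw : -j + w = -i)
    (s t : AdaptedIdx d i) : toResidue (ϖ ^ (-j) * (ϖ ^ w * B (v ⟨i, s⟩) (v ⟨i, t⟩))) =
      J.resB hS i ((β i).fam s) ((β i).fam t) := by
  rw [← mul_assoc, ← zpow_add₀ hS.ne_zero, hw, hv.toResidue_form]

lemma toResidue_subBasis_zero (hv : IsOrthoLift B β v) {j w : ℤ} {s t : Σ i, AdaptedIdx d i}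
    (hst : s.1 ≠ t.1) : toResidue (ϖ ^ (-j) * (ϖ ^ w * B (v s) (v t))) = 0 := by
  rw [hv.ortho s t hst, mul_zero, mul_zero, ← ZeroMemClass.coe_zero 𝒪[F], toResidue_coe, map_zero]

/-- The Gram determinant of the basis of the sublattice at one level. -/
lemma det_subBasis (hv : IsOrthoLift B β v) (j : ℤ) :
    (Matrix.of fun s t : SublatticeIdx d j =>
      redGram B ϖ Sigma.fst (subBasis ϖ v) ⟨j, s⟩ ⟨j, t⟩).det =
    (gram (J.resB hS j) (β j).a).det * (gram (J.resB hS (j - 2)) (β (j - 2)).c').det *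
      ((-1) ^ d.m (j - 1) * ((β (j - 1)).s ^ d.m (j - 1) * 1)) := by
  have e1 : j ≠ j - 1 := by omega
  have e2 : j ≠ j - 2 := by omega
  have e3 : j - 1 ≠ j - 2 := by omega
  have key : (Matrix.of fun s t : SublatticeIdx d j =>
      redGram B ϖ Sigma.fst (subBasis ϖ v) ⟨j, s⟩ ⟨j, t⟩) =
      Matrix.fromBlocks (Matrix.fromBlocks (gram (J.resB hS j) (β j).a) 0 0
        (gram (J.resB hS (j - 2)) (β (j - 2)).c')) 0 0
        (Matrix.fromBlocks (Matrix.of fun s t => redGram B ϖ Sigma.fst (subBasis ϖ v)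
          ⟨j, .inr (.inl s)⟩ ⟨j, .inr (.inl t)⟩)
          (Matrix.diagonal fun _ => (β (j - 1)).s) 1 0) := by
    ext s t
    have h0 : redGram B ϖ Sigma.fst (subBasis ϖ v) ⟨j, s⟩ ⟨j, t⟩ = toResidue (ϖ ^ (-j) *
        (ϖ ^ (AdaptedIdx.weight (AdaptedIdx.source ⟨j, s⟩).2 +
          AdaptedIdx.weight (AdaptedIdx.source ⟨j, t⟩).2) *
          B (v (AdaptedIdx.source ⟨j, s⟩)) (v (AdaptedIdx.source ⟨j, t⟩)))) := by
      rw [← form_subBasis hS]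
      rfl
    rw [Matrix.of_apply, h0]
    rcases s with (s | s) | s | s <;> rcases t with (t | t) | t | t
    · exact hv.toResidue_subBasis (by simp [AdaptedIdx.source, AdaptedIdx.weight]) _ _
    · exact hv.toResidue_subBasis_zero e2
    · exact hv.toResidue_subBasis_zero e1
    · exact hv.toResidue_subBasis_zero e1
    · exact hv.toResidue_subBasis_zero e2.symm
    · exact hv.toResidue_subBasis (by simp [AdaptedIdx.source, AdaptedIdx.weight]; ring) _ _
    · exact hv.toResidue_subBasis_zero e3.symm
    · exact hv.toResidue_subBasis_zero e3.symm
    · exact hv.toResidue_subBasis_zero e1.symm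
    · exact hv.toResidue_subBasis_zero e3
    · exact h0.symm
    · refine (hv.toResidue_subBasis
        (by simp [AdaptedIdx.source, AdaptedIdx.weight]; ring) _ _).trans ?_
      exact ((β (j - 1)).μ_ν s t).trans (Matrix.diagonal_apply (fun _ => (β (j - 1)).s) s t).symm
    · exact hv.toResidue_subBasis_zero e1.symm
    · exact hv.toResidue_subBasis_zero e3
    · refine (hv.toResidue_subBasis
        (by simp [AdaptedIdx.source, AdaptedIdx.weight]; ring) _ _).trans ?_
      exact ((β (j - 1)).ν_μ s t).trans Matrix.one_apply.symm
    -- Two factors `ϖ` on products at level `j - 1` give divisibility by `ϖ^(j+1)`, so the block of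
    -- the `ϖν` vanishes. The block of the `μ` stays unknown, but it does not enter the determinant.
    · have h1 := hv.mem (j - 1) (.inr (.inl s)) (.inr (.inl t))
      refine (hS.toResidue_zpow_mul_eq_zero (hS.zpow_mul_mem_fracPow.2 (hS.fracPow_anti ?_ h1))).2
        (hS.zpow_mul_mem_fracPow.2 (hS.fracPow_anti ?_ h1)) <;>
      simp [AdaptedIdx.source, AdaptedIdx.weight]
      omega
  rw [key, Matrix.det_fromBlocks_zero₂₁, Matrix.det_fromBlocks_zero₂₁, det_fromBlocks_zero_right]
  simp

lemma isGraded_subBasis [Finite 𝓀[F]] [Fintype (Σ j, SublatticeIdx d j)]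
    [DecidableEq (Σ j, SublatticeIdx d j)] (hB : c.IsForm B)
    (hv : IsOrthoLift B β v) : IsGraded B ϖ Sigma.fst (subBasis ϖ v) := by
  refine ⟨hv.subBasis_mem hB, fun j => ?_⟩
  rw [det_toSquareBlock_sigma, hv.det_subBasis]
  exact mul_ne_zero (mul_ne_zero (β j).det_a (β (j - 2)).det_c)
    (AdaptedBasis.sign_hyperbolic c (β (j - 1)).s_mul (β (j - 1)).s_eq _).1

lemma hasTyp_subBasis [FiniteDimensional F V] [Finite 𝓀[F]]
    (hB : c.IsForm B) (hv : IsOrthoLift B β v)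
    (hspan : Submodule.span F (Set.range (subBasis ϖ v)) = ⊤) :
    HasTyp c B ϖ (Submodule.span 𝒪[F] (Set.range (subBasis ϖ v))) d.f
      (d.ψ (c.sign (-1 : 𝓀[F]))) := by
  classical
  have := JordanSplitting.AdaptedBases.finite' J β
  have := Fintype.ofFinite (Σ j, SublatticeIdx d j)
  refine (hv.isGraded_subBasis hB).hasTyp hS hB hspan (fun j => ?_) fun j => ?_
  · rw [Fintype.card_congr (Equiv.sigmaSubtype j)]
    have h1 : c.γ * (2 / c.γ) = 2 := by cases c <;> simp [FormCase.γ]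
    simp only [Fintype.card_sum, Fintype.card_fin, TypData.f]
    rw [mul_add, mul_add, ← mul_assoc, h1]
    ring
  · obtain ⟨h1, h2⟩ := AdaptedBasis.sign_hyperbolic c (β (j - 1)).s_mul (β (j - 1)).s_eq
      (d.m (j - 1))
    rw [det_toSquareBlock_sigma, hv.det_subBasis,
      c.sign_mul (mul_ne_zero (β j).det_a (β (j - 2)).det_c) h1,
      c.sign_mul (β j).det_a (β (j - 2)).det_c, h2, (β j).sign_a, (β (j - 2)).sign_c]
    exact mul_right_comm _ _ _

end IsOrthoLift

/-- The type of a sublattice in terms of its data. -/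
theorem JordanSplitting.hasTyp_of_isDataOf [FiniteDimensional F V] [Finite 𝓀[F]]
    {Λ L : Submodule 𝒪[F] V} (J : JordanSplitting B ϖ Λ) (hS : LatSetting c σ ϖ τ q₀)
    (hB : c.IsForm B) (hΛ : Λ.IsLattice F) (hL : L ≤ Λ) (hL' : ϖ • Λ ≤ L) {d : TypData c}
    (h : IsDataOf J (J.N L) d) :
    HasTyp c B ϖ Λ d.e (d.χ (c.sign (-1 : 𝓀[F]))) ∧
      HasTyp c B ϖ L d.f (d.ψ (c.sign (-1 : 𝓀[F]))) := by
  classical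
  have hfg : Λ.FG := hΛ.fg
  rw [J.isDataOf_iff hS hB hfg hL hL'] at h
  have hβ : Nonempty (J.AdaptedBases hS L d) := by
    refine ⟨fun i => Classical.choice ?_⟩
    have := J.finite_inter hfg i
    exact (h i).2.1.exists_adaptedBasis hS.isResSetting (J.isResForm_resB hS hB i)
      (J.nondeg_resB hS i) (h i).1 (h i).2.2
  obtain ⟨β⟩ := hβ
  refine ⟨(J.hasTyp_iff hS hfg).2 fun i => ?_, ?_⟩
  · have := J.finite_inter hfg i
    exact (β i).hT hS.isResSetting (J.isResForm_resB hS hB i)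
  obtain ⟨v, hv⟩ := J.exists_isLift hL hL' β
  have := AdaptedBases.finite J β
  have := Fintype.ofFinite (Σ i, AdaptedIdx d i)
  have hgr := hv.isGraded hB
  have hΛv : Submodule.span 𝒪[F] (Set.range v) = Λ := by
    apply le_antisymm
    · rw [Submodule.span_le]
      rintro _ ⟨s, rfl⟩
      exact hv.mem s
    · exact hS.le_of_le_sup hfg (hv.le_span hB hfg)
  obtain ⟨v', h1, h2, h3⟩ := hgr.exists_orthogonal hS hB
  obtain ⟨h4, h5⟩ := hgr.of_congr hS h2 h3
  have hΛv' := IsGraded.span_eq hS h1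
  rw [hΛv] at h1 hΛv'
  have hv' : IsOrthoLift B β v' := by
    refine ⟨h2, fun i s t => ?_, fun i s t => ?_⟩
    · have := h4.mem ⟨i, s⟩ ⟨i, t⟩
      rwa [max_self] at this
    · exact (h5 ⟨i, s⟩ ⟨i, t⟩ rfl).trans (hv.toResidue_form i s t)
  have hmem : ∀ s, v' s ∈ Λ := fun s => hΛv' ▸ Submodule.subset_span ⟨s, rfl⟩
  have hLs : Submodule.span 𝒪[F] (Set.range (IsOrthoLift.subBasis ϖ v')) = L := by
    apply le_antisymm
    · rw [Submodule.span_le]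
      rintro _ ⟨x, rfl⟩
      -- Orthogonalization moved the vectors only inside `ϖΛ`, which is contained in `L`.
      have hsub : ∀ s, AdaptedIdx.weight s.2 = 0 → v' s ∈ L := fun s hs => by
        have := add_mem (hL' (h1 s)) (hv.mem_sub s hs)
        rwa [sub_add_cancel] at this
      have hsm : ∀ s, ϖ • v' s ∈ L := fun s =>
        hL' (Submodule.smul_mem_pointwise_smul _ _ _ (hmem s))
      change ϖ ^ AdaptedIdx.weight (AdaptedIdx.source x).2 • v' (AdaptedIdx.source x) ∈ L
      generalize AdaptedIdx.source x = s
      rcases AdaptedIdx.weight_eq s.2 with hs | hs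
      · rw [hs, zpow_zero, one_smul]
        exact hsub s hs
      · rw [hs, zpow_one]
        exact hsm s
    · have hw : ∀ s : Σ i, AdaptedIdx d i, ϖ ^ AdaptedIdx.weight s.2 • v' s ∈
          Submodule.span 𝒪[F] (Set.range (IsOrthoLift.subBasis ϖ v')) := by
        intro s
        obtain ⟨x, rfl⟩ := AdaptedIdx.source_surjective s
        exact Submodule.subset_span ⟨x, rfl⟩
      have hϖ : ϖ • Λ ≤ Submodule.span 𝒪[F] (Set.range (IsOrthoLift.subBasis ϖ v')) := by
        rw [← hΛv', Submodule.smul_span, Submodule.span_le]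
        rintro _ ⟨_, ⟨s, rfl⟩, rfl⟩
        have h6 := hw s
        rcases AdaptedIdx.weight_eq s.2 with hs | hs
        · rw [hs, zpow_zero, one_smul] at h6
          exact Submodule.smul_mem _ (⟨ϖ, hS.unif_mem⟩ : 𝒪[F]) h6
        · rwa [hs, zpow_one] at h6
      refine (hv.sub_le_span hB hfg hL hL').trans (sup_le ?_ hϖ)
      rw [Submodule.span_le]
      rintro _ ⟨⟨i, s⟩, rfl⟩
      have h6 : AdaptedIdx.weight (Sum.map Sum.inl Sum.inr s : AdaptedIdx d i) = 0 := by
        rcases s with s | s <;> rfl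
      have h7 := hw ⟨i, Sum.map Sum.inl Sum.inr s⟩
      rw [h6, zpow_zero, one_smul] at h7
      have h8 := sub_mem h7 (hϖ (h1 ⟨i, Sum.map Sum.inl Sum.inr s⟩))
      rwa [sub_sub_cancel] at h8
  have hspan : Submodule.span F (Set.range (IsOrthoLift.subBasis ϖ v')) = ⊤ := by
    rw [← Submodule.span_span_of_tower 𝒪[F], hLs, eq_top_iff, ← hΛ.span_eq_top,
      Submodule.span_le]
    intro x hx
    have h6 := Submodule.smul_mem (Submodule.span F (L : Set V)) ϖ⁻¹
      (Submodule.subset_span (hL' (Submodule.smul_mem_pointwise_smul _ ϖ _ hx)))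
    rwa [smul_smul, inv_mul_cancel₀ hS.ne_zero, one_smul] at h6
  rw [← hLs]
  exact hv'.hasTyp_subBasis hB hspan

end TypeOfSublattice

/-! ### Counting subspaces with prescribed graded pieces -/

section FilteredCount

open Module

variable {k : Type*} [Field k]

/-- Subspaces with given image and given intersection with the kernel. -/
lemma card_submodule_map_comap {X Y : Type*} [AddCommGroup X] [Module k X] [AddCommGroup Y]
    [Module k Y] [Module.Finite k X] [Module.Finite k Y] {p : Y →ₗ[k] X}
    (hp : Function.Surjective p) (N : Submodule k X) (W' : Submodule k (LinearMap.ker p)) :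
    Nat.card {W : Submodule k Y // W.map p = N ∧ W.comap (LinearMap.ker p).subtype = W'} =
      Nat.card k ^ (finrank k N * finrank k (LinearMap.ker p ⧸ W')) := by
  obtain ⟨s, hs⟩ := p.exists_rightInverse_of_surjective (LinearMap.range_eq_top.2 hp)
  have hs' : ∀ x, p (s x) = x := fun x => LinearMap.congr_fun hs x
  let π : Y →ₗ[k] LinearMap.ker p := (LinearMap.id - s ∘ₗ p).codRestrict _ fun y => by
    simp [hs']
  have hπ : ∀ y, (π y : Y) = y - s (p y) := fun y => rfl
  -- With a section `s` of `p`, a subspace with image `N` and kernel part `W'` is the graph of a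
  -- linear map from `N` to `ker p` modulo `W'`; `π` is the projection to the kernel along `s`.
  let U : (N →ₗ[k] LinearMap.ker p ⧸ W') → Submodule k Y := fun φ =>
    { carrier := {y | ∃ h : p y ∈ N, W'.mkQ (π y) = φ ⟨p y, h⟩}
      zero_mem' := ⟨by simp, by
        have : (⟨p 0, by simp⟩ : N) = 0 := Subtype.ext (map_zero p)
        rw [this, map_zero, map_zero, map_zero]⟩
      add_mem' := by
        rintro y z ⟨hy, h1⟩ ⟨hz, h2⟩
        refine ⟨by rw [map_add]; exact N.add_mem hy hz, ?_⟩
        have : (⟨p (y + z), by rw [map_add]; exact N.add_mem hy hz⟩ : N) =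
            ⟨p y, hy⟩ + ⟨p z, hz⟩ := Subtype.ext (map_add p y z)
        rw [this, map_add, map_add, map_add, h1, h2]
      smul_mem' := by
        rintro a y ⟨hy, h1⟩
        refine ⟨by rw [map_smul]; exact N.smul_mem a hy, ?_⟩
        have : (⟨p (a • y), by rw [map_smul]; exact N.smul_mem a hy⟩ : N) = a • ⟨p y, hy⟩ :=
          Subtype.ext (map_smul p a y)
        rw [this, map_smul, map_smul, map_smul, h1] }
  have hU : ∀ φ y, y ∈ U φ ↔ ∃ h : p y ∈ N, W'.mkQ (π y) = φ ⟨p y, h⟩ := fun φ y => Iff.rfl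
  have hex : ∀ φ (x : N), ∃ z : LinearMap.ker p, W'.mkQ z = φ x ∧ s x + z ∈ U φ := by
    intro φ x
    obtain ⟨z, hz⟩ := W'.mkQ_surjective (φ x)
    have h1 : p (s x + z) = x := by rw [map_add, hs', LinearMap.mem_ker.1 z.2, add_zero]
    have h2 : π (s x + z) = z := Subtype.ext (by rw [hπ, h1, add_sub_cancel_left])
    refine ⟨z, hz, (hU φ _).2 ⟨by rw [h1]; exact x.2, ?_⟩⟩
    rw [h2, hz]
    exact congrArg φ (Subtype.ext h1.symm)
  have hUm : ∀ φ, (U φ).map p = N ∧ (U φ).comap (LinearMap.ker p).subtype = W' := by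
    intro φ
    constructor
    · ext x
      constructor
      · rintro ⟨y, ⟨hy, -⟩, rfl⟩
        exact hy
      · intro hx
        obtain ⟨z, -, h⟩ := hex φ ⟨x, hx⟩
        exact ⟨_, h, by rw [map_add, hs', LinearMap.mem_ker.1 z.2, add_zero]⟩
    · ext z
      have h0 : p z = 0 := z.2
      have h2 : π z = z := Subtype.ext (by rw [hπ, h0, map_zero, sub_zero])
      rw [Submodule.mem_comap, Submodule.subtype_apply, hU, h2]
      have h3 : ∀ h : p z ∈ N, φ ⟨p z, h⟩ = 0 := fun h => by
        rw [← map_zero φ]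
        exact congrArg φ (Subtype.ext h0)
      constructor
      · rintro ⟨h, h4⟩
        rw [h3] at h4
        exact (Submodule.Quotient.mk_eq_zero W').1 h4
      · intro hz
        refine ⟨by rw [h0]; exact N.zero_mem, ?_⟩
        rw [h3]
        exact (Submodule.Quotient.mk_eq_zero W').2 hz
  have hbij : Function.Bijective fun φ => (⟨U φ, hUm φ⟩ :
      {W : Submodule k Y // W.map p = N ∧ W.comap (LinearMap.ker p).subtype = W'}) := by
    constructor
    · intro φ φ' h
      have h' : U φ = U φ' := congrArg Subtype.val h
      ext x
      obtain ⟨z, hz, h1⟩ := hex φ x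
      have h2 : p (s x + z) = x := by rw [map_add, hs', LinearMap.mem_ker.1 z.2, add_zero]
      have h3 : π (s x + z) = z := Subtype.ext (by rw [hπ, h2, add_sub_cancel_left])
      rw [h', hU] at h1
      obtain ⟨h4, h5⟩ := h1
      rw [h3, hz] at h5
      rw [h5]
      exact congrArg φ' (Subtype.ext h2)
    · rintro ⟨W, rfl, rfl⟩
      let f : W →ₗ[k] W.map p := (p.domRestrict W).codRestrict _ fun y => ⟨y, y.2, rfl⟩
      have hf : Function.Surjective f := by
        rintro ⟨_, y, hy, rfl⟩
        exact ⟨⟨y, hy⟩, rfl⟩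
      obtain ⟨r, hr⟩ := f.exists_rightInverse_of_surjective (LinearMap.range_eq_top.2 hf)
      have hr' : ∀ x, p (r x) = x := fun x => congrArg Subtype.val (LinearMap.congr_fun hr x)
      -- The linear map belonging to `W` takes the kernel component of any preimage in `W`, here
      -- chosen by the section `r`; modulo the kernel part of `W` the choice is irrelevant.
      refine ⟨Submodule.mkQ _ ∘ₗ π ∘ₗ W.subtype ∘ₗ r, Subtype.ext ?_⟩
      ext y
      simp only [hU, LinearMap.comp_apply, Submodule.subtype_apply]
      have key : ∀ h : p y ∈ W.map p,
          (Submodule.mkQ (W.comap (LinearMap.ker p).subtype) (π y) =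
            Submodule.mkQ (W.comap (LinearMap.ker p).subtype) (π (r ⟨p y, h⟩)) ↔ y ∈ W) := by
        intro h
        rw [Submodule.mkQ_apply, Submodule.mkQ_apply, Submodule.Quotient.eq, Submodule.mem_comap,
          Submodule.subtype_apply, Submodule.coe_sub, hπ, hπ, hr', sub_sub_sub_cancel_right]
        exact W.sub_mem_iff_left (r ⟨p y, h⟩).2
      constructor
      · rintro ⟨h, h1⟩
        exact (key h).1 h1
      · intro hy
        exact ⟨⟨y, hy, rfl⟩, (key ⟨y, hy, rfl⟩).2 hy⟩
  rw [← Nat.card_congr (Equiv.ofBijective _ hbij), natCard_eq_pow_finrank (K := k),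
    finrank_linearMap]

/-- The elements killed by the projections of index `j < i`. -/
def below {X : ℤ → Type*} [∀ i, AddCommGroup (X i)] [∀ i, Module k (X i)] {Y : Type*}
    [AddCommGroup Y] [Module k Y] (p : ∀ i, Y →ₗ[k] X i) (T : Finset ℤ) (i : ℤ) :
    Submodule k Y where
  carrier := {y | ∀ j ∈ T, j < i → p j y = 0}
  zero_mem' := fun j _ _ => map_zero _
  add_mem' := fun {x y} hx hy j hj hi => by rw [map_add, hx j hj hi, hy j hj hi, add_zero]
  smul_mem' := fun a x hx j hj hi => by rw [map_smul, hx j hj hi, smul_zero]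

variable {X : ℤ → Type*} [∀ i, AddCommGroup (X i)] [∀ i, Module k (X i)]

/-- Subspaces of a product with conditions on the graded pieces. -/
def gradedSubs {Y : Type*} [AddCommGroup Y] [Module k Y] (p : ∀ i, Y →ₗ[k] X i)
    (T : Finset ℤ) (S : ∀ i, Set (Submodule k (X i))) : Set (Submodule k Y) :=
  {W | ∀ i ∈ T, (W ⊓ below p T i).map (p i) ∈ S i}

/-- For the smallest index `t` the filtration condition is empty, and all other pieces are computed
inside the kernel of `p t`. This is the step of the induction on the index set. -/
lemma mem_gradedSubs_insert {Y : Type*} [AddCommGroup Y] [Module k Y] {p : ∀ i, Y →ₗ[k] X i}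
    {t : ℤ} {T : Finset ℤ} (ht : ∀ x ∈ T, t < x) {S : ∀ i, Set (Submodule k (X i))}
    {W : Submodule k Y} : W ∈ gradedSubs p (insert t T) S ↔
      W.map (p t) ∈ S t ∧ W.comap (LinearMap.ker (p t)).subtype ∈
        gradedSubs (fun i => (p i).domRestrict (LinearMap.ker (p t))) T S := by
  have h1 : W ⊓ below p (insert t T) t = W := by
    rw [inf_eq_left]
    intro y _ j hj hjt
    rcases Finset.mem_insert.1 hj with rfl | hj
    · exact absurd hjt (lt_irrefl _)
    · exact absurd hjt (ht j hj).le.not_gt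
  have h2 : ∀ i ∈ T, (W ⊓ below p (insert t T) i).map (p i) =
      (W.comap (LinearMap.ker (p t)).subtype ⊓
        below (fun i => (p i).domRestrict (LinearMap.ker (p t))) T i).map
          ((p i).domRestrict (LinearMap.ker (p t))) := by
    intro i hi
    ext x
    constructor
    · rintro ⟨y, ⟨hy, hy'⟩, rfl⟩
      have h0 : p t y = 0 := hy' t (Finset.mem_insert_self t T) (ht i hi)
      exact ⟨⟨y, h0⟩, ⟨hy, fun j hj hji => hy' j (Finset.mem_insert_of_mem hj) hji⟩, rfl⟩
    · rintro ⟨y, ⟨hy, hy'⟩, rfl⟩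
      refine ⟨y, ⟨hy, fun j hj hji => ?_⟩, rfl⟩
      rcases Finset.mem_insert.1 hj with rfl | hj
      · exact y.2
      · exact hy' j hj hji
  rw [gradedSubs, Set.mem_ofPred_eq, Finset.forall_mem_insert, h1]
  exact and_congr_right' (forall₂_congr fun i hi => by rw [h2 i hi])

/-- Removing the smallest index `t` sends `W` to its image under `p t` and its intersection with the
kernel. By `card_submodule_map_comap` every fibre has `q ^ (a t * ∑ b i)` elements, the sum being
the codimension of the kernel part. The dimensions are carried through the induction because this
codimension needs them. -/
lemma card_gradedSubs [Finite k] [∀ i, Module.Finite k (X i)] {a b : ℤ → ℕ}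
    (S : ∀ i, Set (Submodule k (X i))) (hX : ∀ i, finrank k (X i) = a i + b i)
    (hS : ∀ i, ∀ N ∈ S i, finrank k N = a i) (T : Finset ℤ) :
    ∀ {Y : Type*} [AddCommGroup Y] [Module k Y] [Module.Finite k Y] (p : ∀ i, Y →ₗ[k] X i)
      (_ : Function.Bijective fun y (i : T) => p i y),
      (finrank k Y = ∑ i ∈ T, (a i + b i) ∧
        ∀ W ∈ gradedSubs p T S, finrank k W = ∑ i ∈ T, a i) ∧
      Nat.card (gradedSubs p T S) =
        Nat.card k ^ (∑ i ∈ T, ∑ j ∈ T with j < i, b i * a j) * ∏ i ∈ T, Nat.card (S i) := by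
  induction T using Finset.induction_on_min with
  | empty =>
    intro Y _ _ _ p hp
    have hY : Subsingleton Y := ⟨fun x y => hp.1 (funext fun i => (Finset.notMem_empty _ i.2).elim)⟩
    have h1 : gradedSubs p ∅ S = Set.univ := Set.eq_univ_of_forall fun W i hi => by simp at hi
    refine ⟨⟨by rw [finrank_zero_of_subsingleton, Finset.sum_empty], fun W _ => by
      rw [finrank_zero_of_subsingleton, Finset.sum_empty]⟩, ?_⟩
    rw [h1]
    simp
  | insert t T ht ih =>
    intro Y _ _ _ p hp
    have htT : t ∉ T := fun h => lt_irrefl _ (ht t h)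
    have hsurj : Function.Surjective (p t) := by
      intro x
      obtain ⟨y, hy⟩ := hp.2 fun i => Function.update (0 : ∀ i, X i) t x i
      have := congrFun hy ⟨t, Finset.mem_insert_self t T⟩
      exact ⟨y, this.trans (Function.update_self t x _)⟩
    obtain ⟨⟨h1, h2⟩, h3⟩ := ih (fun i => (p i).domRestrict (LinearMap.ker (p t))) (by
      constructor
      · intro x y hxy
        apply Subtype.ext
        apply hp.1
        ext ⟨i, hi⟩
        rcases Finset.mem_insert.1 hi with rfl | hi
        · exact (LinearMap.mem_ker.1 x.2).trans (LinearMap.mem_ker.1 y.2).symm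
        · exact congrFun hxy ⟨i, hi⟩
      · intro x
        obtain ⟨y, hy⟩ := hp.2 fun i => if h : (i : ℤ) ∈ T then x ⟨i, h⟩ else 0
        have h0 := congrFun hy ⟨t, Finset.mem_insert_self t T⟩
        simp only [htT, dif_neg, not_false_eq_true] at h0
        refine ⟨⟨y, h0⟩, funext fun i => ?_⟩
        have h4 := congrFun hy ⟨i, Finset.mem_insert_of_mem i.2⟩
        simpa using h4)
    have hrank := (p t).finrank_range_add_finrank_ker
    rw [LinearMap.range_eq_top.2 hsurj, finrank_top, hX] at hrank
    refine ⟨⟨?_, fun W hW => ?_⟩, ?_⟩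
    · rw [Finset.sum_insert htT, ← h1, hrank]
    · obtain ⟨h4, h5⟩ := (mem_gradedSubs_insert ht).1 hW
      rw [Finset.sum_insert htT, ← h2 _ h5, ← hS t _ h4]
      have h6 := ((p t).domRestrict W).finrank_range_add_finrank_ker
      have h7 : LinearMap.range ((p t).domRestrict W) = W.map (p t) := by
        ext x
        simp
      have h8 : finrank k (LinearMap.ker ((p t).domRestrict W)) =
          finrank k (W.comap (LinearMap.ker (p t)).subtype) := by
        refine LinearEquiv.finrank_eq
          { toFun := fun y => ⟨⟨y.1.1, y.2⟩, y.1.2⟩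
            invFun := fun y => ⟨⟨y.1.1, y.2⟩, y.1.2⟩
            map_add' := fun _ _ => rfl
            map_smul' := fun _ _ => rfl
            left_inv := fun _ => rfl
            right_inv := fun _ => rfl }
      rw [h7, h8] at h6
      exact h6.symm
    · let G := gradedSubs (fun i => (p i).domRestrict (LinearMap.ker (p t))) T S
      let f : gradedSubs p (insert t T) S → S t × G := fun W =>
        (⟨_, ((mem_gradedSubs_insert ht).1 W.2).1⟩, ⟨_, ((mem_gradedSubs_insert ht).1 W.2).2⟩)
      have hfib : ∀ z : S t × G, Nat.card {W // f W = z} =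
          Nat.card k ^ (a t * ∑ i ∈ T, b i) := by
        rintro ⟨⟨N, hN⟩, ⟨W', hW'⟩⟩
        have h9 : finrank k (LinearMap.ker (p t) ⧸ W') = ∑ i ∈ T, b i := by
          have h10 := W'.finrank_quotient_add_finrank
          rw [h1, h2 W' hW', Finset.sum_add_distrib] at h10
          omega
        rw [← h9, ← hS t N hN, ← card_submodule_map_comap hsurj N W']
        refine Nat.card_congr
          { toFun := fun W => ⟨W.1.1, congrArg (fun z => z.1.1) W.2, congrArg (fun z => z.2.1) W.2⟩
            invFun := fun W => ⟨⟨W.1, (mem_gradedSubs_insert ht).2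
              ⟨by rw [W.2.1]; exact hN, by rw [W.2.2]; exact hW'⟩⟩, Prod.ext (Subtype.ext W.2.1) (Subtype.ext W.2.2)⟩
            left_inv := fun _ => rfl
            right_inv := fun _ => rfl }
      have hcard := Nat.card_congr (Equiv.sigmaFiberEquiv f)
      have := Fintype.ofFinite (S t × G)
      rw [Nat.card_sigma, Finset.sum_congr rfl fun z _ => hfib z, Finset.sum_const,
        Finset.card_univ, ← Nat.card_eq_fintype_card, Nat.card_prod, h3, smul_eq_mul] at hcard
      rw [← hcard, Finset.prod_insert htT, Finset.sum_insert htT]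
      have h11 : ∑ j ∈ insert t T with j < t, b t * a j = 0 := by
        refine Finset.sum_eq_zero fun j hj => ?_
        obtain ⟨hj, hjt⟩ := Finset.mem_filter.1 hj
        rcases Finset.mem_insert.1 hj with rfl | hj
        · exact absurd hjt (lt_irrefl _)
        · exact absurd hjt (ht j hj).le.not_gt
      have h12 : ∀ i ∈ T, ∑ j ∈ insert t T with j < i, b i * a j =
          b i * a t + ∑ j ∈ T with j < i, b i * a j := by
        intro i hi
        rw [Finset.filter_insert, if_pos (ht i hi), Finset.sum_insert]
        simp [htT]
      rw [h11, Finset.sum_congr rfl h12, Finset.sum_add_distrib, ← Finset.sum_mul, zero_add,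
        pow_add, mul_comm (∑ i ∈ T, b i)]
      ring

end FilteredCount

/-! ### Lattices between `ϖΛ` and `Λ` as subspaces of `Λ/ϖΛ` -/

section LatticeCount

open Module

variable {F₀ F : Type*} [Field F₀] [Field F] [ValuativeRel F] [Algebra F₀ F]
  {σ : F ≃ₐ[F₀] F} {V : Type*} [AddCommGroup V] [Module F V]
  {c : FormCase} {ϖ : F} {τ : 𝓀[F] →+* 𝓀[F]} {q₀ : ℕ} {B : Form σ V}
  {Λ L : Submodule 𝒪[F] V}

/-- The map of residue spaces induced by a map of lattices. -/
def resMap {P P' : Submodule 𝒪[F] V} (f : P →ₗ[𝒪[F]] P') : ResSpace P →ₗ[𝓀[F]] ResSpace P' :=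
  LinearMap.extendScalarsOfSurjective (R := 𝒪[F]) IsLocalRing.residue_surjective
    (Submodule.mapQ _ _ f (by
      rw [← Submodule.map_le_iff_le_comap, Submodule.map_smul'']
      exact Submodule.smul_mono le_rfl le_top))

/-- The sublattice of `Λ` corresponding to a subspace of its residue space. -/
def ofResSub (Λ : Submodule 𝒪[F] V) (W : Submodule 𝓀[F] (ResSpace Λ)) : Submodule 𝒪[F] V :=
  ((W.restrictScalars 𝒪[F]).comap (resMk Λ)).map Λ.subtype

lemma mem_ofResSub {W : Submodule 𝓀[F] (ResSpace Λ)} {x : V} :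
    x ∈ ofResSub Λ W ↔ ∃ h : x ∈ Λ, resMk Λ ⟨x, h⟩ ∈ W := by
  constructor
  · rintro ⟨y, hy, rfl⟩
    exact ⟨y.2, hy⟩
  · rintro ⟨h, hx⟩
    exact ⟨⟨x, h⟩, hx, rfl⟩

lemma ofResSub_le (W : Submodule 𝓀[F] (ResSpace Λ)) : ofResSub Λ W ≤ Λ := fun _ hx =>
  (mem_ofResSub.1 hx).1

lemma smul_le_ofResSub (hS : LatSetting c σ ϖ τ q₀) (W : Submodule 𝓀[F] (ResSpace Λ)) :
    ϖ • Λ ≤ ofResSub Λ W := by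
  intro x hx
  obtain ⟨y, hy, rfl⟩ := (Submodule.mem_smul_pointwise_iff_exists _ _ _).1 hx
  have h1 := smul_le_of_le hS Λ hx
  refine mem_ofResSub.2 ⟨h1, ?_⟩
  rw [hS.resMk_eq_zero.2 ⟨y, hy, rfl⟩]
  exact W.zero_mem

lemma resSub_ofResSub (hS : LatSetting c σ ϖ τ q₀) (W : Submodule 𝓀[F] (ResSpace Λ)) :
    resSub Λ (ofResSub Λ W) = W := by
  ext x
  obtain ⟨x, rfl⟩ := resMk_surjective Λ x
  rw [resMk_mem_resSub hS fun y hy =>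
    smul_le_ofResSub hS W (Submodule.smul_mem_pointwise_smul _ _ _ hy), mem_ofResSub]
  exact ⟨fun h => h.2, fun h => ⟨x.2, h⟩⟩

lemma ofResSub_resSub (hS : LatSetting c σ ϖ τ q₀) (hL : L ≤ Λ) (hL' : ϖ • Λ ≤ L) :
    ofResSub Λ (resSub Λ L) = L := by
  ext x
  rw [mem_ofResSub]
  have h1 : ∀ y ∈ Λ, ϖ • y ∈ L := fun y hy => hL' (Submodule.smul_mem_pointwise_smul _ _ _ hy)
  constructor
  · rintro ⟨h, hx⟩
    exact (resMk_mem_resSub hS h1).1 hx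
  · exact fun hx => ⟨hL hx, (resMk_mem_resSub hS h1).2 hx⟩

lemma isLattice_of_smul_le [IsNoetherianRing 𝒪[F]] (hS : LatSetting c σ ϖ τ q₀)
    (hΛ : Λ.IsLattice F) (hL : L ≤ Λ) (hL' : ϖ • Λ ≤ L) : L.IsLattice F := by
  refine ⟨Submodule.FG.of_le hΛ.fg hL, ?_⟩
  rw [eq_top_iff, ← hΛ.span_eq_top, Submodule.span_le]
  intro x hx
  have h1 := Submodule.smul_mem (Submodule.span F (L : Set V)) ϖ⁻¹
    (Submodule.subset_span (hL' (Submodule.smul_mem_pointwise_smul _ ϖ _ hx)))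
  rwa [smul_smul, inv_mul_cancel₀ hS.ne_zero, one_smul] at h1

namespace JordanSplitting

variable (J : JordanSplitting B ϖ Λ)

/-- The projection of residue spaces. -/
def resProj (i : ℤ) : ResSpace Λ →ₗ[𝓀[F]] ResSpace (inter Λ (J.comp i)) :=
  resMap ((((J.proj i).restrictScalars 𝒪[F]).domRestrict Λ).codRestrict _
    fun x => J.proj_mem_inter x.2)

lemma resProj_resMk (i : ℤ) (x : Λ) : J.resProj i (resMk Λ x) =
    resMk (inter Λ (J.comp i)) ⟨_, J.proj_mem_inter x.2⟩ := rfl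

lemma resProj_bijective [FiniteDimensional F V] (hS : LatSetting c σ ϖ τ q₀) :
    Function.Bijective fun (y : ResSpace Λ) (i : J.supp) => J.resProj i y := by
  let Φ : ResSpace Λ →ₗ[𝓀[F]] (∀ i : J.supp, ResSpace (inter Λ (J.comp i))) :=
    LinearMap.pi fun i => J.resProj i
  constructor
  · change Function.Injective Φ
    rw [injective_iff_map_eq_zero]
    intro x hx
    obtain ⟨x, rfl⟩ := resMk_surjective Λ x
    have h1 : ∀ i ∈ J.supp, J.proj i x ∈ ϖ • Λ := by
      intro i hi
      have h2 := congrFun hx ⟨i, hi⟩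
      change J.resProj i (resMk Λ x) = 0 at h2
      rw [resProj_resMk, hS.resMk_eq_zero] at h2
      obtain ⟨y, hy, h3⟩ := h2
      change J.proj i x = ϖ • y at h3
      rw [h3]
      exact Submodule.smul_mem_pointwise_smul _ _ _ hy.1
    have h2 : (x : V) ∈ ϖ • Λ := by
      rw [← J.sum_proj (x : V)]
      exact sum_mem h1
    obtain ⟨y, hy, h3⟩ := (Submodule.mem_smul_pointwise_iff_exists _ _ _).1 h2
    exact hS.resMk_eq_zero.2 ⟨y, hy, h3.symm⟩
  · intro g
    choose w hw using fun i => resMk_surjective _ (g i)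
    have hmem : ∑ i, (w i : V) ∈ Λ := sum_mem fun i _ => (w i).2.1
    refine ⟨resMk Λ ⟨_, hmem⟩, funext fun i => ?_⟩
    change J.resProj i (resMk Λ ⟨_, hmem⟩) = g i
    rw [resProj_resMk, ← hw]
    refine congrArg _ (Subtype.ext ?_)
    change J.proj i (∑ i, (w i : V)) = w i
    rw [map_sum, Finset.sum_eq_single i]
    · exact J.proj_of_mem (w i).2.2
    · exact fun j _ hj => J.proj_of_mem_ne (fun h => hj (Subtype.ext h)) (w j).2.2
    · simp

/-- The projections `N_i` as graded pieces. -/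
lemma map_below_eq_resN [FiniteDimensional F V] (hS : LatSetting c σ ϖ τ q₀) (hL : L ≤ Λ)
    (hL' : ϖ • Λ ≤ L) (i : ℤ) :
    (resSub Λ L ⊓ below (X := fun i => ResSpace (inter Λ (J.comp i))) J.resProj J.supp i).map
      (J.resProj i) = J.resN L i := by
  have hϖL : ∀ y ∈ Λ, ϖ • y ∈ L := fun y hy => hL' (Submodule.smul_mem_pointwise_smul _ _ _ hy)
  ext x
  constructor
  · rintro ⟨w, ⟨hw, hw'⟩, rfl⟩
    obtain ⟨y, rfl⟩ := resMk_surjective Λ w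
    replace hw : (y : V) ∈ L := (resMk_mem_resSub hS hϖL).1 hw
    have h1 : ∀ j ∈ J.supp, j < i → J.proj j y ∈ L := by
      intro j hj hji
      have h2 := hw' j hj hji
      rw [resProj_resMk, hS.resMk_eq_zero] at h2
      obtain ⟨z, hz, h3⟩ := h2
      change J.proj j y = ϖ • z at h3
      rw [h3]
      exact hϖL z hz.1
    -- The lower projections of `y` lie in `ϖΛ ⊆ L`. Subtracting them brings `y` into `L ∩ V^(≥ i)`
    -- without changing its `i`-th projection.
    have h2 : ∀ j, J.proj j (∑ k ∈ J.supp with k < i, J.proj k (y : V)) =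
        if j < i then J.proj j y else 0 := by
      intro j
      rw [map_sum]
      split_ifs with hj
      · by_cases hjs : j ∈ J.supp
        · rw [Finset.sum_eq_single j]
          · exact J.proj_of_mem (J.proj_mem j y)
          · exact fun k _ hk => J.proj_of_mem_ne hk (J.proj_mem k y)
          · intro h
            exact absurd (Finset.mem_filter.2 ⟨hjs, hj⟩) h
        · rw [J.proj_eq_zero hjs, Finset.sum_eq_zero fun k _ => J.proj_eq_zero hjs _]
      · refine Finset.sum_eq_zero fun k hk => J.proj_of_mem_ne ?_ (J.proj_mem k y)
        rintro rfl
        exact hj (Finset.mem_filter.1 hk).2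
    rw [resProj_resMk, resN, resMk_mem_resSub hS fun y hy => J.smul_mem_N hL' hy]
    refine ⟨y - ∑ k ∈ J.supp with k < i, J.proj k (y : V), ⟨sub_mem hw (sum_mem fun j hj => ?_),
      J.mem_compGE.2 fun j hj => ?_⟩, ?_⟩
    · obtain ⟨hj, hji⟩ := Finset.mem_filter.1 hj
      exact h1 j hj hji
    · rw [map_sub, h2, if_pos hj, sub_self]
    · change J.proj i (_ - _) = J.proj i y
      rw [map_sub, h2, if_neg (lt_irrefl i), sub_zero]
  · intro hx
    obtain ⟨p, rfl⟩ := resMk_surjective _ x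
    rw [resN, resMk_mem_resSub hS fun y hy => J.smul_mem_N hL' hy] at hx
    obtain ⟨y, hy, hyp⟩ := hx
    refine ⟨resMk Λ ⟨y, hL hy.1⟩, ⟨(resMk_mem_resSub hS hϖL).2 hy.1, fun j _ hji => ?_⟩, ?_⟩
    · rw [resProj_resMk, ← map_zero (resMk _)]
      exact congrArg _ (Subtype.ext (J.mem_compGE.1 hy.2 j hji))
    · rw [resProj_resMk]
      exact congrArg _ (Subtype.ext hyp)

/-- The lattices `L` with conditions on the projections `N_i`. -/
lemma ncard_eq_card_gradedSubs [FiniteDimensional F V] [IsNoetherianRing 𝒪[F]]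
    (hS : LatSetting c σ ϖ τ q₀) (hΛ : Λ.IsLattice F)
    (S : ∀ i, Set (Submodule 𝓀[F] (ResSpace (inter Λ (J.comp i))))) :
    Set.ncard {L ∈ lattices ϖ Λ | ∀ i ∈ J.supp, J.resN L i ∈ S i} =
      Nat.card (gradedSubs (X := fun i => ResSpace (inter Λ (J.comp i))) J.resProj J.supp S) := by
  rw [← Nat.card_coe_set_eq]
  refine Nat.card_congr
    { toFun := fun L => ⟨resSub Λ L.1, fun i hi => ?_⟩
      invFun := fun W => ⟨ofResSub Λ W.1, ⟨isLattice_of_smul_le hS hΛ (ofResSub_le W.1)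
        (smul_le_ofResSub hS W.1), smul_le_ofResSub hS W.1, ofResSub_le W.1⟩, fun i hi => ?_⟩
      left_inv := fun L => Subtype.ext (ofResSub_resSub hS L.2.1.2.2 L.2.1.2.1)
      right_inv := fun W => Subtype.ext (resSub_ofResSub hS W.1) }
  · rw [J.map_below_eq_resN hS L.2.1.2.2 L.2.1.2.1]
    exact L.2.2 i hi
  · rw [← J.map_below_eq_resN hS (ofResSub_le W.1) (smul_le_ofResSub hS W.1),
      resSub_ofResSub hS]
    exact W.2 i hi

end JordanSplitting

lemma HT.eq_of_subsingleton {k X : Type*} [Field k] [AddCommGroup X] [Module k X] {τ : k →+* k}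
    [Subsingleton X] {b : X →ₗ[k] X →ₛₗ[τ] k} {d : ℕ} {χ : c.Sign} (h : HT c b d χ) : d = 0 := by
  obtain ⟨-, -, h, -⟩ := h
  rw [finrank_zero_of_subsingleton] at h
  exact (Nat.mul_eq_zero.1 h.symm).resolve_left c.γ_pos.ne'

lemma subTyp_of_subsingleton {k X : Type*} [Field k] [AddCommGroup X] [Module k X] {τ : k →+* k}
    [Subsingleton X] (b : X →ₗ[k] X →ₛₗ[τ] k) (W : Submodule k X) : SubTyp c b W 0 1 := by
  have : IsEmpty (Fin (c.γ * 0)) := by rw [mul_zero]; infer_instance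
  refine ⟨fun _ => 0, fun _ => W.zero_mem, ?_, ?_, ?_⟩
  · rw [Matrix.det_isEmpty]
    exact one_ne_zero
  · rw [finrank_zero_of_subsingleton, finrank_zero_of_subsingleton, mul_zero]
  · rw [Matrix.det_isEmpty, FormCase.sign_one]

namespace JordanSplitting

variable (J : JordanSplitting B ϖ Λ)

lemma subsingleton_resSpace [FiniteDimensional F V] {i : ℤ} (hi : i ∉ J.supp) :
    Subsingleton (ResSpace (inter Λ (J.comp i))) := by
  have : Subsingleton (inter Λ (J.comp i)) := by
    refine ⟨fun x y => Subtype.ext ?_⟩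
    have h : ∀ x ∈ inter Λ (J.comp i), x = 0 := fun x hx => by
      simpa [J.comp_eq_bot hi] using hx.2
    rw [h x x.2, h y y.2]
  exact (resMk_surjective (inter Λ (J.comp i))).subsingleton

/-- Since the type of the whole residue space is known, `n`, `ψ₁` and `m` determine `l` and `ψ₂` by
cancellation. Outside the support everything is zero and normalization fixes the signs. -/
lemma isDataOf_iff_mem_goodSubs [FiniteDimensional F V] [Finite 𝓀[F]]
    (hS : LatSetting c σ ϖ τ q₀) (hB : c.IsForm B) (hΛ : Λ.FG) (hL : L ≤ Λ) (hL' : ϖ • Λ ≤ L)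
    {d : TypData c} (hd : d.IsNormalized)
    (h : HasTyp c B ϖ Λ d.e (d.χ (c.sign (-1 : 𝓀[F])))) :
    IsDataOf J (J.N L) d ↔
      ∀ i ∈ J.supp, J.resN L i ∈ goodSubs c (J.resB hS i) (d.n i) (d.ψ₁ i) (d.m i) := by
  have hT := (J.hasTyp_iff hS hΛ).1 h
  rw [J.isDataOf_iff hS hB hΛ hL hL']
  constructor
  · exact fun h i _ => ⟨(h i).1, (h i).2.1⟩
  · intro h i
    have := J.finite_inter hΛ i
    by_cases hi : i ∈ J.supp
    · obtain ⟨h1, h2⟩ := h i hi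
      refine ⟨h1, h2, ?_⟩
      have hb := J.isResForm_resB hS hB i
      obtain ⟨l, ψ, h3⟩ := exists_subTyp hS.isResSetting hb (orth (J.resB hS i) (J.resN L i))
      obtain ⟨β⟩ := h2.exists_adaptedBasis hS.isResSetting hb (J.nondeg_resB hS i) h1 h3
      obtain ⟨h4, h5⟩ := (β.hT hS.isResSetting hb).unique hS.isResSetting (hT i)
      obtain rfl : l = d.l i := by
        simp only [TypData.e] at h4
        omega
      rwa [mul_left_cancel h5] at h3
    · have := J.subsingleton_resSpace hi
      have h1 := (hT i).eq_of_subsingleton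
      simp only [TypData.e] at h1
      have hn : d.n i = 0 := by omega
      have hl : d.l i = 0 := by omega
      have hm : d.m i = 0 := by
        have h2 : 0 < 2 / c.γ := by cases c <;> simp [FormCase.γ]
        have h3 : 2 / c.γ * d.m i = 0 := by omega
        exact (Nat.mul_eq_zero.1 h3).resolve_left h2.ne'
      rw [hn, hl, hm, (hd i).1 hn, (hd i).2 hl]
      exact ⟨finrank_zero_of_subsingleton, subTyp_of_subsingleton _ _,
        subTyp_of_subsingleton _ _⟩

end JordanSplitting

lemma TypData.eq_zero_of_e_eq_zero {d : TypData c} {i : ℤ} (h : d.e i = 0) :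
    d.n i = 0 ∧ d.m i = 0 ∧ d.l i = 0 := by
  simp only [TypData.e] at h
  have h2 : 0 < 2 / c.γ := by cases c <;> simp [FormCase.γ]
  have h3 : 2 / c.γ * d.m i = 0 := by omega
  exact ⟨by omega, (Nat.mul_eq_zero.1 h3).resolve_left h2.ne', by omega⟩

/-- The exponent of `q` in the number of lattices as a finite sum. -/
lemma TypData.finsum_exponent {d : TypData c} {T : Finset ℤ} (h : ∀ i ∉ T, d.e i = 0) :
    (∑ᶠ p : {p : ℤ × ℤ // p.2 < p.1},
      (d.m p.1.1 + c.γ * d.l p.1.1) * (d.m p.1.2 + c.γ * d.n p.1.2)) =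
    ∑ i ∈ T, ∑ j ∈ T with j < i, (d.m i + c.γ * d.l i) * (d.m j + c.γ * d.n j) := by
  have hm : ∀ i ∉ T, d.n i = 0 ∧ d.m i = 0 ∧ d.l i = 0 := fun i hi => eq_zero_of_e_eq_zero (h i hi)
  rw [finsum_subtype_eq_finsum_cond
    (f := fun p : ℤ × ℤ => (d.m p.1 + c.γ * d.l p.1) * (d.m p.2 + c.γ * d.n p.2)),
    finsum_cond_eq_sum_of_cond_iff
    (fun p : ℤ × ℤ => (d.m p.1 + c.γ * d.l p.1) * (d.m p.2 + c.γ * d.n p.2))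
    (t := (T ×ˢ T).filter fun p => p.2 < p.1), Finset.sum_filter,
    Finset.sum_product]
  · simp only [Finset.sum_filter]
  · rintro ⟨i, j⟩ hij
    have hi : i ∈ T := by
      by_contra hi
      simp [hm i hi] at hij
    have hj : j ∈ T := by
      by_contra hj
      simp [hm j hj] at hij
    simp [hi, hj]

/-- The number of lattices with given data. -/
theorem JordanSplitting.ncard_isDataOf [FiniteDimensional F V] [Finite 𝓀[F]]
    [IsNoetherianRing 𝒪[F]] (J : JordanSplitting B ϖ Λ) (hS : LatSetting c σ ϖ τ q₀)
    (hB : c.IsForm B) (hΛ : Λ.IsLattice F) {d : TypData c} (hd : d.IsNormalized)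
    (h : HasTyp c B ϖ Λ d.e (d.χ (c.sign (-1 : 𝓀[F])))) :
    (Set.ncard {L ∈ lattices ϖ Λ | IsDataOf J (J.N L) d} : ℚ) =
      d.count q₀ (Nat.card 𝓀[F]) (c.sign (-1 : 𝓀[F])) := by
  have hfg : Λ.FG := hΛ.fg
  have hT := (J.hasTyp_iff hS hfg).1 h
  have hset : {L ∈ lattices ϖ Λ | IsDataOf J (J.N L) d} = {L ∈ lattices ϖ Λ | ∀ i ∈ J.supp,
      J.resN L i ∈ goodSubs c (J.resB hS i) (d.n i) (d.ψ₁ i) (d.m i)} := by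
    ext L
    exact and_congr_right fun hL => J.isDataOf_iff_mem_goodSubs hS hB hfg hL.2.2 hL.2.1 hd h
  have hfin : ∀ i, Module.Finite 𝒪[F] (inter Λ (J.comp i)) := J.finite_inter hfg
  have hfin' : Module.Finite 𝒪[F] Λ := Module.Finite.iff_fg.2 hfg
  have hγ : c.γ * (2 / c.γ) = 2 := by cases c <;> simp [FormCase.γ]
  have hdim : ∀ i, finrank 𝓀[F] (ResSpace (inter Λ (J.comp i))) =
      (d.m i + c.γ * d.n i) + (d.m i + c.γ * d.l i) := by
    intro i
    rw [(hT i).finrank_eq, TypData.e, mul_add, mul_add, ← mul_assoc, hγ]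
    ring
  have he : ∀ i ∉ J.supp, d.e i = 0 := by
    intro i hi
    have := J.subsingleton_resSpace hi
    exact (hT i).eq_of_subsingleton
  have hcard := (card_gradedSubs (X := fun i => ResSpace (inter Λ (J.comp i)))
    (fun i => goodSubs c (J.resB hS i) (d.n i) (d.ψ₁ i) (d.m i)) hdim
    (fun i N hN => by rw [hN.2.finrank_eq, hN.1, add_comm]) J.supp J.resProj
    (J.resProj_bijective hS)).2
  rw [hset, J.ncard_eq_card_gradedSubs hS hΛ, hcard, TypData.count, TypData.finsum_exponent he,
    finprod_eq_prod_of_mulSupport_subset (s := J.supp)]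
  · push_cast
    congr 1
    refine Finset.prod_congr rfl fun i _ => ?_
    exact card_goodSubs_eq_Q hS.isResSetting (J.isResForm_resB hS hB i) (hT i) (hd i).1 (hd i).2
  -- Outside the support the factor is `1`: it counts the subspaces of the zero space.
  · intro i hi
    by_contra hi'
    obtain ⟨hn, hm, hl⟩ := TypData.eq_zero_of_e_eq_zero (he i hi')
    apply hi
    change Q c q₀ (Nat.card 𝓀[F]) (c.sign (-1 : 𝓀[F])) (d.n i) (d.ψ₁ i) (d.m i) (d.l i) (d.ψ₂ i) = 1
    rw [← card_goodSubs_eq_Q hS.isResSetting (J.isResForm_resB hS hB i) (hT i) (hd i).1 (hd i).2]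
    have := J.subsingleton_resSpace hi'
    have h1 : goodSubs c (J.resB hS i) (d.n i) (d.ψ₁ i) (d.m i) = Set.univ := by
      refine Set.eq_univ_of_forall fun W => ?_
      rw [hn, hm, (hd i).1 hn]
      exact ⟨finrank_zero_of_subsingleton, subTyp_of_subsingleton _ _⟩
    rw [h1]
    simp

end LatticeCount

/-! ### Involutions of finite fields -/

section FiniteField

variable {k : Type*} [Field k] [Finite k]

/-- A nontrivial involution of a finite field is the `q₀`-power map, where `q₀` is the number of
fixed elements. -/
theorem card_and_eq_pow_of_involutive {τ : k →+* k} (hτ : ∀ x, τ (τ x) = x)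
    (hne : τ ≠ RingHom.id k) {q₀ : ℕ} (hq : Nat.card (τ.eqLocusField (RingHom.id k)) = q₀) :
    Nat.card k = q₀ ^ 2 ∧ ∀ x, τ x = x ^ q₀ := by
  classical
  have := Fintype.ofFinite k
  set K := τ.eqLocusField (RingHom.id k) with hK
  have hmem (x : k) : x ∈ K ↔ τ x = x := Iff.rfl
  have : Fintype K := Fintype.ofFinite K
  have hqK : Fintype.card K = q₀ := by rw [← hq, Nat.card_eq_fintype_card]
  have hq1 : 1 < q₀ := hqK ▸ Fintype.one_lt_card
  have hpow {x : k} (hx : x ∈ K) : x ^ q₀ = x := by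
    have := FiniteField.pow_card (⟨x, hx⟩ : K)
    rw [hqK] at this
    exact congrArg Subtype.val this
  obtain ⟨p, hp⟩ := CharP.exists k
  have : CharP K p := (RingHom.charP_iff K.subtype K.subtype.injective p).2 hp
  obtain ⟨n, hpp, hn⟩ := FiniteField.card K p
  have : Fact p.Prime := ⟨hpp⟩
  rw [hqK] at hn
  have hadd (x y : k) : (x + y) ^ q₀ = x ^ q₀ + y ^ q₀ := by
    have : CharP k p := hp
    rw [hn]; exact add_pow_char_pow x y p n
  -- The polynomial `X ^ q₀ - X` has at most `q₀` roots, and the `q₀` elements of the fixed field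
  -- are already roots.
  have hback {x : k} (hx : x ^ q₀ = x) : x ∈ K := by
    by_contra hxK
    let s : Finset k := insert x (Finset.univ.filter (· ∈ K))
    have hs : s.card = q₀ + 1 := by
      rw [Finset.card_insert_of_notMem (by simpa using hxK), ← hqK, Fintype.card_subtype]
    have hle := Polynomial.card_le_degree_of_subset_roots
      (p := (Polynomial.X ^ q₀ - Polynomial.X : Polynomial k)) (Z := s) (by
        intro y hy
        rw [Finset.mem_val] at hy
        rw [Polynomial.mem_roots (FiniteField.X_pow_card_sub_X_ne_zero k hq1)]
        have : y ^ q₀ = y := by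
          rcases Finset.mem_insert.1 hy with rfl | hy
          · exact hx
          · exact hpow (by simpa using hy)
        simp [this])
    rw [FiniteField.X_pow_card_sub_X_natDegree_eq k hq1] at hle
    omega
  have hτq (x : k) : τ x = x ^ q₀ := by
    have hs : (x + τ x) ^ q₀ = x + τ x := hpow ((hmem _).2 (by rw [map_add, hτ, add_comm]))
    have hm : (x * τ x) ^ q₀ = x * τ x := hpow ((hmem _).2 (by rw [map_mul, hτ, mul_comm]))
    rw [hadd] at hs
    rw [mul_pow] at hm
    -- The trace `x + τ x` and the norm `x * τ x` lie in the fixed field, so `x ^ q₀` is a root of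
    -- the quadratic polynomial with roots `x` and `τ x`.
    have h0 : (x ^ q₀ - x) * (x ^ q₀ - τ x) = 0 := by
      linear_combination (x ^ q₀) * hs - hm
    rcases mul_eq_zero.1 h0 with h | h
    · have h := sub_eq_zero.1 h
      rw [h]
      exact (hmem x).1 (hback h)
    · exact (sub_eq_zero.1 h).symm
  refine ⟨?_, hτq⟩
  have hcard : Nat.card k = q₀ ^ Module.finrank K k := by
    rw [Module.natCard_eq_pow_finrank (K := K), hq]
  -- Applying `τ` twice makes every element a root of `X ^ (q₀ ^ 2) - X`. The opposite inequality
  -- holds because `τ ≠ id` forces degree at least two over the fixed field.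
  have hle : Nat.card k ≤ q₀ ^ 2 := by
    have hle := Polynomial.card_le_degree_of_subset_roots
      (p := (Polynomial.X ^ (q₀ ^ 2) - Polynomial.X : Polynomial k)) (Z := Finset.univ) (by
        intro y _
        have h2 : 1 < q₀ ^ 2 := Nat.one_lt_pow two_ne_zero hq1
        rw [Polynomial.mem_roots (FiniteField.X_pow_card_sub_X_ne_zero k h2)]
        have : y ^ q₀ ^ 2 = y := by rw [pow_two, pow_mul, ← hτq, ← hτq, hτ]
        simp [this])
    rw [FiniteField.X_pow_card_sub_X_natDegree_eq k (Nat.one_lt_pow two_ne_zero hq1)] at hle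
    rwa [Nat.card_eq_fintype_card]
  have h2 : 2 ≤ Module.finrank K k := by
    by_contra! hlt
    have hle1 : Nat.card k ≤ Nat.card K := by
      rw [hcard, hq]
      calc q₀ ^ Module.finrank K k ≤ q₀ ^ 1 := Nat.pow_le_pow_right (by omega) (by omega)
        _ = q₀ := pow_one _
    have hsurj : Function.Surjective K.subtype := by
      have := Nat.card_le_card_of_injective _ K.subtype.injective
      exact ((Nat.bijective_iff_injective_and_card _).2
        ⟨K.subtype.injective, le_antisymm this hle1⟩).2
    refine hne (RingHom.ext fun x => ?_)
    obtain ⟨y, rfl⟩ := hsurj x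
    exact (hmem _).1 y.2
  exact le_antisymm hle (hcard ▸ Nat.pow_le_pow_right (by omega) h2)

end FiniteField

/-! ### Rings of integers, Hensel's lemma and Teichmüller representatives -/

section Restrict

variable {K L : Type*} [Field K] [Field L]

/-- If `f a` is invertible in `C`, the inverse of `a` in the field is integral because its image is.
-/
lemma isLocalHom_restrict (f : K →+* L) {A : Subring K} {C : Subring L}
    (h : ∀ x, f x ∈ C ↔ x ∈ A) :
    IsLocalHom (f.restrict A C fun x hx => (h x).2 hx) := by
  refine ⟨fun a ha => ?_⟩
  obtain ⟨b, hb⟩ := isUnit_iff_exists_inv.1 ha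
  have hb' : f a * b = 1 := congrArg Subtype.val hb
  have hf : f a ≠ 0 := left_ne_zero_of_mul_eq_one hb'
  have ha0 : (a : K) ≠ 0 := fun h0 => hf (by rw [h0, map_zero])
  have hinv : (a : K)⁻¹ ∈ A := by
    rw [← h, map_inv₀, ← eq_inv_of_mul_eq_one_right hb']
    exact b.2
  exact isUnit_iff_exists_inv.2 ⟨⟨_, hinv⟩, Subtype.ext (mul_inv_cancel₀ ha0)⟩

end Restrict

section Integers

variable {K : Type*} [Field K] [ValuativeRel K]

lemma mem_integer_iff_vle (x : K) : x ∈ 𝒪[K] ↔ x ≤ᵥ 1 := by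
  rw [Valuation.Compatible.vle_iff_le (v := ValuativeRel.valuation K), map_one]
  rfl

lemma inv_mem_integer_of_notMem {x : K} (hx : x ∉ 𝒪[K]) : x⁻¹ ∈ 𝒪[K] := by
  have h : 1 < ValuativeRel.valuation K x := not_le.1 hx
  change ValuativeRel.valuation K x⁻¹ ≤ 1
  rw [map_inv₀]
  exact inv_le_one_of_one_le₀ h.le

lemma inv_mem_maximalIdeal_of_notMem {x : K} (hx : x ∉ 𝒪[K]) :
    (⟨x⁻¹, inv_mem_integer_of_notMem hx⟩ : 𝒪[K]) ∈ 𝓂[K] := by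
  rw [IsLocalRing.mem_maximalIdeal, mem_nonunits_iff, isUnit_iff_exists_inv]
  rintro ⟨b, hb⟩
  have hb' : x⁻¹ * b = 1 := congrArg Subtype.val hb
  have hx0 : x ≠ 0 := fun h => hx (h ▸ zero_mem _)
  have : (b : K) = x := by
    rw [eq_inv_of_mul_eq_one_right hb', inv_inv]
  exact hx (this ▸ b.2)

lemma residue_card_eq_zero : IsLocalRing.residue 𝒪[K] (Nat.card 𝓀[K] : 𝒪[K]) = 0 := by
  rw [map_natCast]
  by_cases h : Finite 𝓀[K]
  · have := Fintype.ofFinite 𝓀[K]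
    rw [Nat.card_eq_fintype_card, Nat.cast_card_eq_zero]
  -- For an infinite residue field `Nat.card` is `0`, and the claim is trivial.
  · have := not_finite_iff_infinite.1 h
    rw [Nat.card_eq_zero_of_infinite, Nat.cast_zero]

/-- With `q` the residue cardinality, `a ^ q - b ^ q = S * (a - b)` with `S` congruent to `q * b ^
(q - 1)`, so `S` has residue zero. Then `(1 - S) * (a - b) = 0`, and `1 - S` cannot vanish. -/
lemma teichmuller_unique {a b : 𝒪[K]} (ha : a ^ Nat.card 𝓀[K] = a) (hb : b ^ Nat.card 𝓀[K] = b)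
    (h : IsLocalRing.residue 𝒪[K] a = IsLocalRing.residue 𝒪[K] b) : a = b := by
  have hg := geom_sum₂_mul a b (Nat.card 𝓀[K])
  set S := ∑ i ∈ Finset.range (Nat.card 𝓀[K]), a ^ i * b ^ (Nat.card 𝓀[K] - 1 - i)
  have hS : IsLocalRing.residue 𝒪[K] S = 0 := by
    simp only [S, map_sum, map_mul, map_pow, h]
    rw [Finset.sum_congr rfl (g := fun _ => IsLocalRing.residue 𝒪[K] b ^ (Nat.card 𝓀[K] - 1))]
    · rw [Finset.sum_const, Finset.card_range, nsmul_eq_mul, ← map_natCast (IsLocalRing.residue 𝒪[K]),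
        residue_card_eq_zero, zero_mul]
    · intro i hi
      rw [← pow_add]
      congr 1
      have := Finset.mem_range.1 hi
      omega
  rw [ha, hb] at hg
  have h0 : (1 - S) * (a - b) = 0 := by linear_combination -hg
  rcases mul_eq_zero.1 h0 with h1 | h1
  · rw [← sub_eq_zero.1 h1, map_one] at hS
    exact absurd hS one_ne_zero
  · exact sub_eq_zero.1 h1

variable [HenselianRing 𝒪[K] 𝓂[K]]

lemma exists_isRoot_of_residue (f : Polynomial 𝒪[K]) (hf : f.Monic) (a : 𝒪[K])
    (h : IsLocalRing.residue 𝒪[K] (f.eval a) = 0)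
    (h' : IsLocalRing.residue 𝒪[K] (f.derivative.eval a) ≠ 0) :
    ∃ b : 𝒪[K], f.IsRoot b ∧ IsLocalRing.residue 𝒪[K] b = IsLocalRing.residue 𝒪[K] a := by
  obtain ⟨b, hb, hba⟩ := HenselianRing.is_henselian (I := 𝓂[K]) f hf a
    ((IsLocalRing.residue_eq_zero_iff _).1 h) (isUnit_iff_ne_zero (G₀ := 𝓀[K]) |>.2 h')
  exact ⟨b, hb, sub_eq_zero.1 (by rw [← map_sub]; exact (IsLocalRing.residue_eq_zero_iff _).2 hba)⟩

/-- An algebraic description of the integers of a Henselian discretely valued field. -/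
lemma mem_integer_iff_exists_root {p : 𝒪[K]} (hp : 𝓂[K] = Ideal.span {p}) (hp0 : p ≠ 0) (x : K) :
    x ∈ 𝒪[K] ↔ ∃ y : K, y ^ 2 + y + p * x ^ 2 = 0 := by
  have hpm : p ∈ 𝓂[K] := hp ▸ Ideal.mem_span_singleton_self p
  constructor
  · intro hx
    let x' : 𝒪[K] := ⟨x, hx⟩
    have hres : IsLocalRing.residue 𝒪[K] p = 0 := (IsLocalRing.residue_eq_zero_iff _).2 hpm
    let f : Polynomial 𝒪[K] := Polynomial.X ^ 2 + Polynomial.X + Polynomial.C (p * x' ^ 2)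
    have hf : f.Monic := by
      dsimp only [f]; monicity!
    -- Modulo the maximal ideal the polynomial is `X ^ 2 + X`, which has `0` as a simple root.
    obtain ⟨b, hb, -⟩ := exists_isRoot_of_residue f hf 0 (by simp [f, hres]) (by simp [f, hres])
    refine ⟨b, ?_⟩
    have : b ^ 2 + b + p * x' ^ 2 = 0 := by simpa [f] using hb
    exact congrArg Subtype.val this
  · rintro ⟨y, hy⟩
    by_contra hx
    have hx0 : x ≠ 0 := fun h => hx (h ▸ zero_mem _)
    obtain ⟨z, hz, hzm⟩ : ∃ z : 𝒪[K], (z : K) = x⁻¹ ∧ z ∈ 𝓂[K] :=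
      ⟨_, rfl, inv_mem_maximalIdeal_of_notMem hx⟩
    -- If `x` is not integral, put `z = x⁻¹`, which lies in the maximal ideal; then `y * z` is a
    -- root of the Eisenstein polynomial `T ^ 2 + z * T + p`. Such a root would be integral, then
    -- divisible by `p`, and then `p` would be a multiple of `p ^ 2`.
    have hw : (y * z) ^ 2 + z * (y * z) + p = 0 := by
      rw [hz]
      field_simp
      linear_combination hy
    have hwm : y * z ∈ 𝒪[K] := by
      by_contra hw'
      have hw0 : y * z ≠ 0 := fun h => hw' (h ▸ zero_mem _)
      have hum := inv_mem_maximalIdeal_of_notMem hw'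
      set u : 𝒪[K] := ⟨(y * z)⁻¹, inv_mem_integer_of_notMem hw'⟩
      have hu : (u : K) * (y * z) = 1 := inv_mul_cancel₀ hw0
      have h1 : (1 : 𝒪[K]) = -(z * u + p * u ^ 2) := by
        apply Subtype.ext
        change (1 : K) = -(z * u + p * (u : K) ^ 2)
        linear_combination (u : K) ^ 2 * hw - (1 + u * (y * z) + z * u) * hu
      exact (Ideal.ne_top_iff_one _).1 (IsLocalRing.maximalIdeal.isMaximal 𝒪[K]).ne_top
        (h1 ▸ neg_mem (add_mem (Ideal.mul_mem_left _ _ hum) (Ideal.mul_mem_right _ _ hpm)))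
    have hw' : (⟨y * z, hwm⟩ : 𝒪[K]) ^ 2 + z * ⟨y * z, hwm⟩ + p = 0 := Subtype.ext hw
    set w : 𝒪[K] := ⟨y * z, hwm⟩
    have hwmem : w ∈ 𝓂[K] := by
      apply (IsLocalRing.maximalIdeal.isMaximal 𝒪[K]).isPrime.mem_of_pow_mem 2
      rw [show w ^ 2 = -(z * w + p) by linear_combination hw']
      exact neg_mem (add_mem (Ideal.mul_mem_right _ _ hzm) hpm)
    rw [hp, Ideal.mem_span_singleton] at hwmem hzm
    obtain ⟨w', hw2⟩ := hwmem
    obtain ⟨z', hz2⟩ := hzm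
    have h0 : p * (1 + p * (w' ^ 2 + z' * w')) = 0 := by
      rw [hw2, hz2] at hw'
      linear_combination hw'
    have h1 : (1 : 𝒪[K]) = -(p * (w' ^ 2 + z' * w')) := by
      linear_combination (mul_eq_zero.1 h0).resolve_left hp0
    exact (Ideal.ne_top_iff_one _).1 (IsLocalRing.maximalIdeal.isMaximal 𝒪[K]).ne_top
      (h1 ▸ neg_mem (Ideal.mul_mem_right _ _ hpm))

variable [Finite 𝓀[K]]

/-- Every residue class contains a Teichmüller representative. -/
lemma exists_teichmuller (x : 𝓀[K]) :
    ∃ a : 𝒪[K], a ^ Nat.card 𝓀[K] = a ∧ IsLocalRing.residue 𝒪[K] a = x := by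
  have := Fintype.ofFinite 𝓀[K]
  obtain ⟨a, rfl⟩ := IsLocalRing.residue_surjective x
  have h1 : 1 < Nat.card 𝓀[K] := Finite.one_lt_card
  let f : Polynomial 𝒪[K] := Polynomial.X ^ Nat.card 𝓀[K] - Polynomial.X
  have hf : f.Monic := by
    apply Polynomial.monic_X_pow_sub
    rw [Polynomial.degree_X]
    exact_mod_cast h1
  obtain ⟨b, hb, hba⟩ := exists_isRoot_of_residue f hf a
    (by
      simp only [f, Polynomial.eval_sub, Polynomial.eval_pow, Polynomial.eval_X, map_sub, map_pow]
      rw [Nat.card_eq_fintype_card, FiniteField.pow_card, sub_self])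
    (by
      have := residue_card_eq_zero (K := K)
      simp only [f, Polynomial.derivative_X_pow, Polynomial.derivative_X,
        Polynomial.eval_sub, Polynomial.eval_mul, Polynomial.eval_C, Polynomial.eval_one, map_sub,
        map_mul, map_one, this]
      simp)
  exact ⟨b, by simpa [f, sub_eq_zero] using hb, hba⟩


end Integers

/-! ### The automorphism on the integers and on the residue field -/

section FieldExtension

variable {F₀ F : Type*} [Field F₀] [Field F] [Algebra F₀ F]

lemma eq_one_of_bijective (h : Function.Bijective (algebraMap F₀ F)) (σ : F ≃ₐ[F₀] F) : σ = 1 := by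
  ext x
  obtain ⟨y, rfl⟩ := h.2 x
  simp

variable {σ : F ≃ₐ[F₀] F}

lemma involutive_of_finrank_eq_two (h : Module.finrank F₀ F = 2) (hσ : σ ≠ 1) (x : F) :
    σ (σ x) = x := by
  have hfd : FiniteDimensional F₀ F := Module.finite_of_finrank_pos (by omega)
  have hc : Nat.card (F ≃ₐ[F₀] F) ≤ 2 := by
    rw [Nat.card_eq_fintype_card, ← h]
    exact AlgEquiv.card_le
  have h2 : orderOf σ ≤ 2 := (Nat.le_of_dvd Nat.card_pos (orderOf_dvd_natCard σ)).trans hc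
  have h0 : 0 < orderOf σ := orderOf_pos σ
  have h1 : orderOf σ ≠ 1 := fun h => hσ (orderOf_eq_one_iff.1 h)
  have hpow := pow_orderOf_eq_one σ
  rw [show orderOf σ = 2 by omega, pow_two] at hpow
  exact DFunLike.congr_fun hpow x

/-- A fixed element outside `F₀` would form a basis together with `1`, and `σ` would be the
identity. -/
lemma mem_range_of_map_eq_self (h : Module.finrank F₀ F = 2) (hσ : σ ≠ 1) {x : F}
    (hx : σ x = x) : x ∈ Set.range (algebraMap F₀ F) := by
  by_contra hnot
  have hfd : FiniteDimensional F₀ F := Module.finite_of_finrank_pos (by omega)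
  have hli : LinearIndependent F₀ ![1, x] := by
    rw [LinearIndependent.pair_iff]
    intro s t hst
    have ht : t = 0 := by
      by_contra ht
      refine hnot ⟨-s / t, ?_⟩
      rw [Algebra.smul_def, Algebra.smul_def, mul_one] at hst
      have ht' : algebraMap F₀ F t ≠ 0 := by simpa using ht
      rw [map_div₀, map_neg, div_eq_iff ht']
      linear_combination -hst
    subst ht
    rw [zero_smul, add_zero, Algebra.smul_def, mul_one, map_eq_zero] at hst
    exact ⟨hst, rfl⟩
  have hspan := hli.span_eq_top_of_card_eq_finrank' (by rw [h, Fintype.card_fin])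
  refine hσ (AlgEquiv.ext fun y => ?_)
  have hy : y ∈ Submodule.span F₀ (Set.range ![1, x]) := hspan ▸ Submodule.mem_top
  rw [Matrix.range_cons, Matrix.range_cons, Matrix.range_empty, Set.union_empty,
    Set.singleton_union, Submodule.mem_span_pair] at hy
  obtain ⟨a, b, rfl⟩ := hy
  simp [hx]

end FieldExtension

section Automorphism

variable {F₀ F : Type*} [Field F₀] [Field F] [ValuativeRel F] [Algebra F₀ F] {σ : F ≃ₐ[F₀] F}

/-- The restriction of an automorphism to the integers. -/
def integerEnd (σ : F ≃ₐ[F₀] F) (h : ∀ x, σ x ∈ 𝒪[F] ↔ x ∈ 𝒪[F]) : 𝒪[F] →+* 𝒪[F] :=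
  (σ : F →+* F).restrict 𝒪[F] 𝒪[F] fun x hx => (h x).2 hx

instance (h : ∀ x, σ x ∈ 𝒪[F] ↔ x ∈ 𝒪[F]) : IsLocalHom (integerEnd σ h) :=
  isLocalHom_restrict _ h

@[simp] lemma coe_integerEnd (h : ∀ x, σ x ∈ 𝒪[F] ↔ x ∈ 𝒪[F]) (x : 𝒪[F]) :
    (integerEnd σ h x : F) = σ x := rfl

variable [HenselianRing 𝒪[F] 𝓂[F]]

/-- No compatibility of `σ` with the valuation is assumed. It follows because
`mem_integer_iff_exists_root` describes the integers by solvability of an equation whose only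
parameter `p` is fixed by `σ`. -/
lemma map_mem_integer_iff {p : 𝒪[F]} (hp : 𝓂[F] = Ideal.span {p}) (hp0 : p ≠ 0)
    (hpσ : σ p = p) (x : F) : σ x ∈ 𝒪[F] ↔ x ∈ 𝒪[F] := by
  rw [mem_integer_iff_exists_root hp hp0, mem_integer_iff_exists_root hp hp0]
  constructor
  · rintro ⟨y, hy⟩
    refine ⟨σ.symm y, σ.injective ?_⟩
    simpa [hpσ] using hy
  · rintro ⟨y, hy⟩
    refine ⟨σ y, ?_⟩
    simpa [hpσ] using congrArg σ hy

end Automorphism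

section Extension

variable {F₀ F : Type*} [Field F₀] [ValuativeRel F₀] [Field F] [ValuativeRel F] [Algebra F₀ F]
  [ValuativeExtension F₀ F]

lemma algebraMap_mem_integer_iff (x : F₀) : algebraMap F₀ F x ∈ 𝒪[F] ↔ x ∈ 𝒪[F₀] := by
  rw [mem_integer_iff_vle, mem_integer_iff_vle, ← map_one (algebraMap F₀ F),
    ValuativeExtension.vle_iff_vle]

variable (F₀ F) in
/-- The inclusion of the rings of integers. -/
def integerMap : 𝒪[F₀] →+* 𝒪[F] :=
  (algebraMap F₀ F).restrict 𝒪[F₀] 𝒪[F] fun x hx => (algebraMap_mem_integer_iff x).2 hx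

instance : IsLocalHom (integerMap F₀ F) := isLocalHom_restrict _ algebraMap_mem_integer_iff

@[simp] lemma coe_integerMap (x : 𝒪[F₀]) : (integerMap F₀ F x : F) = algebraMap F₀ F x := rfl

/-- The setting of the symmetric and the alternating case. -/
theorem latSetting_of_bijective {c : FormCase} (hc : c ≠ .unramifiedHermitian)
    [IsDiscreteValuationRing 𝒪[F]] (h : Function.Bijective (algebraMap F₀ F)) (σ : F ≃ₐ[F₀] F)
    {p : 𝒪[F₀]} (hp : Irreducible p) (hk : c = .symmetric → ringChar 𝓀[F] ≠ 2) (q₀ : ℕ) :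
    LatSetting c σ (algebraMap F₀ F p) (RingHom.id 𝓀[F]) q₀ := by
  have hbij : Function.Bijective (integerMap F₀ F) := by
    refine ⟨fun x y hxy => Subtype.ext (h.1 (congrArg Subtype.val hxy)), fun y => ?_⟩
    obtain ⟨x, hx⟩ := h.2 y
    exact ⟨⟨x, (algebraMap_mem_integer_iff (F := F) x).1 (hx ▸ y.2)⟩, Subtype.ext hx⟩
  have hirr : Irreducible (integerMap F₀ F p) :=
    (MulEquiv.irreducible_iff (RingEquiv.ofBijective _ hbij)).2 hp
  refine ⟨⟨_, coe_integerMap p, hirr.maximalIdeal_eq⟩, ?_, ?_, ?_, ?_, ?_, fun _ =>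
    eq_one_of_bijective h σ⟩
  · exact fun h0 => hirr.ne_zero (Subtype.ext h0)
  · intro x hx
    rwa [eq_one_of_bijective h σ]
  · rw [eq_one_of_bijective h σ, AlgEquiv.one_apply]
  · intro x _
    rw [eq_one_of_bijective h σ, AlgEquiv.one_apply, RingHom.id_apply]
  · match c, hc, hk with
    | .symmetric, _, hk => exact ⟨rfl, hk rfl⟩
    | .alternating, _, _ => exact rfl

section Quadratic

variable {σ : F ≃ₐ[F₀] F}

variable [HenselianRing 𝒪[F] 𝓂[F]]

variable [Finite 𝓀[F]] (h : ∀ x, σ x ∈ 𝒪[F] ↔ x ∈ 𝒪[F])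

/-- The Teichmüller representative of a fixed residue class is fixed, by uniqueness, and so comes
from `F₀`. -/
lemma mem_range_of_residue_map_eq_self (h2 : Module.finrank F₀ F = 2) (hσ : σ ≠ 1) {x : 𝓀[F]}
    (hx : IsLocalRing.ResidueField.map (integerEnd σ h) x = x) :
    ∃ a : 𝒪[F₀], IsLocalRing.residue 𝒪[F] (integerMap F₀ F a) = x := by
  obtain ⟨a, ha, rfl⟩ := exists_teichmuller x
  have hfix : integerEnd σ h a = a := teichmuller_unique (by rw [← map_pow, ha]) ha
    (by rw [← IsLocalRing.ResidueField.map_residue, hx])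
  obtain ⟨b, hb⟩ := mem_range_of_map_eq_self h2 hσ (congrArg Subtype.val hfix)
  exact ⟨⟨b, (algebraMap_mem_integer_iff (F := F) b).1 (hb ▸ a.2)⟩,
    congrArg _ (Subtype.ext hb)⟩

/-- If `σ` acted trivially on residues, every integer would be an element of `F₀` plus `p` times an
integer. Iterating, `σ y - y` would lie in all powers of the maximal ideal, hence vanish by Krull's
intersection theorem, and `σ` would be trivial. -/
lemma residue_map_ne_id [IsNoetherianRing 𝒪[F]] (h2 : Module.finrank F₀ F = 2) (hσ : σ ≠ 1)
    {p : 𝒪[F]} (hp : 𝓂[F] = Ideal.span {p}) (hpσ : σ p = p) :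
    IsLocalRing.ResidueField.map (integerEnd σ h) ≠ RingHom.id 𝓀[F] := by
  intro hid
  have hdiff (n : ℕ) : ∀ y : 𝒪[F], integerEnd σ h y - y ∈ 𝓂[F] ^ n := by
    induction n with
    | zero => intro y; simp
    | succ n ih =>
      intro y
      obtain ⟨a, ha⟩ := mem_range_of_residue_map_eq_self (x := IsLocalRing.residue 𝒪[F] y) h h2 hσ
        (by rw [hid, RingHom.id_apply])
      have hy : y - integerMap F₀ F a ∈ 𝓂[F] := by
        rw [← IsLocalRing.residue_eq_zero_iff, map_sub, ha, sub_self]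
      rw [hp, Ideal.mem_span_singleton] at hy
      obtain ⟨z, hz⟩ := hy
      have hpe : integerEnd σ h p = p := Subtype.ext hpσ
      have hae : integerEnd σ h (integerMap F₀ F a) = integerMap F₀ F a :=
        Subtype.ext (σ.commutes _)
      have hye : integerEnd σ h y - y = p * (integerEnd σ h z - z) := by
        have hy' : y = integerMap F₀ F a + p * z := by rw [← hz]; ring
        rw [hy', map_add, map_mul, hae, hpe]
        ring
      rw [hye, pow_succ']
      exact Ideal.mul_mem_mul (hp ▸ Ideal.mem_span_singleton_self p) (ih z)
  have hint (y : F) (hy : y ∈ 𝒪[F]) : σ y = y := by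
    have hmem : integerEnd σ h ⟨y, hy⟩ - ⟨y, hy⟩ ∈ ⨅ n : ℕ, 𝓂[F] ^ n :=
      Submodule.mem_iInf _ |>.2 fun n => hdiff n _
    rw [Ideal.iInf_pow_eq_bot_of_isLocalRing _
      (IsLocalRing.maximalIdeal.isMaximal 𝒪[F]).ne_top, Ideal.mem_bot, sub_eq_zero] at hmem
    exact congrArg Subtype.val hmem
  refine hσ (AlgEquiv.ext fun y => ?_)
  by_cases hy : y ∈ 𝒪[F]
  · exact hint y hy
  · have := hint _ (inv_mem_integer_of_notMem hy)
    rw [map_inv₀] at this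
    exact inv_injective this

/-- The setting of the Hermitian case. -/
theorem exists_latSetting_of_isUnramifiedExt [IsDiscreteValuationRing 𝒪[F]]
    (h2 : Module.finrank F₀ F = 2) (hur : IsUnramifiedExt F₀ F) (hσ : σ ≠ 1) {p₀ : 𝒪[F₀]}
    (hp₀ : Irreducible p₀) :
    ∃ τ, LatSetting .unramifiedHermitian σ (algebraMap F₀ F p₀) τ (Nat.card 𝓀[F₀]) := by
  obtain ⟨p, hp, hpp⟩ := hur p₀ hp₀
  have hpσ : σ p = p := by rw [hpp, σ.commutes]
  have h := map_mem_integer_iff hp.maximalIdeal_eq hp.ne_zero hpσ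
  set τ := IsLocalRing.ResidueField.map (integerEnd σ h) with hτ
  -- The fixed field of the residue automorphism is the image of the residue field of `F₀`, so the
  -- number `q₀` of fixed elements is its cardinality.
  have hcard : Nat.card (τ.eqLocusField (RingHom.id 𝓀[F])) = Nat.card 𝓀[F₀] := by
    set ι := IsLocalRing.ResidueField.map (integerMap F₀ F) with hι
    have hιmem (x : 𝓀[F₀]) : ι x ∈ τ.eqLocusField (RingHom.id 𝓀[F]) := by
      obtain ⟨a, rfl⟩ := IsLocalRing.residue_surjective x
      refine (show τ (ι (IsLocalRing.residue _ a)) = ι (IsLocalRing.residue _ a) from ?_)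
      rw [hι, IsLocalRing.ResidueField.map_residue, hτ, IsLocalRing.ResidueField.map_residue]
      exact congrArg _ (Subtype.ext (σ.commutes _))
    refine (Nat.card_congr (Equiv.ofBijective (fun x => ⟨ι x, hιmem x⟩) ⟨?_, ?_⟩)).symm
    · exact fun x y hxy => ι.injective (congrArg Subtype.val hxy)
    · rintro ⟨x, hx⟩
      obtain ⟨a, ha⟩ := mem_range_of_residue_map_eq_self h h2 hσ hx
      exact ⟨IsLocalRing.residue _ a, Subtype.ext
        ((IsLocalRing.ResidueField.map_residue _ _).trans ha)⟩
  have hinv (x : 𝓀[F]) : τ (τ x) = x := by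
    obtain ⟨a, rfl⟩ := IsLocalRing.residue_surjective x
    rw [hτ, IsLocalRing.ResidueField.map_residue, IsLocalRing.ResidueField.map_residue]
    exact congrArg _ (Subtype.ext (involutive_of_finrank_eq_two h2 hσ _))
  refine ⟨τ, ⟨p, hpp, hp.maximalIdeal_eq⟩, ?_, fun x hx => (h x).2 hx, σ.commutes _, ?_, ?_,
    fun hc => absurd rfl hc⟩
  · rw [← hpp]
    exact fun h0 => hp.ne_zero (Subtype.ext h0)
  · intro x hx
    rw [show x = ((⟨x, hx⟩ : 𝒪[F]) : F) from rfl, ← coe_integerEnd h, toResidue_coe, toResidue_coe,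
      hτ, IsLocalRing.ResidueField.map_residue]
  · exact card_and_eq_pow_of_involutive hinv
      (residue_map_ne_id h h2 hσ hp.maximalIdeal_eq hpσ) hcard

end Quadratic

end Extension

/-! ### The three cases for local fields -/

section LocalField

lemma henselianRing_integer (F : Type*) [Field F] [ValuativeRel F] [TopologicalSpace F]
    [IsNonarchimedeanLocalField F] : HenselianRing 𝒪[F] 𝓂[F] := by
  let := IsTopologicalAddGroup.rightUniformSpace F
  have := isUniformAddGroup_of_addCommGroup (G := F)
  have : IsAdicComplete 𝓂[F] 𝒪[F] := inferInstance
  infer_instance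

variable {F₀ F : Type*} [Field F₀] [ValuativeRel F₀] [Field F] [ValuativeRel F]
  [TopologicalSpace F] [IsNonarchimedeanLocalField F] [Algebra F₀ F] [ValuativeExtension F₀ F]

theorem FormCase.IsSetting.exists_latSetting {c : FormCase} {σ : F ≃ₐ[F₀] F} (hσ : c.IsSetting σ)
    {p : 𝒪[F₀]} (hp : Irreducible p) :
    ∃ τ, LatSetting c σ (algebraMap F₀ F p) τ (Nat.card 𝓀[F₀]) := by
  match c, hσ with
  | .unramifiedHermitian, ⟨h2, hur, h⟩ =>
    have := henselianRing_integer F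
    exact exists_latSetting_of_isUnramifiedExt h2 hur h hp
  | .symmetric, ⟨h, hk⟩ =>
    exact ⟨_, latSetting_of_bijective (by simp) h σ hp (fun _ => hk) _⟩
  | .alternating, h =>
    exact ⟨_, latSetting_of_bijective (by simp) h σ hp (by simp) _⟩

end LocalField

/-! ### Sorting the lattices of given type by their data -/

section TypeCount

variable {F₀ F : Type*} [Field F₀] [Field F] [ValuativeRel F] [Algebra F₀ F]
  {σ : F ≃ₐ[F₀] F} {V : Type*} [AddCommGroup V] [Module F V]
  {c : FormCase} {ϖ : F} {τ : 𝓀[F] →+* 𝓀[F]} {q₀ : ℕ} {B : Form σ V}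
  {Λ L : Submodule 𝒪[F] V}

/-- There are only finitely many normalized data with given `e` of finite support. -/
lemma TypData.finite_isNormalized {e : ℤ → ℕ} {T : Finset ℤ} (he : ∀ i ∉ T, e i = 0) :
    {d : TypData c | d.IsNormalized ∧ e = d.e}.Finite := by
  have hS : Finite c.Sign := inferInstance
  refine Set.Finite.of_injOn
    (f := fun (d : TypData c) (i : T) => (d.n i, d.m i, d.l i, d.ψ₁ i, d.ψ₂ i))
    (t := Set.pi Set.univ fun i : T => Set.Iic (e i) ×ˢ Set.Iic (e i) ×ˢ Set.Iic (e i) ×ˢ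
      (Set.univ : Set c.Sign) ×ˢ (Set.univ : Set c.Sign)) ?_ ?_ ?_
  · rintro d ⟨-, rfl⟩ i -
    have h2 : 0 < 2 / c.γ := by cases c <;> simp [FormCase.γ]
    have h3 : d.m i ≤ 2 / c.γ * d.m i := Nat.le_mul_of_pos_left _ h2
    simp only [Set.mem_prod, Set.mem_Iic, Set.mem_univ, and_true, TypData.e]
    omega
  · rintro d ⟨hd, h⟩ d' ⟨hd', h'⟩ hdd
    have hz (i : ℤ) (hi : i ∉ T) : d.n i = d'.n i ∧ d.m i = d'.m i ∧ d.l i = d'.l i ∧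
        d.ψ₁ i = d'.ψ₁ i ∧ d.ψ₂ i = d'.ψ₂ i := by
      obtain ⟨h1, h2, h3⟩ := TypData.eq_zero_of_e_eq_zero (d := d) (i := i) (h ▸ he i hi)
      obtain ⟨h1', h2', h3'⟩ := TypData.eq_zero_of_e_eq_zero (d := d') (i := i) (h' ▸ he i hi)
      rw [h1, h2, h3, h1', h2', h3', (hd i).1 h1, (hd i).2 h3, (hd' i).1 h1', (hd' i).2 h3']
      exact ⟨rfl, rfl, rfl, rfl, rfl⟩
    have key (i : ℤ) : d.n i = d'.n i ∧ d.m i = d'.m i ∧ d.l i = d'.l i ∧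
        d.ψ₁ i = d'.ψ₁ i ∧ d.ψ₂ i = d'.ψ₂ i := by
      by_cases hi : i ∈ T
      · have := congrFun hdd ⟨i, hi⟩
        simpa only [Prod.mk.injEq] using this
      · exact hz i hi
    cases d
    cases d'
    simp only [TypData.mk.injEq]
    exact ⟨funext fun i => (key i).1, funext fun i => (key i).2.1, funext fun i => (key i).2.2.1,
      funext fun i => (key i).2.2.2.1, funext fun i => (key i).2.2.2.2⟩
  · exact Set.Finite.pi fun i => (Set.finite_Iic _).prod ((Set.finite_Iic _).prod
      ((Set.finite_Iic _).prod (Set.finite_univ.prod Set.finite_univ)))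

lemma finite_lattices [Finite 𝓀[F]] (hS : LatSetting c σ ϖ τ q₀) (hΛ : Λ.FG) :
    (lattices ϖ Λ).Finite := by
  have : Module.Finite 𝒪[F] Λ := Module.Finite.iff_fg.2 hΛ
  refine Set.Finite.of_injOn (f := resSub Λ) (t := Set.univ) (fun _ _ => Set.mem_univ _) ?_
    Set.finite_univ
  intro L hL L' hL' h
  rw [← ofResSub_resSub hS hL.2.2 hL.2.1, h, ofResSub_resSub hS hL'.2.2 hL'.2.1]

namespace JordanSplitting

variable [FiniteDimensional F V] (J : JordanSplitting B ϖ Λ) {e : ℤ → ℕ} {χ : ℤ → c.Sign}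

lemma finite_typData (J : JordanSplitting B ϖ Λ) (hS : LatSetting c σ ϖ τ q₀) (hΛ : Λ.FG) (h : HasTyp c B ϖ Λ e χ) :
    {d : TypData c | d.IsNormalized ∧ e = d.e}.Finite := by
  refine TypData.finite_isNormalized (T := J.supp) fun i hi => ?_
  have := J.subsingleton_resSpace hi
  exact ((J.hasTyp_iff hS hΛ).1 h i).eq_of_subsingleton

variable [Finite 𝓀[F]]

lemma exists_isDataOf_hasTyp (hS : LatSetting c σ ϖ τ q₀)
    (hB : c.IsForm B) (hΛ : Λ.IsLattice F) (h : HasTyp c B ϖ Λ e χ) (hL : L ∈ lattices ϖ Λ) :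
    ∃ d : TypData c, IsDataOf J (J.N L) d ∧ d.IsNormalized ∧ e = d.e ∧
      χ = d.χ (c.sign (-1 : 𝓀[F])) ∧ HasTyp c B ϖ L d.f (d.ψ (c.sign (-1 : 𝓀[F]))) := by
  obtain ⟨d, hd⟩ := J.exists_isDataOf hS hB hΛ.fg hL.2.2 hL.2.1
  obtain ⟨h1, h2⟩ := J.hasTyp_of_isDataOf hS hB hΛ hL.2.2 hL.2.1 hd
  obtain ⟨he, hχ⟩ := h.unique hS hΛ.fg h1
  exact ⟨d, hd, J.isDataOf_isNormalized hS hB hΛ.fg hL.2.2 hL.2.1 hd, he, hχ, h2⟩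

lemma hasTyp_iff_of_isDataOf (hS : LatSetting c σ ϖ τ q₀) (hB : c.IsForm B) (hΛ : Λ.IsLattice F)
    (hL : L ∈ lattices ϖ Λ) {d : TypData c} (hd : IsDataOf J (J.N L) d) (f : ℤ → ℕ)
    (ψ : ℤ → c.Sign) :
    HasTyp c B ϖ L f ψ ↔ f = d.f ∧ ψ = d.ψ (c.sign (-1 : 𝓀[F])) := by
  have h2 := (J.hasTyp_of_isDataOf hS hB hΛ hL.2.2 hL.2.1 hd).2
  constructor
  · exact fun h => h.unique hS hL.1.fg h2
  · rintro ⟨rfl, rfl⟩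
    exact h2

/-- Counting the lattices of a given type by their data. -/
theorem ncard_hasTyp (hS : LatSetting c σ ϖ τ q₀) (hB : c.IsForm B) (hΛ : Λ.IsLattice F)
    (h : HasTyp c B ϖ Λ e χ) (f : ℤ → ℕ) (ψ : ℤ → c.Sign) :
    Set.ncard {L ∈ lattices ϖ Λ | HasTyp c B ϖ L f ψ} =
      ∑ᶠ d ∈ {d : TypData c | d.IsNormalized ∧ e = d.e ∧ χ = d.χ (c.sign (-1 : 𝓀[F])) ∧
          f = d.f ∧ ψ = d.ψ (c.sign (-1 : 𝓀[F]))},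
        Set.ncard {L ∈ lattices ϖ Λ | IsDataOf J (J.N L) d} := by
  classical
  have hfin := finite_lattices hS hΛ.fg
  have hD : {d : TypData c | d.IsNormalized ∧ e = d.e ∧ χ = d.χ (c.sign (-1 : 𝓀[F])) ∧
      f = d.f ∧ ψ = d.ψ (c.sign (-1 : 𝓀[F]))}.Finite :=
    (J.finite_typData hS hΛ.fg h).subset fun d hd => ⟨hd.1, hd.2.1⟩
  rw [finsum_mem_eq_finite_toFinset_sum _ hD]
  let T := (hfin.subset (Set.sep_subset _ fun L => HasTyp c B ϖ L f ψ)).toFinset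
  -- Data are chosen for every submodule, with a meaningless default away from the lattices; the
  -- lattices of given type are then partitioned into the fibres of this choice.
  have hex (L : Submodule 𝒪[F] V) : ∃ d : TypData c, L ∈ lattices ϖ Λ → IsDataOf J (J.N L) d := by
    by_cases hL : L ∈ lattices ϖ Λ
    · obtain ⟨d, hd⟩ := J.exists_isDataOf hS hB hΛ.fg hL.2.2 hL.2.1
      exact ⟨d, fun _ => hd⟩
    · exact ⟨⟨0, 0, 0, 1, 1⟩, fun h => absurd h hL⟩
  choose D hDat using hex
  rw [Set.ncard_eq_toFinset_card _ (hfin.subset (Set.sep_subset _ _)),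
    Finset.card_eq_sum_card_fiberwise (f := D) (t := hD.toFinset)]
  · refine Finset.sum_congr rfl fun d hd => ?_
    rw [Set.ncard_eq_toFinset_card _ (hfin.subset (Set.sep_subset _ _))]
    congr 1
    ext L
    rw [Set.Finite.mem_toFinset] at hd
    simp only [Finset.mem_filter, Set.Finite.mem_toFinset]
    constructor
    · rintro ⟨hL, rfl⟩
      exact ⟨hL.1, hDat L hL.1⟩
    · rintro ⟨hL, hLd⟩
      exact ⟨⟨hL, (J.hasTyp_iff_of_isDataOf hS hB hΛ hL hLd f ψ).2 hd.2.2.2⟩,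
        J.isDataOf_unique hS hB hΛ.fg hL.2.2 hL.2.1 (hDat L hL) hLd⟩
  · intro L hL
    simp only [Set.Finite.coe_toFinset] at hL ⊢
    obtain ⟨d, hd, hn, he, hχ, -⟩ := J.exists_isDataOf_hasTyp hS hB hΛ h hL.1
    rw [J.isDataOf_unique hS hB hΛ.fg hL.1.2.2 hL.1.2.1 (hDat L hL.1) hd]
    exact ⟨hn, he, hχ, (J.hasTyp_iff_of_isDataOf hS hB hΛ hL.1 hd f ψ).1 hL.2⟩

end JordanSplitting

end TypeCount

end LatticeTyp

end

/-! ### The main theorem -/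

theorem mainTheorem5 (c : FormCase)
    {F₀ F : Type*}
    [Field F₀] [ValuativeRel F₀] [TopologicalSpace F₀] [IsNonarchimedeanLocalField F₀] [CharZero F₀]
    [Field F] [ValuativeRel F] [TopologicalSpace F] [IsNonarchimedeanLocalField F] [CharZero F]
    [Algebra F₀ F] [ValuativeExtension F₀ F]
    (σ : F ≃ₐ[F₀] F) (hσ : c.IsSetting σ)
    (ϖ₀ : 𝒪[F₀]) (hϖ₀ : Irreducible ϖ₀) (ϖ : F) (hϖ : ϖ = algebraMap F₀ F (ϖ₀ : F₀))
    {V : Type*} [AddCommGroup V] [Module F V] [FiniteDimensional F V]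
    (B : Form σ V) (hB : c.IsForm B)
    (Λ : Submodule 𝒪[F] V) (hΛ : Λ.IsLattice F) (J : JordanSplitting B ϖ Λ)
    (ε : c.Sign) (hε : ε = c.sign (-1 : 𝓀[F])) :
    ∃ (e : ℤ → ℕ) (χ : ℤ → c.Sign), HasTyp c B ϖ Λ e χ ∧
      -- the type of `L` is given in terms of the data of the projections
      (∀ L ∈ lattices ϖ Λ, ∃ d : TypData c, IsDataOf J (J.N L) d ∧
        e = d.e ∧ χ = d.χ ε ∧ HasTyp c B ϖ L d.f (d.ψ ε)) ∧
      -- in particular the type of `L` is determined by the projections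
      (∀ L ∈ lattices ϖ Λ, ∀ L' ∈ lattices ϖ Λ, (∀ i, J.N L i = J.N L' i) →
        ∀ (f : ℤ → ℕ) (ψ : ℤ → c.Sign), HasTyp c B ϖ L f ψ ↔ HasTyp c B ϖ L' f ψ) ∧
      -- the types that occur come from data
      (∀ (f : ℤ → ℕ) (ψ : ℤ → c.Sign), (∃ L ∈ lattices ϖ Λ, HasTyp c B ϖ L f ψ) →
        ∃ d : TypData c, d.IsNormalized ∧ e = d.e ∧ χ = d.χ ε ∧ f = d.f ∧ ψ = d.ψ ε) ∧
      -- the number of `L` with given data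
      (∀ d : TypData c, d.IsNormalized → e = d.e → χ = d.χ ε →
        (Set.ncard {L ∈ lattices ϖ Λ | IsDataOf J (J.N L) d} : ℚ) =
          d.count (Nat.card 𝓀[F₀]) (Nat.card 𝓀[F]) ε) ∧
      -- the number of `L` with given type
      (∀ (f : ℤ → ℕ) (ψ : ℤ → c.Sign),
        {d : TypData c | d.IsNormalized ∧ e = d.e ∧ χ = d.χ ε ∧ f = d.f ∧ ψ = d.ψ ε}.Finite ∧
        (Set.ncard {L ∈ lattices ϖ Λ | HasTyp c B ϖ L f ψ} : ℚ) =
          ∑ᶠ d ∈ {d : TypData c | d.IsNormalized ∧ e = d.e ∧ χ = d.χ ε ∧ f = d.f ∧ ψ = d.ψ ε},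
            d.count (Nat.card 𝓀[F₀]) (Nat.card 𝓀[F]) ε) := by
  subst hϖ hε
  -- Apart from finiteness of the residue field and Noetherianity of the ring of integers, `hS` is
  -- all that the rest needs to know about the fields.
  obtain ⟨τ, hS⟩ := hσ.exists_latSetting hϖ₀
  obtain ⟨e, χ, h⟩ := J.exists_hasTyp hS hB hΛ.fg
  refine ⟨e, χ, h, ?_, ?_, ?_, ?_, ?_⟩
  · intro L hL
    obtain ⟨d, hd, -, he, hχ, hL⟩ := J.exists_isDataOf_hasTyp hS hB hΛ h hL
    exact ⟨d, hd, he, hχ, hL⟩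
  · intro L hL L' hL' hN f ψ
    obtain ⟨d, hd⟩ := J.exists_isDataOf hS hB hΛ.fg hL.2.2 hL.2.1
    have hd' : IsDataOf J (J.N L') d := (funext hN : J.N L = J.N L') ▸ hd
    rw [J.hasTyp_iff_of_isDataOf hS hB hΛ hL hd, J.hasTyp_iff_of_isDataOf hS hB hΛ hL' hd']
  · rintro f ψ ⟨L, hL, hLf⟩
    obtain ⟨d, hd, hn, he, hχ, -⟩ := J.exists_isDataOf_hasTyp hS hB hΛ h hL
    exact ⟨d, hn, he, hχ, (J.hasTyp_iff_of_isDataOf hS hB hΛ hL hd f ψ).1 hLf⟩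
  · rintro d hd rfl rfl
    exact J.ncard_isDataOf hS hB hΛ hd h
  · intro f ψ
    have hfin := (J.finite_typData hS hΛ.fg h).subset
      (t := {d : TypData c | d.IsNormalized ∧ e = d.e ∧ χ = d.χ (c.sign (-1 : 𝓀[F])) ∧
        f = d.f ∧ ψ = d.ψ (c.sign (-1 : 𝓀[F]))}) fun d hd => ⟨hd.1, hd.2.1⟩
    refine ⟨hfin, ?_⟩
    rw [J.ncard_hasTyp hS hB hΛ h, finsum_mem_eq_finite_toFinset_sum _ hfin,
      finsum_mem_eq_finite_toFinset_sum _ hfin, Nat.cast_sum]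
    refine Finset.sum_congr rfl fun d hd => ?_
    obtain ⟨hn, he, hχ, -⟩ := hfin.mem_toFinset.1 hd
    exact J.ncard_isDataOf hS hB hΛ hn (he ▸ hχ ▸ h)
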